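/- All vector spaces, algebras and categories are over $\mathbb{C}$; $\mathsf{Vect}$ is the category of finite-dimensional vector spaces; $S$, $\Delta$, $\varepsilon$ are the antipode, comultiplication and counit; $\beta(a)=\sum a^{[-1]}\otimes a^{[0]}$ is the coaction of a left comodule algebra. **The quantum double model $(H,\mathfrak A)_{\rm QD}$.** Let $H$ be a finite-dimensional semisimple Hopf algebra and $\mathfrak A$ a nonzero finite-dimensional semisimple left $H$-comodule algebra. Consider a directed trivalent lattice on a surface with boundary such that the bulk lies on the left of every boundary edge and no vertex is a source or a sink. At a vertex, $x$ denotes an incoming and $y$ an outgoing edge, and $z$ the third edge, on the left of the path $x,y$; at a boundary vertex $x,y$ are boundary edges and $z$ is a bulk edge. The total space is the tensor product of a copy of $H$ for each bulk edge and a copy of $\mathfrak A$ for each boundary edge. Let $h_H\in H$ and $\varphi_{\hat H}\in\hat H=H^\vee$ be the Haar integrals and $\lambda=\sum a\otimes b\in\mathfrak A\otimes\mathfrak A$ the symmetric separability idempotent. * At a bulk vertex, $A_v$ is given, with $\Delta^{(2)}(h_H)=\sum h_1\otimes h_2\otimes h_3$, by $(x,y,z)\mapsto\sum(h_1x,\,yS(h_2),\,h_3z)$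 if $z$ is incoming, with last entry $zS(h_3)$ if $z$ is outgoing. * At a boundary vertex, $A_v$ is given by $(x,y,z)\mapsto \sum (a^{[0]}x,\,yb,\,a^{[-1]}z)$ ($z$ incoming) or last entry $zS(a^{[-1]})$ ($z$ outgoing) if the chosen site lies after $z$ in the direction of the boundary, and by $\sum(ax,\,yb^{[0]},\,S(b^{[-1]})z)$ ($z$ incoming) or last entry $zb^{[-1]}$ ($z$ outgoing) if it lies before $z$. * At a face with edges $e_1,\dots,e_n$ in counterclockwise order, $B_f=\sum T^{\varphi_1}_{e_1}\cdots T^{\varphi_n}_{e_n}$, where $\sum\varphi_1\otimes\cdots\otimes\varphi_n$ is the iterated coproduct of $\varphi_{\hat H}$ in $\hat H$ and $T^\varphi x=\sum\varphi(S(x_1))x_2$ (bulk edge with the face on its left), $\sum\varphi(x_2)x_1$ (bulk edge with the face on its right), $\sum\varphi(S(x^{[-1]}))x^{[0]}$ (boundary edge). The Hamiltonian is $\sum_v(1-A_v)+\sum_f(1-B_f)$, where $v$ runs over bulk and boundary vertices. **The extended string-net model $(\mathcal C,\omega_{\mathcal C},\mathcal M,\omega_{\mathcal M})_{\rm SN}$.**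 Let $\mathcal C$ be a fusion category, $\omega_{\mathcal C}:\mathcal C\to\mathsf{Vect}$ a linear strong monoidal functor, $\mathcal M$ a nonzero indecomposable finite semisimple left $\mathcal C$-module category, and $\omega_{\mathcal M}:\mathcal M\to\mathsf{Vect}$ a functor with natural coherent isomorphisms $\omega_{\mathcal C}(X)\otimes\omega_{\mathcal M}(N)\cong\omega_{\mathcal M}(X\otimes N)$. Bulk and boundary edges carry $\bigoplus_i\omega_{\mathcal C}(i)\otimes\omega_{\mathcal C}(i)^\vee$ and $\bigoplus_x\omega_{\mathcal M}(x)\otimes\omega_{\mathcal M}(x)^\vee$, sums over the simple objects. Let $W^y_{ix}\in\mathrm{End}\,\omega_{\mathcal C}(i)\otimes\mathrm{End}\,\omega_{\mathcal M}(x)\otimes\mathrm{End}\,\omega_{\mathcal M}(y)^\vee$ be the projector of $\omega_{\mathcal C}(i)\otimes\omega_{\mathcal M}(x)\otimes\omega_{\mathcal M}(y)^\vee\cong\mathrm{Hom}_{\mathbb C}(\omega_{\mathcal M}(y),\omega_{\mathcal M}(i\otimes x))$ onto $\mathrm{Hom}_{\mathcal M}(y,i\otimes x)$ along the trace-orthogonal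 complement of $\mathrm{Hom}_{\mathcal M}(i\otimes x,y)$; for bulk symbols take $\mathcal M=\mathcal C$, $\omega_{\mathcal M}=\omega_{\mathcal C}$. The vertex operator is $\bigoplus W^y_{ix}$ if $z$ (labelled $i$) is incoming, and the transpose of $\bigoplus W^x_{iy}$ if $z$ is outgoing, acting on the tensor factors of the edge spaces at the vertex (the factor $\omega(\cdot)$ of an incoming edge and $\omega(\cdot)^\vee$ of an outgoing one). The face operator is $B_f=\sum_\nu\frac{\dim\nu}{\sum_\mu(\dim\mu)^2}B_f^\nu$, with $\dim=\dim\omega(\cdot)$, where $B_f^\nu$ is the partial trace over $\omega_{\mathcal C}(\nu)$ of the ordered product over the edges of $f$ of $\bigoplus_{x,x'}\sqrt{\dim x\dim x'}\,W^{x'}_{\nu x}$ (edge with $f$ on its left) or $\bigoplus_{x,x'}\sqrt{\dim x\dim x'}\,W^{x}_{x'\nu}$ (edge with $f$ on its right), where the legs of $x$ and $x'$ are contracted with the old and new label of the edge. The Hamiltonian is again $\sum_v(1-Q_v)+\sum_f(1-B_f)$. **Proposition.** 1. Let $H$ be a finite-dimensional $C^*$ Hopf algebra and $\mathfrak A$ a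 nonzero finite-dimensional semisimple left $H$-comodule algebra that is not the direct sum of two nonzero two-sided ideals that are subcomodules. Then $\mathcal C=\mathsf{Rep}(H)$ is a fusion category, which together with its forgetful functor $\omega_{\mathcal C}$ is equivalent to a unitary fusion category with a unitary fiber functor; $H\to\mathrm{End}(\omega_{\mathcal C})$ is bijective; $\mathcal M={}_{\mathfrak A}\mathsf{Mod}$, with $a(u\otimes n)=\sum a^{[-1]}u\otimes a^{[0]}n$, is a nonzero indecomposable finite semisimple $\mathcal C$-module category; the identity maps make the forgetful functor $\omega_{\mathcal M}$ compatible with the actions, $\omega_{\mathcal M}(X\otimes N)=\omega_{\mathcal C}(X)\otimes\omega_{\mathcal M}(N)$; the elements $h_H$, $\varphi_{\hat H}$, $\lambda$ exist and are unique; and the Fourier transforms $a\mapsto\bigoplus_x\sqrt{\dim x}\,\rho_x(a)$ of $H$ and $\mathfrak A$ (with $\mathrm{End}\,V=V\otimes V^\vee$) are bijective and identify, on every such lattice, the vertex operators, face operators and Hamiltonians of $(H,\mathfrak A)_{\rm QD}$ with those of $(\mathcal C,\omega_{\mathcal C},\mathcal M,\omega_{\mathcal M})_{\rm SN}$. 2.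 Let $\mathcal C,\omega_{\mathcal C},\mathcal M$ be as in the definition of the string-net model. Then $H=\mathrm{End}(\omega_{\mathcal C})$ is a finite-dimensional semisimple Hopf algebra, with $\Delta$ and $\varepsilon$ given by the action on $\omega_{\mathcal C}(X\otimes Y)\cong\omega_{\mathcal C}(X)\otimes\omega_{\mathcal C}(Y)$ and on $\omega_{\mathcal C}(\mathbb 1)$. It is a $C^*$ Hopf algebra for a suitable involution if $(\mathcal C,\omega_{\mathcal C})$ is equivalent to a unitary fusion category with a unitary fiber functor, and for the pointwise adjoint if $(\mathcal C,\omega_{\mathcal C})$ itself carries such structures. The functor $X\mapsto\omega_{\mathcal C}(X)$ is a monoidal equivalence $\mathcal C\simeq\mathsf{Rep}(H)$, with the monoidal structure of $\omega_{\mathcal C}$. For every nonzero $M\in\mathcal M$, the internal endomorphism object $\underline{\mathrm{Hom}}(M,M)$ exists; $\mathfrak M=\omega_{\mathcal C}(\underline{\mathrm{Hom}}(M,M))$ is an $H$-module algebra; $\mathfrak A=\mathfrak M^{\rm op}\#H^{\rm cop}$, that is $\mathfrak M\otimes H$ with $(a\#h)(b\#g)=\sum(h_2\cdot b)a\,\#\,h_1g$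 and $\beta(a\#h)=\sum h_1\otimes(a\#h_2)$, is a nonzero finite-dimensional semisimple left $H$-comodule algebra that is not the direct sum of two nonzero two-sided ideals that are subcomodules; and there is a linear equivalence $G:\mathcal M\simeq{}_{\mathfrak A}\mathsf{Mod}$ of module categories along $\mathcal C\simeq\mathsf{Rep}(H)$. The elements $h_H,\varphi_{\hat H},\lambda$ exist and are unique, the forgetful functor of ${}_{\mathfrak A}\mathsf{Mod}$ composed with $G$ is an admissible $\omega_{\mathcal M}$, and for every $\omega_{\mathcal M}$ isomorphic to it compatibly with the actions, the Fourier transforms are bijective and identify $(H,\mathfrak A)_{\rm QD}$ with $(\mathcal C,\omega_{\mathcal C},\mathcal M,\omega_{\mathcal M})_{\rm SN}$ as in part 1. -/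

import Mathlib

open CategoryTheory MonoidalCategory MonoidalLeftAction
open scoped TensorProduct ComplexConjugate

universe u v u₁ v₁ u₂ v₂ u₃ v₃ u₄ v₄

noncomputable section

namespace QDSN

/-- Finite-dimensional complex vector spaces. -/
abbrev Vect : Type 1 := FGModuleCat.{0} ℂ

/-- The linear map underlying a morphism of `Vect`. -/
abbrev lin {V W : Vect} (f : V ⟶ W) : V →ₗ[ℂ] W := f.hom.hom

/-- A left `H`-comodule algebra: an algebra `A` with a coassociative and counital coaction
`A → H ⊗ A` that is a homomorphism of algebras. -/
class LeftComoduleAlgebra (H : Type u) (A : Type v) [Ring H] [Bialgebra ℂ H]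
    [Ring A] [Algebra ℂ A] where
  coact : A →ₐ[ℂ] H ⊗[ℂ] A
  coact_coassoc : ∀ a : A,
    TensorProduct.assoc ℂ H H A ((Coalgebra.comul (R := ℂ) (A := H)).rTensor A (coact a)) =
      coact.toLinearMap.lTensor H (coact a)
  coact_counit : ∀ a : A,
    TensorProduct.lid ℂ A ((Coalgebra.counit (R := ℂ) (A := H)).rTensor A (coact a)) = a

/-! ### Finite-dimensional modules over a complex algebra -/

/-- A finite-dimensional left module over the complex algebra `A`. -/
structure FdMod (A : Type u) [Ring A] [Algebra ℂ A] where
  V : Vect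
  ρ : A →ₐ[ℂ] Module.End ℂ V

namespace FdMod

section Cat
variable {A : Type u} [Ring A] [Algebra ℂ A]

/-- The space of `A`-linear maps. -/
def homs (M N : FdMod A) : Submodule ℂ (M.V ⟶ N.V) where
  carrier := {f | ∀ a : A, lin f ∘ₗ M.ρ a = N.ρ a ∘ₗ lin f}
  add_mem' {f g} hf hg a := by
    have hf := hf a
    have hg := hg a
    change (lin f + lin g) ∘ₗ _ = _ ∘ₗ (lin f + lin g)
    rw [LinearMap.add_comp, LinearMap.comp_add, hf, hg]
  zero_mem' a := by
    change (0 : M.V →ₗ[ℂ] N.V) ∘ₗ _ = _ ∘ₗ (0 : M.V →ₗ[ℂ] N.V)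
    simp
  smul_mem' c f hf a := by
    have hf := hf a
    change (c • lin f) ∘ₗ _ = _ ∘ₗ (c • lin f)
    rw [LinearMap.smul_comp, LinearMap.comp_smul, hf]

instance : Category.{0} (FdMod A) where
  Hom M N := homs M N
  id M := ⟨𝟙 M.V, fun _ => rfl⟩
  comp {M N P} f g := ⟨f.1 ≫ g.1, fun a => by
    have hf := f.2 a
    have hg := g.2 a
    change (lin g.1 ∘ₗ lin f.1) ∘ₗ _ = _ ∘ₗ (lin g.1 ∘ₗ lin f.1)
    rw [LinearMap.comp_assoc, hf, ← LinearMap.comp_assoc, hg, LinearMap.comp_assoc]⟩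
  id_comp f := Subtype.ext (Category.id_comp f.1)
  comp_id f := Subtype.ext (Category.comp_id f.1)
  assoc f g h := Subtype.ext (Category.assoc f.1 g.1 h.1)

instance : Preadditive (FdMod A) where
  homGroup M N := inferInstanceAs (AddCommGroup (homs M N))
  add_comp _ _ _ f f' g := Subtype.ext (Preadditive.add_comp _ _ _ f.1 f'.1 g.1)
  comp_add _ _ _ f g g' := Subtype.ext (Preadditive.comp_add _ _ _ f.1 g.1 g'.1)

instance : Linear ℂ (FdMod A) where
  homModule M N := inferInstanceAs (Module ℂ (homs M N))
  smul_comp _ _ _ c f g := Subtype.ext (Linear.smul_comp _ _ _ c f.1 g.1)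
  comp_smul _ _ _ f c g := Subtype.ext (Linear.comp_smul _ _ _ f.1 c g.1)

variable (A) in
/-- The functor that forgets the action. -/
def forget : FdMod A ⥤ Vect where
  obj M := M.V
  map f := f.1

instance : (forget A).Faithful where
  map_injective h := Subtype.ext h

instance : (forget A).Additive where
  map_add := rfl

instance : (forget A).Linear ℂ where
  map_smul _ _ := rfl

/-- An isomorphism of vector spaces that commutes with the action. -/
def mkIso {M N : FdMod A} (i : M.V ≅ N.V) (h : ∀ a, lin i.hom ∘ₗ M.ρ a = N.ρ a ∘ₗ lin i.hom) :
    M ≅ N where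
  hom := ⟨i.hom, h⟩
  inv := ⟨i.inv, fun a => by
    have h1 : lin i.inv ∘ₗ lin i.hom = LinearMap.id :=
      congrArg (fun f : M.V ⟶ M.V => lin f) i.hom_inv_id
    have h2 : lin i.hom ∘ₗ lin i.inv = LinearMap.id :=
      congrArg (fun f : N.V ⟶ N.V => lin f) i.inv_hom_id
    calc lin i.inv ∘ₗ N.ρ a = lin i.inv ∘ₗ (N.ρ a ∘ₗ lin i.hom) ∘ₗ lin i.inv := by
          rw [LinearMap.comp_assoc, h2, LinearMap.comp_id]
      _ = (lin i.inv ∘ₗ lin i.hom) ∘ₗ M.ρ a ∘ₗ lin i.inv := by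
          rw [← h a]; rfl
      _ = M.ρ a ∘ₗ lin i.inv := by rw [h1, LinearMap.id_comp]⟩
  hom_inv_id := Subtype.ext i.hom_inv_id
  inv_hom_id := Subtype.ext i.inv_hom_id

end Cat

end FdMod

/-! ### Tensor products of actions -/

section Unbundled

variable {H : Type u} {A : Type v} [Ring H] [Bialgebra ℂ H] [Ring A] [Algebra ℂ A]
  {V W U : Type} [AddCommGroup V] [Module ℂ V] [AddCommGroup W] [Module ℂ W]
  [AddCommGroup U] [Module ℂ U]

/-- The action of `H ⊗ A` on `V ⊗ W`. -/
def actTensor (ρ : H →ₐ[ℂ] Module.End ℂ V) (σ : A →ₐ[ℂ] Module.End ℂ W) :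
    H ⊗[ℂ] A →ₐ[ℂ] Module.End ℂ (V ⊗[ℂ] W) :=
  (Module.endTensorEndAlgHom (R := ℂ) (S := ℂ) (A := ℂ) (M := V) (N := W)).comp
    (Algebra.TensorProduct.map ρ σ)

lemma actTensor_tmul (ρ : H →ₐ[ℂ] Module.End ℂ V) (σ : A →ₐ[ℂ] Module.End ℂ W) (h : H) (a : A) :
    actTensor ρ σ (h ⊗ₜ a) = TensorProduct.map (ρ h) (σ a) := rfl

lemma actTensor_left {ρ : H →ₐ[ℂ] Module.End ℂ V} {τ : H →ₐ[ℂ] Module.End ℂ U}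
    (σ : A →ₐ[ℂ] Module.End ℂ W) (f : V →ₗ[ℂ] U) (hf : ∀ h, f ∘ₗ ρ h = τ h ∘ₗ f) (t : H ⊗[ℂ] A) :
    TensorProduct.map f LinearMap.id ∘ₗ actTensor ρ σ t =
      actTensor τ σ t ∘ₗ TensorProduct.map f LinearMap.id := by
  induction t with
  | zero => simp
  | add s t hs ht => rw [map_add, map_add, LinearMap.comp_add, LinearMap.add_comp, hs, ht]
  | tmul h b =>
    rw [actTensor_tmul, actTensor_tmul, ← TensorProduct.map_comp, ← TensorProduct.map_comp, hf h]
    rfl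

lemma actTensor_right (ρ : H →ₐ[ℂ] Module.End ℂ V) {σ : A →ₐ[ℂ] Module.End ℂ W}
    {τ : A →ₐ[ℂ] Module.End ℂ U} (f : W →ₗ[ℂ] U) (hf : ∀ a, f ∘ₗ σ a = τ a ∘ₗ f) (t : H ⊗[ℂ] A) :
    TensorProduct.map LinearMap.id f ∘ₗ actTensor ρ σ t =
      actTensor ρ τ t ∘ₗ TensorProduct.map LinearMap.id f := by
  induction t with
  | zero => simp
  | add s t hs ht => rw [map_add, map_add, LinearMap.comp_add, LinearMap.add_comp, hs, ht]
  | tmul h b =>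
    rw [actTensor_tmul, actTensor_tmul, ← TensorProduct.map_comp, ← TensorProduct.map_comp, hf b]
    rfl

lemma actTensor_assoc (β : A →ₐ[ℂ] H ⊗[ℂ] A)
    (hβ : ∀ a : A,
      TensorProduct.assoc ℂ H H A ((Coalgebra.comul (R := ℂ) (A := H)).rTensor A (β a)) =
        β.toLinearMap.lTensor H (β a))
    (ρ : H →ₐ[ℂ] Module.End ℂ V) (τ : H →ₐ[ℂ] Module.End ℂ U) (σ : A →ₐ[ℂ] Module.End ℂ W)
    (a : A) :
    (TensorProduct.assoc ℂ V U W).toLinearMap ∘ₗ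
        actTensor ((actTensor ρ τ).comp (Bialgebra.comulAlgHom ℂ H)) σ (β a) =
      actTensor ρ ((actTensor τ σ).comp β) (β a) ∘ₗ (TensorProduct.assoc ℂ V U W).toLinearMap := by
  let F : H ⊗[ℂ] (H ⊗[ℂ] A) →ₗ[ℂ] Module.End ℂ (V ⊗[ℂ] (U ⊗[ℂ] W)) :=
    TensorProduct.lift ((TensorProduct.mapBilinear (RingHom.id ℂ) V (U ⊗[ℂ] W) V
      (U ⊗[ℂ] W)).compl₁₂ ρ.toLinearMap (actTensor τ σ).toLinearMap)
  have e1 : ∀ t : H ⊗[ℂ] A, (TensorProduct.assoc ℂ V U W).toLinearMap ∘ₗ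
      actTensor ((actTensor ρ τ).comp (Bialgebra.comulAlgHom ℂ H)) σ t =
      F (TensorProduct.assoc ℂ H H A ((Coalgebra.comul (R := ℂ) (A := H)).rTensor A t)) ∘ₗ
        (TensorProduct.assoc ℂ V U W).toLinearMap := by
    intro t
    induction t with
    | zero => simp
    | add s t hs ht =>
      simp only [map_add, LinearMap.comp_add, LinearMap.add_comp, hs, ht]
    | tmul h b =>
      rw [actTensor_tmul, LinearMap.rTensor_tmul]
      change _ ∘ₗ TensorProduct.map (actTensor ρ τ (Coalgebra.comul h)) _ = _
      induction (Coalgebra.comul (R := ℂ) h) with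
      | zero => simp
      | add s t hs ht =>
        simp only [map_add, TensorProduct.map_add_left, TensorProduct.add_tmul,
          LinearMap.comp_add, LinearMap.add_comp, hs, ht]
      | tmul x y =>
        refine TensorProduct.ext_threefold fun p q r => ?_
        rfl
  have e2 : ∀ t : H ⊗[ℂ] A,
      actTensor ρ ((actTensor τ σ).comp β) t = F (β.toLinearMap.lTensor H t) := by
    intro t
    induction t with
    | zero => simp
    | add s t hs ht => simp only [map_add, hs, ht]
    | tmul h b => rfl
  rw [e1, e2, hβ]

lemma actTensor_unit (β : A →ₐ[ℂ] H ⊗[ℂ] A)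
    (hβ : ∀ a : A, TensorProduct.lid ℂ A ((Coalgebra.counit (R := ℂ) (A := H)).rTensor A (β a)) = a)
    (σ : A →ₐ[ℂ] Module.End ℂ W) (a : A) :
    (TensorProduct.lid ℂ W).toLinearMap ∘ₗ
        actTensor ((Algebra.lmul ℂ ℂ).comp (Bialgebra.counitAlgHom ℂ H)) σ (β a) =
      σ a ∘ₗ (TensorProduct.lid ℂ W).toLinearMap := by
  have e1 : ∀ t : H ⊗[ℂ] A, (TensorProduct.lid ℂ W).toLinearMap ∘ₗ
      actTensor ((Algebra.lmul ℂ ℂ).comp (Bialgebra.counitAlgHom ℂ H)) σ t =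
      σ (TensorProduct.lid ℂ A ((Coalgebra.counit (R := ℂ) (A := H)).rTensor A t)) ∘ₗ
        (TensorProduct.lid ℂ W).toLinearMap := by
    intro t
    induction t with
    | zero => simp
    | add s t hs ht => simp only [map_add, LinearMap.comp_add, LinearMap.add_comp, hs, ht]
    | tmul h b =>
      refine TensorProduct.ext' fun p q => ?_
      change ((Coalgebra.counit (R := ℂ) h) * p) • (σ b q) =
        σ ((Coalgebra.counit (R := ℂ) h) • b) (p • q)
      rw [map_smul, map_smul, LinearMap.smul_apply, smul_smul, mul_comm]
  rw [e1, hβ]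

lemma actTensor_unit_right (ρ : H →ₐ[ℂ] Module.End ℂ V) (a : H) :
    (TensorProduct.rid ℂ V).toLinearMap ∘ₗ
        actTensor ρ ((Algebra.lmul ℂ ℂ).comp (Bialgebra.counitAlgHom ℂ H))
          (Bialgebra.comulAlgHom ℂ H a) =
      ρ a ∘ₗ (TensorProduct.rid ℂ V).toLinearMap := by
  have e1 : ∀ t : H ⊗[ℂ] H, (TensorProduct.rid ℂ V).toLinearMap ∘ₗ
      actTensor ρ ((Algebra.lmul ℂ ℂ).comp (Bialgebra.counitAlgHom ℂ H)) t =
      ρ (TensorProduct.rid ℂ H ((Coalgebra.counit (R := ℂ) (A := H)).lTensor H t)) ∘ₗ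
        (TensorProduct.rid ℂ V).toLinearMap := by
    intro t
    induction t with
    | zero => simp
    | add s t hs ht => simp only [map_add, LinearMap.comp_add, LinearMap.add_comp, hs, ht]
    | tmul h b =>
      refine TensorProduct.ext' fun p q => ?_
      change ((Coalgebra.counit (R := ℂ) b) * q) • (ρ h p) =
        ρ ((Coalgebra.counit (R := ℂ) b) • h) (q • p)
      rw [map_smul, map_smul, LinearMap.smul_apply, smul_smul, mul_comm]
  rw [e1]
  change ρ (TensorProduct.rid ℂ H ((Coalgebra.counit (R := ℂ)).lTensor H (Coalgebra.comul a))) ∘ₗ _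
    = _
  rw [Coalgebra.lTensor_counit_comul]
  simp

end Unbundled

section Coherence
variable {D : Type*} [Category D] [MonoidalCategory D]

lemma coh_assoc (X Y Z : D) : (α_ X Y Z).hom =
    (𝟙 _ ≫ (𝟙 _ ⊗ₘ 𝟙 _)) ≫ (α_ X Y Z).hom ≫ ((𝟙 _ ⊗ₘ 𝟙 _) ≫ 𝟙 _) := by simp

lemma coh_right (X : D) : (ρ_ X).hom = (𝟙 _ ≫ (𝟙 _ ⊗ₘ 𝟙 _)) ≫ (ρ_ X).hom := by simp

lemma coh_left (X : D) : (λ_ X).hom = (𝟙 _ ≫ (𝟙 _ ⊗ₘ 𝟙 _)) ≫ (λ_ X).hom := by simp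

lemma coh_comp {X Y Z P Q R : D} (f₁ : X ⟶ Y) (f₂ : Y ⟶ Z) (g₁ : P ⟶ Q) (g₂ : Q ⟶ R) :
    (f₁ ≫ f₂) ▷ P ≫ Z ◁ (g₁ ≫ g₂) = (f₁ ▷ P ≫ Y ◁ g₁) ≫ (f₂ ▷ Q ≫ Z ◁ g₂) := by
  simp [MonoidalCategory.whisker_exchange_assoc]

lemma coh_assoc_nat {X X' Y Y' Z Z' : D} (f : X ⟶ X') (g : Y ⟶ Y') (h : Z ⟶ Z') :
    ((f ▷ Y ≫ X' ◁ g) ▷ Z ≫ (X' ⊗ Y') ◁ h) ≫ (α_ _ _ _).hom =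
      (α_ _ _ _).hom ≫ f ▷ (Y ⊗ Z) ≫ X' ◁ (g ▷ Z ≫ Y' ◁ h) := by simp

lemma coh_unit_nat {X Y : D} (f : X ⟶ Y) : (λ_ X).hom ≫ f = 𝟙_ D ◁ f ≫ (λ_ Y).hom := by simp

lemma coh_whisker {X Y : D} (f : X ⟶ Y) (P Q : D) :
    (f ▷ P) ▷ Q = (α_ _ _ _).hom ≫ f ▷ (P ⊗ Q) ≫ (α_ _ _ _).inv := by simp

lemma coh_unit (X Y : D) : (λ_ X).hom ▷ Y = (α_ _ _ _).hom ≫ (λ_ (X ⊗ Y)).hom := by simp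

lemma coh_tensor {X Y P Q : D} (f : X ⟶ Y) (g : P ⟶ Q) :
    (f ▷ P) ≫ (Y ◁ g) = 𝟙 _ ≫ (f ⊗ₘ g) ≫ 𝟙 _ := by simp [MonoidalCategory.tensorHom_def]

end Coherence

lemma coh_triv {D : Type*} [Category D] {X Y : D} (f : X ⟶ Y) : f = 𝟙 _ ≫ f ≫ 𝟙 _ := by simp

namespace FdMod

section Tensor

variable {H : Type u} {A : Type v} [Ring H] [Bialgebra ℂ H] [Ring A] [Algebra ℂ A]

/-- `X ⊗ N` as an `A`-module, through an algebra homomorphism `β : A → H ⊗ A`. -/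
def tens (β : A →ₐ[ℂ] H ⊗[ℂ] A) (X : FdMod H) (N : FdMod A) : FdMod A where
  V := X.V ⊗ N.V
  ρ := (actTensor (V := X.V) (W := N.V) X.ρ N.ρ).comp β

/-- The trivial module. -/
def triv (H : Type u) [Ring H] [Bialgebra ℂ H] : FdMod H where
  V := 𝟙_ Vect
  ρ := (Algebra.lmul ℂ ℂ).comp (Bialgebra.counitAlgHom ℂ H)

/-- The tensor product of representations of a bialgebra `H`. -/
instance : MonoidalCategoryStruct (FdMod H) where
  tensorObj X Y := tens (Bialgebra.comulAlgHom ℂ H) X Y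
  whiskerLeft X _ _ f := ⟨X.V ◁ f.1, fun a => actTensor_right (V := X.V) X.ρ (lin f.1) f.2 _⟩
  whiskerRight f Y := ⟨f.1 ▷ Y.V, fun a => actTensor_left (W := Y.V) Y.ρ (lin f.1) f.2 _⟩
  tensorUnit := triv H
  associator X Y Z := mkIso (α_ X.V Y.V Z.V)
    (actTensor_assoc (V := X.V) (U := Y.V) (W := Z.V) (Bialgebra.comulAlgHom ℂ H)
      (fun a => Coalgebra.coassoc_apply a) X.ρ Y.ρ Z.ρ)
  leftUnitor X := mkIso (λ_ X.V)
    (actTensor_unit (W := X.V) (Bialgebra.comulAlgHom ℂ H) (fun a => by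
      change TensorProduct.lid ℂ H ((Coalgebra.counit (R := ℂ)).rTensor H (Coalgebra.comul a)) = a
      rw [Coalgebra.rTensor_counit_comul]; simp) X.ρ)
  rightUnitor X := mkIso (ρ_ X.V) (actTensor_unit_right (V := X.V) X.ρ)

/-- The data showing that the forgetful functor preserves the tensor product strictly. -/
def forgetData : Monoidal.InducingFunctorData (forget H) where
  μIso X Y := Iso.refl (X.V ⊗ Y.V)
  εIso := Iso.refl (𝟙_ Vect)
  whiskerLeft_eq X _ _ f := coh_triv (X.V ◁ f.1)
  whiskerRight_eq f Y := coh_triv (f.1 ▷ Y.V)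
  tensorHom_eq f g := coh_tensor f.1 g.1
  associator_eq X Y Z := coh_assoc X.V Y.V Z.V
  leftUnitor_eq X := coh_left X.V
  rightUnitor_eq X := coh_right X.V

instance : MonoidalCategory (FdMod H) := Monoidal.induced (forget H) forgetData

instance : (forget H).Monoidal := Monoidal.fromInducedMonoidal (forget H) forgetData

/-- `Rep(H)` acts on `A`-modules for a left `H`-comodule algebra `A`: `a` acts on `X ⊗ N` by
`x ⊗ n ↦ ∑ a⁽⁻¹⁾ x ⊗ a⁽⁰⁾ n`. -/
instance [LeftComoduleAlgebra H A] : MonoidalLeftAction (FdMod H) (FdMod A) where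
  actionObj X N := tens (LeftComoduleAlgebra.coact (H := H)) X N
  actionHomLeft f N := ⟨f.1 ▷ N.V, fun a => actTensor_left (W := N.V) N.ρ (lin f.1) f.2 _⟩
  actionHomRight X _ _ f := ⟨X.V ◁ f.1, fun a => actTensor_right (V := X.V) X.ρ (lin f.1) f.2 _⟩
  actionAssocIso X Y N := mkIso (α_ X.V Y.V N.V)
    (actTensor_assoc (V := X.V) (U := Y.V) (W := N.V) _
    LeftComoduleAlgebra.coact_coassoc X.ρ Y.ρ N.ρ)
  actionUnitIso N := mkIso (λ_ N.V) (actTensor_unit (W := N.V) _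
    LeftComoduleAlgebra.coact_counit N.ρ)
  actionHom_def _ _ := rfl
  actionHomRight_id X N := Subtype.ext (MonoidalCategory.whiskerLeft_id X.V N.V)
  id_actionHomLeft X N := Subtype.ext (MonoidalCategory.id_whiskerRight X.V N.V)
  actionHom_comp f₁ f₂ g₁ g₂ := Subtype.ext (coh_comp f₁.1 f₂.1 g₁.1 g₂.1)
  actionAssocIso_hom_naturality f g h := Subtype.ext (coh_assoc_nat f.1 g.1 h.1)
  actionUnitIso_hom_naturality f := Subtype.ext (coh_unit_nat f.1)
  whiskerLeft_actionHomLeft X _ _ f N := Subtype.ext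
    (MonoidalCategory.whisker_assoc X.V f.1 N.V)
  whiskerRight_actionHomLeft Y f N := Subtype.ext (coh_whisker f.1 _ N.V)
  associator_actionHom X Y Z N := Subtype.ext
    (MonoidalCategory.pentagon X.V Y.V Z.V N.V)
  leftUnitor_actionHom X N := Subtype.ext (coh_unit X.V N.V)
  rightUnitor_actionHom X N := Subtype.ext
    (MonoidalCategory.triangle X.V N.V).symm

end Tensor

end FdMod

/-! ### Hopf algebras and comodule algebras -/

/-- A left `H`-comodule algebra is indecomposable if it is not a direct sum of two nonzero
two-sided ideals that are subcomodules. -/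
def IsIndecomposable (H : Type u) (A : Type v) [Ring H] [Bialgebra ℂ H] [Ring A] [Algebra ℂ A]
    [LeftComoduleAlgebra H A] : Prop :=
  ∀ I J : Submodule ℂ A,
    (∀ K ∈ ({I, J} : Set (Submodule ℂ A)), (∀ a : A, ∀ x ∈ K, a * x ∈ K ∧ x * a ∈ K) ∧
      ∀ x ∈ K, LeftComoduleAlgebra.coact (H := H) x ∈ LinearMap.range (K.subtype.lTensor H)) →
    IsCompl I J → I = ⊥ ∨ J = ⊥

/-- A finite-dimensional Hopf algebra with an involution is a `C*` Hopf algebra if the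
comultiplication is a `*`-homomorphism and the algebra has a faithful `*`-representation on a
Hilbert space. -/
def IsCStarHopf (H : Type u) [Ring H] [Bialgebra ℂ H] [StarRing H] [StarModule ℂ H] : Prop :=
  (∀ x : H, Coalgebra.comul (R := ℂ) (star x) =
    TensorProduct.map (starLinearEquiv ℂ (A := H)).toLinearMap
      (starLinearEquiv ℂ (A := H)).toLinearMap (Coalgebra.comul (R := ℂ) x)) ∧
  ∃ (E : Type) (_ : NormedAddCommGroup E) (_ : InnerProductSpace ℂ E) (_ : CompleteSpace E)
    (π : H →⋆ₐ[ℂ] (E →L[ℂ] E)), Function.Injective π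

/-! ### Fusion categories and module categories -/

section Cat

variable (C : Type u₁) [Category.{v₁} C] [Preadditive C] [Linear ℂ C]

variable {C} in
/-- `s` is a complete list, without repetition, of the simple objects of a semisimple category. -/
structure IsSimpleSystem {I : Type} [Fintype I] (s : I → C) : Prop where
  finrank_end : ∀ i, Module.finrank ℂ (s i ⟶ s i) = 1
  hom_zero : ∀ i j, i ≠ j → Subsingleton (s i ⟶ s j)
  decomposition : ∀ X : C, ∃ (k : ℕ) (t : Fin k → I) (b : Limits.Bicone fun a => s (t a)),
    Nonempty b.IsBilimit ∧ Nonempty (b.pt ≅ X)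

/-- A finite semisimple `ℂ`-linear category. -/
def IsFinSemisimple : Prop :=
  Limits.HasFiniteBiproducts C ∧ ∃ (n : ℕ) (s : Fin n → C), IsSimpleSystem s

variable [MonoidalCategory C]

/-- A fusion category over `ℂ`. -/
structure IsFusion : Prop where
  bilinear : ∃ _ : MonoidalPreadditive C, MonoidalLinear ℂ C
  finSemisimple : IsFinSemisimple C
  rigid : Nonempty (RigidCategory C)
  finrank_unit : Module.finrank ℂ (𝟙_ C ⟶ 𝟙_ C) = 1

/-- The structure of a unitary monoidal category: a positive `*`-operation on morphisms that is
compatible with the tensor product. -/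
structure UnitaryStructure where
  dag : ∀ {X Y : C}, (X ⟶ Y) → (Y ⟶ X)
  dag_dag : ∀ {X Y : C} (f : X ⟶ Y), dag (dag f) = f
  dag_comp : ∀ {X Y Z : C} (f : X ⟶ Y) (g : Y ⟶ Z), dag (f ≫ g) = dag g ≫ dag f
  dag_add : ∀ {X Y : C} (f g : X ⟶ Y), dag (f + g) = dag f + dag g
  dag_smul : ∀ {X Y : C} (c : ℂ) (f : X ⟶ Y), dag (c • f) = conj c • dag f
  dag_tensor : ∀ {X Y Z W : C} (f : X ⟶ Y) (g : Z ⟶ W), dag (f ⊗ₘ g) = dag f ⊗ₘ dag g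
  dag_associator : ∀ X Y Z : C, dag (α_ X Y Z).hom = (α_ X Y Z).inv
  dag_leftUnitor : ∀ X : C, dag (λ_ X).hom = (λ_ X).inv
  dag_rightUnitor : ∀ X : C, dag (ρ_ X).hom = (ρ_ X).inv
  eq_zero : ∀ {X Y : C} (f : X ⟶ Y), f ≫ dag f = 0 → f = 0
  positive : ∀ {X Y : C} (f : X ⟶ Y), ∃ g : X ⟶ X, f ≫ dag f = g ≫ dag g

variable {C}

/-- The structure of a unitary tensor functor to Hilbert spaces on a fiber functor. -/
structure UnitaryFiber (U : UnitaryStructure C) (ω : C ⥤ Vect) [ω.Monoidal] where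
  form : ∀ X : C, ω.obj X →ₗ⋆[ℂ] ω.obj X →ₗ[ℂ] ℂ
  form_symm : ∀ (X : C) (x y : ω.obj X), conj (form X x y) = form X y x
  form_pos : ∀ (X : C) (x : ω.obj X), x ≠ 0 → 0 < (form X x x).re
  form_dag : ∀ {X Y : C} (f : X ⟶ Y) (x : ω.obj X) (y : ω.obj Y),
    form Y (lin (ω.map f) x) y = form X x (lin (ω.map (U.dag f)) y)
  form_tensor : ∀ (X Y : C) (x x' : ω.obj X) (y y' : ω.obj Y),
    form (X ⊗ Y) (lin (Functor.LaxMonoidal.μ ω X Y) (x ⊗ₜ y))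
      (lin (Functor.LaxMonoidal.μ ω X Y) (x' ⊗ₜ y')) = form X x x' * form Y y y'
  form_unit : form (𝟙_ C) (lin (Functor.LaxMonoidal.ε ω) (1 : ℂ))
    (lin (Functor.LaxMonoidal.ε ω) (1 : ℂ)) = 1

/-- A `ℂ`-linear monoidal category with a fiber functor is unitarizable if it is equivalent, as a
category with a fiber functor, to one with a unitary structure and a unitary fiber functor. -/
def IsUnitarizable (ω : C ⥤ Vect) [ω.Monoidal] : Prop :=
  ∃ (D : Type u₁) (_ : Category.{v₁} D) (_ : Preadditive D) (_ : Linear ℂ D)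
    (_ : MonoidalCategory D) (U : UnitaryStructure D) (ω' : D ⥤ Vect) (_ : ω'.Monoidal)
    (E : D ⥤ C) (_ : E.Monoidal) (κ : E ⋙ ω ≅ ω'),
    E.IsEquivalence ∧ E.Additive ∧ (∀ (X Y : D) (c : ℂ) (f : X ⟶ Y), E.map (c • f) = c • E.map f) ∧
    NatTrans.IsMonoidal κ.hom ∧ Nonempty (UnitaryFiber U ω')

variable (C)
variable (M : Type u₂) [Category.{v₂} M] [Preadditive M] [Linear ℂ M] [MonoidalLeftAction C M]

/-- `M` is a nonzero, indecomposable, finite semisimple `C`-module category with a bilinear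
action. -/
structure IsIndecomposableModuleCategory : Prop where
  add_left : ∀ {X Y : C} (f g : X ⟶ Y) (m : M), (f + g) ⊵ₗ m = f ⊵ₗ m + g ⊵ₗ m
  smul_left : ∀ {X Y : C} (c : ℂ) (f : X ⟶ Y) (m : M), (c • f) ⊵ₗ m = c • (f ⊵ₗ m)
  add_right : ∀ (X : C) {m n : M} (f g : m ⟶ n), X ⊴ₗ (f + g) = X ⊴ₗ f + X ⊴ₗ g
  smul_right : ∀ (X : C) {m n : M} (c : ℂ) (f : m ⟶ n), X ⊴ₗ (c • f) = c • (X ⊴ₗ f)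
  finSemisimple : IsFinSemisimple M
  nonzero : ∃ m : M, ¬ Limits.IsZero m
  indecomposable : ∀ P Q : M → Prop,
    (∀ (X : C) (m : M), P m → P (X ⊙ₗ m)) → (∀ (X : C) (m : M), Q m → Q (X ⊙ₗ m)) →
    (∀ m n : M, P m → Q n → Subsingleton (m ⟶ n) ∧ Subsingleton (n ⟶ m)) →
    (∀ m : M, ∃ (p q : M) (b : Limits.BinaryBicone p q),
      P p ∧ Q q ∧ Nonempty b.IsBilimit ∧ Nonempty (b.pt ≅ m)) →
    (∀ m, P m → Limits.IsZero m) ∨ (∀ m, Q m → Limits.IsZero m)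

end Cat

section ModuleFunctor

variable {C : Type u₁} [Category.{v₁} C] [MonoidalCategory C]
  {D : Type u₂} [Category.{v₂} D] [MonoidalCategory D]
  {M : Type u₃} [Category.{v₃} M] [MonoidalLeftAction C M]
  {N : Type u₄} [Category.{v₄} N] [MonoidalLeftAction D N]

/-- The structure of a module functor over the monoidal functor `K : C ⥤ D` on a functor from the
`C`-module category `M` to the `D`-module category `N`. -/
structure ModuleFunctorAlong (K : C ⥤ D) [K.Monoidal] (F : M ⥤ N) where
  iso : ∀ (X : C) (m : M), K.obj X ⊙ₗ F.obj m ≅ F.obj (X ⊙ₗ m)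
  natural_left : ∀ {X Y : C} (f : X ⟶ Y) (m : M),
    K.map f ⊵ₗ F.obj m ≫ (iso Y m).hom = (iso X m).hom ≫ F.map (f ⊵ₗ m)
  natural_right : ∀ (X : C) {m n : M} (g : m ⟶ n),
    K.obj X ⊴ₗ F.map g ≫ (iso X n).hom = (iso X m).hom ≫ F.map (X ⊴ₗ g)
  assoc : ∀ (X Y : C) (m : M),
    Functor.LaxMonoidal.μ K X Y ⊵ₗ F.obj m ≫ (iso (X ⊗ Y) m).hom ≫ F.map (αₗ X Y m).hom =
      (αₗ (K.obj X) (K.obj Y) (F.obj m)).hom ≫ K.obj X ⊴ₗ (iso Y m).hom ≫ (iso X (Y ⊙ₗ m)).hom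
  unit : ∀ m : M,
    Functor.LaxMonoidal.ε K ⊵ₗ F.obj m ≫ (iso (𝟙_ C) m).hom ≫ F.map (λₗ m).hom = (λₗ (F.obj m)).hom

end ModuleFunctor

/-! ### Internal endomorphisms -/

/-- An internal endomorphism object of `m`. -/
structure InternalEnd (C : Type u₁) [Category.{v₁} C] [MonoidalCategory C]
    {M : Type u₂} [Category.{v₂} M] [MonoidalLeftAction C M] (m : M) where
  obj : C
  ev : obj ⊙ₗ m ⟶ m
  universal : ∀ (X : C) (f : X ⊙ₗ m ⟶ m), ∃! t : X ⟶ obj, t ⊵ₗ m ≫ ev = f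

namespace InternalEnd

variable {C : Type u₁} [Category.{v₁} C] [MonoidalCategory C]
    {M : Type u₂} [Category.{v₂} M] [MonoidalLeftAction C M] {m : M} (E : InternalEnd C m)

def lift {X : C} (f : X ⊙ₗ m ⟶ m) : X ⟶ E.obj := (E.universal X f).choose

lemma lift_ev {X : C} (f : X ⊙ₗ m ⟶ m) : E.lift f ⊵ₗ m ≫ E.ev = f :=
  (E.universal X f).choose_spec.1

lemma ext {X : C} {f g : X ⟶ E.obj} (h : f ⊵ₗ m ≫ E.ev = g ⊵ₗ m ≫ E.ev) : f = g :=
  (E.universal X _).unique h rfl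

lemma whisker_ev {X : C} (f : X ⟶ E.obj) :
    (f ▷ E.obj) ⊵ₗ m ≫ (αₗ E.obj E.obj m).hom ≫ E.obj ⊴ₗ E.ev ≫ E.ev =
      (αₗ X E.obj m).hom ≫ X ⊴ₗ E.ev ≫ f ⊵ₗ m ≫ E.ev := by
  rw [whiskerRight_actionHomLeft]
  simp only [Category.assoc, Iso.inv_hom_id_assoc]
  rw [← action_exchange_assoc]

/-- The multiplication corresponds to `ev ∘ (E ⊗ ev)` and the unit to the unitor. -/
instance mon : MonObj E.obj where
  one := E.lift (λₗ m).hom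
  mul := E.lift ((αₗ E.obj E.obj m).hom ≫ E.obj ⊴ₗ E.ev ≫ E.ev)
  one_mul := E.ext (by
    rw [MonoidalLeftAction.comp_actionHomLeft, Category.assoc, lift_ev, whisker_ev, lift_ev,
      unit_actionHomRight, leftUnitor_actionHom]
    simp)
  mul_one := E.ext (by
    rw [MonoidalLeftAction.comp_actionHomLeft, Category.assoc, lift_ev,
      whiskerLeft_actionHomLeft, rightUnitor_actionHom]
    simp only [Category.assoc, Iso.inv_hom_id_assoc]
    rw [← actionHomRight_comp_assoc, lift_ev])
  mul_assoc := E.ext (by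
    rw [MonoidalLeftAction.comp_actionHomLeft, MonoidalLeftAction.comp_actionHomLeft,
      MonoidalLeftAction.comp_actionHomLeft, Category.assoc, Category.assoc, Category.assoc,
      lift_ev, whisker_ev, lift_ev, whiskerLeft_actionHomLeft]
    simp only [Category.assoc, Iso.inv_hom_id_assoc]
    rw [← actionHomRight_comp_assoc E.obj (E.lift _ ⊵ₗ m), lift_ev, tensor_actionHomRight]
    simp)

end InternalEnd

/-- The algebra of a monoid object of `Vect`. -/
def VAlg (V : Vect) [MonObj V] : Type := V

section VAlg
variable (V : Vect) [MonObj V]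

instance : AddCommGroup (VAlg V) := inferInstanceAs (AddCommGroup V)
instance : Module ℂ (VAlg V) := inferInstanceAs (Module ℂ V)

def VAlg.mul : VAlg V →ₗ[ℂ] VAlg V →ₗ[ℂ] VAlg V :=
  TensorProduct.curry (lin (MonObj.mul (X := V)))

def VAlg.one : VAlg V := lin (MonObj.one (X := V)) (1 : ℂ)

lemma VAlg.mul_assoc' (x y z : VAlg V) : mul V (mul V x y) z = mul V x (mul V y z) :=
  congrArg (fun f : (V ⊗ V) ⊗ V ⟶ V => lin f ((x ⊗ₜ y) ⊗ₜ z)) (MonObj.mul_assoc V)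

lemma VAlg.one_mul' (x : VAlg V) : mul V (one V) x = x :=
  (congrArg (fun f : 𝟙_ Vect ⊗ V ⟶ V => lin f ((1 : ℂ) ⊗ₜ x)) (MonObj.one_mul V)).trans
    (one_smul ℂ (x : V))

lemma VAlg.mul_one' (x : VAlg V) : mul V x (one V) = x :=
  (congrArg (fun f : V ⊗ 𝟙_ Vect ⟶ V => lin f (x ⊗ₜ (1 : ℂ))) (MonObj.mul_one V)).trans
    (one_smul ℂ (x : V))

instance : Ring (VAlg V) where
  __ := (inferInstance : AddCommGroup (VAlg V))
  mul x y := VAlg.mul V x y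
  one := VAlg.one V
  left_distrib x y z := map_add (VAlg.mul V x) y z
  right_distrib x y z := LinearMap.congr_fun (map_add (VAlg.mul V) x y) z
  zero_mul x := LinearMap.congr_fun (map_zero (VAlg.mul V)) x
  mul_zero x := map_zero (VAlg.mul V x)
  mul_assoc := VAlg.mul_assoc' V
  one_mul := VAlg.one_mul' V
  mul_one := VAlg.mul_one' V
instance : Algebra ℂ (VAlg V) := Algebra.ofModule
  (fun c x y => LinearMap.congr_fun (map_smul (VAlg.mul V) c x) y)
  (fun c x y => map_smul (VAlg.mul V x) c y)

end VAlg

/-! ### The smash product -/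

/-- The structure of a left `H`-module algebra on the algebra `A`. -/
structure ModuleAlgebra (H : Type u) (A : Type v) [Ring H] [Bialgebra ℂ H]
    [Ring A] [Algebra ℂ A] where
  act : H →ₐ[ℂ] Module.End ℂ A
  act_mul : ∀ (h : H) (a b : A), act h (a * b) =
    LinearMap.mul' ℂ A (Module.endTensorEndAlgHom (R := ℂ) (S := ℂ) (A := ℂ) (M := A) (N := A)
      (Algebra.TensorProduct.map act act (Coalgebra.comul h)) (a ⊗ₜ b))
  act_one : ∀ h : H, act h 1 = Coalgebra.counit (R := ℂ) h • (1 : A)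

/-- The underlying space of the smash product `Aᵒᵖ # Hᶜᵒᵖ`. -/
def OpSmash {H : Type u} {A : Type v} [Ring H] [Bialgebra ℂ H] [Ring A] [Algebra ℂ A]
    (_ : ModuleAlgebra H A) : Type (max u v) := A ⊗[ℂ] H

namespace OpSmash

variable {H : Type u} {A : Type v} [Ring H] [Bialgebra ℂ H] [Ring A] [Algebra ℂ A]
  (m : ModuleAlgebra H A)

instance : AddCommGroup (OpSmash m) := inferInstanceAs (AddCommGroup (A ⊗[ℂ] H))
instance : Module ℂ (OpSmash m) := inferInstanceAs (Module ℂ (A ⊗[ℂ] H))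

/-- `h ⊗ k` acts on `A ⊗ H` by `b ⊗ g ↦ (k · b) ⊗ h g`. -/
def psi₂ : H ⊗[ℂ] H →ₗ[ℂ] Module.End ℂ (A ⊗[ℂ] H) :=
  TensorProduct.lift (((TensorProduct.mapBilinear (RingHom.id ℂ) A H A H).compl₁₂
    m.act.toLinearMap (Algebra.lmul ℂ H).toLinearMap).flip)

lemma psi₂_tmul (h k : H) :
    psi₂ m (h ⊗ₜ k) = TensorProduct.map (m.act k) (LinearMap.mulLeft ℂ h) := rfl

lemma psi₂_mul (s t : H ⊗[ℂ] H) : psi₂ m (s * t) = psi₂ m s * psi₂ m t := by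
  induction s with
  | zero => simp
  | add x y hx hy => rw [add_mul, map_add, hx, hy, map_add, add_mul]
  | tmul h k =>
    induction t with
    | zero => simp
    | add x y hx hy => rw [mul_add, map_add, hx, hy, map_add, mul_add]
    | tmul h' k' =>
      rw [Algebra.TensorProduct.tmul_mul_tmul, psi₂_tmul, psi₂_tmul, psi₂_tmul, map_mul,
        LinearMap.mulLeft_mul]
      exact TensorProduct.map_comp _ _ _ _

/-- `h` acts on `A ⊗ H` by `b ⊗ g ↦ ∑ (h₂ · b) ⊗ h₁ g`. -/
def psi : H →ₗ[ℂ] Module.End ℂ (A ⊗[ℂ] H) := psi₂ m ∘ₗ Coalgebra.comul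

/-- Right multiplication by `a` on the first factor. -/
def rmul : A →ₗ[ℂ] Module.End ℂ (A ⊗[ℂ] H) :=
  (LinearMap.rTensorHom H) ∘ₗ (LinearMap.mul ℂ A).flip

/-- Left multiplication in the smash product:
`(a # h) (b # g) = ∑ (h₂ · b) a # h₁ g`. -/
def lam : A ⊗[ℂ] H →ₗ[ℂ] Module.End ℂ (A ⊗[ℂ] H) :=
  TensorProduct.lift ((LinearMap.mul ℂ (Module.End ℂ (A ⊗[ℂ] H))).compl₁₂ rmul (psi m))

lemma lam_tmul (a : A) (h : H) : lam m (a ⊗ₜ h) = rmul a * psi m h := rfl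

lemma psi_mul (h k : H) : psi m (h * k) = psi m h * psi m k := by
  simp only [psi, LinearMap.comp_apply, Bialgebra.comul_mul, psi₂_mul]

lemma psi_one : psi m 1 = 1 := by
  simp only [psi, LinearMap.comp_apply, Bialgebra.comul_one, Algebra.TensorProduct.one_def,
    psi₂_tmul, map_one]
  refine TensorProduct.ext' fun a h => ?_
  simp

/-- `x ⊗ y ⊗ z` acts by `c ⊗ g ↦ (y · c) (z · b) ⊗ x g`. -/
def tri (b : A) : H ⊗[ℂ] (H ⊗[ℂ] H) →ₗ[ℂ] Module.End ℂ (A ⊗[ℂ] H) :=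
  TensorProduct.lift (((TensorProduct.mapBilinear (RingHom.id ℂ) A H A H).compl₁₂
    (TensorProduct.lift (((LinearMap.mul ℂ (Module.End ℂ A)).flip).compl₁₂ m.act.toLinearMap
      ((LinearMap.mul ℂ A).flip ∘ₗ m.act.toLinearMap.flip b)))
    (Algebra.lmul ℂ H).toLinearMap).flip)

lemma tri_tmul (b : A) (x y z : H) : tri m b (x ⊗ₜ (y ⊗ₜ z)) =
    TensorProduct.map (LinearMap.mulRight ℂ (m.act z b) * m.act y) (LinearMap.mulLeft ℂ x) := rfl

/-- `h ⊗ k` is sent to right multiplication by `k · b` after the action of `h`. -/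
def duo (b : A) : H ⊗[ℂ] H →ₗ[ℂ] Module.End ℂ (A ⊗[ℂ] H) :=
  TensorProduct.lift ((LinearMap.mul ℂ (Module.End ℂ (A ⊗[ℂ] H))).compl₁₂
    (rmul ∘ₗ m.act.toLinearMap.flip b) (psi m)).flip

lemma duo_tmul (b : A) (h k : H) : duo m b (h ⊗ₜ k) = rmul (m.act k b) * psi m h := rfl

lemma psi₂_rmul (b : A) (s : H ⊗[ℂ] H) :
    psi₂ m s * rmul b = tri m b (Coalgebra.comul.lTensor H s) := by
  induction s with
  | zero => simp
  | add x y hx hy => rw [map_add, add_mul, hx, hy, map_add, map_add]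
  | tmul h k =>
    have key : m.act k ∘ₗ LinearMap.mulRight ℂ b =
        TensorProduct.lift (((LinearMap.mul ℂ (Module.End ℂ A)).flip).compl₁₂ m.act.toLinearMap
          ((LinearMap.mul ℂ A).flip ∘ₗ m.act.toLinearMap.flip b)) (Coalgebra.comul k) := by
      refine LinearMap.ext fun c => ?_
      refine (m.act_mul k c b).trans ?_
      induction (Coalgebra.comul (R := ℂ) k) with
      | zero => simp
      | add x y hx hy => simp only [map_add, LinearMap.add_apply, hx, hy]
      | tmul x y => rfl
    have : psi₂ m (h ⊗ₜ k) * rmul b =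
        TensorProduct.map (m.act k ∘ₗ LinearMap.mulRight ℂ b) (LinearMap.mulLeft ℂ h) :=
      TensorProduct.ext' fun _ _ => rfl
    rw [this, key]
    rfl

lemma duo_eq (b : A) (s : H ⊗[ℂ] H) :
    duo m b s = tri m b (TensorProduct.assoc ℂ H H H (Coalgebra.comul.rTensor H s)) := by
  induction s with
  | zero => simp
  | add x y hx hy => simp only [map_add, hx, hy]
  | tmul h k =>
    rw [duo_tmul, psi, LinearMap.comp_apply, LinearMap.rTensor_tmul]
    induction (Coalgebra.comul (R := ℂ) h) with
    | zero => simp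
    | add x y hx hy => simp only [map_add, mul_add, TensorProduct.add_tmul, hx, hy]
    | tmul x y => exact TensorProduct.ext' fun _ _ => rfl

lemma psi_rmul (h : H) (b : A) : psi m h * rmul b = duo m b (Coalgebra.comul h) := by
  rw [duo_eq, Coalgebra.coassoc_apply, ← psi₂_rmul]
  rfl

lemma lam_rmul (a : A) (t : A ⊗[ℂ] H) : lam m (rmul a t) = rmul a * lam m t := by
  induction t with
  | zero => simp
  | add x y hx hy => rw [map_add, map_add, hx, hy, map_add, mul_add]
  | tmul c h =>
    change rmul (c * a) * psi m h = rmul a * (rmul c * psi m h)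
    rw [← mul_assoc]
    congr 1
    exact TensorProduct.ext' fun x y => by
      change (x * (c * a)) ⊗ₜ[ℂ] y = ((x * c) * a) ⊗ₜ[ℂ] y
      rw [mul_assoc]

lemma lam_psi (h g : H) (b : A) : lam m (psi m h (b ⊗ₜ g)) = psi m h * rmul b * psi m g := by
  rw [psi_rmul, psi, LinearMap.comp_apply]
  induction (Coalgebra.comul (R := ℂ) h) with
  | zero => simp
  | add x y hx hy => simp only [map_add, LinearMap.add_apply, add_mul, hx, hy]
  | tmul x y =>
    change rmul (m.act y b) * psi m (x * g) = (rmul (m.act y b) * psi m x) * psi m g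
    rw [psi_mul, mul_assoc]

lemma lam_lam (s t : A ⊗[ℂ] H) : lam m (lam m s t) = lam m s * lam m t := by
  induction s with
  | zero => simp
  | add x y hx hy => rw [map_add, LinearMap.add_apply, map_add, hx, hy, add_mul]
  | tmul a h =>
    induction t with
    | zero => simp
    | add x y hx hy => rw [map_add, map_add, hx, hy, map_add, mul_add]
    | tmul b g =>
      change lam m (rmul a (psi m h (b ⊗ₜ g))) = (rmul a * psi m h) * (rmul b * psi m g)
      rw [lam_rmul, lam_psi]
      simp only [mul_assoc]

lemma lam_one : lam m (1 ⊗ₜ 1) = 1 := by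
  rw [lam_tmul, psi_one, mul_one]
  exact TensorProduct.ext' fun x y => by
    change (x * 1) ⊗ₜ[ℂ] y = x ⊗ₜ[ℂ] y
    rw [mul_one]

lemma lam_apply_one (t : A ⊗[ℂ] H) : lam m t (1 ⊗ₜ 1) = t := by
  induction t with
  | zero => simp
  | add x y hx hy => rw [map_add, LinearMap.add_apply, hx, hy]
  | tmul a h =>
    change rmul a (psi₂ m (Coalgebra.comul h) (1 ⊗ₜ 1)) = a ⊗ₜ h
    have : ∀ s : H ⊗[ℂ] H, psi₂ m s ((1 : A) ⊗ₜ (1 : H)) =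
        (1 : A) ⊗ₜ (TensorProduct.rid ℂ H (Coalgebra.counit.lTensor H s)) := by
      intro s
      induction s with
      | zero => simp
      | add x y hx hy => simp only [map_add, LinearMap.add_apply, hx, hy, TensorProduct.tmul_add]
      | tmul x y =>
        change m.act y 1 ⊗ₜ[ℂ] (x * 1) = (1 : A) ⊗ₜ[ℂ] (Coalgebra.counit (R := ℂ) y • x)
        rw [m.act_one, mul_one, TensorProduct.smul_tmul]
    rw [this, Coalgebra.lTensor_counit_comul]
    change (TensorProduct.rid ℂ H (h ⊗ₜ 1) : H) |> fun k => ((1 : A) * a) ⊗ₜ[ℂ] k = a ⊗ₜ h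
    simp

instance : Ring (OpSmash m) where
  __ := (inferInstance : AddCommGroup (OpSmash m))
  mul s t := lam m s t
  one := (1 : A) ⊗ₜ[ℂ] (1 : H)
  left_distrib x y z := map_add (lam m x) y z
  right_distrib x y z := LinearMap.congr_fun (map_add (lam m) x y) z
  zero_mul x := LinearMap.congr_fun (map_zero (lam m)) x
  mul_zero x := map_zero (lam m x)
  mul_assoc x y z := LinearMap.congr_fun (lam_lam m x y) z
  one_mul x := LinearMap.congr_fun (lam_one m) x
  mul_one x := lam_apply_one m x

instance : Algebra ℂ (OpSmash m) := Algebra.ofModule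
  (fun c x y => LinearMap.congr_fun (map_smul (lam m) c x) y)
  (fun c x y => map_smul (lam m x) c y)

/-- The coaction `a # h ↦ ∑ h₁ ⊗ (a # h₂)`. -/
def coactLin : A ⊗[ℂ] H →ₗ[ℂ] H ⊗[ℂ] (A ⊗[ℂ] H) :=
  (TensorProduct.leftComm ℂ A H H).toLinearMap ∘ₗ Coalgebra.comul.lTensor A

lemma coactLin_tmul (a : A) (h : H) :
    coactLin (a ⊗ₜ[ℂ] h) = TensorProduct.leftComm ℂ A H H (a ⊗ₜ Coalgebra.comul h) := rfl

/-- `u ⊗ v ⊗ w` sends `r ⊗ k` to `u r ⊗ (w · b) a ⊗ v k`. -/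
def quad (a b : A) : H ⊗[ℂ] (H ⊗[ℂ] H) →ₗ[ℂ] (H ⊗[ℂ] H →ₗ[ℂ] H ⊗[ℂ] (A ⊗[ℂ] H)) :=
  TensorProduct.lift ((TensorProduct.mapBilinear (RingHom.id ℂ) H H H (A ⊗[ℂ] H)).compl₁₂
    (LinearMap.mul ℂ H)
    { toFun := fun p => rmul a ∘ₗ psi₂ m p ∘ₗ TensorProduct.mk ℂ A H b
      map_add' := fun p q => by
        rw [map_add, LinearMap.add_comp, LinearMap.comp_add]
      map_smul' := fun c p => by
        rw [map_smul, LinearMap.smul_comp, LinearMap.comp_smul, RingHom.id_apply] })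

lemma quad_tmul (a b : A) (u : H) (p : H ⊗[ℂ] H) (r k : H) :
    quad m a b (u ⊗ₜ p) (r ⊗ₜ k) = (u * r) ⊗ₜ rmul a (psi₂ m p (b ⊗ₜ k)) := rfl

/-- The product of `H ⊗ (Aᵒᵖ # Hᶜᵒᵖ)`. -/
def mulH : H ⊗[ℂ] (A ⊗[ℂ] H) →ₗ[ℂ] H ⊗[ℂ] (A ⊗[ℂ] H) →ₗ[ℂ] H ⊗[ℂ] (A ⊗[ℂ] H) :=
  TensorProduct.map₂ (LinearMap.mul ℂ H) (lam m)

lemma mulH_tmul (x y : H) (s t : A ⊗[ℂ] H) :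
    mulH m (x ⊗ₜ s) (y ⊗ₜ t) = (x * y) ⊗ₜ lam m s t := rfl

lemma coactLin_lam (s t : A ⊗[ℂ] H) :
    coactLin (lam m s t) = mulH m (coactLin s) (coactLin t) := by
  have red : ∀ (a : A) (h : H) (b : A) (g : H),
      coactLin (lam m (a ⊗ₜ h) (b ⊗ₜ g)) = mulH m (coactLin (a ⊗ₜ h)) (coactLin (b ⊗ₜ g)) := by
    intro a h b g
    have e1 : ∀ s : H ⊗[ℂ] H, coactLin (rmul a (psi₂ m s (b ⊗ₜ g))) =
        quad m a b (TensorProduct.assoc ℂ H H H (Coalgebra.comul.rTensor H s))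
          (Coalgebra.comul g) := by
      intro s
      induction s with
      | zero => simp
      | add x y hx hy => simp only [map_add, LinearMap.add_apply, hx, hy]
      | tmul p q =>
        change TensorProduct.leftComm ℂ A H H
          ((m.act q b * a) ⊗ₜ Coalgebra.comul (p * g)) = _
        rw [Bialgebra.comul_mul, LinearMap.rTensor_tmul]
        induction (Coalgebra.comul (R := ℂ) p) with
        | zero => simp
        | add x y hx hy =>
          simp only [add_mul, TensorProduct.tmul_add, TensorProduct.add_tmul, map_add,
            LinearMap.add_apply, hx, hy]
        | tmul u v =>
          induction (Coalgebra.comul (R := ℂ) g) with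
          | zero => simp
          | add x y hx hy =>
            simp only [mul_add, TensorProduct.tmul_add, map_add, hx, hy]
          | tmul r k =>
            rw [Algebra.TensorProduct.tmul_mul_tmul]
            rfl
    have e2 : ∀ s : H ⊗[ℂ] H, quad m a b (Coalgebra.comul.lTensor H s) (Coalgebra.comul g) =
        mulH m (TensorProduct.leftComm ℂ A H H (a ⊗ₜ s))
          (TensorProduct.leftComm ℂ A H H (b ⊗ₜ Coalgebra.comul g)) := by
      intro s
      induction s with
      | zero => simp
      | add x y hx hy => simp only [map_add, LinearMap.add_apply, TensorProduct.tmul_add, hx, hy]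
      | tmul p q =>
        induction (Coalgebra.comul (R := ℂ) g) with
        | zero => simp
        | add x y hx hy => simp only [map_add, TensorProduct.tmul_add, hx, hy]
        | tmul r k => rfl
    change coactLin (rmul a (psi₂ m (Coalgebra.comul h) (b ⊗ₜ g))) = _
    rw [e1, Coalgebra.coassoc_apply, e2]
    rfl
  induction s with
  | zero => simp
  | add x y hx hy => simp only [map_add, LinearMap.add_apply, hx, hy]
  | tmul a h =>
    induction t with
    | zero => simp
    | add x y hx hy => simp only [map_add, hx, hy]
    | tmul b g => exact red a h b g

lemma coactLin_coassoc (x : A ⊗[ℂ] H) :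
    TensorProduct.assoc ℂ H H (A ⊗[ℂ] H)
      ((Coalgebra.comul (R := ℂ) (A := H)).rTensor (A ⊗[ℂ] H) (coactLin x)) =
      coactLin.lTensor H (coactLin x) := by
  induction x with
  | zero => simp
  | add x y hx hy => simp only [map_add, hx, hy]
  | tmul a h =>
    have e : ∀ s : H ⊗[ℂ] H, TensorProduct.assoc ℂ H H (A ⊗[ℂ] H)
        ((Coalgebra.comul (R := ℂ) (A := H)).rTensor (A ⊗[ℂ] H)
          (TensorProduct.leftComm ℂ A H H (a ⊗ₜ s))) =
        ((TensorProduct.mk ℂ A H a).lTensor H).lTensor H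
          (TensorProduct.assoc ℂ H H H (Coalgebra.comul.rTensor H s)) := by
      intro s
      induction s with
      | zero => simp
      | add x y hx hy => simp only [map_add, TensorProduct.tmul_add, hx, hy]
      | tmul p q =>
        rw [LinearMap.rTensor_tmul, TensorProduct.leftComm_tmul, LinearMap.rTensor_tmul]
        induction (Coalgebra.comul (R := ℂ) p) with
        | zero => simp
        | add x y hx hy => simp only [map_add, TensorProduct.add_tmul, hx, hy]
        | tmul u v => rfl
    have e' : ∀ s : H ⊗[ℂ] H, coactLin.lTensor H (TensorProduct.leftComm ℂ A H H (a ⊗ₜ s)) =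
        ((TensorProduct.mk ℂ A H a).lTensor H).lTensor H (Coalgebra.comul.lTensor H s) := by
      intro s
      induction s with
      | zero => simp
      | add x y hx hy => simp only [map_add, TensorProduct.tmul_add, hx, hy]
      | tmul p q =>
        rw [LinearMap.lTensor_tmul, TensorProduct.leftComm_tmul, LinearMap.lTensor_tmul,
          LinearMap.lTensor_tmul, coactLin_tmul]
        induction (Coalgebra.comul (R := ℂ) q) with
        | zero => simp
        | add x y hx hy => simp only [map_add, TensorProduct.tmul_add, hx, hy]
        | tmul u v => rfl
    rw [coactLin_tmul, e, Coalgebra.coassoc_apply, e']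

lemma coactLin_counit (x : A ⊗[ℂ] H) :
    TensorProduct.lid ℂ (A ⊗[ℂ] H)
      ((Coalgebra.counit (R := ℂ) (A := H)).rTensor (A ⊗[ℂ] H) (coactLin x)) = x := by
  induction x with
  | zero => simp
  | add x y hx hy => simp only [map_add, hx, hy]
  | tmul a h =>
    have e : ∀ s : H ⊗[ℂ] H, TensorProduct.lid ℂ (A ⊗[ℂ] H)
        ((Coalgebra.counit (R := ℂ) (A := H)).rTensor (A ⊗[ℂ] H)
          (TensorProduct.leftComm ℂ A H H (a ⊗ₜ s))) =
        a ⊗ₜ TensorProduct.lid ℂ H ((Coalgebra.counit (R := ℂ) (A := H)).rTensor H s) := by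
      intro s
      induction s with
      | zero => simp
      | add x y hx hy => simp only [map_add, TensorProduct.tmul_add, hx, hy]
      | tmul p q => simp
    rw [coactLin_tmul, e, Coalgebra.rTensor_counit_comul]
    simp

lemma map₂_eq_mul {B : Type*} [Ring B] [Algebra ℂ B] (f : B →ₗ[ℂ] B →ₗ[ℂ] B)
    (hf : ∀ x y, f x y = x * y) (s t : H ⊗[ℂ] B) :
    TensorProduct.map₂ (LinearMap.mul ℂ H) f s t = s * t := by
  induction s with
  | zero => simp
  | add x y hx hy => rw [map_add, LinearMap.add_apply, hx, hy, add_mul]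
  | tmul x a =>
    induction t with
    | zero => simp
    | add y z hy hz => rw [map_add, hy, hz, mul_add]
    | tmul y b =>
      rw [TensorProduct.map₂_apply_tmul, TensorProduct.map_tmul, hf, Algebra.TensorProduct.tmul_mul_tmul]
      rfl

instance comoduleAlgebra : LeftComoduleAlgebra H (OpSmash m) where
  coact := AlgHom.ofLinearMap (coactLin : OpSmash m →ₗ[ℂ] H ⊗[ℂ] OpSmash m)
    (by
      change TensorProduct.leftComm ℂ A H H ((1 : A) ⊗ₜ Coalgebra.comul (1 : H)) = _
      rw [Bialgebra.comul_one]
      rfl)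
    (fun x y => (coactLin_lam m x y).trans
      (map₂_eq_mul (B := OpSmash m) (lam m) (fun _ _ => rfl) _ _))
  coact_coassoc x := coactLin_coassoc x
  coact_counit x := coactLin_counit x

end OpSmash

/-! ### Endomorphisms of a fiber functor -/

/-- The action of the endomorphism algebra of `ω` on `ω X`. -/
def endAct {C : Type u₁} [Category.{v₁} C] (ω : C ⥤ Vect) (X : C) :
    End ω →ₐ[ℂ] Module.End ℂ (ω.obj X) where
  toFun f := lin (NatTrans.app f X)
  map_one' := rfl
  map_mul' _ _ := rfl
  map_zero' := rfl
  map_add' _ _ := rfl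
  commutes' _ := rfl

section Tannaka

variable {C : Type u₁} [Category.{v₁} C] (ω : C ⥤ Vect)
  {H : Type u} [Ring H] [Algebra ℂ H] (e : H →ₐ[ℂ] End ω)

/-- The functor `X ↦ ω X` to modules over an algebra that acts on `ω`. -/
def comparison : C ⥤ FdMod H where
  obj X := ⟨ω.obj X, (endAct ω X).comp e⟩
  map f := ⟨ω.map f, fun a => congrArg lin (NatTrans.naturality (e a : ω ⟶ ω) f).symm⟩
  map_id X := Subtype.ext (ω.map_id X)
  map_comp f g := Subtype.ext (ω.map_comp f g)

end Tannaka

/-- The map from an algebra to the endomorphisms of the forgetful functor of its modules. -/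
def toEndForget (H : Type u) [Ring H] [Algebra ℂ H] : H →ₐ[ℂ] End (FdMod.forget H) where
  toFun h := { app := fun X => FGModuleCat.ofHom (X.ρ h)
               naturality := fun _ _ f => FGModuleCat.hom_ext (f.2 h).symm }
  map_one' := NatTrans.ext (funext fun X => FGModuleCat.hom_ext (map_one X.ρ))
  map_mul' h k := NatTrans.ext (funext fun X => FGModuleCat.hom_ext (map_mul X.ρ h k))
  map_zero' := NatTrans.ext (funext fun X => FGModuleCat.hom_ext (map_zero X.ρ))
  map_add' h k := NatTrans.ext (funext fun X => FGModuleCat.hom_ext (map_add X.ρ h k))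
  commutes' c := NatTrans.ext (funext fun X => FGModuleCat.hom_ext (X.ρ.commutes c))

/-! ### Lattices -/

/-- A trivalent bulk vertex: `x` enters, `y` leaves and `z` is the third edge, attached on the left
of the path from `x` to `y`. The counterclockwise order is `x, y, z`. -/
structure BulkVertex (E : Type) where
  x : E
  y : E
  z : E
  /-- whether the third edge points towards the vertex -/
  zIn : Bool
  x_ne_y : x ≠ y
  x_ne_z : x ≠ z
  y_ne_z : y ≠ z

/-- A trivalent boundary vertex: the boundary edge `x` enters, the boundary edge `y` leaves, and the
bulk edge `z` is attached on the left of the boundary, where the bulk is. -/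
structure BoundaryVertex (E B : Type) where
  x : B
  y : B
  z : E
  /-- whether the bulk edge points towards the vertex -/
  zIn : Bool
  /-- whether the chosen boundary site lies after the bulk edge in the direction of the boundary -/
  upper : Bool
  x_ne_y : x ≠ y

/-- One step of the counterclockwise path around a face. -/
inductive Step (E B : Type) where
  /-- a bulk edge that has the face on its left -/
  | left (e : E)
  /-- a bulk edge that has the face on its right -/
  | right (e : E)
  /-- a boundary edge; boundary edges always have the bulk on their left -/
  | boundary (b : B)

/-- The combinatorial data of a directed trivalent lattice on a surface with boundary from which
the two models are built. The edges of a face are listed counterclockwise from its site. -/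
structure Lattice where
  E : Type
  B : Type
  V : Type
  W : Type
  F : Type
  [fintypeE : Fintype E]
  [fintypeB : Fintype B]
  [fintypeV : Fintype V]
  [fintypeW : Fintype W]
  [fintypeF : Fintype F]
  [decidableEqE : DecidableEq E]
  [decidableEqB : DecidableEq B]
  bulkVertex : V → BulkVertex E
  boundaryVertex : W → BoundaryVertex E B
  face : F → List (Step E B)

attribute [instance] Lattice.fintypeE Lattice.fintypeB Lattice.fintypeV Lattice.fintypeW
  Lattice.fintypeF Lattice.decidableEqE Lattice.decidableEqB

section Total

variable (L : Lattice) (P : Type u₁) (Q : Type u₂) [AddCommGroup P] [Module ℂ P]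
  [AddCommGroup Q] [Module ℂ Q]

/-- The total space, with a copy of `P` on each bulk edge and of `Q` on each boundary edge. -/
abbrev Total : Type _ := (⨂[ℂ] _ : L.E, P) ⊗[ℂ] (⨂[ℂ] _ : L.B, Q)

variable {P Q}

/-- An operator on the bulk edge `e`. -/
def bulkOp (e : L.E) : Module.End ℂ P →ₗ[ℂ] Module.End ℂ (Total L P Q) :=
  LinearMap.rTensorHom _ ∘ₗ
    (PiTensorProduct.mapMultilinear ℂ (fun _ : L.E => P) (fun _ => P)).toLinearMap
      (fun _ => LinearMap.id) e

/-- An operator on the boundary edge `b`. -/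
def bdryOp (b : L.B) : Module.End ℂ Q →ₗ[ℂ] Module.End ℂ (Total L P Q) :=
  LinearMap.lTensorHom _ ∘ₗ
    (PiTensorProduct.mapMultilinear ℂ (fun _ : L.B => Q) (fun _ => Q)).toLinearMap
      (fun _ => LinearMap.id) b

variable {L} in
/-- The commuting projector Hamiltonian built from vertex and face operators. -/
def hamiltonian (v : L.V → Module.End ℂ (Total L P Q)) (w : L.W → Module.End ℂ (Total L P Q))
    (f : L.F → Module.End ℂ (Total L P Q)) : Module.End ℂ (Total L P Q) :=
  ∑ i, (1 - v i) + ∑ i, (1 - w i) + ∑ i, (1 - f i)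

end Total

/-- The product of two linear maps to an algebra. -/
def mulMap {P : Type u₁} {Q : Type u₂} {R : Type u₃} [AddCommGroup P] [Module ℂ P]
    [AddCommGroup Q] [Module ℂ Q] [Semiring R] [Algebra ℂ R] (f : P →ₗ[ℂ] R) (g : Q →ₗ[ℂ] R) :
    P ⊗[ℂ] Q →ₗ[ℂ] R :=
  LinearMap.mul' ℂ R ∘ₗ TensorProduct.map f g

/-! ### The Hopf quantum double model -/

namespace QD

section Integrals

variable (H : Type u) [Ring H] [Bialgebra ℂ H]

/-- The Haar integral of `H`. -/
def IsHaar (h : H) : Prop :=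
  (∀ k : H, k * h = Coalgebra.counit (R := ℂ) k • h ∧ h * k = Coalgebra.counit (R := ℂ) k • h) ∧
    Coalgebra.counit (R := ℂ) h = 1

/-- The Haar integral of the dual of `H`. -/
def IsDualHaar (φ : Module.Dual ℂ H) : Prop :=
  (∀ h : H, TensorProduct.rid ℂ H (φ.lTensor H (Coalgebra.comul h)) = φ h • 1 ∧
    TensorProduct.lid ℂ H (φ.rTensor H (Coalgebra.comul h)) = φ h • 1) ∧ φ 1 = 1

/-- A symmetric separability idempotent of the algebra `A`. -/
def IsSymmSeparabilityIdempotent (A : Type v) [Ring A] [Algebra ℂ A] (l : A ⊗[ℂ] A) : Prop :=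
  (∀ a : A, (LinearMap.mulLeft ℂ a).rTensor A l = (LinearMap.mulRight ℂ a).lTensor A l) ∧
    LinearMap.mul' ℂ A l = 1 ∧ TensorProduct.comm ℂ A A l = l

end Integrals

variable {H : Type u} {A : Type v} [Ring H] [HopfAlgebra ℂ H] [Ring A] [Algebra ℂ A]
  [LeftComoduleAlgebra H A]

/-- The edge operator `L₊ʰ x = h x`. -/
def Lp : A →ₗ[ℂ] Module.End ℂ A := LinearMap.mul ℂ A

/-- Right multiplication; the edge operator `L₋ʰ` is right multiplication by `S h`. -/
def Rm : A →ₗ[ℂ] Module.End ℂ A := (LinearMap.mul ℂ A).flip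

/-- The antipode. -/
abbrev S : H →ₗ[ℂ] H := HopfAlgebra.antipode ℂ (A := H)

/-- The edge operator `T₊ᵠ x = ∑ φ(x₂) x₁`. -/
def Tp : Module.Dual ℂ H →ₗ[ℂ] Module.End ℂ H where
  toFun φ := (TensorProduct.rid ℂ H).toLinearMap ∘ₗ φ.lTensor H ∘ₗ Coalgebra.comul
  map_add' φ ψ := by
    rw [LinearMap.lTensor_add, LinearMap.add_comp, LinearMap.comp_add]
  map_smul' c φ := by
    rw [LinearMap.lTensor_smul, LinearMap.smul_comp, LinearMap.comp_smul, RingHom.id_apply]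

/-- The edge operator `T₋ᵠ x = ∑ φ(S(x⁽⁻¹⁾)) x⁽⁰⁾` on a left comodule with coaction `β`. -/
def Tm (β : A →ₗ[ℂ] H ⊗[ℂ] A) : Module.Dual ℂ H →ₗ[ℂ] Module.End ℂ A where
  toFun φ := (TensorProduct.lid ℂ A).toLinearMap ∘ₗ (φ ∘ₗ S).rTensor A ∘ₗ β
  map_add' φ ψ := by
    rw [LinearMap.add_comp, LinearMap.rTensor_add, LinearMap.add_comp, LinearMap.comp_add]
  map_smul' c φ := by
    rw [LinearMap.smul_comp, LinearMap.rTensor_smul, LinearMap.smul_comp, LinearMap.comp_smul,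
      RingHom.id_apply]

variable (L : Lattice)

variable (A) in
/-- The operator `A^h` at a bulk vertex: `L^{h₁}` on `x`, `L^{h₂}` on `y` and `L^{h₃}` on `z`, with
`L₊` on incoming and `L₋` on outgoing edges. -/
def bulkVertex (v : BulkVertex L.E) : H →ₗ[ℂ] Module.End ℂ (Total L H A) :=
  mulMap (bulkOp L v.x ∘ₗ Lp)
    (mulMap (bulkOp L v.y ∘ₗ Rm ∘ₗ S) (bulkOp L v.z ∘ₗ bif v.zIn then Lp else Rm ∘ₗ S) ∘ₗ
      Coalgebra.comul) ∘ₗ Coalgebra.comul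

/-- The operator `A^{a ⊗ b}` at a boundary vertex. For a site after the bulk edge, it sends
`(x, y, z)` to `(a⁽⁰⁾ x, y b, a⁽⁻¹⁾ z)` or `(a⁽⁰⁾ x, y b, z S(a⁽⁻¹⁾))`; for a site before the bulk
edge, it sends `(x, y, z)` to `(a x, y b⁽⁰⁾, S(b⁽⁻¹⁾) z)` or `(a x, y b⁽⁰⁾, z b⁽⁻¹⁾)`, depending on
the direction of the bulk edge. -/
def boundaryVertex (w : BoundaryVertex L.E L.B) :
    A ⊗[ℂ] A →ₗ[ℂ] Module.End ℂ (Total L H A) :=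
  bif w.upper then
    mulMap
      (mulMap (bulkOp L w.z ∘ₗ bif w.zIn then Lp else Rm ∘ₗ S) (bdryOp L w.x ∘ₗ Lp) ∘ₗ
        (LeftComoduleAlgebra.coact (H := H) (A := A)).toLinearMap)
      (bdryOp L w.y ∘ₗ Rm)
  else
    mulMap (bdryOp L w.x ∘ₗ Lp)
      (mulMap (bulkOp L w.z ∘ₗ bif w.zIn then Lp ∘ₗ S else Rm) (bdryOp L w.y ∘ₗ Rm) ∘ₗ
        (LeftComoduleAlgebra.coact (H := H) (A := A)).toLinearMap)

/-- The action of the dual of `H` on an edge of a face. -/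
def step : Step L.E L.B → (Module.Dual ℂ H →ₗ[ℂ] Module.End ℂ (Total L H A))
  | .left e => bulkOp L e ∘ₗ Tm Coalgebra.comul
  | .right e => bulkOp L e ∘ₗ Tp
  | .boundary b => bdryOp L b ∘ₗ Tm (LeftComoduleAlgebra.coact (H := H) (A := A)).toLinearMap

/-- The comultiplication of the dual of `H`. -/
def dualComul [Module.Finite ℂ H] : Module.Dual ℂ H →ₗ[ℂ] Module.Dual ℂ H ⊗[ℂ] Module.Dual ℂ H :=
  (TensorProduct.dualDistribEquiv ℂ H H).symm.toLinearMap ∘ₗ (LinearMap.mul' ℂ H).dualMap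

/-- The operator `B^φ = ∑ T^{φ₁} ⊗ ⋯ ⊗ T^{φₙ}` of a face. -/
def face [Module.Finite ℂ H] :
    List (Step L.E L.B) → (Module.Dual ℂ H →ₗ[ℂ] Module.End ℂ (Total L H A))
  | [] => (LinearMap.toSpanSingleton ℂ _ 1) ∘ₗ Module.Dual.eval ℂ H 1
  | p :: l => mulMap (step L p) (face l) ∘ₗ dualComul

end QD

/-! ### The extended string-net model -/

namespace SN

section Legs

/-- The inverse of the transposition of endomorphisms of a finite-dimensional space. -/
def undual (V : Vect) : Module.End ℂ (Module.Dual ℂ V) →ₗ[ℂ] Module.End ℂ V :=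
  (Module.evalEquiv ℂ V).symm.conj.toLinearMap ∘ₗ Module.Dual.transpose (R := ℂ)

/-- The identification of endomorphisms of `V` with elements of `V ⊗ V^∨`. -/
def flat (V : Vect) : Module.End ℂ V →ₗ[ℂ] V ⊗[ℂ] Module.Dual ℂ V :=
  (TensorProduct.comm ℂ _ _).toLinearMap ∘ₗ (dualTensorHomEquiv ℂ V V).symm.toLinearMap

variable {M : Type u₂} [Category.{v₂} M] (F : M ⥤ Vect) {I : Type} (t : I → M)

/-- The edge space `⨁ F(x) ⊗ F(x)^∨`. -/
abbrev EdgeSpace : Type := ∀ x : I, F.obj (t x) ⊗[ℂ] Module.Dual ℂ (F.obj (t x))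

variable {F t} [DecidableEq I]

/-- An operator from the summand of `x` to the summand of `y`. -/
def block (x y : I) :
    (F.obj (t x) ⊗[ℂ] Module.Dual ℂ (F.obj (t x)) →ₗ[ℂ]
      F.obj (t y) ⊗[ℂ] Module.Dual ℂ (F.obj (t y))) →ₗ[ℂ] Module.End ℂ (EdgeSpace F t) where
  toFun g := LinearMap.single ℂ _ y ∘ₗ g ∘ₗ LinearMap.proj x
  map_add' f g := by rw [LinearMap.add_comp, LinearMap.comp_add]
  map_smul' c f := by rw [LinearMap.smul_comp, LinearMap.comp_smul, RingHom.id_apply]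

/-- An operator on the factor `F(x)` of the summand of `x`; zero on the other summands. -/
def target (x : I) : Module.End ℂ (F.obj (t x)) →ₗ[ℂ] Module.End ℂ (EdgeSpace F t) :=
  block x x ∘ₗ LinearMap.rTensorHom _

/-- An operator on the factor `F(x)^∨` of the summand of `x`; zero on the other summands. -/
def source (x : I) :
    Module.End ℂ (Module.Dual ℂ (F.obj (t x))) →ₗ[ℂ] Module.End ℂ (EdgeSpace F t) :=
  block x x ∘ₗ LinearMap.lTensorHom _

end Legs

section Symbol

variable {C : Type u₁} [Category.{v₁} C] [MonoidalCategory C]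
  {M : Type u₂} [Category.{v₂} M] [MonoidalLeftAction C M]
  (ω : C ⥤ Vect) (F : M ⥤ Vect) (J : ∀ (X : C) (N : M), ω.obj X ⊗ F.obj N ≅ F.obj (X ⊙ₗ N))

open Classical in
/-- The projection of the space of linear maps `F(U) → F(V)` to the image of `Hom(U, V)`, along the
orthogonal complement of the image of `Hom(V, U)` with respect to the trace pairing. -/
def homProj (U V : M) :
    (F.obj U →ₗ[ℂ] F.obj V) →ₗ[ℂ] (F.obj U →ₗ[ℂ] F.obj V) :=
  let P : Submodule ℂ (F.obj U →ₗ[ℂ] F.obj V) :=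
    Submodule.span ℂ (Set.range fun g : U ⟶ V => lin (F.map g))
  let Q : Submodule ℂ (F.obj U →ₗ[ℂ] F.obj V) :=
    ⨅ g : V ⟶ U, LinearMap.ker (LinearMap.trace ℂ (F.obj U) ∘ₗ LinearMap.llcomp ℂ _ _ _ (lin (F.map g)))
  if h : IsCompl P Q then P.projection Q h else 0

/-- The identification of `ω(i) ⊗ F(x) ⊗ F(y)^∨` with the linear maps from `F(y)` to `F(i ⊗ x)`. -/
def vertexEquiv (i : C) (x y : M) :
    ω.obj i ⊗[ℂ] (F.obj x ⊗[ℂ] Module.Dual ℂ (F.obj y)) ≃ₗ[ℂ] (F.obj y →ₗ[ℂ] F.obj (i ⊙ₗ x)) :=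
  (TensorProduct.assoc ℂ _ _ _).symm ≪≫ₗ TensorProduct.comm ℂ _ _ ≪≫ₗ
    dualTensorHomEquiv ℂ (F.obj y) (ω.obj i ⊗[ℂ] F.obj x) ≪≫ₗ
    LinearEquiv.congrRight (FGModuleCat.isoToLinearEquiv (J i x))

/-- The `3j`-symbol `W^y_{i x}`, that is, the projector of `ω(i) ⊗ F(x) ⊗ F(y)^∨` to
`Hom(y, i ⊗ x)`, as an element of `End ω(i) ⊗ End F(x) ⊗ End F(y)^∨`. -/
def symbol (i : C) (x y : M) : Module.End ℂ (ω.obj i) ⊗[ℂ] (Module.End ℂ (F.obj x) ⊗[ℂ]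
    Module.End ℂ (Module.Dual ℂ (F.obj y))) :=
  (homTensorHomEquiv ℂ (F.obj x) (Module.Dual ℂ (F.obj y)) (F.obj x)
    (Module.Dual ℂ (F.obj y))).symm.toLinearMap.lTensor _
    ((homTensorHomEquiv ℂ (ω.obj i) (F.obj x ⊗[ℂ] Module.Dual ℂ (F.obj y)) (ω.obj i)
      (F.obj x ⊗[ℂ] Module.Dual ℂ (F.obj y))).symm
      ((vertexEquiv ω F J i x y).symm.conj (homProj F y (i ⊙ₗ x))))

variable {I K : Type} [Fintype I] [DecidableEq I] [Fintype K] [DecidableEq K]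
  (s : I → C) (t : K → M)

/-- The vertex operator `Q`, as an element of the algebra `R` of operators of the lattice:
`⨁ Q^{i x; y}` for an incoming and its transpose `⨁ Q^{i y; x}` for an outgoing edge `z`, where the
factors act on the ends of the edges at the vertex. -/
def vertex {R : Type u} [Semiring R] [Algebra ℂ R] (zIn : Bool)
    (z : Module.End ℂ (EdgeSpace ω s) →ₗ[ℂ] R) (x y : Module.End ℂ (EdgeSpace F t) →ₗ[ℂ] R) : R :=
  bif zIn then
    ∑ i, ∑ a, ∑ b, mulMap (z ∘ₗ target i) (mulMap (x ∘ₗ target a) (y ∘ₗ source b))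
      (symbol ω F J (s i) (t a) (t b))
  else
    ∑ i, ∑ a, ∑ b, mulMap (z ∘ₗ source i ∘ₗ Module.Dual.transpose (R := ℂ))
      (mulMap (y ∘ₗ source b ∘ₗ Module.Dual.transpose (R := ℂ)) (x ∘ₗ target a ∘ₗ undual _))
      (symbol ω F J (s i) (t b) (t a))

/-- The square root of the product of the dimensions of two objects. -/
def sqrtDim (x y : M) : ℂ :=
  (Real.sqrt (Module.finrank ℂ (F.obj x) * Module.finrank ℂ (F.obj y)) : ℝ)

/-- The operator-valued matrix on an edge with a face on its left:
`⨁ √(dim x dim x') W^{x'}_{ν x}`, contracted with the summand of `x` by evaluation. -/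
def edgeLeft (ν : C) : Module.End ℂ (ω.obj ν) ⊗[ℂ] Module.End ℂ (EdgeSpace F t) :=
  ∑ x, ∑ x', sqrtDim F (t x) (t x') •
    LinearMap.lTensor (Module.End ℂ (ω.obj ν))
      (block x x' ∘ₗ dualTensorHom ℂ _ _ ∘ₗ
        TensorProduct.map
          ({ toFun := fun T => contractRight ℂ _ ∘ₗ T.rTensor _
             map_add' := fun T T' => by rw [LinearMap.rTensor_add, LinearMap.comp_add]
             map_smul' := fun c T => by
              rw [LinearMap.rTensor_smul, LinearMap.comp_smul, RingHom.id_apply] } :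
            Module.End ℂ (F.obj (t x)) →ₗ[ℂ]
              Module.Dual ℂ (F.obj (t x) ⊗[ℂ] Module.Dual ℂ (F.obj (t x))))
          (flat _ ∘ₗ undual (F.obj (t x'))))
      (symbol ω F J ν (t x) (t x'))

end Symbol

section Model

variable {C : Type u₁} [Category.{v₁} C] [MonoidalCategory C]
  {M : Type u₂} [Category.{v₂} M] [MonoidalLeftAction C M]
  (ω : C ⥤ Vect) [ω.Monoidal] (F : M ⥤ Vect)
  (J : ∀ (X : C) (N : M), ω.obj X ⊗ F.obj N ≅ F.obj (X ⊙ₗ N))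
  {I K : Type} [Fintype I] [DecidableEq I] [Fintype K] [DecidableEq K]
  (s : I → C) (t : K → M)

/-- The isomorphisms `ω(X) ⊗ ω(Y) ≅ ω(X ⊗ Y)`. -/
def bulkJ (X Y : C) : ω.obj X ⊗ ω.obj Y ≅ ω.obj (X ⊙ₗ Y) := Functor.Monoidal.μIso ω X Y

/-- The operator-valued matrix on a bulk edge with a face on its right:
`⨁ √(dim i dim i') W^{i}_{i' ν}`, contracted with the summand of `i` by evaluation. -/
def edgeRight (ν : C) : Module.End ℂ (ω.obj ν) ⊗[ℂ] Module.End ℂ (EdgeSpace ω s) :=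
  ∑ i, ∑ i', sqrtDim ω (s i) (s i') •
    LinearMap.lTensor (Module.End ℂ (ω.obj ν))
      (block i i' ∘ₗ dualTensorHom ℂ _ _ ∘ₗ (TensorProduct.comm ℂ _ _).toLinearMap ∘ₗ
        TensorProduct.map (flat (ω.obj (s i')))
          ({ toFun := fun T => contractRight ℂ _ ∘ₗ T.lTensor _
             map_add' := fun T T' => by rw [LinearMap.lTensor_add, LinearMap.comp_add]
             map_smul' := fun c T => by
              rw [LinearMap.lTensor_smul, LinearMap.comp_smul, RingHom.id_apply] } :
            Module.End ℂ (Module.Dual ℂ (ω.obj (s i))) →ₗ[ℂ]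
              Module.Dual ℂ (ω.obj (s i) ⊗[ℂ] Module.Dual ℂ (ω.obj (s i)))))
      (TensorProduct.leftComm ℂ _ _ _ (symbol ω ω (bulkJ ω) (s i') ν (s i)))

variable (L : Lattice)

/-- The operator of the extended string-net model at a bulk vertex. -/
def bulkVertex (v : BulkVertex L.E) :
    Module.End ℂ (Total L (EdgeSpace ω s) (EdgeSpace F t)) :=
  vertex ω ω (bulkJ ω) s s v.zIn (bulkOp L v.z) (bulkOp L v.x) (bulkOp L v.y)

/-- The operator of the extended string-net model at a boundary vertex. -/
def boundaryVertex (w : BoundaryVertex L.E L.B) :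
    Module.End ℂ (Total L (EdgeSpace ω s) (EdgeSpace F t)) :=
  vertex ω F J s t w.zIn (bulkOp L w.z) (bdryOp L w.x) (bdryOp L w.y)

/-- The contribution of an edge to the operator `B^ν` of a face. -/
def step (ν : C) : Step L.E L.B →
    Module.End ℂ (ω.obj ν) ⊗[ℂ] Module.End ℂ (Total L (EdgeSpace ω s) (EdgeSpace F t))
  | .left e => LinearMap.lTensor _ (bulkOp L e) (edgeLeft ω ω (bulkJ ω) s ν)
  | .right e => LinearMap.lTensor _ (bulkOp L e) (edgeRight ω s ν)
  | .boundary b => LinearMap.lTensor _ (bdryOp L b) (edgeLeft ω F J t ν)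

/-- The face operator `B = ∑ (dim ν / ∑ dim²) B^ν`, where `B^ν` is the partial trace over `ω(ν)` of
the product of the contributions of the edges. -/
def face (l : List (Step L.E L.B)) :
    Module.End ℂ (Total L (EdgeSpace ω s) (EdgeSpace F t)) :=
  ∑ i, ((Module.finrank ℂ (ω.obj (s i)) : ℂ) /
      ∑ j, (Module.finrank ℂ (ω.obj (s j)) : ℂ) ^ 2) •
    TensorProduct.lid ℂ _ (LinearMap.rTensor _ (LinearMap.trace ℂ (ω.obj (s i)))
      (l.map (step ω F J s t L (s i))).prod)

end Model

end SN

/-! ### Equivalence of the lattice models -/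

/-- The Fourier transform `a ↦ ⨁ √(dim x) ρ_x(a)` from an algebra that acts on the functor `F` to
the edge space of `F`. -/
def fourier {M : Type u₂} [Category.{v₂} M] (F : M ⥤ Vect) {I : Type} (t : I → M)
    {A : Type v} [Ring A] [Algebra ℂ A] (act : ∀ N : M, A →ₐ[ℂ] Module.End ℂ (F.obj N)) :
    A →ₗ[ℂ] SN.EdgeSpace F t :=
  LinearMap.pi fun x => ((Real.sqrt (Module.finrank ℂ (F.obj (t x))) : ℝ) : ℂ) •
    SN.flat (F.obj (t x)) ∘ₗ (act (t x)).toLinearMap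

/-- The Fourier transforms of `H` and of `A` identify the quantum double model of `(H, A)` with the
extended string-net model of `(C, ω, M, F)`: they are bijective, and on each lattice they
intertwine the vertex operators, the face operators and the Hamiltonians. -/
def ModelsEquivalent {H : Type u} {A : Type v} [Ring H] [HopfAlgebra ℂ H] [Module.Finite ℂ H]
    [Ring A] [Algebra ℂ A] [LeftComoduleAlgebra H A]
    (h : H) (φ : Module.Dual ℂ H) (l : A ⊗[ℂ] A)
    {C : Type u₁} [Category.{v₁} C] [MonoidalCategory C]
    {M : Type u₂} [Category.{v₂} M] [MonoidalLeftAction C M]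
    (ω : C ⥤ Vect) [ω.Monoidal] (F : M ⥤ Vect)
    (J : ∀ (X : C) (N : M), ω.obj X ⊗ F.obj N ≅ F.obj (X ⊙ₗ N))
    {I K : Type} [Fintype I] [DecidableEq I] [Fintype K] [DecidableEq K] (s : I → C) (t : K → M)
    (actH : ∀ X : C, H →ₐ[ℂ] Module.End ℂ (ω.obj X))
    (actA : ∀ N : M, A →ₐ[ℂ] Module.End ℂ (F.obj N)) : Prop :=
  Function.Bijective (fourier ω s actH) ∧ Function.Bijective (fourier F t actA) ∧
  ∀ L : Lattice,
    let Φ : Total L H A →ₗ[ℂ] Total L (SN.EdgeSpace ω s) (SN.EdgeSpace F t) :=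
      TensorProduct.map (PiTensorProduct.map fun _ => fourier ω s actH)
        (PiTensorProduct.map fun _ => fourier F t actA)
    let Av : L.V → Module.End ℂ (Total L H A) := fun v => QD.bulkVertex A L (L.bulkVertex v) h
    let Aw : L.W → Module.End ℂ (Total L H A) := fun w =>
      QD.boundaryVertex (H := H) L (L.boundaryVertex w) l
    let Bf : L.F → Module.End ℂ (Total L H A) := fun f => QD.face L (L.face f) φ
    let Qv := fun v : L.V => SN.bulkVertex ω F s t L (L.bulkVertex v)
    let Qw := fun w : L.W => SN.boundaryVertex ω F J s t L (L.boundaryVertex w)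
    let Bf' := fun f : L.F => SN.face ω F J s t L (L.face f)
    Function.Bijective Φ ∧
    (∀ v, Φ ∘ₗ Av v = Qv v ∘ₗ Φ) ∧ (∀ w, Φ ∘ₗ Aw w = Qw w ∘ₗ Φ) ∧ (∀ f, Φ ∘ₗ Bf f = Bf' f ∘ₗ Φ) ∧
    Φ ∘ₗ hamiltonian Av Aw Bf = hamiltonian Qv Qw Bf' ∘ₗ Φ

end QDSN

end

open QDSN

noncomputable section

namespace QDSN
open QDSN.QD (S)

/-! ### Shortcut instances, which speed up the search for classes of linear maps -/

section Shortcut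

variable {V W : Type*} [AddCommMonoid V] [AddCommMonoid W] [Module ℂ V] [Module ℂ W]

instance : ZeroHomClass (V →ₗ[ℂ] W) V W where
  map_zero f := f.map_zero

instance : AddHomClass (V →ₗ[ℂ] W) V W where
  map_add f := f.map_add

instance : ZeroHomClass (V ≃ₗ[ℂ] W) V W where
  map_zero f := f.map_zero

instance : AddHomClass (V ≃ₗ[ℂ] W) V W where
  map_add f := f.map_add

end Shortcut

/-! ### Traces on comodule algebras -/

section Coact

variable {H : Type u} [Ring H] [Bialgebra ℂ H]

/-- A coassociative and counital coaction on a vector space. -/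
structure IsCoact {A : Type v} [AddCommGroup A] [Module ℂ A] (β : A →ₗ[ℂ] H ⊗[ℂ] A) : Prop where
  assoc : ∀ a, TensorProduct.assoc ℂ H H A ((Coalgebra.comul (R := ℂ) (A := H)).rTensor A (β a)) =
    β.lTensor H (β a)
  counit : ∀ a, TensorProduct.lid ℂ A ((Coalgebra.counit (R := ℂ) (A := H)).rTensor A (β a)) = a

lemma isCoact_comul : IsCoact (H := H) (Coalgebra.comul (R := ℂ) (A := H)) where
  assoc := Coalgebra.coassoc_apply
  counit a := by rw [Coalgebra.rTensor_counit_comul]; simp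

lemma isCoact_coact (A : Type v) [Ring A] [Algebra ℂ A] [LeftComoduleAlgebra H A] :
    IsCoact (LeftComoduleAlgebra.coact (H := H) (A := A)).toLinearMap where
  assoc := LeftComoduleAlgebra.coact_coassoc
  counit := LeftComoduleAlgebra.coact_counit

variable {A : Type v} [AddCommGroup A] [Module ℂ A] {β : A →ₗ[ℂ] H ⊗[ℂ] A}

lemma IsCoact.cancel (hβ : IsCoact β) (B : H ⊗[ℂ] H →ₗ[ℂ] H)
    (hB : ∀ h, B (Coalgebra.comul h) = Coalgebra.counit (R := ℂ) h • 1) (c : A) :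
    B.rTensor A ((TensorProduct.assoc ℂ H H A).symm (β.lTensor H (β c))) = 1 ⊗ₜ c := by
  rw [← hβ.assoc, LinearEquiv.symm_apply_apply]
  have key : ∀ t : H ⊗[ℂ] A, B.rTensor A ((Coalgebra.comul (R := ℂ)).rTensor A t) =
      1 ⊗ₜ TensorProduct.lid ℂ A ((Coalgebra.counit (R := ℂ) (A := H)).rTensor A t) := by
    intro t
    induction t with
    | zero => simp
    | add x y hx hy => simp only [map_add, hx, hy, TensorProduct.tmul_add]
    | tmul h a =>
      simp only [LinearMap.rTensor_tmul, hB, TensorProduct.lid_tmul, TensorProduct.smul_tmul]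
  rw [key, hβ.counit]

/-- The operator `a ↦ f(a⁽⁻¹⁾) a⁽⁰⁾`. -/
def coop (β : A →ₗ[ℂ] H ⊗[ℂ] A) (f : Module.Dual ℂ H) : Module.End ℂ A :=
  (TensorProduct.lid ℂ A).toLinearMap ∘ₗ f.rTensor A ∘ₗ β

/-- The operators `a ↦ f(a⁽⁻¹⁾ y) a⁽⁰⁾`, as a linear map in `y`. -/
def coopMul (β : A →ₗ[ℂ] H ⊗[ℂ] A) (f : Module.Dual ℂ H) : H →ₗ[ℂ] Module.End ℂ A where
  toFun y := coop β (f ∘ₗ LinearMap.mulRight ℂ y)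
  map_add' x y := LinearMap.ext fun a => by
    simp only [coop, LinearMap.comp_apply, LinearMap.add_apply, LinearEquiv.coe_coe]
    induction β a with
    | zero => simp
    | add s t hs ht => simp only [map_add, hs, ht]; abel
    | tmul p q => simp [mul_add, add_smul]
  map_smul' c y := LinearMap.ext fun a => by
    simp only [coop, LinearMap.comp_apply, LinearMap.smul_apply, LinearEquiv.coe_coe, RingHom.id_apply]
    induction β a with
    | zero => simp
    | add s t hs ht => simp only [map_add, hs, ht, smul_add]
    | tmul p q => simp [mul_smul]

end Coact

section Hopf

variable {H : Type u} [Ring H] [HopfAlgebra ℂ H]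

lemma antipode_sq_cancel (h : H) :
    (LinearMap.mul' ℂ H ∘ₗ TensorProduct.map (S ∘ₗ S) S ∘ₗ (TensorProduct.comm ℂ H H).toLinearMap)
      (Coalgebra.comul h) = Coalgebra.counit (R := ℂ) h • 1 := by
  have : ∀ t : H ⊗[ℂ] H, (LinearMap.mul' ℂ H ∘ₗ TensorProduct.map (S ∘ₗ S) S ∘ₗ
      (TensorProduct.comm ℂ H H).toLinearMap) t =
      S (LinearMap.mul' ℂ H ((S (H := H)).lTensor H t)) := by
    intro t
    induction t with
    | zero => simp
    | add s t hs ht => simp only [map_add, hs, ht]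
    | tmul p q => simp [HopfAlgebra.antipode_mul_antidistrib]
  rw [this, HopfAlgebra.mul_antipode_lTensor_comul_apply, Algebra.algebraMap_eq_smul_one, map_smul,
    HopfAlgebra.antipode_one]

lemma mul_antipode_comul (h : H) :
    (LinearMap.mul' ℂ H ∘ₗ (S (H := H)).lTensor H) (Coalgebra.comul h) =
      Coalgebra.counit (R := ℂ) h • 1 := by
  rw [LinearMap.comp_apply, HopfAlgebra.mul_antipode_lTensor_comul_apply,
    Algebra.algebraMap_eq_smul_one]

lemma antipode_mul_comul (h : H) :
    (LinearMap.mul' ℂ H ∘ₗ (S (H := H)).rTensor H) (Coalgebra.comul h) =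
      Coalgebra.counit (R := ℂ) h • 1 := by
  rw [LinearMap.comp_apply, HopfAlgebra.mul_antipode_rTensor_comul_apply,
    Algebra.algebraMap_eq_smul_one]

variable {A : Type v} [Ring A] [Algebra ℂ A]

/-- The linear form `a ↦ tr(L_a σ)`. -/
def traceForm (σ : A →ₗ[ℂ] A) : Module.Dual ℂ A :=
  LinearMap.trace ℂ A ∘ₗ LinearMap.mulRight ℂ (A := Module.End ℂ A) σ ∘ₗ LinearMap.mul ℂ A

lemma traceForm_apply (σ : A →ₗ[ℂ] A) (a : A) :
    traceForm σ a = LinearMap.trace ℂ A (LinearMap.mulLeft ℂ a * σ) := rfl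

variable (A) in
/-- The character of the regular representation. -/
def regChar : Module.Dual ℂ A := traceForm LinearMap.id

lemma regChar_apply (x : A) : regChar A x = LinearMap.trace ℂ A (LinearMap.mulLeft ℂ x) := rfl

variable [Module.Finite ℂ H]

theorem traceForm_coinvariant (β : A →ₐ[ℂ] H ⊗[ℂ] A) (hβ : IsCoact β.toLinearMap) (σ : A →ₗ[ℂ] A)
    (hσ : ∀ a, β (σ a) = TensorProduct.map (S ∘ₗ S) σ (β a)) (a : A) :
    TensorProduct.rid ℂ H ((traceForm σ).lTensor H (β a)) = traceForm σ a • 1 := by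
  rw [← sub_eq_zero, ← Module.forall_dual_apply_eq_zero_iff ℂ]
  intro f
  rw [map_sub, sub_eq_zero, map_smul, smul_eq_mul]
  let b := Module.finBasis ℂ H
  let M : H ⊗[ℂ] A →ₗ[ℂ] Module.End ℂ A := (TensorProduct.lid ℂ _).toLinearMap ∘ₗ
    TensorProduct.map f (LinearMap.mulRight ℂ (A := Module.End ℂ A) σ ∘ₗ LinearMap.mul ℂ A)
  have e0 : ∀ t : H ⊗[ℂ] A, f (TensorProduct.rid ℂ H ((traceForm σ).lTensor H t)) =
      LinearMap.trace ℂ A (M t) := by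
    intro t
    induction t with
    | zero => simp
    | add s t hs ht => simp only [map_add, hs, ht]
    | tmul p q =>
      simp only [LinearMap.lTensor_tmul, TensorProduct.rid_tmul, map_smul, M, LinearMap.comp_apply,
        TensorProduct.map_tmul, LinearEquiv.coe_coe, TensorProduct.lid_tmul, smul_eq_mul]
      rw [mul_comm]
      rfl
  have e1 : M (β a) = ∑ j, coopMul β.toLinearMap f (b j) *
      ((LinearMap.mulLeft ℂ a * σ) * coop β.toLinearMap (b.coord j ∘ₗ S)) := by
    refine LinearMap.ext fun c => ?_
    let P : H ⊗[ℂ] A →ₗ[ℂ] A := (TensorProduct.lid ℂ A).toLinearMap ∘ₗ f.rTensor A ∘ₗ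
      LinearMap.mulLeft ℂ (β a) ∘ₗ σ.lTensor H
    have g1 : ∀ t : H ⊗[ℂ] A, ∑ j, coopMul β.toLinearMap f (b j)
        (a * σ (TensorProduct.lid ℂ A ((b.coord j ∘ₗ S).rTensor A t))) =
        P ((LinearMap.mul' ℂ H ∘ₗ TensorProduct.map (S ∘ₗ S) S ∘ₗ
          (TensorProduct.comm ℂ H H).toLinearMap).rTensor A ((TensorProduct.assoc ℂ H H A).symm
            (β.toLinearMap.lTensor H t))) := by
      intro t
      induction t with
      | zero => simp
      | add s t hs ht => simp only [map_add, mul_add, Finset.sum_add_distrib, hs, ht]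
      | tmul x c' =>
        have h1 : ∀ j, coopMul β.toLinearMap f (b j)
            (a * σ (TensorProduct.lid ℂ A ((b.coord j ∘ₗ S).rTensor A (x ⊗ₜ c')))) =
            coopMul β.toLinearMap f (b.repr (S x) j • b j) (a * σ c') := by
          intro j
          simp [LinearMap.smul_apply]
        simp only [h1]
        rw [← LinearMap.sum_apply, ← map_sum, b.sum_repr]
        change TensorProduct.lid ℂ A ((f ∘ₗ LinearMap.mulRight ℂ (S x)).rTensor A (β (a * σ c'))) =
          P ((LinearMap.mul' ℂ H ∘ₗ TensorProduct.map (S ∘ₗ S) S ∘ₗ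
            (TensorProduct.comm ℂ H H).toLinearMap).rTensor A ((TensorProduct.assoc ℂ H H A).symm
              (x ⊗ₜ β c')))
        rw [map_mul, hσ]
        induction β c' with
        | zero => simp
        | add s t hs ht => simp only [map_add, mul_add, TensorProduct.tmul_add, hs, ht]
        | tmul y c'' =>
          simp only [P, LinearMap.comp_apply, TensorProduct.map_tmul, TensorProduct.assoc_symm_tmul,
            LinearMap.rTensor_tmul, LinearMap.lTensor_tmul, LinearMap.mulLeft_apply,
            LinearEquiv.coe_coe, TensorProduct.comm_tmul, LinearMap.mul'_apply]
          induction β a with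
          | zero => simp
          | add s t hs ht => simp only [map_add, add_mul, hs, ht]
          | tmul p q => simp [mul_assoc]
    have g2 : M (β a) c = P (1 ⊗ₜ c) := by
      simp only [P, M, LinearMap.comp_apply, LinearMap.lTensor_tmul, LinearMap.mulLeft_apply]
      induction β a with
      | zero => simp
      | add s t hs ht => simp only [map_add, add_mul, LinearMap.add_apply, hs, ht]
      | tmul p q => simp
    rw [g2, ← hβ.cancel _ antipode_sq_cancel c]
    refine (g1 (β c)).symm.trans ?_
    rw [LinearMap.sum_apply]
    rfl
  have e2 : ∑ j, coop β.toLinearMap (b.coord j ∘ₗ S) * coopMul β.toLinearMap f (b j) =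
      f 1 • (1 : Module.End ℂ A) := by
    refine LinearMap.ext fun c => ?_
    have g1 : ∀ t : H ⊗[ℂ] A, ∑ j, coop β.toLinearMap (b.coord j ∘ₗ S)
        (TensorProduct.lid ℂ A ((f ∘ₗ LinearMap.mulRight ℂ (b j)).rTensor A t)) =
        TensorProduct.lid ℂ A (f.rTensor A ((LinearMap.mul' ℂ H ∘ₗ (S (H := H)).lTensor H).rTensor A
          ((TensorProduct.assoc ℂ H H A).symm (β.toLinearMap.lTensor H t)))) := by
      intro t
      induction t with
      | zero => simp
      | add s t hs ht => simp only [map_add, Finset.sum_add_distrib, hs, ht]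
      | tmul x c' =>
        simp only [coop, LinearMap.comp_apply, LinearMap.rTensor_tmul, LinearMap.lTensor_tmul,
          AlgHom.toLinearMap_apply, LinearEquiv.coe_coe, TensorProduct.lid_tmul, map_smul,
          LinearMap.mulRight_apply]
        induction β c' with
        | zero => simp
        | add s t hs ht =>
          simp only [map_add, smul_add, Finset.sum_add_distrib, TensorProduct.tmul_add, hs, ht]
        | tmul y c'' =>
          simp only [LinearMap.rTensor_tmul, TensorProduct.lid_tmul, LinearMap.comp_apply,
            TensorProduct.assoc_symm_tmul, LinearMap.lTensor_tmul, LinearMap.mul'_apply, smul_smul]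
          rw [← Finset.sum_smul]
          congr 1
          conv_rhs => rw [← b.sum_repr (S y), Finset.mul_sum, map_sum]
          refine Finset.sum_congr rfl fun j _ => ?_
          rw [mul_smul_comm, map_smul, smul_eq_mul, mul_comm]
          rfl
    rw [LinearMap.sum_apply]
    refine (g1 (β c)).trans ?_
    have := hβ.cancel _ mul_antipode_comul c
    rw [AlgHom.toLinearMap_apply] at this
    rw [this]
    simp
  rw [e0, e1, map_sum]
  have e3 : ∀ j, LinearMap.trace ℂ A (coopMul β.toLinearMap f (b j) *
      ((LinearMap.mulLeft ℂ a * σ) * coop β.toLinearMap (b.coord j ∘ₗ S))) =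
      LinearMap.trace ℂ A ((LinearMap.mulLeft ℂ a * σ) *
        (coop β.toLinearMap (b.coord j ∘ₗ S) * coopMul β.toLinearMap f (b j))) := by
    intro j
    rw [LinearMap.trace_mul_comm, mul_assoc]
  simp only [e3]
  rw [← map_sum, ← Finset.mul_sum, e2, mul_smul_comm, mul_one, map_smul, mul_comm, traceForm_apply]
  rw [smul_eq_mul, mul_comm]

end Hopf

/-! ### Integrals and the square of the antipode -/

section Antipode

variable {H : Type u} [Ring H] [HopfAlgebra ℂ H]

open Coalgebra in
lemma sum_antipode_tmul_mul_comul (x : H) :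
    (LinearMap.mul' ℂ (H ⊗[ℂ] H) ∘ₗ TensorProduct.map
      ((TensorProduct.mk ℂ H H).flip 1 ∘ₗ S) (comul (R := ℂ))) (comul x) = 1 ⊗ₜ x := by
  rw [← isCoact_comul.cancel _ antipode_mul_comul x]
  induction comul (R := ℂ) x with
  | zero => simp
  | add s t hs ht => simp only [map_add, hs, ht]
  | tmul u v =>
    simp only [LinearMap.comp_apply, TensorProduct.map_tmul, LinearMap.lTensor_tmul]
    induction comul (R := ℂ) v with
    | zero => simp
    | add s t hs ht => simp only [map_add, TensorProduct.tmul_add, hs, ht]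
    | tmul p q => simp

open Coalgebra in
lemma sum_comul_mul_tmul_antipode (x : H) :
    (LinearMap.mul' ℂ (H ⊗[ℂ] H) ∘ₗ TensorProduct.map
      (comul (R := ℂ)) (TensorProduct.mk ℂ H H 1 ∘ₗ S)) (comul x) = x ⊗ₜ 1 := by
  have h1 : ∀ t : H ⊗[ℂ] H, (LinearMap.mul' ℂ (H ⊗[ℂ] H) ∘ₗ TensorProduct.map
      (comul (R := ℂ)) (TensorProduct.mk ℂ H H 1 ∘ₗ S)) t =
      ((LinearMap.mul' ℂ H ∘ₗ (S (H := H)).lTensor H).lTensor H)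
        (TensorProduct.assoc ℂ H H H ((comul (R := ℂ)).rTensor H t)) := by
    intro t
    induction t with
    | zero => simp
    | add s t hs ht => simp only [map_add, hs, ht]
    | tmul u v =>
      simp only [LinearMap.comp_apply, TensorProduct.map_tmul, LinearMap.rTensor_tmul]
      induction comul (R := ℂ) u with
      | zero => simp
      | add s t hs ht => simp only [map_add, TensorProduct.add_tmul, hs, ht]
      | tmul p q => simp
  rw [h1, coassoc_apply]
  have h2 : ∀ t : H ⊗[ℂ] H, ((LinearMap.mul' ℂ H ∘ₗ (S (H := H)).lTensor H).lTensor H)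
      ((comul (R := ℂ)).lTensor H t) =
      TensorProduct.rid ℂ H ((counit (R := ℂ)).lTensor H t) ⊗ₜ 1 := by
    intro t
    induction t with
    | zero => simp
    | add s t hs ht => simp only [map_add, TensorProduct.add_tmul, hs, ht]
    | tmul u v =>
      rw [LinearMap.lTensor_tmul, LinearMap.lTensor_tmul, mul_antipode_comul,
        LinearMap.lTensor_tmul, TensorProduct.rid_tmul, TensorProduct.smul_tmul]
  rw [h2, lTensor_counit_comul]
  simp

theorem comul_antipode (h : H) : Coalgebra.comul (R := ℂ) (S h) =
    TensorProduct.map S S (TensorProduct.comm ℂ H H (Coalgebra.comul (R := ℂ) h)) := by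
  have key : (WithConv.toConv ((Coalgebra.comul (R := ℂ)) ∘ₗ S (H := H)) :
      WithConv (H →ₗ[ℂ] H ⊗[ℂ] H)) = WithConv.toConv (TensorProduct.map S S ∘ₗ
        (TensorProduct.comm ℂ H H).toLinearMap ∘ₗ Coalgebra.comul (R := ℂ)) := by
    symm
    refine left_inv_eq_right_inv (a := WithConv.toConv (Coalgebra.comul (R := ℂ))) ?_
      LinearMap.comul_right_inv
    apply WithConv.ext
    refine LinearMap.ext fun x => ?_
    rw [LinearMap.convMul_apply, LinearMap.convOne_apply]
    let R : H ⊗[ℂ] H →ₗ[ℂ] H ⊗[ℂ] H := LinearMap.mul' ℂ (H ⊗[ℂ] H) ∘ₗ TensorProduct.map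
      ((TensorProduct.mk ℂ H H).flip 1 ∘ₗ S) (Coalgebra.comul (R := ℂ))
    let Q : H ⊗[ℂ] (H ⊗[ℂ] H) →ₗ[ℂ] H ⊗[ℂ] H := LinearMap.mul' ℂ (H ⊗[ℂ] H) ∘ₗ
      TensorProduct.map (TensorProduct.mk ℂ H H 1 ∘ₗ S) R
    have e1 : ∀ t : H ⊗[ℂ] H, LinearMap.mul' ℂ (H ⊗[ℂ] H) (TensorProduct.map
        (TensorProduct.map S S ∘ₗ (TensorProduct.comm ℂ H H).toLinearMap ∘ₗ
          Coalgebra.comul (R := ℂ)) (Coalgebra.comul (R := ℂ)) t) =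
        Q (TensorProduct.assoc ℂ H H H ((Coalgebra.comul (R := ℂ)).rTensor H t)) := by
      intro t
      induction t with
      | zero => simp
      | add s t hs ht => simp only [map_add, hs, ht]
      | tmul u v =>
        simp only [LinearMap.comp_apply, TensorProduct.map_tmul, LinearMap.rTensor_tmul]
        induction Coalgebra.comul (R := ℂ) u with
        | zero => simp
        | add s t hs ht => simp only [map_add, TensorProduct.add_tmul, hs, ht]
        | tmul p q => simp [Q, R, ← mul_assoc]
    have e2 : ∀ t : H ⊗[ℂ] H, Q ((Coalgebra.comul (R := ℂ)).lTensor H t) =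
        1 ⊗ₜ (LinearMap.mul' ℂ H ∘ₗ (S (H := H)).rTensor H) t := by
      intro t
      induction t with
      | zero => simp
      | add s t hs ht => simp only [map_add, TensorProduct.tmul_add, hs, ht]
      | tmul u v =>
        simp only [Q, LinearMap.lTensor_tmul, LinearMap.comp_apply, TensorProduct.map_tmul]
        have := sum_antipode_tmul_mul_comul v
        simp only [R] at this ⊢
        rw [this]
        simp
    rw [e1, Coalgebra.coassoc_apply, e2, antipode_mul_comul]
    simp [Algebra.algebraMap_eq_smul_one, Algebra.TensorProduct.one_def]
  exact LinearMap.congr_fun (congrArg WithConv.ofConv key) h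

lemma comul_antipode_sq (h : H) : Coalgebra.comul (R := ℂ) (S (S h)) =
    TensorProduct.map (S ∘ₗ S) (S ∘ₗ S) (Coalgebra.comul (R := ℂ) h) := by
  rw [comul_antipode, comul_antipode]
  induction Coalgebra.comul (R := ℂ) h with
  | zero => simp
  | add s t hs ht => simp only [map_add, hs, ht]
  | tmul u v => simp

end Antipode

section Haar

variable {H : Type u} [Ring H] [HopfAlgebra ℂ H]

lemma IsHaar.unique {h k : H} (hh : QD.IsHaar H h) (hk : QD.IsHaar H k) : h = k := by
  have h1 := (hh.1 k).1
  have h2 := (hk.1 h).2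
  rw [hk.2, one_smul] at h1
  rw [hh.2, one_smul] at h2
  exact h1.symm.trans h2

theorem exists_isHaar [IsSemisimpleRing H] : ∃ h : H, QD.IsHaar H h := by
  let K : Ideal H := RingHom.ker (Bialgebra.counitAlgHom ℂ H)
  obtain ⟨C, hC⟩ := exists_isCompl K
  obtain ⟨a, ha, c, hc, hac⟩ := Submodule.mem_sup.1
    (hC.sup_eq_top ▸ Submodule.mem_top : (1 : H) ∈ K ⊔ C)
  have ha' : Coalgebra.counit (R := ℂ) a = 0 := ha
  have hε : Coalgebra.counit (R := ℂ) c = 1 := by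
    have := congrArg (Coalgebra.counit (R := ℂ)) hac
    rwa [map_add, ha', zero_add, Bialgebra.counit_one] at this
  have left : ∀ k : H, k * c = Coalgebra.counit (R := ℂ) k • c := by
    intro k
    rw [← sub_eq_zero]
    have h1 : k * c - Coalgebra.counit (R := ℂ) k • c ∈ C := by
      refine C.sub_mem (C.smul_mem k hc) ?_
      rw [Algebra.smul_def]
      exact C.smul_mem _ hc
    have h2 : k * c - Coalgebra.counit (R := ℂ) k • c ∈ K := by
      change Coalgebra.counit (R := ℂ) _ = 0
      rw [map_sub, map_smul, Bialgebra.counit_mul, hε]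
      simp
    exact (Submodule.disjoint_def.1 hC.disjoint) _ h2 h1
  have left0 : ∀ x ∈ K, x * c = 0 := fun x hx => by
    have hx' : Coalgebra.counit (R := ℂ) x = 0 := hx
    rw [left, hx', zero_smul]
  let I : Ideal H :=
    { carrier := {y | ∃ x ∈ K, c * x = y}
      add_mem' := by
        rintro _ _ ⟨x, hx, rfl⟩ ⟨y, hy, rfl⟩
        exact ⟨x + y, K.add_mem hx hy, mul_add _ _ _⟩
      zero_mem' := ⟨0, K.zero_mem, mul_zero _⟩
      smul_mem' := by
        rintro k _ ⟨x, hx, rfl⟩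
        refine ⟨Coalgebra.counit (R := ℂ) k • x, ?_, ?_⟩
        · rw [Algebra.smul_def]
          exact K.smul_mem _ hx
        · rw [smul_eq_mul, ← mul_assoc, left, smul_mul_assoc, mul_smul_comm] }
  have right0 : ∀ x ∈ K, c * x = 0 := by
    intro x hx
    obtain ⟨D, hD⟩ := exists_isCompl I
    obtain ⟨_, ⟨x', hx', rfl⟩, d, hd, hid⟩ := Submodule.mem_sup.1
      (hD.sup_eq_top ▸ Submodule.mem_top : (1 : H) ∈ I ⊔ D)
    have h1 : c * x = c * x * d := by
      conv_lhs => rw [← mul_one (c * x), ← hid, mul_add, ← mul_assoc, mul_assoc c x c, left0 x hx,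
        mul_zero, zero_mul, zero_add]
    exact (Submodule.disjoint_def.1 hD.disjoint) _ ⟨x, hx, rfl⟩ (h1 ▸ D.smul_mem _ hd)
  refine ⟨c, fun k => ⟨left k, ?_⟩, hε⟩
  have := right0 (k - Coalgebra.counit (R := ℂ) k • 1) (by
    change Coalgebra.counit (R := ℂ) _ = 0
    rw [map_sub, map_smul, Bialgebra.counit_one]
    simp)
  rwa [mul_sub, mul_smul_comm, mul_one, sub_eq_zero] at this

lemma IsHaar.antipode_eq {h : H} (hh : QD.IsHaar H h) (hS : Function.Surjective (S (H := H))) :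
    S h = h := by
  refine IsHaar.unique ⟨fun k => ?_, by rw [HopfAlgebra.counit_antipode, hh.2]⟩ hh
  obtain ⟨k, rfl⟩ := hS k
  rw [← HopfAlgebra.antipode_mul_antidistrib, ← HopfAlgebra.antipode_mul_antidistrib, (hh.1 k).1,
    (hh.1 k).2, map_smul, HopfAlgebra.counit_antipode]
  exact ⟨rfl, rfl⟩

open Coalgebra in
lemma IsHaar.tmul_mul_comul {h : H} (hh : QD.IsHaar H h) (x : H) :
    (1 ⊗ₜ x) * comul (R := ℂ) h = (S x ⊗ₜ 1) * comul (R := ℂ) h := by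
  rw [← sum_antipode_tmul_mul_comul x]
  have key : ∀ t : H ⊗[ℂ] H, (LinearMap.mul' ℂ (H ⊗[ℂ] H) ∘ₗ TensorProduct.map
      ((TensorProduct.mk ℂ H H).flip 1 ∘ₗ S) (comul (R := ℂ))) t * comul (R := ℂ) h =
      (S (TensorProduct.rid ℂ H ((counit (R := ℂ)).lTensor H t)) ⊗ₜ 1) * comul (R := ℂ) h := by
    intro t
    induction t with
    | zero => simp
    | add s t hs ht => simp only [map_add, TensorProduct.add_tmul, add_mul, hs, ht]
    | tmul u v =>
      simp only [LinearMap.comp_apply, TensorProduct.map_tmul, LinearMap.mul'_apply, mul_assoc,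
        ← Bialgebra.comul_mul, (hh.1 v).1, map_smul, LinearMap.lTensor_tmul, TensorProduct.rid_tmul,
        LinearMap.flip_apply, TensorProduct.mk_apply, mul_smul_comm]
      rw [← TensorProduct.smul_tmul', smul_mul_assoc]
  rw [key, lTensor_counit_comul, TensorProduct.rid_tmul, one_smul]

open Coalgebra in
lemma IsHaar.comul_mul_tmul {h : H} (hh : QD.IsHaar H h) (x : H) :
    comul (R := ℂ) h * (x ⊗ₜ 1) = comul (R := ℂ) h * (1 ⊗ₜ S x) := by
  rw [← sum_comul_mul_tmul_antipode x]
  have key : ∀ t : H ⊗[ℂ] H, comul (R := ℂ) h * (LinearMap.mul' ℂ (H ⊗[ℂ] H) ∘ₗ TensorProduct.map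
      (comul (R := ℂ)) (TensorProduct.mk ℂ H H 1 ∘ₗ S)) t =
      comul (R := ℂ) h * (1 ⊗ₜ S (TensorProduct.lid ℂ H ((counit (R := ℂ)).rTensor H t))) := by
    intro t
    induction t with
    | zero => simp
    | add s t hs ht => simp only [map_add, TensorProduct.tmul_add, mul_add, hs, ht]
    | tmul u v =>
      simp only [LinearMap.comp_apply, TensorProduct.map_tmul, LinearMap.mul'_apply, ← mul_assoc,
        ← Bialgebra.comul_mul, (hh.1 u).2, map_smul, LinearMap.rTensor_tmul, TensorProduct.lid_tmul,
        TensorProduct.mk_apply, smul_mul_assoc, TensorProduct.tmul_smul, mul_smul_comm]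
  rw [key, rTensor_counit_comul, TensorProduct.lid_tmul, one_smul]

end Haar

section Contraction

variable {V : Type u} {W : Type v} [AddCommMonoid V] [Module ℂ V] [AddCommMonoid W] [Module ℂ W]

/-- Contraction of the first factor with a linear form. -/
def contrL (f : Module.Dual ℂ V) : V ⊗[ℂ] W →ₗ[ℂ] W :=
  (TensorProduct.lid ℂ W).toLinearMap ∘ₗ f.rTensor W

/-- Contraction of the second factor with a linear form. -/
def contrR (f : Module.Dual ℂ W) : V ⊗[ℂ] W →ₗ[ℂ] V :=
  (TensorProduct.rid ℂ V).toLinearMap ∘ₗ f.lTensor V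

@[simp] lemma contrL_tmul (f : Module.Dual ℂ V) (x : V) (y : W) :
    contrL f (x ⊗ₜ y) = f x • y := by simp [contrL]

@[simp] lemma contrR_tmul (f : Module.Dual ℂ W) (x : V) (y : W) :
    contrR f (x ⊗ₜ y) = f y • x := by simp [contrR]

lemma contrL_comp {V' : Type*} [AddCommMonoid V'] [Module ℂ V'] (f : Module.Dual ℂ V)
    (g : V' →ₗ[ℂ] V) (t : V' ⊗[ℂ] W) : contrL (f ∘ₗ g) t = contrL f (g.rTensor W t) := by
  induction t with
  | zero => simp
  | add s t hs ht => simp only [map_add, hs, ht]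
  | tmul x y => simp

lemma contrR_comp {W' : Type*} [AddCommMonoid W'] [Module ℂ W'] (f : Module.Dual ℂ W)
    (g : W' →ₗ[ℂ] W) (t : V ⊗[ℂ] W') : contrR (f ∘ₗ g) t = contrR f (g.lTensor V t) := by
  induction t with
  | zero => simp
  | add s t hs ht => simp only [map_add, hs, ht]
  | tmul x y => simp

/-- The contraction `f ↦ x f(y)` as a linear map in `f`. -/
def contrRHom (t : V ⊗[ℂ] W) : Module.Dual ℂ W →ₗ[ℂ] V where
  toFun f := contrR f t
  map_add' f g := by simp [contrR, LinearMap.lTensor_add]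
  map_smul' c f := by simp [contrR, LinearMap.lTensor_smul]

end Contraction

section SquareForm

variable {H : Type u} [Ring H] [HopfAlgebra ℂ H] [Module.Finite ℂ H]

variable (H) in
/-- The integral `x ↦ tr(L_x S²)` of the dual. -/
def sqForm : Module.Dual ℂ H := traceForm (S ∘ₗ S)

open Coalgebra in
lemma contrR_sqForm (x : H) : contrR (sqForm H) (comul (R := ℂ) x) = sqForm H x • 1 :=
  traceForm_coinvariant (Bialgebra.comulAlgHom ℂ H) isCoact_comul (S ∘ₗ S) comul_antipode_sq x

omit [Module.Finite ℂ H] in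
lemma sqForm_mul_comm (x y : H) : sqForm H (x * y) = sqForm H (y * S (S x)) := by
  have h1 : ∀ z : H, (S ∘ₗ S (H := H)) ∘ₗ LinearMap.mulLeft ℂ z =
      LinearMap.mulLeft ℂ (S (S z)) ∘ₗ (S ∘ₗ S) := fun z => LinearMap.ext fun w => by
    simp [HopfAlgebra.antipode_mul_antidistrib]
  rw [sqForm, traceForm_apply, traceForm_apply, LinearMap.mulLeft_mul, LinearMap.mulLeft_mul]
  change LinearMap.trace ℂ H ((LinearMap.mulLeft ℂ x * LinearMap.mulLeft ℂ y) * (S ∘ₗ S)) =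
    LinearMap.trace ℂ H ((LinearMap.mulLeft ℂ y * LinearMap.mulLeft ℂ (S (S x))) * (S ∘ₗ S))
  rw [mul_assoc, LinearMap.trace_mul_comm, mul_assoc, mul_assoc]
  congr 2
  exact h1 x

lemma trace_rankOne {V : Type*} [AddCommGroup V] [Module ℂ V] [Module.Finite ℂ V]
    (f : Module.Dual ℂ V) (v : V) : LinearMap.trace ℂ V (f.smulRight v) = f v := by
  have : f.smulRight v = dualTensorHom ℂ V V (f ⊗ₜ v) := by
    ext; simp [dualTensorHom_apply]
  rw [this, LinearMap.trace_eq_contract_apply, contractLeft_apply]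

lemma sqForm_haar {h : H} (hh : QD.IsHaar H h) : sqForm H h = 1 := by
  rw [sqForm, traceForm_apply]
  have : LinearMap.mulLeft ℂ h * (S ∘ₗ S (H := H)) = (Coalgebra.counit (R := ℂ)).smulRight h := by
    refine LinearMap.ext fun x => ?_
    change h * S (S x) = _
    rw [(hh.1 _).2, HopfAlgebra.counit_antipode, HopfAlgebra.counit_antipode]
    rfl
  rw [this, trace_rankOne, hh.2]

variable {h : H}

open Coalgebra in
lemma contrR_haar_mul (hh : QD.IsHaar H h) (x : H) :
    contrR (sqForm H ∘ₗ LinearMap.mulRight ℂ (S x)) (comul (R := ℂ) h) = x := by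
  have e : (LinearMap.mulRight ℂ (S x)).lTensor H (comul (R := ℂ) h) =
      comul (R := ℂ) h * (1 ⊗ₜ S x) := by
    induction comul (R := ℂ) h with
    | zero => simp
    | add s t hs ht => simp only [map_add, add_mul, hs, ht]
    | tmul u v => simp
  have e2 : ∀ t : H ⊗[ℂ] H, contrR (sqForm H) (t * (x ⊗ₜ 1)) = contrR (sqForm H) t * x := by
    intro t
    induction t with
    | zero => simp
    | add s t hs ht => simp only [map_add, add_mul, hs, ht]
    | tmul u v => simp
  rw [contrR_comp, e, ← IsHaar.comul_mul_tmul hh, e2, contrR_sqForm, sqForm_haar hh, one_smul, one_mul]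

lemma antipode_bijective (hh : QD.IsHaar H h) : Function.Bijective (S (H := H)) := by
  have : Function.Injective (S (H := H)) := by
    rw [injective_iff_map_eq_zero]
    intro x hx
    rw [← contrR_haar_mul hh x, hx]
    simp [contrR]
  exact ⟨this, LinearMap.surjective_of_injective this⟩

open Coalgebra in
lemma contrR_haar_injective (hh : QD.IsHaar H h) {f g : Module.Dual ℂ H}
    (hfg : contrR f (comul (R := ℂ) h) = contrR g (comul (R := ℂ) h)) : f = g := by
  have surj : Function.Surjective (contrRHom (comul (R := ℂ) h)) := fun x =>
    ⟨_, contrR_haar_mul hh x⟩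
  exact (LinearMap.injective_iff_surjective_of_finrank_eq_finrank
    (Subspace.dual_finrank_eq)).2 surj hfg

open Coalgebra in
lemma contrL_sqForm (hh : QD.IsHaar H h) (x : H) :
    contrL (sqForm H) (comul (R := ℂ) x) =
      sqForm H x • contrL (sqForm H) (comul (R := ℂ) h) := by
  rw [← sub_eq_zero, ← Module.forall_dual_apply_eq_zero_iff ℂ]
  intro f
  rw [map_sub, sub_eq_zero, map_smul]
  let f' : Module.Dual ℂ H := f ∘ₗ contrL (sqForm H) ∘ₗ comul (R := ℂ)
  have e1 : ∀ t : H ⊗[ℂ] (H ⊗[ℂ] H), contrR (f ∘ₗ contrL (sqForm H)) t =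
      contrR f (contrR (sqForm H) |>.rTensor H ((TensorProduct.assoc ℂ H H H).symm t)) := by
    intro t
    induction t with
    | zero => simp
    | add s t hs ht => simp only [map_add, hs, ht]
    | tmul u v =>
      induction v with
      | zero => simp
      | add s t hs ht => simp only [map_add, TensorProduct.tmul_add, hs, ht]
      | tmul v w => simp [mul_smul, smul_comm (f w)]
  have e2 : ∀ t : H ⊗[ℂ] H, contrR f ((contrR (sqForm H)).rTensor H ((comul (R := ℂ)).rTensor H t)) =
      f (contrL (sqForm H) t) • 1 := by
    intro t
    induction t with
    | zero => simp
    | add s t hs ht => simp only [map_add, add_smul, hs, ht]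
    | tmul u v =>
      rw [LinearMap.rTensor_tmul, LinearMap.rTensor_tmul, contrR_sqForm, contrR_tmul, contrL_tmul,
        map_smul, smul_smul, smul_eq_mul, mul_comm]
  have e3 : ∀ y : H, contrR f' (comul (R := ℂ) y) = f' y • 1 := by
    intro y
    change contrR ((f ∘ₗ contrL (sqForm H)) ∘ₗ comul (R := ℂ)) (comul (R := ℂ) y) = _
    rw [contrR_comp, e1, coassoc_symm_apply, e2]
    rfl
  have e4 : f' = f' h • sqForm H := by
    refine contrR_haar_injective hh ?_
    rw [e3]
    have := (contrRHom (comul (R := ℂ) h)).map_smul (f' h) (sqForm H)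
    refine Eq.trans ?_ this.symm
    change _ = f' h • contrR (sqForm H) (comul (R := ℂ) h)
    rw [contrR_sqForm, sqForm_haar hh, one_smul]
  have := LinearMap.congr_fun e4 x
  rw [LinearMap.smul_apply, smul_eq_mul, mul_comm] at this
  exact this

open Coalgebra in
/-- The distinguished group-like element. -/
def modular (h : H) : H := contrL (sqForm H) (comul (R := ℂ) h)

open Coalgebra in
lemma isGroupLikeElem_modular (hh : QD.IsHaar H h) : IsGroupLikeElem ℂ (modular h) where
  counit_eq_one := by
    rw [← sqForm_haar hh, modular]
    conv_rhs => rw [← one_smul ℂ h, ← TensorProduct.rid_tmul, ← lTensor_counit_comul]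
    induction comul (R := ℂ) h with
    | zero => simp
    | add s t hs ht => simp only [map_add, hs, ht]
    | tmul u v => simp [mul_comm]
  comul_eq_tmul_self := by
    have e1 : ∀ t : H ⊗[ℂ] H, comul (R := ℂ) (contrL (sqForm H) t) =
        (contrL (sqForm H)).rTensor H ((TensorProduct.assoc ℂ H H H).symm
          ((comul (R := ℂ)).lTensor H t)) := by
      intro t
      induction t with
      | zero => simp
      | add s t hs ht => simp only [map_add, hs, ht]
      | tmul u v =>
        rw [contrL_tmul, map_smul, LinearMap.lTensor_tmul]
        induction comul (R := ℂ) v with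
        | zero => simp
        | add s t hs ht => simp only [map_add, TensorProduct.tmul_add, smul_add, hs, ht]
        | tmul v w => simp [TensorProduct.smul_tmul']
    have e2 : ∀ t : H ⊗[ℂ] H, (contrL (sqForm H)).rTensor H ((comul (R := ℂ)).rTensor H t) =
        modular h ⊗ₜ contrL (sqForm H) t := by
      intro t
      induction t with
      | zero => simp
      | add s t hs ht => simp only [map_add, TensorProduct.tmul_add, hs, ht]
      | tmul u v =>
        rw [LinearMap.rTensor_tmul, LinearMap.rTensor_tmul, contrL_sqForm hh, contrL_tmul,
          TensorProduct.smul_tmul]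
        rfl
    conv_lhs => rw [modular, e1, coassoc_symm_apply, e2]
    rfl

lemma modular_eq_one (hh : QD.IsHaar H h) (h1 : sqForm H (1 : H) ≠ 0) : modular h = 1 := by
  have := contrL_sqForm hh 1
  rw [Bialgebra.comul_one, Algebra.TensorProduct.one_def, contrL_tmul] at this
  exact (smul_right_injective H h1 this).symm

omit [Module.Finite ℂ H] in
open Coalgebra in
lemma modular_mul_antipode (hh : QD.IsHaar H h) (x : H) :
    modular h * S (S (S (S x))) = x * modular h := by
  have a1 : ∀ (y : H) (t : H ⊗[ℂ] H), (LinearMap.mulLeft ℂ y).rTensor H t = (y ⊗ₜ 1) * t := by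
    intro y t
    induction t with
    | zero => simp
    | add s t hs ht => simp only [map_add, mul_add, hs, ht]
    | tmul u v => simp
  have a2 : ∀ (y : H) (t : H ⊗[ℂ] H), (LinearMap.mulRight ℂ y).rTensor H t = t * (y ⊗ₜ 1) := by
    intro y t
    induction t with
    | zero => simp
    | add s t hs ht => simp only [map_add, add_mul, hs, ht]
    | tmul u v => simp
  have e1 : contrL (sqForm H ∘ₗ LinearMap.mulLeft ℂ (S x)) (comul (R := ℂ) h) = x * modular h := by
    rw [contrL_comp, a1, ← IsHaar.tmul_mul_comul hh, modular]
    induction comul (R := ℂ) h with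
    | zero => simp
    | add s t hs ht => simp only [map_add, mul_add, hs, ht]
    | tmul u v => simp
  have e2 : ∀ y, contrL (sqForm H ∘ₗ LinearMap.mulRight ℂ y) (comul (R := ℂ) h) =
      modular h * S y := by
    intro y
    rw [contrL_comp, a2, IsHaar.comul_mul_tmul hh, modular]
    induction comul (R := ℂ) h with
    | zero => simp
    | add s t hs ht => simp only [map_add, add_mul, hs, ht]
    | tmul u v => simp
  rw [← e1, ← e2]
  congr 2
  exact LinearMap.ext fun u => (sqForm_mul_comm (S x) u).symm

end SquareForm

/-! ### Positivity of the trace of the square of the antipode -/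

section Matrices

open Matrix
open scoped ComplexOrder

lemma trace_pow_pred {n : Type*} [Fintype n] [DecidableEq n] (G : Matrix n n ℂ) (N : ℕ)
    (h : G ^ (N + 1) = 1) : (G ^ N).trace = conj G.trace := by
  let B : Matrix n n ℂ := ∑ k ∈ Finset.range (N + 1), (G ^ k)ᴴ * G ^ k
  have hB : B.PosDef := by
    have : B = ∑ k ∈ Finset.range N, (G ^ (k + 1))ᴴ * G ^ (k + 1) + 1 := by
      simp only [B]
      rw [Finset.sum_range_succ']
      simp
    rw [this]
    refine Matrix.PosDef.posSemidef_add ?_ Matrix.PosDef.one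
    exact Matrix.posSemidef_sum _ fun k _ => Matrix.posSemidef_conjTranspose_mul_self _
  have hinv : Gᴴ * B * G = B := by
    have e : ∀ k, Gᴴ * ((G ^ k)ᴴ * G ^ k) * G = (G ^ (k + 1))ᴴ * G ^ (k + 1) := by
      intro k
      rw [pow_succ, conjTranspose_mul]
      simp only [mul_assoc]
    have : Gᴴ * B * G = ∑ k ∈ Finset.range (N + 1), (G ^ (k + 1))ᴴ * G ^ (k + 1) := by
      simp only [B, Finset.mul_sum, Finset.sum_mul, e]
    rw [this, Finset.sum_range_succ, h]
    simp only [B]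
    rw [Finset.sum_range_succ']
    simp
  have hu : IsUnit B := hB.isUnit
  obtain ⟨u, hu⟩ := hu
  have e2 : G ^ N = ((u⁻¹ : (Matrix n n ℂ)ˣ) : Matrix n n ℂ) * Gᴴ * B := by
    have h1 : B * G ^ N = Gᴴ * B := by
      calc B * G ^ N = Gᴴ * B * (G * G ^ N) := by rw [← mul_assoc, hinv]
        _ = Gᴴ * B := by rw [← pow_succ', h, mul_one]
    rw [mul_assoc, ← h1, ← hu, ← mul_assoc, Units.inv_mul, one_mul]
  rw [e2, Matrix.trace_mul_comm, ← mul_assoc, ← hu, Units.mul_inv, one_mul,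
    Matrix.trace_conjTranspose]
  rfl

lemma trace_pi_matrix {n : ℕ} {d : Fin n → ℕ} (A B : ∀ i, Matrix (Fin (d i)) (Fin (d i)) ℂ)
    (f : Module.End ℂ (∀ i, Matrix (Fin (d i)) (Fin (d i)) ℂ))
    (hf : ∀ m i, f m i = A i * m i * B i) :
    LinearMap.trace ℂ _ f = ∑ i, (A i).trace * (B i).trace := by
  classical
  let b := Pi.basis fun i => Matrix.stdBasis ℂ (Fin (d i)) (Fin (d i))
  rw [LinearMap.trace_eq_matrix_trace ℂ b, Matrix.trace, Fintype.sum_sigma]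
  refine Finset.sum_congr rfl fun i _ => ?_
  rw [Fintype.sum_prod_type, Matrix.trace, Matrix.trace, Finset.sum_mul_sum]
  refine Finset.sum_congr rfl fun p _ => Finset.sum_congr rfl fun q _ => ?_
  rw [Matrix.diag_apply, LinearMap.toMatrix_apply, Pi.basis_repr]
  have : f (b ⟨i, (p, q)⟩) i = A i * Matrix.single p q 1 * B i := by
    rw [hf]
    simp [b, Pi.basis_apply, Matrix.stdBasis_eq_single]
  rw [this]
  change (A i * Matrix.single p q 1 * B i : Matrix (Fin (d i)) (Fin (d i)) ℂ) p q = _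
  rw [Matrix.mul_apply, Finset.sum_eq_single q]
  · simp
  · intro r _ hr
    simp [Matrix.mul_single_apply_of_ne _ _ _ _ _ hr]
  · simp

lemma exists_conj_matrix {d : ℕ} (σ : Matrix (Fin d) (Fin d) ℂ ≃ₐ[ℂ] Matrix (Fin d) (Fin d) ℂ) :
    ∃ T T' : Matrix (Fin d) (Fin d) ℂ, T * T' = 1 ∧ T' * T = 1 ∧ ∀ m, σ m = T * m * T' := by
  let e := Matrix.toLinAlgEquiv' (R := ℂ) (n := Fin d)
  obtain ⟨T, hT⟩ := ((e.symm.trans σ).trans e).eq_linearEquivConjAlgEquiv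
  refine ⟨e.symm T.toLinearMap, e.symm T.symm.toLinearMap, ?_, ?_, fun m => ?_⟩
  · rw [← map_mul]
    have : T.toLinearMap * T.symm.toLinearMap = 1 := LinearMap.ext fun x => T.apply_symm_apply x
    rw [this, map_one]
  · rw [← map_mul]
    have : T.symm.toLinearMap * T.toLinearMap = 1 := LinearMap.ext fun x => T.symm_apply_apply x
    rw [this, map_one]
  · have h := AlgEquiv.congr_fun hT (e m)
    simp only [AlgEquiv.trans_apply, AlgEquiv.symm_apply_apply] at h
    rw [← e.symm_apply_apply (σ m), h]
    conv_rhs => rw [← e.symm_apply_apply m, ← map_mul, ← map_mul]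
    rfl

end Matrices

section Positivity

variable {H : Type u} [Ring H] [HopfAlgebra ℂ H] [Module.Finite ℂ H] {h : H}

lemma sqForm_nondegenerate (hh : QD.IsHaar H h) {y : H} (hy : ∀ x, sqForm H (x * y) = 0) :
    y = 0 := by
  obtain ⟨y, rfl⟩ := (antipode_bijective hh).2 y
  have : sqForm H ∘ₗ LinearMap.mulRight ℂ (S y) = 0 := LinearMap.ext hy
  have h2 := contrR_haar_mul hh y
  rw [this] at h2
  rw [← h2]
  simp [contrR]

lemma antipode_sq_central (hh : QD.IsHaar H h) {e : H} (he : ∀ x, e * x = x * e) : S (S e) = e := by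
  rw [← sub_eq_zero]
  refine sqForm_nondegenerate hh fun x => ?_
  rw [mul_sub, map_sub, ← sqForm_mul_comm, he, sub_self]

lemma modular_pow (hh : QD.IsHaar H h) : ∃ N, modular h ^ (N + 1) = 1 := by
  have : Finite (GroupLike ℂ H) := (linearIndep_groupLikeVal (R := ℂ) (A := H)).finite
  let g : GroupLike ℂ H := ⟨modular h, isGroupLikeElem_modular hh⟩
  obtain ⟨n, hn, hg⟩ := (isOfFinOrder_of_finite g).exists_pow_eq_one
  refine ⟨n - 1, ?_⟩
  rw [Nat.sub_add_cancel hn]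
  exact congrArg GroupLike.val hg

/-- The square of the antipode as an algebra automorphism. -/
def antipodeSq (hh : QD.IsHaar H h) : H ≃ₐ[ℂ] H :=
  AlgEquiv.ofBijective (AlgHom.ofLinearMap (S ∘ₗ S) (by simp [HopfAlgebra.antipode_one])
    (fun x y => by simp [HopfAlgebra.antipode_mul_antidistrib]))
    ((antipode_bijective hh).comp (antipode_bijective hh))

theorem sqForm_one_ne_zero [IsSemisimpleRing H] (hh : QD.IsHaar H h) : sqForm H (1 : H) ≠ 0 := by
  classical
  obtain ⟨n, d, hd, ⟨Θ⟩⟩ := IsSemisimpleRing.exists_algEquiv_pi_matrix_of_isAlgClosed ℂ H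
  let σ : (∀ i, Matrix (Fin (d i)) (Fin (d i)) ℂ) ≃ₐ[ℂ] (∀ i, Matrix (Fin (d i)) (Fin (d i)) ℂ) :=
    (Θ.symm.trans (antipodeSq hh)).trans Θ
  have hσ : ∀ x, σ (Θ x) = Θ (S (S x)) := fun x => by
    simp only [σ, AlgEquiv.trans_apply, AlgEquiv.symm_apply_apply]
    rfl
  have hσ1 : ∀ i, σ (Pi.single i 1) = Pi.single i 1 := by
    intro i
    have := antipode_sq_central hh (e := Θ.symm (Pi.single i 1)) (fun x => by
      apply Θ.injective
      rw [map_mul, map_mul, Θ.apply_symm_apply]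
      funext j
      by_cases hj : j = i
      · subst hj; simp
      · simp [Pi.single_eq_of_ne hj])
    rw [← Θ.apply_symm_apply (Pi.single i 1), hσ, this]
  have hloc : ∀ y i, σ y i = σ (Pi.single i (y i)) i := by
    intro y i
    have : Pi.single i (y i) = y * Pi.single i 1 := by
      funext j
      by_cases hj : j = i
      · subst hj; simp
      · simp [Pi.single_eq_of_ne hj]
    rw [this, map_mul, hσ1]
    simp
  let τ : ∀ i, Matrix (Fin (d i)) (Fin (d i)) ℂ →ₐ[ℂ] Matrix (Fin (d i)) (Fin (d i)) ℂ := fun i =>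
    AlgHom.ofLinearMap (LinearMap.proj i ∘ₗ σ.toLinearMap ∘ₗ
      LinearMap.single ℂ (fun i => Matrix (Fin (d i)) (Fin (d i)) ℂ) i)
      (by simp [hσ1]) (fun x y => by
        simp only [LinearMap.comp_apply, LinearMap.coe_single, AlgEquiv.toLinearMap_apply]
        rw [Pi.single_mul, map_mul]
        rfl)
  have hτ : ∀ i m, τ i m = σ (Pi.single i m) i := fun i m => rfl
  have hinj : ∀ i, Function.Injective (τ i) := by
    intro i
    rw [injective_iff_map_eq_zero]
    intro m hm
    have h0 : σ (Pi.single i m) = 0 := by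
      funext j
      by_cases hj : j = i
      · subst hj; exact hm
      · rw [hloc, Pi.single_eq_of_ne hj]; simp
    have := σ.injective (h0.trans (map_zero σ).symm)
    simpa using congrFun this i
  have hbij : ∀ i, Function.Bijective (τ i) := fun i =>
    ⟨hinj i, (LinearMap.injective_iff_surjective (f := (τ i).toLinearMap)).1 (hinj i)⟩
  have hT := fun i => exists_conj_matrix (AlgEquiv.ofBijective (τ i) (hbij i))
  choose T T' hTT' hT'T hT using hT
  have hσT : ∀ y i, σ y i = T i * y i * T' i := fun y i => by
    rw [hloc, ← hτ]
    exact hT i (y i)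
  have htr : ∀ x, sqForm H x = ∑ i, (Θ x i * T i).trace * (T' i).trace := by
    intro x
    rw [sqForm, traceForm_apply, ← LinearMap.trace_conj' _ Θ.toLinearEquiv]
    refine trace_pi_matrix (fun i => Θ x i * T i) T' _ fun m i => ?_
    have : Θ.toLinearEquiv.conj (LinearMap.mulLeft ℂ x * (S ∘ₗ S)) m =
        Θ x * σ m := by
      obtain ⟨m, rfl⟩ := Θ.surjective m
      rw [hσ, ← map_mul]
      change Θ (x * S (S (Θ.symm (Θ m)))) = _
      rw [Θ.symm_apply_apply]
    rw [this, Pi.mul_apply, hσT]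
    simp only [mul_assoc]
  obtain ⟨N, hN⟩ := modular_pow hh
  have hgN : ∀ i, Θ (modular h) i ^ (N + 1) = 1 := fun i => by
    rw [← Pi.pow_apply, ← map_pow, hN, map_one, Pi.one_apply]
  have key : ∀ i, ∃ w : ℂ, (T i).trace * (T' i).trace = w * conj w ∧ (w = 0 → (T' i).trace = 0) := by
    intro i
    set g := Θ (modular h) i with hg
    have hcomm : ∀ m, g * (T i * T i) * m = m * (g * (T i * T i)) := by
      intro m
      have h1 : Θ (modular h) * σ (σ (Pi.single i m)) = Pi.single i m * Θ (modular h) := by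
        rw [← Θ.apply_symm_apply (Pi.single i m), hσ, hσ, ← map_mul, ← map_mul,
          modular_mul_antipode hh]
      have h2 := congrFun h1 i
      rw [Pi.mul_apply, Pi.mul_apply, hσT, hσT, Pi.single_eq_same, ← hg] at h2
      calc g * (T i * T i) * m = g * (T i * (T i * m * T' i) * T' i) * (T i * T i) := by
            have : T i * m * T' i * T' i * T i * T i = T i * m := by
              rw [mul_assoc _ (T' i) (T i), hT'T, mul_one, mul_assoc _ (T' i) (T i), hT'T, mul_one]
            simp only [mul_assoc] at this ⊢
            rw [this]
        _ = m * (g * (T i * T i)) := by rw [h2, mul_assoc]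
    obtain ⟨c, hc⟩ := Matrix.mem_range_scalar_of_commute_single (M := g * (T i * T i))
      (fun p q _ => (hcomm _).symm)
    have hTT : T i * T i = c • g ^ N := by
      calc T i * T i = g ^ (N + 1) * (T i * T i) := by rw [hgN, one_mul]
        _ = g ^ N * (g * (T i * T i)) := by rw [pow_succ, mul_assoc]
        _ = c • g ^ N := by
          rw [← hc, Matrix.scalar_apply, ← Matrix.smul_one_eq_diagonal, mul_smul_comm, mul_one]
    have hpow : T i ^ (2 * (N + 1)) = c ^ (N + 1) • (1 : Matrix (Fin (d i)) (Fin (d i)) ℂ) := by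
      rw [pow_mul, pow_two, hTT, smul_pow, ← pow_mul, mul_comm, pow_mul, hgN, one_pow]
    have hc0 : c ^ (N + 1) ≠ 0 := by
      intro h0
      rw [h0, zero_smul] at hpow
      have h1 : T' i ^ (2 * (N + 1)) * T i ^ (2 * (N + 1)) = 1 := by
        have hcm : Commute (T' i) (T i) := (hT'T i).trans (hTT' i).symm
        rw [← hcm.mul_pow, hT'T, one_pow]
      rw [hpow, mul_zero] at h1
      have := hd i
      exact zero_ne_one h1
    obtain ⟨z, hz⟩ := IsAlgClosed.exists_pow_nat_eq (c ^ (N + 1)) (n := 2 * (N + 1)) (by omega)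
    have hz0 : z ≠ 0 := by
      rintro rfl
      rw [zero_pow (by omega)] at hz
      exact hc0 hz.symm
    let G := z⁻¹ • T i
    have hG : G ^ (2 * N + 1 + 1) = 1 := by
      have : 2 * N + 1 + 1 = 2 * (N + 1) := by ring
      rw [this, smul_pow, hpow, smul_smul, ← hz, inv_pow, inv_mul_cancel₀, one_smul]
      rw [hz]; exact hc0
    have hG' : G ^ (2 * N + 1) = z • T' i := by
      calc G ^ (2 * N + 1) = G ^ (2 * N + 1) * (G * (z • T' i)) := by
            rw [smul_mul_smul_comm, inv_mul_cancel₀ hz0, hTT', one_smul, mul_one]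
        _ = z • T' i := by rw [← mul_assoc, ← pow_succ, hG, one_mul]
    have htG := trace_pow_pred G (2 * N + 1) hG
    rw [hG', Matrix.trace_smul, smul_eq_mul] at htG
    refine ⟨G.trace, ?_, fun h0 => ?_⟩
    · rw [← htG, Matrix.trace_smul, smul_eq_mul]
      field_simp
    · rw [h0, map_zero] at htG
      exact (mul_eq_zero.1 htG).resolve_left hz0
  choose w hw hw0 using key
  intro h0
  have hsum : ∑ i, Complex.normSq (w i) = 0 := by
    have : ((∑ i, Complex.normSq (w i) : ℝ) : ℂ) = 0 := by
      rw [← h0, htr]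
      push_cast
      refine Finset.sum_congr rfl fun i _ => ?_
      rw [map_one, Pi.one_apply, one_mul, hw, Complex.mul_conj]
    exact_mod_cast this
  have hzero : ∀ i, w i = 0 := fun i => Complex.normSq_eq_zero.1
    ((Finset.sum_eq_zero_iff_of_nonneg fun i _ => Complex.normSq_nonneg _).1 hsum i
      (Finset.mem_univ i))
  have := htr h
  rw [sqForm_haar hh] at this
  refine one_ne_zero (this.trans (Finset.sum_eq_zero fun i _ => ?_))
  rw [hw0 i (hzero i), mul_zero]

end Positivity

/-! ### The antipode of a semisimple Hopf algebra is an involution -/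

section Involution

variable {H : Type u} [Ring H] [HopfAlgebra ℂ H] [Module.Finite ℂ H] {h : H}

omit [Module.Finite ℂ H] in
lemma Tp_apply (f : Module.Dual ℂ H) (x : H) : QD.Tp f x = contrR f (Coalgebra.comul (R := ℂ) x) :=
  rfl

lemma regChar_haar (hh : QD.IsHaar H h) : regChar H h = 1 := by
  rw [regChar_apply]
  have : LinearMap.mulLeft ℂ h = (Coalgebra.counit (R := ℂ)).smulRight h :=
    LinearMap.ext fun x => (hh.1 x).2
  rw [this, trace_rankOne, hh.2]

lemma antipode_four (hh : QD.IsHaar H h) (h1 : sqForm H (1 : H) ≠ 0) (x : H) :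
    S (S (S (S x))) = x := by
  have := modular_mul_antipode hh x
  rwa [modular_eq_one hh h1, one_mul, mul_one] at this

open Coalgebra in
lemma trace_sq_mul_Tp (hh : QD.IsHaar H h) (h1 : sqForm H (1 : H) ≠ 0) (f : Module.Dual ℂ H) :
    LinearMap.trace ℂ H ((S ∘ₗ S) * QD.Tp f) = f h * sqForm H (1 : H) := by
  let Θ : Module.Dual ℂ (Module.Dual ℂ H) :=
    LinearMap.trace ℂ H ∘ₗ LinearMap.mulLeft ℂ (A := Module.End ℂ H) (S ∘ₗ S) ∘ₗ QD.Tp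
  have hS4 := antipode_four hh h1
  obtain ⟨θ, hθ⟩ := (Module.evalEquiv ℂ H).surjective Θ
  have hθ' : ∀ f, LinearMap.trace ℂ H ((S ∘ₗ S) * QD.Tp f) = f θ := fun f =>
    (LinearMap.congr_fun hθ f).symm
  have inv : ∀ x f, LinearMap.trace ℂ H ((S ∘ₗ S) * QD.Tp (f ∘ₗ LinearMap.mulLeft ℂ x)) =
      counit (R := ℂ) x * LinearMap.trace ℂ H ((S ∘ₗ S) * QD.Tp f) := by
    intro x f
    let Φ : H ⊗[ℂ] H →ₗ[ℂ] Module.End ℂ H := LinearMap.mul' ℂ (Module.End ℂ H) ∘ₗ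
      TensorProduct.map (LinearMap.mulRight ℂ (A := Module.End ℂ H) (QD.Tp f) ∘ₗ
        LinearMap.mul ℂ H ∘ₗ S) (LinearMap.mul ℂ H)
    have e1 : QD.Tp (f ∘ₗ LinearMap.mulLeft ℂ x) = Φ (comul (R := ℂ) x) := by
      refine LinearMap.ext fun y => ?_
      have a1 : ∀ t : H ⊗[ℂ] H, (LinearMap.mulLeft ℂ x).lTensor H t = (1 ⊗ₜ x) * t := by
        intro t
        induction t with
        | zero => simp
        | add s t hs ht => simp only [map_add, mul_add, hs, ht]
        | tmul u v => simp
      rw [Tp_apply, contrR_comp, a1, ← sum_antipode_tmul_mul_comul x]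
      induction comul (R := ℂ) x with
      | zero => simp
      | add s t hs ht => simp only [map_add, add_mul, LinearMap.add_apply, hs, ht]
      | tmul u v =>
        simp only [Φ, LinearMap.comp_apply, TensorProduct.map_tmul, LinearMap.mul'_apply,
          LinearMap.mulRight_apply, Module.End.mul_apply, LinearMap.mul_apply', mul_assoc,
          ← Bialgebra.comul_mul, Tp_apply, LinearMap.flip_apply, TensorProduct.mk_apply]
        induction comul (R := ℂ) (v * y) with
        | zero => simp
        | add s t hs ht => simp only [map_add, mul_add, hs, ht]
        | tmul p q => simp
    have e2 : ∀ t : H ⊗[ℂ] H, LinearMap.trace ℂ H ((S ∘ₗ S) * Φ t) =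
        LinearMap.trace ℂ H (LinearMap.mulLeft ℂ ((LinearMap.mul' ℂ H ∘ₗ
          TensorProduct.map LinearMap.id (S ∘ₗ S ∘ₗ S) ∘ₗ (TensorProduct.comm ℂ H H).toLinearMap) t) *
          ((S ∘ₗ S) * QD.Tp f)) := by
      intro t
      induction t with
      | zero => simp
      | add s t hs ht =>
        have : ∀ a b : H, LinearMap.mulLeft ℂ (a + b) = LinearMap.mulLeft ℂ a + LinearMap.mulLeft ℂ b :=
          fun a b => (LinearMap.mul ℂ H).map_add a b
        rw [map_add, mul_add, map_add, hs, ht, map_add, this, add_mul, map_add]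
      | tmul u v =>
        simp only [LinearMap.comp_apply, LinearEquiv.coe_coe, TensorProduct.comm_tmul,
          TensorProduct.map_tmul, LinearMap.id_apply, LinearMap.mul'_apply, LinearMap.mulLeft_mul]
        have h2 : (S ∘ₗ S) * Φ (u ⊗ₜ v) =
            (LinearMap.mulLeft ℂ (S (S (S u))) * ((S ∘ₗ S) * QD.Tp f)) * LinearMap.mulLeft ℂ v := by
          refine LinearMap.ext fun y => ?_
          change S (S (S u * QD.Tp f (v * y))) = S (S (S u)) * S (S (QD.Tp f (v * y)))
          rw [HopfAlgebra.antipode_mul_antidistrib, HopfAlgebra.antipode_mul_antidistrib]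
        rw [h2, LinearMap.trace_mul_comm, ← mul_assoc]
        rfl
    have e3 : (LinearMap.mul' ℂ H ∘ₗ TensorProduct.map LinearMap.id (S ∘ₗ S ∘ₗ S) ∘ₗ
        (TensorProduct.comm ℂ H H).toLinearMap) (comul (R := ℂ) x) = counit (R := ℂ) x • 1 := by
      apply (antipode_bijective hh).1
      rw [map_smul, HopfAlgebra.antipode_one, ← mul_antipode_comul x]
      induction comul (R := ℂ) x with
      | zero => simp
      | add s t hs ht => simp only [map_add, hs, ht]
      | tmul u v => simp [HopfAlgebra.antipode_mul_antidistrib, hS4]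
    rw [e1, e2, e3]
    have : LinearMap.mulLeft ℂ (counit (R := ℂ) x • (1 : H)) = counit (R := ℂ) x • 1 :=
      LinearMap.ext fun y => by simp
    rw [this, smul_mul_assoc, one_mul, map_smul, smul_eq_mul]
  have e4 : h * θ = θ := by
    rw [← sub_eq_zero, ← Module.forall_dual_apply_eq_zero_iff ℂ]
    intro f
    have := inv h f
    rw [hθ', hθ', hh.2, one_mul] at this
    rw [map_sub, sub_eq_zero]
    exact this
  have e5 : θ = counit (R := ℂ) θ • h := e4.symm.trans (hh.1 θ).2
  have e6 : counit (R := ℂ) θ = sqForm H (1 : H) := by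
    rw [← hθ' (counit (R := ℂ)), sqForm, traceForm_apply]
    have a : QD.Tp (counit (R := ℂ)) = (1 : Module.End ℂ H) := LinearMap.ext fun x => by
      rw [Tp_apply, contrR, LinearMap.comp_apply, lTensor_counit_comul]
      simp
    rw [a, mul_one, LinearMap.mulLeft_one]
    rfl
  rw [hθ', e5, map_smul, smul_eq_mul, mul_comm, e6]

open Coalgebra in
lemma regChar_mul_regChar (x : H) :
    LinearMap.mul' ℂ ℂ (TensorProduct.map (regChar H) (regChar H) (comul (R := ℂ) x)) =
      Module.finrank ℂ H * regChar H x := by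
  have e0 : ∀ t : H ⊗[ℂ] H, LinearMap.mul' ℂ ℂ (TensorProduct.map (regChar H) (regChar H) t) =
      LinearMap.trace ℂ (H ⊗[ℂ] H) (LinearMap.mulLeft ℂ t) := by
    intro t
    induction t with
    | zero => simp
    | add s t hs ht =>
      have : LinearMap.mulLeft ℂ (s + t) = LinearMap.mulLeft ℂ s + LinearMap.mulLeft ℂ t :=
        (LinearMap.mul ℂ (H ⊗[ℂ] H)).map_add s t
      rw [map_add, map_add, hs, ht, this, map_add]
    | tmul u v =>
      have : LinearMap.mulLeft ℂ (u ⊗ₜ[ℂ] v) =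
          TensorProduct.map (LinearMap.mulLeft ℂ u) (LinearMap.mulLeft ℂ v) :=
        TensorProduct.ext' fun p q => by simp
      rw [this, LinearMap.trace_tensorProduct']
      rfl
  let T : H ⊗[ℂ] H →ₗ[ℂ] H ⊗[ℂ] H := LinearMap.mul' ℂ (H ⊗[ℂ] H) ∘ₗ
    TensorProduct.map (comul (R := ℂ)) (TensorProduct.mk ℂ H H 1)
  have hT : ∀ u v, T (u ⊗ₜ v) = comul (R := ℂ) u * (1 ⊗ₜ v) := fun u v => rfl
  have hsurj : Function.Surjective T := by
    intro t
    induction t with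
    | zero => exact ⟨0, map_zero _⟩
    | add s t hs ht =>
      obtain ⟨a, rfl⟩ := hs
      obtain ⟨b, rfl⟩ := ht
      exact ⟨a + b, map_add _ _ _⟩
    | tmul u v =>
      refine ⟨(LinearMap.mulRight ℂ v ∘ₗ S).lTensor H (comul (R := ℂ) u), ?_⟩
      have : ∀ t : H ⊗[ℂ] H, T ((LinearMap.mulRight ℂ v ∘ₗ S).lTensor H t) =
          (LinearMap.mul' ℂ (H ⊗[ℂ] H) ∘ₗ TensorProduct.map
            (comul (R := ℂ)) (TensorProduct.mk ℂ H H 1 ∘ₗ S)) t * (1 ⊗ₜ v) := by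
        intro t
        induction t with
        | zero => simp
        | add s t hs ht => simp only [map_add, add_mul, hs, ht]
        | tmul p q =>
          rw [LinearMap.lTensor_tmul, hT]
          simp [mul_assoc]
      rw [this, sum_comul_mul_tmul_antipode]
      simp
  let E := LinearEquiv.ofBijective T ⟨(LinearMap.injective_iff_surjective).2 hsurj, hsurj⟩
  have e1 : LinearMap.mulLeft ℂ (comul (R := ℂ) x) =
      E.conj (TensorProduct.map (LinearMap.mulLeft ℂ x) LinearMap.id) := by
    refine LinearMap.ext fun t => ?_
    obtain ⟨t, rfl⟩ := hsurj t
    have h1 : E.symm (T t) = t := E.symm_apply_apply t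
    rw [LinearEquiv.conj_apply_apply, h1]
    change _ = T (TensorProduct.map _ _ t)
    induction t with
    | zero => simp
    | add s t hs ht =>
      rw [map_add, map_add, hs (E.symm_apply_apply s), ht (E.symm_apply_apply t), map_add, map_add]
    | tmul u v =>
      rw [TensorProduct.map_tmul, hT, hT, LinearMap.mulLeft_apply, LinearMap.mulLeft_apply,
        Bialgebra.comul_mul, mul_assoc]
      rfl
  rw [e0, e1, LinearMap.trace_conj', LinearMap.trace_tensorProduct', LinearMap.trace_id, mul_comm]
  rfl

open Coalgebra in
/-- The antipode of a finite-dimensional semisimple complex Hopf algebra is an involution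
(Larson and Radford). -/
theorem antipode_antipode [IsSemisimpleRing H] (x : H) : S (S x) = x := by
  obtain ⟨h, hh⟩ := exists_isHaar (H := H)
  have hne := sqForm_one_ne_zero hh
  have : Nontrivial H := ⟨1, 0, fun h0 => hne (by rw [h0, map_zero])⟩
  let d := Module.finrank ℂ H
  have hd : 0 < d := Module.finrank_pos
  have hd0 : (d : ℂ) ≠ 0 := by exact_mod_cast hd.ne'
  let U : Module.End ℂ H := S ∘ₗ S
  let E : Module.End ℂ H := (d : ℂ)⁻¹ • QD.Tp (regChar H)
  have hUU : U * U = 1 := LinearMap.ext fun x => antipode_four hh hne x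
  have hTT : QD.Tp (regChar H) * QD.Tp (regChar H) = (d : ℂ) • QD.Tp (regChar H) := by
    refine LinearMap.ext fun y => ?_
    change contrR (regChar H) (comul (R := ℂ) (contrR (regChar H) (comul (R := ℂ) y))) =
      (d : ℂ) • contrR (regChar H) (comul (R := ℂ) y)
    let W : H ⊗[ℂ] (H ⊗[ℂ] H) →ₗ[ℂ] H :=
      contrR (LinearMap.mul' ℂ ℂ ∘ₗ TensorProduct.map (regChar H) (regChar H))
    have a1 : ∀ t : H ⊗[ℂ] H, contrR (regChar H) (comul (R := ℂ) (contrR (regChar H) t)) =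
        W (TensorProduct.assoc ℂ H H H ((comul (R := ℂ)).rTensor H t)) := by
      intro t
      induction t with
      | zero => simp
      | add s t hs ht => simp only [map_add, hs, ht]
      | tmul u v =>
        rw [contrR_tmul, map_smul, map_smul, LinearMap.rTensor_tmul]
        induction comul (R := ℂ) u with
        | zero => simp
        | add s t hs ht => simp only [map_add, smul_add, TensorProduct.add_tmul, hs, ht]
        | tmul p q => simp [W, smul_smul, mul_comm]
    have a2 : ∀ t : H ⊗[ℂ] H, W ((comul (R := ℂ)).lTensor H t) = (d : ℂ) • contrR (regChar H) t := by
      intro t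
      induction t with
      | zero => simp
      | add s t hs ht => simp only [map_add, smul_add, hs, ht]
      | tmul u v =>
        rw [LinearMap.lTensor_tmul, contrR_tmul]
        simp only [contrR_tmul, LinearMap.comp_apply, regChar_mul_regChar, mul_smul]
        rfl
    rw [a1, coassoc_apply, a2]
  have hE : IsIdempotentElem E := by
    change E * E = E
    rw [smul_mul_smul_comm, hTT, smul_smul, mul_assoc, inv_mul_cancel₀ hd0, mul_one]
  have hchi : regChar H ∘ₗ (S ∘ₗ S) = regChar H := by
    refine LinearMap.ext fun x => ?_
    let e := (antipodeSq hh).toLinearEquiv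
    rw [LinearMap.comp_apply, regChar_apply, regChar_apply, ← LinearMap.trace_conj' (LinearMap.mulLeft ℂ x) e]
    congr 1
    refine LinearMap.ext fun y => ?_
    obtain ⟨y, rfl⟩ := e.surjective y
    rw [LinearEquiv.conj_apply_apply, e.symm_apply_apply]
    exact (map_mul (antipodeSq hh) x y).symm
  have hUT : U * QD.Tp (regChar H) = QD.Tp (regChar H) * U := by
    refine LinearMap.ext fun y => ?_
    change S (S (contrR (regChar H) (comul (R := ℂ) y))) =
      contrR (regChar H) (comul (R := ℂ) (S (S y)))
    rw [comul_antipode_sq]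
    induction comul (R := ℂ) y with
    | zero => simp
    | add s t hs ht => simp only [map_add, hs, ht]
    | tmul u v =>
      have := LinearMap.congr_fun hchi v
      simp only [LinearMap.comp_apply] at this
      simp [this]
  have hUE : U * E = E * U := by
    simp only [E, mul_smul_comm, smul_mul_assoc, hUT]
  have htr : LinearMap.trace ℂ H U = d * LinearMap.trace ℂ H (U * E) := by
    have h1 := trace_sq_mul_Tp hh hne (regChar H)
    rw [regChar_haar hh, one_mul] at h1
    have h2 : LinearMap.trace ℂ H U = sqForm H (1 : H) := by
      rw [sqForm, traceForm_apply, LinearMap.mulLeft_one]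
      rfl
    have h3 : LinearMap.trace ℂ H (U * QD.Tp (regChar H)) = sqForm H (1 : H) := h1
    rw [h2, ← h3]
    simp only [E, mul_smul_comm, map_smul, smul_eq_mul]
    rw [← mul_assoc, mul_inv_cancel₀ hd0, one_mul]
  have hnat : ∀ P : Module.End ℂ H, IsIdempotentElem P → ∃ r : ℕ, LinearMap.trace ℂ H P = r :=
    fun P hP => ⟨_, LinearMap.IsProj.trace (LinearMap.isProj_range_iff_isIdempotentElem P |>.2 hP)⟩
  let P : Module.End ℂ H := (2 : ℂ)⁻¹ • (1 + U)
  have hP : IsIdempotentElem P := by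
    change P * P = P
    simp only [P, smul_mul_smul_comm, add_mul, mul_add, mul_one, one_mul, hUU]
    rw [add_comm U 1, ← two_smul ℂ (1 + U), smul_smul]
    norm_num
  have hUP : U = (2 : ℂ) • P - 1 := by
    simp only [P, smul_smul]
    norm_num
  have hPE : IsIdempotentElem (P * E) := by
    have hc : P * E = E * P := by
      simp only [P, smul_mul_assoc, mul_smul_comm, add_mul, mul_add, one_mul, mul_one, hUE]
    change P * E * (P * E) = P * E
    calc P * E * (P * E) = P * (E * P) * E := by simp only [mul_assoc]
      _ = (P * P) * (E * E) := by rw [← hc]; simp only [mul_assoc]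
      _ = P * E := by rw [hP.eq, hE.eq]
  obtain ⟨r, hr⟩ := hnat P hP
  obtain ⟨s, hs⟩ := hnat (1 - P) hP.one_sub
  obtain ⟨a, ha⟩ := hnat (P * E) hPE
  obtain ⟨b, hb⟩ := hnat E hE
  have h1 : LinearMap.trace ℂ H 1 = d := LinearMap.trace_one ℂ H
  have hrs : r + s = d := by
    rw [map_sub, h1, hr] at hs
    have : (r : ℂ) + s = d := by rw [← hs]; ring
    exact_mod_cast this
  have hU1 : (2 * r - d : ℤ) = d * (2 * a - b) := by
    have : (2 * r - d : ℂ) = d * (2 * a - b) := by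
      have h2 : LinearMap.trace ℂ H U = 2 * r - d := by
        rw [hUP, map_sub, map_smul, hr, h1, smul_eq_mul]
      have h3 : LinearMap.trace ℂ H (U * E) = 2 * a - b := by
        rw [hUP, sub_mul, one_mul, smul_mul_assoc, map_sub, map_smul, ha, hb, smul_eq_mul]
      rw [← h2, ← h3, htr]
    exact_mod_cast this
  have hr0 : r ≠ 0 := by
    rintro rfl
    have hP0 : P = 0 := LinearMap.IsIdempotentElem.eq_zero_of_trace_eq_zero hP (by rw [hr]; simp)
    have : P 1 = 1 := by
      simp only [P, U, LinearMap.smul_apply, LinearMap.add_apply, Module.End.one_apply,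
        LinearMap.comp_apply, HopfAlgebra.antipode_one]
      rw [← two_smul ℂ (1 : H), smul_smul]
      norm_num
    rw [hP0] at this
    exact zero_ne_one this
  have htr0 : (2 * r - d : ℤ) ≠ 0 := by
    intro h0
    apply hne
    have h2 : LinearMap.trace ℂ H U = sqForm H (1 : H) := by
      rw [sqForm, traceForm_apply, LinearMap.mulLeft_one]
      rfl
    rw [← h2, hUP, map_sub, map_smul, hr, h1, smul_eq_mul]
    exact_mod_cast h0
  have hm : (2 * a - b : ℤ) = 1 := by
    set m : ℤ := 2 * a - b with hm
    have hd' : (0 : ℤ) < d := by exact_mod_cast hd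
    have hrs' : (r : ℤ) + s = d := by exact_mod_cast hrs
    have hr' : (0 : ℤ) < r := by positivity
    have u1 : m < 2 := by
      by_contra hcon
      nlinarith
    have u2 : -1 < m := by
      by_contra hcon
      nlinarith
    have u3 : m ≠ 0 := by
      intro h0
      rw [h0, mul_zero] at hU1
      exact htr0 hU1
    omega
  have hs0 : s = 0 := by
    rw [hm, mul_one] at hU1
    omega
  have hP1 : 1 - P = 0 := LinearMap.IsIdempotentElem.eq_zero_of_trace_eq_zero hP.one_sub
    (by rw [hs, hs0]; simp)
  have hU : U = 1 := by
    rw [hUP, ← sub_eq_zero.1 hP1, two_smul]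
    simp
  exact LinearMap.congr_fun hU x

end Involution

/-! ### Symmetric separability idempotents -/

section Separability

variable {A : Type v} [Ring A] [Algebra ℂ A]

variable {l l' : A ⊗[ℂ] A}

lemma IsSep.right (hl : QD.IsSymmSeparabilityIdempotent A l) (a : A) :
    (LinearMap.mulRight ℂ a).rTensor A l = (LinearMap.mulLeft ℂ a).lTensor A l := by
  have h := hl.1 a
  have e1 : ∀ t : A ⊗[ℂ] A, TensorProduct.comm ℂ A A ((LinearMap.mulRight ℂ a).lTensor A t) =
      (LinearMap.mulRight ℂ a).rTensor A (TensorProduct.comm ℂ A A t) := by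
    intro t
    induction t with
    | zero => simp
    | add s t hs ht => simp only [map_add, hs, ht]
    | tmul u v => simp
  have e2 : ∀ t : A ⊗[ℂ] A, TensorProduct.comm ℂ A A ((LinearMap.mulLeft ℂ a).rTensor A t) =
      (LinearMap.mulLeft ℂ a).lTensor A (TensorProduct.comm ℂ A A t) := by
    intro t
    induction t with
    | zero => simp
    | add s t hs ht => simp only [map_add, hs, ht]
    | tmul u v => simp
  rw [← hl.2.2, ← e1, ← e2, h]

lemma IsSep.unique (hl : QD.IsSymmSeparabilityIdempotent A l)
    (hl' : QD.IsSymmSeparabilityIdempotent A l') : l = l' := by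
  -- the element `∑ l₁ l'₁ ⊗ l'₂ l₂`
  let F : A ⊗[ℂ] A →ₗ[ℂ] A ⊗[ℂ] A →ₗ[ℂ] A ⊗[ℂ] A :=
    TensorProduct.map₂ (LinearMap.mul ℂ A) (LinearMap.mul ℂ A).flip
  have hF : ∀ a b c d, F (a ⊗ₜ b) (c ⊗ₜ d) = (a * c) ⊗ₜ (d * b) := fun _ _ _ _ => rfl
  have h1 : F l l' = l' := by
    have : ∀ t : A ⊗[ℂ] A, F t l' = (LinearMap.mulRight ℂ (LinearMap.mul' ℂ A t)).lTensor A l' := by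
      intro t
      induction t with
      | zero => simp
      | add s t hs ht =>
        have e : ∀ a b : A, LinearMap.mulRight ℂ (a + b) =
          LinearMap.mulRight ℂ a + LinearMap.mulRight ℂ b := (LinearMap.mul ℂ A).flip.map_add
        rw [map_add, LinearMap.add_apply, hs, ht, map_add, e, LinearMap.lTensor_add]
        rfl
      | tmul u v =>
        have e : ∀ s : A ⊗[ℂ] A, F (u ⊗ₜ v) s = (LinearMap.mulRight ℂ v).lTensor A
            ((LinearMap.mulLeft ℂ u).rTensor A s) := by
          intro s
          induction s with
          | zero => simp
          | add s t hs ht => simp only [map_add, hs, ht]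
          | tmul c d => rw [hF]; simp
        rw [e, hl'.1 u]
        rw [← LinearMap.comp_apply, ← LinearMap.lTensor_comp]
        congr 2
        exact LinearMap.ext fun x => by simp
    rw [this, hl.2.1, LinearMap.mulRight_one, LinearMap.lTensor_id, LinearMap.id_apply]
  have h2 : F l l' = l := by
    have : ∀ t : A ⊗[ℂ] A, F l t = (LinearMap.mulLeft ℂ
        (LinearMap.mul' ℂ A (TensorProduct.comm ℂ A A t))).lTensor A l := by
      intro t
      induction t with
      | zero => simp
      | add s t hs ht =>
        have e : ∀ a b : A, LinearMap.mulLeft ℂ (a + b) =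
          LinearMap.mulLeft ℂ a + LinearMap.mulLeft ℂ b := (LinearMap.mul ℂ A).map_add
        rw [map_add, hs, ht, map_add, map_add, e, LinearMap.lTensor_add]
        rfl
      | tmul u v =>
        have e : ∀ s : A ⊗[ℂ] A, F s (u ⊗ₜ v) = (LinearMap.mulLeft ℂ v).lTensor A
            ((LinearMap.mulRight ℂ u).rTensor A s) := by
          intro s
          induction s with
          | zero => simp
          | add s t hs ht => simp only [map_add, LinearMap.add_apply, hs, ht]
          | tmul c d => rw [hF]; simp
        rw [e, IsSep.right hl u]
        rw [← LinearMap.comp_apply, ← LinearMap.lTensor_comp]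
        congr 2
        exact LinearMap.ext fun x => by simp
    rw [this, hl'.2.2, hl'.2.1, LinearMap.mulLeft_one, LinearMap.lTensor_id, LinearMap.id_apply]
  exact h2.symm.trans h1

variable [Module.Finite ℂ A]

/-- A symmetric separability idempotent is dual to the trace of the regular representation. -/
lemma IsSep.contrL_regChar (hl : QD.IsSymmSeparabilityIdempotent A l) (x : A) :
    contrL (regChar A ∘ₗ LinearMap.mulLeft ℂ x) l = x := by
  let b := Module.finBasis ℂ A
  have h0 : ∀ t : A ⊗[ℂ] A, contrL (regChar A ∘ₗ LinearMap.mulLeft ℂ x) t =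
      ∑ j, contrL (b.coord j ∘ₗ LinearMap.mulLeft ℂ x) ((LinearMap.mulRight ℂ (b j)).rTensor A t) := by
    intro t
    induction t with
    | zero => simp
    | add s t hs ht => simp only [map_add, Finset.sum_add_distrib, hs, ht]
    | tmul u v =>
      simp only [LinearMap.rTensor_tmul, contrL_tmul, LinearMap.comp_apply, LinearMap.mulLeft_apply,
        LinearMap.mulRight_apply, ← Finset.sum_smul]
      congr 1
      rw [regChar_apply, LinearMap.trace_eq_matrix_trace ℂ b, Matrix.trace]
      refine Finset.sum_congr rfl fun j _ => ?_
      rw [Matrix.diag_apply, LinearMap.toMatrix_apply]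
      simp
  rw [h0]
  simp only [IsSep.right hl]
  have h1 : ∀ t : A ⊗[ℂ] A, ∑ j, contrL (b.coord j ∘ₗ LinearMap.mulLeft ℂ x)
      ((LinearMap.mulLeft ℂ (b j)).lTensor A t) = x * LinearMap.mul' ℂ A t := by
    intro t
    induction t with
    | zero => simp
    | add s t hs ht => simp only [map_add, Finset.sum_add_distrib, mul_add, hs, ht]
    | tmul u v =>
      simp only [LinearMap.lTensor_tmul, contrL_tmul, LinearMap.comp_apply, LinearMap.mulLeft_apply,
        LinearMap.mul'_apply, ← mul_assoc, ← smul_mul_assoc, ← Finset.sum_mul]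
      congr 1
      exact b.sum_repr (x * u)
  rw [h1, hl.2.1, mul_one]

omit [Module.Finite ℂ A] in
lemma regChar_mul_comm (x y : A) : regChar A (x * y) = regChar A (y * x) := by
  rw [regChar_apply, regChar_apply, LinearMap.mulLeft_mul, LinearMap.mulLeft_mul]
  exact LinearMap.trace_mul_comm ℂ _ _

omit [Module.Finite ℂ A] in
theorem exists_isSep_pi_matrix {n : ℕ} {d : Fin n → ℕ} (hd : ∀ i, NeZero (d i))
    (Θ : A ≃ₐ[ℂ] ∀ i, Matrix (Fin (d i)) (Fin (d i)) ℂ) :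
    ∃ l : A ⊗[ℂ] A, QD.IsSymmSeparabilityIdempotent A l := by
  classical
  let e : ∀ i, Fin (d i) → Fin (d i) → A := fun i p q => Θ.symm (Pi.single i (Matrix.single p q 1))
  have he : ∀ (a : A) i p q, a * e i p q = ∑ r, Θ a i r p • e i r q := by
    intro a i p q
    apply Θ.injective
    rw [map_mul, map_sum]
    simp only [map_smul, e, Θ.apply_symm_apply]
    funext j
    rw [Finset.sum_apply]
    by_cases hj : j = i
    · subst hj
      ext s t
      simp only [Pi.mul_apply, Pi.single_eq_same, Pi.smul_apply, Matrix.sum_apply, Matrix.smul_apply,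
        smul_eq_mul]
      by_cases ht : t = q
      · subst ht
        simp [Matrix.single_apply]
      · rw [Matrix.mul_single_apply_of_ne _ _ _ _ _ ht]
        simp [Ne.symm ht]
    · simp [Pi.single_eq_of_ne hj]
  have he' : ∀ (a : A) i p q, e i p q * a = ∑ r, Θ a i q r • e i p r := by
    intro a i p q
    apply Θ.injective
    rw [map_mul, map_sum]
    simp only [map_smul, e, Θ.apply_symm_apply]
    funext j
    rw [Finset.sum_apply]
    by_cases hj : j = i
    · subst hj
      ext s t
      simp only [Pi.mul_apply, Pi.single_eq_same, Pi.smul_apply, Matrix.sum_apply, Matrix.smul_apply,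
        smul_eq_mul]
      by_cases ht : s = p
      · subst ht
        simp [Matrix.single_apply]
      · rw [Matrix.single_mul_apply_of_ne _ _ _ _ _ ht]
        simp [Ne.symm ht]
    · simp [Pi.single_eq_of_ne hj]
  have hee : ∀ i p q, e i p q * e i q p = e i p p := by
    intro i p q
    apply Θ.injective
    rw [map_mul]
    simp only [e, Θ.apply_symm_apply]
    rw [← Pi.single_mul, Matrix.single_mul_single_same, one_mul]
  have hone : ∑ i, ∑ p, e i p p = 1 := by
    apply Θ.injective
    rw [map_sum, map_one]
    simp only [map_sum, e, Θ.apply_symm_apply]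
    funext j
    rw [Finset.sum_apply, Finset.sum_eq_single j]
    · rw [Finset.sum_apply]
      simp [Matrix.sum_single_one]
    · intro i _ hi
      rw [Finset.sum_apply]
      simp [Pi.single_eq_of_ne hi.symm]
    · simp
  refine ⟨∑ i, (d i : ℂ)⁻¹ • ∑ p, ∑ q, e i p q ⊗ₜ e i q p, fun a => ?_, ?_, ?_⟩
  · simp only [map_sum, map_smul, LinearMap.rTensor_tmul, LinearMap.lTensor_tmul,
      LinearMap.mulLeft_apply, LinearMap.mulRight_apply, he, he', TensorProduct.sum_tmul,
      TensorProduct.tmul_sum, TensorProduct.smul_tmul', TensorProduct.tmul_smul]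
    refine Finset.sum_congr rfl fun i _ => ?_
    congr 1
    rw [Finset.sum_comm]
    conv_rhs => rw [Finset.sum_comm]
    refine Finset.sum_congr rfl fun q _ => ?_
    rw [Finset.sum_comm]
  · simp only [map_sum, map_smul, LinearMap.mul'_apply, hee, Finset.sum_const, Finset.card_univ,
      Fintype.card_fin, ← Finset.smul_sum, ← Nat.cast_smul_eq_nsmul ℂ, smul_smul]
    rw [← hone]
    refine Finset.sum_congr rfl fun i _ => ?_
    have := hd i
    rw [inv_mul_cancel₀ (by exact_mod_cast NeZero.ne (d i)), one_smul]
  · simp only [map_sum, map_smul, TensorProduct.comm_tmul]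
    refine Finset.sum_congr rfl fun i _ => ?_
    rw [Finset.sum_comm]

theorem existsUnique_isSep [IsSemisimpleRing A] :
    ∃! l : A ⊗[ℂ] A, QD.IsSymmSeparabilityIdempotent A l := by
  obtain ⟨n, d, hd, ⟨Θ⟩⟩ := IsSemisimpleRing.exists_algEquiv_pi_matrix_of_isAlgClosed ℂ A
  obtain ⟨l, hl⟩ := exists_isSep_pi_matrix hd Θ
  exact ⟨l, hl, fun l' hl' => IsSep.unique hl' hl⟩

end Separability

section SepCoaction

variable {H : Type u} [Ring H] [HopfAlgebra ℂ H] [Module.Finite ℂ H]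
  {A : Type v} [Ring A] [Algebra ℂ A] (β : A →ₐ[ℂ] H ⊗[ℂ] A)

theorem contrR_regChar (hβ : IsCoact β.toLinearMap) (hS : ∀ x : H, S (S x) = x) (a : A) :
    contrR (regChar A) (β a) = regChar A a • 1 := by
  refine traceForm_coinvariant β hβ LinearMap.id (fun a => ?_) a
  have : (S ∘ₗ S : H →ₗ[ℂ] H) = LinearMap.id := LinearMap.ext hS
  rw [this, TensorProduct.map_id]
  rfl

lemma contrR_regChar_mul (hβ : IsCoact β.toLinearMap) (hS : ∀ x : H, S (S x) = x) (x a : A) :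
    contrR (regChar A ∘ₗ LinearMap.mulLeft ℂ x) (β a) =
      contrR (regChar A ∘ₗ LinearMap.mulRight ℂ a) ((S (H := H)).rTensor A (β x)) := by
  let G : H ⊗[ℂ] A →ₗ[ℂ] H := contrR (regChar A) ∘ₗ LinearMap.mulRight ℂ (β a) ∘ₗ
    (LinearMap.mul' ℂ H ∘ₗ (S (H := H)).rTensor H).rTensor A ∘ₗ
      (TensorProduct.assoc ℂ H H A).symm.toLinearMap ∘ₗ β.toLinearMap.lTensor H
  have e1 : G (β x) = contrR (regChar A ∘ₗ LinearMap.mulLeft ℂ x) (β a) := by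
    have := hβ.cancel _ antipode_mul_comul x
    simp only [G, LinearMap.comp_apply, LinearEquiv.coe_coe]
    rw [AlgHom.toLinearMap_apply] at this
    rw [this, contrR_comp]
    congr 1
    rw [LinearMap.mulRight_apply]
    generalize β a = t
    induction t with
    | zero => simp
    | add s t hs ht => simp only [map_add, mul_add, hs, ht]
    | tmul u v => simp
  have e2 : ∀ t : H ⊗[ℂ] A, G t =
      contrR (regChar A ∘ₗ LinearMap.mulRight ℂ a) ((S (H := H)).rTensor A t) := by
    intro t
    induction t with
    | zero => simp
    | add s t hs ht => simp only [map_add, hs, ht]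
    | tmul u v =>
      have h1 : G (u ⊗ₜ v) = S u * contrR (regChar A) (β v * β a) := by
        simp only [G, LinearMap.comp_apply, LinearEquiv.coe_coe, LinearMap.lTensor_tmul,
          AlgHom.toLinearMap_apply]
        induction β v with
        | zero => simp
        | add s t hs ht =>
          simp only [map_add, mul_add, add_mul, TensorProduct.tmul_add, hs, ht]
        | tmul p q =>
          simp only [TensorProduct.assoc_symm_tmul, LinearMap.rTensor_tmul, LinearMap.comp_apply,
            LinearMap.mul'_apply, LinearMap.mulRight_apply]
          induction β a with
          | zero => simp
          | add s t hs ht => simp only [map_add, mul_add, hs, ht]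
          | tmul r s => simp [mul_assoc]
      rw [h1, ← map_mul, contrR_regChar β hβ hS]
      simp
  rw [← e1, e2]

variable [Module.Finite ℂ A] {l : A ⊗[ℂ] A}

lemma IsSep.ext_contrR {W : Type*} [AddCommGroup W] [Module ℂ W]
    (hl : QD.IsSymmSeparabilityIdempotent A l) {w w' : W ⊗[ℂ] A}
    (h : ∀ a, contrR (regChar A ∘ₗ LinearMap.mulRight ℂ a) w =
      contrR (regChar A ∘ₗ LinearMap.mulRight ℂ a) w') : w = w' := by
  let K : W ⊗[ℂ] A →ₗ[ℂ] A →ₗ[ℂ] W := TensorProduct.lift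
    (LinearMap.smulRightₗ ∘ₗ (LinearMap.mul ℂ A).compr₂ (regChar A)).flip
  have hK : ∀ w a, K w a = contrR (regChar A ∘ₗ LinearMap.mulRight ℂ a) w := by
    intro w a
    induction w with
    | zero => simp
    | add s t hs ht => simp only [map_add, LinearMap.add_apply, hs, ht]
    | tmul u v => simp [K]
  have hl' : ∀ w, (K w).rTensor A l = w := by
    intro w
    induction w with
    | zero => simp
    | add s t hs ht => rw [map_add, LinearMap.rTensor_add, LinearMap.add_apply, hs, ht]
    | tmul u v =>
      have : ∀ t : A ⊗[ℂ] A, (K (u ⊗ₜ v)).rTensor A t =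
          u ⊗ₜ contrL (regChar A ∘ₗ LinearMap.mulLeft ℂ v) t := by
        intro t
        induction t with
        | zero => simp
        | add s t hs ht => simp only [map_add, TensorProduct.tmul_add, hs, ht]
        | tmul p q => simp [K, TensorProduct.smul_tmul]
      rw [this, IsSep.contrL_regChar hl]
  rw [← hl' w, ← hl' w', LinearMap.ext fun a => (hK w a).trans ((h a).trans (hK w' a).symm)]

/-- The Haar-type invariance of the symmetric separability idempotent of a comodule algebra. -/
theorem IsSep.coinvariant (hβ : IsCoact β.toLinearMap) (hS : ∀ x : H, S (S x) = x)
    (hl : QD.IsSymmSeparabilityIdempotent A l) :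
    TensorProduct.assoc ℂ H A A (β.toLinearMap.rTensor A l) =
      TensorProduct.leftComm ℂ A H A (((S (H := H)).rTensor A).lTensor A
        (β.toLinearMap.lTensor A l)) := by
  let R : H ⊗[ℂ] (A ⊗[ℂ] A) ≃ₗ[ℂ] (H ⊗[ℂ] A) ⊗[ℂ] A :=
    (TensorProduct.comm ℂ A A).lTensor H ≪≫ₗ (TensorProduct.assoc ℂ H A A).symm
  apply R.injective
  refine IsSep.ext_contrR hl fun x => ?_
  trans (S (H := H)).rTensor A (β x)
  · -- `∑ a⁽⁻¹⁾ tr(a⁽⁰⁾ x) ⊗ b = ∑ S(x⁽⁻¹⁾) ⊗ x⁽⁰⁾`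
    have e1 : ∀ t : A ⊗[ℂ] A, contrR (regChar A ∘ₗ LinearMap.mulRight ℂ x)
        (R (TensorProduct.assoc ℂ H A A (β.toLinearMap.rTensor A t))) =
        (contrR (regChar A ∘ₗ LinearMap.mulLeft ℂ x) ∘ₗ β.toLinearMap).rTensor A t := by
      intro t
      induction t with
      | zero => simp
      | add s t hs ht => simp only [map_add, hs, ht]
      | tmul u v =>
        simp only [LinearMap.rTensor_tmul, LinearMap.comp_apply]
        generalize β.toLinearMap u = w
        induction w with
        | zero => simp
        | add s t hs ht => simp only [map_add, TensorProduct.add_tmul, hs, ht]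
        | tmul p q => simp [R, regChar_mul_comm q x, TensorProduct.smul_tmul']
    rw [e1]
    have e2 : ∀ (w : H ⊗[ℂ] A) (g : A →ₗ[ℂ] H),
        (∀ a, g a = contrR (regChar A ∘ₗ LinearMap.mulRight ℂ a) w) → g.rTensor A l = w := by
      intro w g hg
      refine IsSep.ext_contrR hl fun y => ?_
      have : ∀ t : A ⊗[ℂ] A, contrR (regChar A ∘ₗ LinearMap.mulRight ℂ y) (g.rTensor A t) =
          g (contrR (regChar A ∘ₗ LinearMap.mulRight ℂ y) t) := by
        intro t
        induction t with
        | zero => simp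
        | add s t hs ht => simp only [map_add, hs, ht]
        | tmul p q => simp
      rw [this, ← hg]
      congr 1
      have h3 : ∀ t : A ⊗[ℂ] A, contrR (regChar A ∘ₗ LinearMap.mulRight ℂ y) t =
          contrL (regChar A ∘ₗ LinearMap.mulLeft ℂ y) (TensorProduct.comm ℂ A A t) := by
        intro t
        induction t with
        | zero => simp
        | add s t hs ht => simp only [map_add, hs, ht]
        | tmul p q => simp [regChar_mul_comm q y]
      rw [h3, hl.2.2, IsSep.contrL_regChar hl]
    refine e2 _ _ fun a => ?_
    rw [LinearMap.comp_apply, AlgHom.toLinearMap_apply, contrR_regChar_mul β hβ hS]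
  · have e1 : ∀ t : A ⊗[ℂ] A, contrR (regChar A ∘ₗ LinearMap.mulRight ℂ x)
        (R (TensorProduct.leftComm ℂ A H A (((S (H := H)).rTensor A).lTensor A
        (β.toLinearMap.lTensor A t)))) =
        (S (H := H)).rTensor A (β (contrL (regChar A ∘ₗ LinearMap.mulLeft ℂ x) t)) := by
      intro t
      induction t with
      | zero => simp
      | add s t hs ht => simp only [map_add, hs, ht]
      | tmul u v =>
        simp only [LinearMap.lTensor_tmul, contrL_tmul, LinearMap.comp_apply, map_smul,
          AlgHom.toLinearMap_apply]
        generalize β v = w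
        induction w with
        | zero => simp
        | add s t hs ht =>
          simp only [map_add, TensorProduct.tmul_add, smul_add, hs, ht]
        | tmul p q => simp [R, regChar_mul_comm u x]
    rw [e1, IsSep.contrL_regChar hl]

end SepCoaction

/-! ### Integrals of a semisimple Hopf algebra -/

section Integrals

variable {H : Type u} [Ring H] [HopfAlgebra ℂ H] {h : H}

lemma map_antipode_mulLeft (a : H) (t : H ⊗[ℂ] H) :
    (S (H := H)).lTensor H ((1 ⊗ₜ a) * t) =
      (LinearMap.mulRight ℂ (S a)).lTensor H ((S (H := H)).lTensor H t) := by
  induction t with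
  | zero => simp
  | add s t hs ht => simp only [map_add, mul_add, hs, ht]
  | tmul u v => simp [HopfAlgebra.antipode_mul_antidistrib]

lemma comm_lTensor_antipode (hS : ∀ x : H, S (S x) = x) (t : H ⊗[ℂ] H) :
    TensorProduct.comm ℂ H H ((S (H := H)).lTensor H t) = (S (H := H)).lTensor H
      (TensorProduct.map S S (TensorProduct.comm ℂ H H t)) := by
  induction t with
  | zero => simp
  | add s t hs ht => simp only [map_add, hs, ht]
  | tmul u v => simp [hS]

lemma comm_rTensor_antipode (hS : ∀ x : H, S (S x) = x) (t : H ⊗[ℂ] H) :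
    TensorProduct.comm ℂ H H ((S (H := H)).rTensor H t) = (S (H := H)).rTensor H
      (TensorProduct.map S S (TensorProduct.comm ℂ H H t)) := by
  induction t with
  | zero => simp
  | add s t hs ht => simp only [map_add, hs, ht]
  | tmul u v => simp [hS]

lemma IsHaar.map_antipode_comul (hh : QD.IsHaar H h) (hS : ∀ x : H, S (S x) = x) :
    TensorProduct.map S S (TensorProduct.comm ℂ H H (Coalgebra.comul (R := ℂ) h)) =
      Coalgebra.comul (R := ℂ) h := by
  rw [← comul_antipode, IsHaar.antipode_eq hh fun x => ⟨S x, hS x⟩]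

/-- The element `∑ h₁ ⊗ S(h₂)`. -/
theorem IsHaar.isSep (hh : QD.IsHaar H h) (hS : ∀ x : H, S (S x) = x) :
    QD.IsSymmSeparabilityIdempotent H ((S (H := H)).lTensor H (Coalgebra.comul (R := ℂ) h)) := by
  refine ⟨fun a => ?_, ?_, ?_⟩
  · have e1 : ∀ t : H ⊗[ℂ] H, (LinearMap.mulLeft ℂ a).rTensor H ((S (H := H)).lTensor H t) =
        (S (H := H)).lTensor H ((a ⊗ₜ 1) * t) := by
      intro t
      induction t with
      | zero => simp
      | add s t hs ht => simp only [map_add, mul_add, hs, ht]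
      | tmul u v => simp
    have e2 := IsHaar.tmul_mul_comul hh (S a)
    rw [hS] at e2
    rw [e1, ← e2, map_antipode_mulLeft, hS]
  · have := mul_antipode_comul h
    rw [LinearMap.comp_apply, hh.2, one_smul] at this
    exact this
  · rw [comm_lTensor_antipode hS, IsHaar.map_antipode_comul hh hS]

/-- The element `∑ S(h₁) ⊗ h₂`. -/
theorem IsHaar.isSep' (hh : QD.IsHaar H h) (hS : ∀ x : H, S (S x) = x) :
    QD.IsSymmSeparabilityIdempotent H ((S (H := H)).rTensor H (Coalgebra.comul (R := ℂ) h)) := by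
  refine ⟨fun a => ?_, ?_, ?_⟩
  · have e1 : ∀ t : H ⊗[ℂ] H, (LinearMap.mulLeft ℂ a).rTensor H ((S (H := H)).rTensor H t) =
        (S (H := H)).rTensor H (t * (S a ⊗ₜ 1)) := by
      intro t
      induction t with
      | zero => simp
      | add s t hs ht => simp only [map_add, add_mul, hs, ht]
      | tmul u v => simp [HopfAlgebra.antipode_mul_antidistrib, hS]
    have e3 : ∀ t : H ⊗[ℂ] H, (S (H := H)).rTensor H (t * (1 ⊗ₜ a)) =
        (LinearMap.mulRight ℂ a).lTensor H ((S (H := H)).rTensor H t) := by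
      intro t
      induction t with
      | zero => simp
      | add s t hs ht => simp only [map_add, add_mul, hs, ht]
      | tmul u v => simp
    have e2 := IsHaar.comul_mul_tmul hh (S a)
    rw [hS] at e2
    rw [e1, e2, e3]
  · have := antipode_mul_comul h
    rw [LinearMap.comp_apply, hh.2, one_smul] at this
    exact this
  · rw [comm_rTensor_antipode hS, IsHaar.map_antipode_comul hh hS]

/-- The comultiplication of the Haar integral is symmetric. -/
theorem IsHaar.comm_comul (hh : QD.IsHaar H h) (hS : ∀ x : H, S (S x) = x) :
    TensorProduct.comm ℂ H H (Coalgebra.comul (R := ℂ) h) = Coalgebra.comul (R := ℂ) h := by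
  have e := IsSep.unique (IsHaar.isSep hh hS) (IsHaar.isSep' hh hS)
  have e1 := congrArg ((S (H := H)).lTensor H) e
  have h1 : ∀ t : H ⊗[ℂ] H, (S (H := H)).lTensor H ((S (H := H)).lTensor H t) = t := by
    intro t
    induction t with
    | zero => simp
    | add s t hs ht => simp only [map_add, hs, ht]
    | tmul u v => simp [hS]
  have h2 : ∀ t : H ⊗[ℂ] H, (S (H := H)).lTensor H ((S (H := H)).rTensor H t) =
      TensorProduct.comm ℂ H H (TensorProduct.map S S (TensorProduct.comm ℂ H H t)) := by
    intro t
    induction t with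
    | zero => simp
    | add s t hs ht => simp only [map_add, hs, ht]
    | tmul u v => simp
  rw [h1, h2, IsHaar.map_antipode_comul hh hS] at e1
  exact e1.symm

theorem existsUnique_isHaar [Module.Finite ℂ H] [IsSemisimpleRing H] : ∃! h : H, QD.IsHaar H h := by
  obtain ⟨h, hh⟩ := exists_isHaar (H := H)
  exact ⟨h, hh, fun k hk => IsHaar.unique hk hh⟩

lemma IsDualHaar.unique {φ ψ : Module.Dual ℂ H} (hφ : QD.IsDualHaar H φ) (hψ : QD.IsDualHaar H ψ) :
    φ = ψ := by
  refine LinearMap.ext fun x => ?_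
  have e : ∀ t : H ⊗[ℂ] H, ψ (TensorProduct.rid ℂ H (φ.lTensor H t)) =
      φ (TensorProduct.lid ℂ H (ψ.rTensor H t)) := by
    intro t
    induction t with
    | zero => simp
    | add s t hs ht => simp only [map_add, hs, ht]
    | tmul u v => simp [mul_comm]
  have e1 := e (Coalgebra.comul x)
  rwa [(hφ.1 x).1, (hψ.1 x).2, map_smul, map_smul, hφ.2, hψ.2, smul_eq_mul, smul_eq_mul, mul_one,
    mul_one] at e1

variable [Module.Finite ℂ H] [IsSemisimpleRing H]

lemma sqForm_eq_regChar : sqForm H = regChar H := by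
  have : (S ∘ₗ S : H →ₗ[ℂ] H) = LinearMap.id := LinearMap.ext antipode_antipode
  rw [sqForm, this, regChar]

omit [IsSemisimpleRing H] in
lemma regChar_one : regChar H 1 = Module.finrank ℂ H := by
  rw [regChar_apply, LinearMap.mulLeft_one, LinearMap.trace_id]

/-- The dual Haar integral is the normalized character of the regular representation. -/
theorem isDualHaar_regChar : QD.IsDualHaar H ((Module.finrank ℂ H : ℂ)⁻¹ • regChar H) := by
  obtain ⟨h, hh⟩ := exists_isHaar (H := H)
  have hne := sqForm_one_ne_zero hh
  refine ⟨fun x => ⟨?_, ?_⟩, ?_⟩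
  · have := contrR_regChar (Bialgebra.comulAlgHom ℂ H) isCoact_comul antipode_antipode x
    rw [LinearMap.lTensor_smul, LinearMap.smul_apply, map_smul, LinearMap.smul_apply, smul_assoc]
    congr 1
  · have := contrL_sqForm hh x
    rw [show contrL (sqForm H) (Coalgebra.comul (R := ℂ) h) = 1 from modular_eq_one hh hne,
      sqForm_eq_regChar] at this
    rw [LinearMap.rTensor_smul, LinearMap.smul_apply, map_smul, LinearMap.smul_apply, smul_assoc]
    congr 1
  · rw [sqForm_eq_regChar, regChar_one] at hne
    rw [LinearMap.smul_apply, regChar_one, smul_eq_mul, inv_mul_cancel₀ hne]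

theorem existsUnique_isDualHaar : ∃! φ : Module.Dual ℂ H, QD.IsDualHaar H φ :=
  ⟨_, isDualHaar_regChar, fun _ hψ => IsDualHaar.unique hψ isDualHaar_regChar⟩

end Integrals

/-! ### The `3j`-symbols as separability idempotents -/

section Average

variable {A : Type v} [Ring A] [Algebra ℂ A] {U V : Type*} [AddCommGroup U] [Module ℂ U]
  [AddCommGroup V] [Module ℂ V]

/-- The operator `T ↦ σ(a) T ρ(b)` on linear maps, as a function of `a ⊗ b`. -/
def average (ρ : A →ₐ[ℂ] Module.End ℂ U) (σ : A →ₐ[ℂ] Module.End ℂ V) :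
    A ⊗[ℂ] A →ₗ[ℂ] Module.End ℂ (U →ₗ[ℂ] V) :=
  mulMap (LinearMap.llcomp ℂ U V V ∘ₗ σ.toLinearMap)
    ((LinearMap.llcomp ℂ U U V).flip ∘ₗ ρ.toLinearMap)

lemma average_tmul (ρ : A →ₐ[ℂ] Module.End ℂ U) (σ : A →ₐ[ℂ] Module.End ℂ V) (a b : A)
    (T : U →ₗ[ℂ] V) : average ρ σ (a ⊗ₜ b) T = σ a ∘ₗ T ∘ₗ ρ b := rfl

variable {ρ : A →ₐ[ℂ] Module.End ℂ U} {σ : A →ₐ[ℂ] Module.End ℂ V} {l : A ⊗[ℂ] A}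

lemma average_comm (hl : QD.IsSymmSeparabilityIdempotent A l) (T : U →ₗ[ℂ] V) (x : A) :
    average ρ σ l T ∘ₗ ρ x = σ x ∘ₗ average ρ σ l T := by
  have e1 : ∀ t : A ⊗[ℂ] A, average ρ σ t T ∘ₗ ρ x =
      average ρ σ ((LinearMap.mulRight ℂ x).lTensor A t) T := by
    intro t
    induction t with
    | zero => simp
    | add s t hs ht => simp only [map_add, LinearMap.add_apply, LinearMap.add_comp, hs, ht]
    | tmul u v => simp [average_tmul, LinearMap.comp_assoc, Module.End.mul_eq_comp]
  have e2 : ∀ t : A ⊗[ℂ] A, σ x ∘ₗ average ρ σ t T =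
      average ρ σ ((LinearMap.mulLeft ℂ x).rTensor A t) T := by
    intro t
    induction t with
    | zero => simp
    | add s t hs ht => simp only [map_add, LinearMap.add_apply, LinearMap.comp_add, hs, ht]
    | tmul u v => simp [average_tmul, LinearMap.comp_assoc, Module.End.mul_eq_comp]
  rw [e1, e2, hl.1]

lemma average_of_comm (hl : QD.IsSymmSeparabilityIdempotent A l) {T : U →ₗ[ℂ] V}
    (hT : ∀ a, T ∘ₗ ρ a = σ a ∘ₗ T) : average ρ σ l T = T := by
  have e1 : ∀ t : A ⊗[ℂ] A, average ρ σ t T = σ (LinearMap.mul' ℂ A t) ∘ₗ T := by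
    intro t
    induction t with
    | zero => simp
    | add s t hs ht => simp only [map_add, LinearMap.add_apply, LinearMap.add_comp, hs, ht]
    | tmul u v =>
      rw [average_tmul, hT, LinearMap.mul'_apply, map_mul, Module.End.mul_eq_comp,
        LinearMap.comp_assoc]
  rw [e1, hl.2.1, map_one]
  rfl

variable [Module.Finite ℂ U] [Module.Finite ℂ V]

omit [Module.Finite ℂ V] in
lemma trace_average (hl : QD.IsSymmSeparabilityIdempotent A l) (T : U →ₗ[ℂ] V) (g : V →ₗ[ℂ] U) :
    LinearMap.trace ℂ U (g ∘ₗ average ρ σ l T) = LinearMap.trace ℂ U (average σ ρ l g ∘ₗ T) := by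
  have e1 : ∀ t : A ⊗[ℂ] A, LinearMap.trace ℂ U (g ∘ₗ average ρ σ t T) =
      LinearMap.trace ℂ U (average σ ρ (TensorProduct.comm ℂ A A t) g ∘ₗ T) := by
    intro t
    induction t with
    | zero => simp
    | add s t hs ht => simp only [map_add, LinearMap.add_apply, LinearMap.add_comp,
        LinearMap.comp_add, hs, ht]
    | tmul u v =>
      exact LinearMap.trace_comp_comm' (ρ v : U →ₗ[ℂ] U) (g ∘ₗ σ u ∘ₗ T)
  rw [e1, hl.2.2]

omit [Module.Finite ℂ V] in
lemma eq_zero_of_trace {T : U →ₗ[ℂ] V}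
    (h : ∀ g : V →ₗ[ℂ] U, LinearMap.trace ℂ U (g ∘ₗ T) = 0) : T = 0 := by
  refine LinearMap.ext fun u => ?_
  rw [LinearMap.zero_apply, ← Module.forall_dual_apply_eq_zero_iff ℂ]
  intro f
  have := h (f.smulRight u)
  have e : f.smulRight u ∘ₗ T = (f ∘ₗ T).smulRight u := rfl
  rwa [e, LinearMap.trace_smulRight] at this

end Average

section HomProj

variable {A : Type v} [Ring A] [Algebra ℂ A] {M : Type u₂} [Category.{v₂} M] {F : M ⥤ Vect}

/-- The morphisms of the category are the linear maps that commute with the action of the algebra. -/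
def FullyActs (F : M ⥤ Vect) (act : ∀ N : M, A →ₐ[ℂ] Module.End ℂ (F.obj N)) : Prop :=
  ∀ (U V : M) (T : F.obj U →ₗ[ℂ] F.obj V),
    (∀ a, T ∘ₗ act U a = act V a ∘ₗ T) ↔ ∃ g : U ⟶ V, lin (F.map g) = T

variable {act : ∀ N : M, A →ₐ[ℂ] Module.End ℂ (F.obj N)} {l : A ⊗[ℂ] A}

theorem homProj_eq (hF : FullyActs F act) (hl : QD.IsSymmSeparabilityIdempotent A l) (U V : M) :
    SN.homProj F U V = average (act U) (act V) l := by
  let P : Submodule ℂ (F.obj U →ₗ[ℂ] F.obj V) :=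
    Submodule.span ℂ (Set.range fun g : U ⟶ V => lin (F.map g))
  let Q : Submodule ℂ (F.obj U →ₗ[ℂ] F.obj V) :=
    ⨅ g : V ⟶ U, LinearMap.ker
      (LinearMap.trace ℂ (F.obj U) ∘ₗ LinearMap.llcomp ℂ _ _ _ (lin (F.map g)))
  have hPmem : ∀ T, T ∈ P ↔ ∀ a, T ∘ₗ act U a = act V a ∘ₗ T := by
    intro T
    constructor
    · intro hT
      induction hT using Submodule.span_induction with
      | mem x hx => exact (hF U V x).2 hx
      | zero => simp
      | add x y _ _ hx hy => intro a; rw [LinearMap.add_comp, LinearMap.comp_add, hx, hy]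
      | smul c x _ hx => intro a; rw [LinearMap.smul_comp, LinearMap.comp_smul, hx]
    · intro hT
      exact Submodule.subset_span ((hF U V T).1 hT)
  have hQmem : ∀ T, T ∈ Q ↔ ∀ g : F.obj V →ₗ[ℂ] F.obj U, (∀ a, g ∘ₗ act V a = act U a ∘ₗ g) →
      LinearMap.trace ℂ (F.obj U) (g ∘ₗ T) = 0 := by
    intro T
    rw [Submodule.mem_iInf]
    constructor
    · intro h g hg
      obtain ⟨g', rfl⟩ := (hF V U g).1 hg
      exact h g'
    · intro h g
      exact h _ ((hF V U _).2 ⟨g, rfl⟩)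
  have hE1 : ∀ T, average (act U) (act V) l T ∈ P := fun T =>
    (hPmem _).2 fun a => average_comm hl T a
  have hE2 : ∀ T, T - average (act U) (act V) l T ∈ Q := fun T => (hQmem _).2 fun g hg => by
    rw [LinearMap.comp_sub, map_sub, trace_average hl, average_of_comm hl hg, sub_self]
  have hPQ : IsCompl P Q := by
    constructor
    · rw [Submodule.disjoint_def]
      intro T hP hQ
      refine eq_zero_of_trace fun g => ?_
      rw [← average_of_comm hl ((hPmem T).1 hP), trace_average hl]
      exact (hQmem T).1 hQ _ fun a => average_comm hl g a
    · rw [codisjoint_iff, eq_top_iff]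
      intro T _
      rw [← add_sub_cancel (average (act U) (act V) l T) T]
      exact Submodule.add_mem_sup (hE1 T) (hE2 T)
  have : SN.homProj F U V = P.projection Q hPQ := dif_pos hPQ
  rw [this]
  refine LinearMap.ext fun T => ?_
  conv_lhs => rw [← add_sub_cancel (average (act U) (act V) l T) T, map_add,
    Submodule.projection_apply_of_mem_left hPQ (hE1 T),
    Submodule.projection_apply_of_mem_right hPQ (hE2 T), add_zero]

end HomProj

section Symbol

variable {H : Type u} [Ring H] [Bialgebra ℂ H] {A : Type v} [Ring A] [Algebra ℂ A]
  {C : Type u₁} [Category.{v₁} C] [MonoidalCategory C]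
  {M : Type u₂} [Category.{v₂} M] [MonoidalLeftAction C M]
  {ω : C ⥤ Vect} {F : M ⥤ Vect} {J : ∀ (X : C) (N : M), ω.obj X ⊗ F.obj N ≅ F.obj (X ⊙ₗ N)}
  {actH : ∀ X : C, H →ₐ[ℂ] Module.End ℂ (ω.obj X)}
  {actA : ∀ N : M, A →ₐ[ℂ] Module.End ℂ (F.obj N)} {β : A →ₐ[ℂ] H ⊗[ℂ] A} {l : A ⊗[ℂ] A}

/-- The isomorphisms `ω(X) ⊗ F(N) ≅ F(X ⊗ N)` are linear over the algebra `A`, which acts on the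
left side through `β`. -/
def Intertwines (J : ∀ (X : C) (N : M), ω.obj X ⊗ F.obj N ≅ F.obj (X ⊙ₗ N))
    (actH : ∀ X : C, H →ₐ[ℂ] Module.End ℂ (ω.obj X))
    (actA : ∀ N : M, A →ₐ[ℂ] Module.End ℂ (F.obj N)) (β : A →ₐ[ℂ] H ⊗[ℂ] A) : Prop :=
  ∀ (X : C) (N : M) (a : A) (v : ω.obj X ⊗[ℂ] F.obj N),
    lin (J X N).hom (actTensor (actH X) (actA N) (β a) v) =
      actA (X ⊙ₗ N) a (lin (J X N).hom v)

/-- `a ⊗ b` sent to `∑ ρ(a⁽⁻¹⁾) ⊗ ρ(a⁽⁰⁾) ⊗ ρ(b)ᵗ`. -/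
def tripleAct (actH : ∀ X : C, H →ₐ[ℂ] Module.End ℂ (ω.obj X))
    (actA : ∀ N : M, A →ₐ[ℂ] Module.End ℂ (F.obj N)) (i : C) (x y : M) :
    H ⊗[ℂ] (A ⊗[ℂ] A) →ₗ[ℂ] Module.End ℂ (ω.obj i) ⊗[ℂ] (Module.End ℂ (F.obj x) ⊗[ℂ]
      Module.End ℂ (Module.Dual ℂ (F.obj y))) :=
  TensorProduct.map (actH i).toLinearMap (TensorProduct.map (actA x).toLinearMap
    (Module.Dual.transpose (R := ℂ) ∘ₗ (actA y).toLinearMap))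

theorem symbol_eq (hF : FullyActs F actA) (hl : QD.IsSymmSeparabilityIdempotent A l)
    (hJ : Intertwines J actH actA β) (i : C) (x y : M) :
    SN.symbol ω F J i x y = tripleAct actH actA i x y
      (TensorProduct.assoc ℂ H A A (β.toLinearMap.rTensor A l)) := by
  rw [SN.symbol, homProj_eq hF hl]
  let e1 := homTensorHomEquiv ℂ (F.obj x) (Module.Dual ℂ (F.obj y)) (F.obj x)
    (Module.Dual ℂ (F.obj y))
  let e2 := homTensorHomEquiv ℂ (ω.obj i) (F.obj x ⊗[ℂ] Module.Dual ℂ (F.obj y)) (ω.obj i)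
    (F.obj x ⊗[ℂ] Module.Dual ℂ (F.obj y))
  let e3 := SN.vertexEquiv ω F J i x y
  have hv : ∀ (v : ω.obj i) (w : F.obj x) (f : Module.Dual ℂ (F.obj y)) (z : F.obj y),
      e3 (v ⊗ₜ (w ⊗ₜ f)) z = f z • lin (J i x).hom (v ⊗ₜ w) := by
    intro v w f z
    change lin (J i x).hom (dualTensorHom ℂ _ _ (f ⊗ₜ (v ⊗ₜ w)) z) = _
    rw [dualTensorHom_apply, map_smul]
  have key : ∀ t : A ⊗[ℂ] A, e2 (e1.toLinearMap.lTensor _ (tripleAct actH actA i x y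
      (TensorProduct.assoc ℂ H A A (β.toLinearMap.rTensor A t)))) =
      e3.symm.conj (average (actA y) (actA (i ⊙ₗ x)) t) := by
    intro t
    induction t with
    | zero => simp
    | add s t hs ht => simp only [map_add, hs, ht]
    | tmul a b =>
      refine TensorProduct.ext_threefold' fun v w f => ?_
      apply e3.injective
      rw [LinearEquiv.conj_apply_apply, LinearEquiv.symm_symm, LinearEquiv.apply_symm_apply,
        average_tmul]
      refine LinearMap.ext fun z => ?_
      rw [LinearMap.comp_apply, LinearMap.comp_apply, hv, map_smul, ← hJ,
        LinearMap.rTensor_tmul, AlgHom.toLinearMap_apply]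
      generalize β a = u
      induction u with
      | zero => simp
      | add s t hs ht =>
        simp only [map_add, TensorProduct.add_tmul, LinearMap.add_apply, smul_add, hs, ht]
      | tmul p q =>
        have : e2 (e1.toLinearMap.lTensor _ (tripleAct actH actA i x y
            (TensorProduct.assoc ℂ H A A ((p ⊗ₜ q) ⊗ₜ b)))) (v ⊗ₜ (w ⊗ₜ f)) =
            actH i p v ⊗ₜ (actA x q w ⊗ₜ (f ∘ₗ actA y b)) := by
          simp only [tripleAct, TensorProduct.assoc_tmul, TensorProduct.map_tmul,
            LinearMap.lTensor_tmul, LinearEquiv.coe_coe, e2, homTensorHomEquiv_apply, e1,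
            TensorProduct.homTensorHomMap_apply]
          rfl
        rw [this, hv]
        rfl
  have := (e2.symm_apply_eq.2 (key l).symm)
  change e1.symm.toLinearMap.lTensor _ (e2.symm (e3.symm.conj _)) = _
  rw [this, ← LinearMap.comp_apply, ← LinearMap.lTensor_comp, LinearEquiv.symm_comp,
    LinearMap.lTensor_id, LinearMap.id_apply]

end Symbol

/-! ### The Fourier transform on edges -/

section Flat

variable {V : Vect}

lemma flat_dualTensorHom (w : Module.Dual ℂ V ⊗[ℂ] V) :
    SN.flat V (dualTensorHom ℂ V V w) = TensorProduct.comm ℂ _ _ w := by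
  have : dualTensorHom ℂ V V w = dualTensorHomEquiv ℂ V V w := by simp
  rw [this]
  change TensorProduct.comm ℂ _ _ ((dualTensorHomEquiv ℂ V V).symm _) = _
  rw [LinearEquiv.symm_apply_apply]

lemma exists_dualTensorHom (T : Module.End ℂ V) : ∃ w, dualTensorHom ℂ V V w = T :=
  ⟨(dualTensorHomEquiv ℂ V V).symm T, by
    have : ∀ w, dualTensorHom ℂ V V w = dualTensorHomEquiv ℂ V V w := by simp
    rw [this, LinearEquiv.apply_symm_apply]⟩

lemma flat_bijective : Function.Bijective (SN.flat V) :=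
  (TensorProduct.comm ℂ _ _).bijective.comp (dualTensorHomEquiv ℂ V V).symm.bijective

lemma rTensor_flat (T' T : Module.End ℂ V) :
    LinearMap.rTensor _ T' (SN.flat V T) = SN.flat V (T' * T) := by
  obtain ⟨w, rfl⟩ := exists_dualTensorHom T
  have : ∀ w, T' * dualTensorHom ℂ V V w = dualTensorHom ℂ V V (LinearMap.lTensor _ T' w) := by
    intro w
    induction w with
    | zero => simp
    | add s t hs ht => simp only [map_add, mul_add, hs, ht]
    | tmul f v => exact LinearMap.ext fun x => by simp
  rw [this, flat_dualTensorHom, flat_dualTensorHom]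
  induction w with
  | zero => simp
  | add s t hs ht => simp only [map_add, hs, ht]
  | tmul f v => simp

lemma lTensor_flat (T' T : Module.End ℂ V) :
    LinearMap.lTensor _ (Module.Dual.transpose (R := ℂ) T') (SN.flat V T) =
      SN.flat V (T * T') := by
  obtain ⟨w, rfl⟩ := exists_dualTensorHom T
  have : ∀ w, dualTensorHom ℂ V V w * T' =
      dualTensorHom ℂ V V (LinearMap.rTensor _ (Module.Dual.transpose (R := ℂ) T') w) := by
    intro w
    induction w with
    | zero => simp
    | add s t hs ht => simp only [map_add, add_mul, hs, ht]
    | tmul f v => exact LinearMap.ext fun x => by simp [Module.Dual.transpose_apply]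
  rw [this, flat_dualTensorHom, flat_dualTensorHom]
  induction w with
  | zero => simp
  | add s t hs ht => simp only [map_add, hs, ht]
  | tmul f v => simp

lemma contractRight_flat (T : Module.End ℂ V) :
    contractRight ℂ V (SN.flat V T) = LinearMap.trace ℂ V T := by
  obtain ⟨w, rfl⟩ := exists_dualTensorHom T
  rw [flat_dualTensorHom, LinearMap.trace_eq_contract_apply]
  induction w with
  | zero => simp
  | add s t hs ht => simp only [map_add, hs, ht]
  | tmul f v => simp

lemma undual_transpose (T : Module.End ℂ V) :
    SN.undual V (Module.Dual.transpose (R := ℂ) T) = T := by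
  refine LinearMap.ext fun v => ?_
  apply (Module.evalEquiv ℂ V).injective
  change Module.evalEquiv ℂ V ((Module.evalEquiv ℂ V).symm _) = _
  rw [LinearEquiv.apply_symm_apply]
  rfl

end Flat

lemma contrL_lTensor {V W W' : Type*} [AddCommMonoid V] [Module ℂ V] [AddCommMonoid W] [Module ℂ W]
    [AddCommMonoid W'] [Module ℂ W'] (f : Module.Dual ℂ V) (g : W →ₗ[ℂ] W') (t : V ⊗[ℂ] W) :
    contrL f (g.lTensor V t) = g (contrL f t) := by
  induction t with
  | zero => simp
  | add s t hs ht => simp only [map_add, hs, ht]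
  | tmul x y => simp

section Edge

variable {A : Type v} [Ring A] [Algebra ℂ A] {M : Type u₂} [Category.{v₂} M] {F : M ⥤ Vect}
  {act : ∀ N : M, A →ₐ[ℂ] Module.End ℂ (F.obj N)} {K : Type} {t : K → M}

lemma fourier_apply (a : A) (x : K) : fourier F t act a x =
    ((Real.sqrt (Module.finrank ℂ (F.obj (t x))) : ℝ) : ℂ) • SN.flat _ (act (t x) a) := rfl

theorem fourier_bijective
    (hb : Function.Bijective fun (a : A) (x : K) => act (t x) a) :
    Function.Bijective (fourier F t act) := by
  have h : ∀ x, Function.Bijective fun T : Module.End ℂ (F.obj (t x)) =>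
      ((Real.sqrt (Module.finrank ℂ (F.obj (t x))) : ℝ) : ℂ) • SN.flat _ T := by
    intro x
    by_cases h0 : Module.finrank ℂ (F.obj (t x)) = 0
    · have hs : Subsingleton (F.obj (t x)) := Module.finrank_zero_iff.1 h0
      have : Subsingleton (F.obj (t x) ⊗[ℂ] Module.Dual ℂ (F.obj (t x))) :=
        (Module.finrank_zero_iff (R := ℂ)).1 (by rw [Module.finrank_tensorProduct, h0, zero_mul])
      exact ⟨fun _ _ _ => Subsingleton.elim _ _, fun w => ⟨0, Subsingleton.elim _ _⟩⟩
    · have hne : ((Real.sqrt (Module.finrank ℂ (F.obj (t x))) : ℝ) : ℂ) ≠ 0 := by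
        rw [Complex.ofReal_ne_zero, Real.sqrt_ne_zero']
        exact_mod_cast Nat.pos_of_ne_zero h0
      exact (LinearEquiv.smulOfNeZero ℂ _ _ hne).bijective.comp flat_bijective
  exact (Function.Bijective.piMap h).comp hb

variable [Fintype K] [DecidableEq K]

/-- Left multiplication on the edge space. -/
def opL (t : K → M) (act : ∀ N : M, A →ₐ[ℂ] Module.End ℂ (F.obj N)) :
    A →ₗ[ℂ] Module.End ℂ (SN.EdgeSpace F t) :=
  ∑ x, SN.target x ∘ₗ (act (t x)).toLinearMap

/-- Right multiplication on the edge space. -/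
def opR (t : K → M) (act : ∀ N : M, A →ₐ[ℂ] Module.End ℂ (F.obj N)) :
    A →ₗ[ℂ] Module.End ℂ (SN.EdgeSpace F t) :=
  ∑ x, SN.source x ∘ₗ Module.Dual.transpose (R := ℂ) ∘ₗ (act (t x)).toLinearMap

omit [Fintype K] in
lemma block_apply (x y : K) (g) (v : SN.EdgeSpace F t) :
    SN.block x y g v = Pi.single y (g (v x)) := rfl

lemma sum_block_diag (g : ∀ x : K, Module.End ℂ (F.obj (t x) ⊗[ℂ] Module.Dual ℂ (F.obj (t x)))) (v : SN.EdgeSpace F t) (y : K) :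
    (∑ x, SN.block (t := t) x x (g x)) v y = g y (v y) := by
  rw [LinearMap.sum_apply, Finset.sum_apply, Finset.sum_eq_single y]
  · rw [block_apply, Pi.single_eq_same]
  · intro x _ hx
    rw [block_apply, Pi.single_eq_of_ne hx.symm]
  · simp

lemma trace_block (x : K)
    (g : Module.End ℂ (F.obj (t x) ⊗[ℂ] Module.Dual ℂ (F.obj (t x)))) :
    LinearMap.trace ℂ _ (SN.block (t := t) x x g) = LinearMap.trace ℂ _ g := by
  refine (LinearMap.trace_comp_comm' (g ∘ₗ LinearMap.proj x) (LinearMap.single ℂ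
    (fun x => F.obj (t x) ⊗[ℂ] Module.Dual ℂ (F.obj (t x))) x)).trans ?_
  rw [LinearMap.comp_assoc, LinearMap.proj_comp_single_same, LinearMap.comp_id]

lemma opL_apply (a : A) (v : SN.EdgeSpace F t) (y : K) :
    opL t act a v y = LinearMap.rTensor _ (act (t y) a) (v y) := by
  rw [opL, LinearMap.sum_apply]
  exact sum_block_diag (fun x => LinearMap.rTensor _ (act (t x) a)) v y

lemma opR_apply (a : A) (v : SN.EdgeSpace F t) (y : K) :
    opR t act a v y = LinearMap.lTensor _ (Module.Dual.transpose (R := ℂ) (act (t y) a)) (v y) := by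
  rw [opR, LinearMap.sum_apply]
  exact sum_block_diag
    (fun x => LinearMap.lTensor _ (Module.Dual.transpose (R := ℂ) (act (t x) a))) v y

lemma fourier_comp_Lp (a : A) :
    fourier F t act ∘ₗ QD.Lp a = opL t act a ∘ₗ fourier F t act := by
  refine LinearMap.ext fun c => funext fun x => ?_
  rw [LinearMap.comp_apply, LinearMap.comp_apply, opL_apply, fourier_apply, fourier_apply, map_smul,
    rTensor_flat, ← map_mul]
  rfl

lemma fourier_comp_Rm (a : A) :
    fourier F t act ∘ₗ QD.Rm a = opR t act a ∘ₗ fourier F t act := by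
  refine LinearMap.ext fun c => funext fun x => ?_
  rw [LinearMap.comp_apply, LinearMap.comp_apply, opR_apply, fourier_apply, fourier_apply, map_smul,
    lTensor_flat, ← map_mul]
  rfl

/-- The character of the regular representation. -/
theorem regChar_eq_sum (hb : Function.Bijective fun (a : A) (x : K) => act (t x) a) (a : A) :
    regChar A a = ∑ x, (Module.finrank ℂ (F.obj (t x)) : ℂ) *
      LinearMap.trace ℂ _ (act (t x) a) := by
  let e : A ≃ₗ[ℂ] SN.EdgeSpace F t := LinearEquiv.ofBijective _ (fourier_bijective hb)
  have h1 : e.conj (LinearMap.mulLeft ℂ a) = opL t act a := by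
    refine LinearMap.ext fun v => ?_
    obtain ⟨c, rfl⟩ := e.surjective v
    rw [LinearEquiv.conj_apply_apply, LinearEquiv.symm_apply_apply]
    exact LinearMap.congr_fun (fourier_comp_Lp (F := F) (t := t) (act := act) a) c
  rw [regChar_apply, ← LinearMap.trace_conj' _ e, h1, opL, LinearMap.sum_apply, map_sum]
  refine Finset.sum_congr rfl fun x _ => ?_
  change LinearMap.trace ℂ _ (SN.block x x (LinearMap.rTensor _ (act (t x) a))) = _
  rw [trace_block, LinearMap.rTensor, LinearMap.trace_tensorProduct', LinearMap.trace_id,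
    Subspace.dual_finrank_eq, mul_comm]

lemma sqrtDim_mul (x y : M) : SN.sqrtDim F x y *
    ((Real.sqrt (Module.finrank ℂ (F.obj x)) : ℝ) : ℂ) =
      (Module.finrank ℂ (F.obj x) : ℂ) * ((Real.sqrt (Module.finrank ℂ (F.obj y)) : ℝ) : ℂ) := by
  have h : (0 : ℝ) ≤ Module.finrank ℂ (F.obj x) := Nat.cast_nonneg _
  rw [SN.sqrtDim, Real.sqrt_mul h, ← Complex.ofReal_mul, mul_right_comm, Real.mul_self_sqrt h]
  push_cast
  rfl

end Edge

lemma contrL_leftComm_map {P Q R P' Q' R' : Type*} [AddCommGroup P] [Module ℂ P]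
    [AddCommGroup Q] [Module ℂ Q] [AddCommGroup R] [Module ℂ R] [AddCommGroup P'] [Module ℂ P']
    [AddCommGroup Q'] [Module ℂ Q'] [AddCommGroup R'] [Module ℂ R'] (g : Module.Dual ℂ Q')
    (f₁ : P →ₗ[ℂ] P') (f₂ : Q →ₗ[ℂ] Q') (f₃ : R →ₗ[ℂ] R') (w : P ⊗[ℂ] (Q ⊗[ℂ] R)) :
    contrL g (TensorProduct.leftComm ℂ P' Q' R'
      (TensorProduct.map f₁ (TensorProduct.map f₂ f₃) w)) =
      TensorProduct.map f₁ f₃ (contrL (g ∘ₗ f₂) (TensorProduct.leftComm ℂ P Q R w)) := by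
  induction w with
  | zero => simp
  | add s t hs ht => simp only [map_add, hs, ht]
  | tmul p q =>
    induction q with
    | zero => simp
    | add s t hs ht => simp only [map_add, TensorProduct.tmul_add, hs, ht]
    | tmul q r => simp

section EdgeStep

variable {H : Type u} [Ring H] [HopfAlgebra ℂ H] [Module.Finite ℂ H] {A : Type v} [Ring A]
  [Algebra ℂ A] [Module.Finite ℂ A] {β : A →ₐ[ℂ] H ⊗[ℂ] A} {l : A ⊗[ℂ] A}

lemma IsSep.contrL_mulRight (hl : QD.IsSymmSeparabilityIdempotent A l) (x : A) :
    contrL (regChar A ∘ₗ LinearMap.mulRight ℂ x) l = x := by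
  have : regChar A ∘ₗ LinearMap.mulRight ℂ x = regChar A ∘ₗ LinearMap.mulLeft ℂ x :=
    LinearMap.ext fun y => regChar_mul_comm y x
  rw [this, IsSep.contrL_regChar hl]

lemma IsSep.contrR_mulLeft (hl : QD.IsSymmSeparabilityIdempotent A l) (x : A) :
    contrR (regChar A ∘ₗ LinearMap.mulLeft ℂ x) l = x := by
  have h3 : ∀ t : A ⊗[ℂ] A, contrR (regChar A ∘ₗ LinearMap.mulLeft ℂ x) t =
      contrL (regChar A ∘ₗ LinearMap.mulLeft ℂ x) (TensorProduct.comm ℂ A A t) := by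
    intro t
    induction t with
    | zero => simp
    | add s t hs ht => simp only [map_add, hs, ht]
    | tmul p q => simp
  rw [h3, hl.2.2, IsSep.contrL_regChar hl]

/-- `∑ a⁽⁻¹⁾ ⊗ tr(a⁽⁰⁾ x) b = S(x⁽⁻¹⁾) ⊗ x⁽⁰⁾` -/
lemma IsSep.lTensor_contrL (hβ : IsCoact β.toLinearMap) (hS : ∀ x : H, S (S x) = x)
    (hl : QD.IsSymmSeparabilityIdempotent A l) (x : A) :
    (contrL (regChar A ∘ₗ LinearMap.mulRight ℂ x)).lTensor H
      (TensorProduct.assoc ℂ H A A (β.toLinearMap.rTensor A l)) = (S (H := H)).rTensor A (β x) := by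
  rw [IsSep.coinvariant β hβ hS hl]
  have e : ∀ t : A ⊗[ℂ] A, (contrL (regChar A ∘ₗ LinearMap.mulRight ℂ x)).lTensor H
      (TensorProduct.leftComm ℂ A H A (((S (H := H)).rTensor A).lTensor A
        (β.toLinearMap.lTensor A t))) =
      (S (H := H)).rTensor A (β (contrL (regChar A ∘ₗ LinearMap.mulRight ℂ x) t)) := by
    intro t
    induction t with
    | zero => simp
    | add s t hs ht => simp only [map_add, hs, ht]
    | tmul u v =>
      simp only [LinearMap.lTensor_tmul, contrL_tmul, LinearMap.comp_apply, map_smul,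
        AlgHom.toLinearMap_apply]
      generalize β v = w
      induction w with
      | zero => simp
      | add s t hs ht => simp only [map_add, TensorProduct.tmul_add, smul_add, hs, ht]
      | tmul p q => simp
  rw [e, IsSep.contrL_mulRight hl]

variable {C : Type u₁} [Category.{v₁} C] [MonoidalCategory C]
  {M : Type u₂} [Category.{v₂} M] [MonoidalLeftAction C M]
  {ω : C ⥤ Vect} {F : M ⥤ Vect} {J : ∀ (X : C) (N : M), ω.obj X ⊗ F.obj N ≅ F.obj (X ⊙ₗ N)}
  {actH : ∀ X : C, H →ₐ[ℂ] Module.End ℂ (ω.obj X)}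
  {actA : ∀ N : M, A →ₐ[ℂ] Module.End ℂ (F.obj N)}
  {I K : Type} [Fintype I] [DecidableEq I] [Fintype K] [DecidableEq K] {s : I → C} {t : K → M}

omit [Module.Finite ℂ H] [Module.Finite ℂ A] [MonoidalCategory C] [MonoidalLeftAction C M] in
lemma contrL_tripleAct (i : C) (x y : M) (g : Module.Dual ℂ (Module.End ℂ (ω.obj i)))
    (w : H ⊗[ℂ] (A ⊗[ℂ] A)) : contrL g (tripleAct actH actA i x y w) =
      TensorProduct.map (actA x).toLinearMap
        (Module.Dual.transpose (R := ℂ) ∘ₗ (actA y).toLinearMap)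
        (contrL (g ∘ₗ (actH i).toLinearMap) w) := by
  induction w with
  | zero => simp
  | add s t hs ht => simp only [map_add, hs, ht]
  | tmul p q => simp [tripleAct]

theorem edgeLeft_fourier (hF : FullyActs F actA) (hl : QD.IsSymmSeparabilityIdempotent A l)
    (hJ : Intertwines J actH actA β) (hβ : IsCoact β.toLinearMap) (hS : ∀ x : H, S (S x) = x)
    (hb : Function.Bijective fun (a : A) (x : K) => actA (t x) a)
    (ν : C) (g : Module.Dual ℂ (Module.End ℂ (ω.obj ν))) :
    fourier F t actA ∘ₗ QD.Tm β.toLinearMap (g ∘ₗ (actH ν).toLinearMap) =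
      contrL g (SN.edgeLeft ω F J t ν) ∘ₗ fourier F t actA := by
  refine LinearMap.ext fun c => ?_
  have e1 : QD.Tm β.toLinearMap (g ∘ₗ (actH ν).toLinearMap) c =
      contrL (regChar A ∘ₗ LinearMap.mulRight ℂ c) (contrL (g ∘ₗ (actH ν).toLinearMap)
        (TensorProduct.assoc ℂ H A A (β.toLinearMap.rTensor A l))) := by
    rw [← contrL_lTensor, IsSep.lTensor_contrL hβ hS hl, ← contrL_comp]
    rfl
  rw [LinearMap.comp_apply, e1, LinearMap.comp_apply, SN.edgeLeft]
  simp only [map_sum, LinearMap.sum_apply, map_smul, LinearMap.smul_apply, contrL_lTensor]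
  simp only [symbol_eq hF hl hJ, contrL_tripleAct]
  generalize contrL (g ∘ₗ (actH ν).toLinearMap)
        (TensorProduct.assoc ℂ H A A (β.toLinearMap.rTensor A l)) = w
  induction w with
  | zero => simp
  | add s t hs ht =>
    simp only [map_add, LinearMap.add_apply, smul_add, Finset.sum_add_distrib, hs, ht]
  | tmul a b =>
    rw [contrL_tmul, map_smul, LinearMap.comp_apply, LinearMap.mulRight_apply, regChar_eq_sum hb,
      Finset.sum_smul]
    refine Finset.sum_congr rfl fun x _ => ?_
    funext y
    rw [Finset.sum_apply, Finset.sum_eq_single y]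
    · simp only [LinearMap.comp_apply, TensorProduct.map_tmul, AlgHom.toLinearMap_apply,
        LinearMap.coe_mk, AddHom.coe_mk]
      rw [Pi.smul_apply, Pi.smul_apply, block_apply, Pi.single_eq_same, fourier_apply, fourier_apply,
        dualTensorHom_apply, LinearMap.comp_apply, map_smul, rTensor_flat, map_smul,
        contractRight_flat, undual_transpose, ← map_mul, smul_smul, smul_smul, smul_eq_mul, ← mul_assoc,
        sqrtDim_mul]
      congr 1
      ring
    · intro z _ hz
      simp only [LinearMap.comp_apply]
      rw [Pi.smul_apply, block_apply, Pi.single_eq_of_ne hz.symm, smul_zero]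
    · simp

variable [ω.Monoidal]

theorem edgeRight_fourier {k : H ⊗[ℂ] H} (hω : FullyActs ω actH)
    (hk : QD.IsSymmSeparabilityIdempotent H k)
    (hμ : Intertwines (M := C) (SN.bulkJ ω) actH actH (Bialgebra.comulAlgHom ℂ H))
    (hb : Function.Bijective fun (a : H) (x : I) => actH (s x) a)
    (ν : C) (g : Module.Dual ℂ (Module.End ℂ (ω.obj ν))) :
    fourier ω s actH ∘ₗ QD.Tp (g ∘ₗ (actH ν).toLinearMap) =
      contrL g (SN.edgeRight ω s ν) ∘ₗ fourier ω s actH := by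
  refine LinearMap.ext fun c => ?_
  have e1 : QD.Tp (g ∘ₗ (actH ν).toLinearMap) c =
      contrR (regChar H ∘ₗ LinearMap.mulLeft ℂ c) (contrL (g ∘ₗ (actH ν).toLinearMap)
        (TensorProduct.leftComm ℂ H H H (TensorProduct.assoc ℂ H H H
          ((Bialgebra.comulAlgHom ℂ H).toLinearMap.rTensor H k)))) := by
    rw [Tp_apply]
    conv_lhs => rw [← IsSep.contrR_mulLeft hk c]
    have : ∀ (f f' : Module.Dual ℂ H) (w : H ⊗[ℂ] H),
        contrR f (Coalgebra.comul (R := ℂ) (contrR f' w)) =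
        contrR f' (contrL f (TensorProduct.leftComm ℂ H H H (TensorProduct.assoc ℂ H H H
          ((Bialgebra.comulAlgHom ℂ H).toLinearMap.rTensor H w)))) := by
      intro f f' w
      induction w with
      | zero => simp
      | add s t hs ht => simp only [map_add, hs, ht]
      | tmul u v =>
        rw [contrR_tmul, map_smul, map_smul, LinearMap.rTensor_tmul, AlgHom.toLinearMap_apply,
          Bialgebra.comulAlgHom_apply]
        generalize Coalgebra.comul (R := ℂ) u = z
        induction z with
        | zero => simp
        | add s t hs ht => simp only [map_add, TensorProduct.add_tmul, smul_add, hs, ht]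
        | tmul p q => simp [smul_smul, mul_comm]
    rw [this]
  have e2 : ∀ (i j : I) (w : H ⊗[ℂ] (H ⊗[ℂ] H)), contrL g (TensorProduct.leftComm ℂ _ _ _
      (tripleAct (M := C) actH actH (s i) ν (s j) w)) = TensorProduct.map (actH (s i)).toLinearMap
        (Module.Dual.transpose (R := ℂ) ∘ₗ (actH (s j)).toLinearMap)
        (contrL (g ∘ₗ (actH ν).toLinearMap) (TensorProduct.leftComm ℂ H H H w)) :=
    fun i j w => contrL_leftComm_map _ _ _ _ _
  rw [LinearMap.comp_apply, e1, LinearMap.comp_apply, SN.edgeRight]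
  simp only [map_sum, LinearMap.sum_apply, map_smul, LinearMap.smul_apply, contrL_lTensor]
  simp only [symbol_eq hω hk hμ, e2]
  generalize contrL (g ∘ₗ (actH ν).toLinearMap) (TensorProduct.leftComm ℂ H H H
    (TensorProduct.assoc ℂ H H H ((Bialgebra.comulAlgHom ℂ H).toLinearMap.rTensor H k))) = w
  induction w with
  | zero => simp
  | add s t hs ht =>
    simp only [map_add, LinearMap.add_apply, smul_add, Finset.sum_add_distrib, hs, ht]
  | tmul a b =>
    rw [contrR_tmul, map_smul, LinearMap.comp_apply, LinearMap.mulLeft_apply, regChar_eq_sum hb,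
      Finset.sum_smul]
    refine Finset.sum_congr rfl fun x _ => ?_
    funext y
    rw [Finset.sum_apply, Finset.sum_eq_single y]
    · simp only [LinearMap.comp_apply, TensorProduct.map_tmul, AlgHom.toLinearMap_apply,
        LinearMap.coe_mk, AddHom.coe_mk, LinearEquiv.coe_coe, TensorProduct.comm_tmul]
      rw [Pi.smul_apply, Pi.smul_apply, block_apply, Pi.single_eq_same, fourier_apply, fourier_apply,
        dualTensorHom_apply, LinearMap.comp_apply, map_smul, lTensor_flat, map_smul,
        contractRight_flat, ← map_mul, smul_smul, smul_smul, smul_eq_mul, ← mul_assoc,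
        sqrtDim_mul]
      congr 1
      ring
    · intro z _ hz
      simp only [LinearMap.comp_apply]
      rw [Pi.smul_apply, block_apply, Pi.single_eq_of_ne hz.symm, smul_zero]
    · simp

end EdgeStep

/-! ### Operators on the total space -/

/-- The map `f` carries the operator `X` to the operator `X'`. -/
def Carries {V W : Type*} [AddCommMonoid V] [Module ℂ V] [AddCommMonoid W] [Module ℂ W]
    (f : V →ₗ[ℂ] W) (X : Module.End ℂ V) (X' : Module.End ℂ W) : Prop :=
  f ∘ₗ X = X' ∘ₗ f

section Carries

variable {V W : Type*} [AddCommMonoid V] [Module ℂ V] [AddCommMonoid W] [Module ℂ W]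
  {f : V →ₗ[ℂ] W} {X Y : Module.End ℂ V} {X' Y' : Module.End ℂ W}

lemma Carries.mul (h : Carries f X X') (h' : Carries f Y Y') : Carries f (X * Y) (X' * Y') := by
  change f ∘ₗ (X ∘ₗ Y) = (X' ∘ₗ Y') ∘ₗ f
  rw [← LinearMap.comp_assoc, show f ∘ₗ X = X' ∘ₗ f from h, LinearMap.comp_assoc,
    show f ∘ₗ Y = Y' ∘ₗ f from h', LinearMap.comp_assoc]

lemma Carries.add (h : Carries f X X') (h' : Carries f Y Y') : Carries f (X + Y) (X' + Y') := by
  rw [Carries] at *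
  rw [LinearMap.comp_add, LinearMap.add_comp, h, h']

lemma Carries.one : Carries f 1 1 := rfl

lemma Carries.zero : Carries f 0 0 := by
  rw [Carries, LinearMap.comp_zero, LinearMap.zero_comp]

lemma Carries.smul (c : ℂ) (h : Carries f X X') : Carries f (c • X) (c • X') := by
  rw [Carries] at *
  rw [LinearMap.comp_smul, LinearMap.smul_comp, h]

lemma Carries.sum {ι : Type*} (s : Finset ι) {X : ι → Module.End ℂ V} {X' : ι → Module.End ℂ W}
    (h : ∀ i, Carries f (X i) (X' i)) : Carries f (∑ i ∈ s, X i) (∑ i ∈ s, X' i) := by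
  classical
  induction s using Finset.induction with
  | empty => exact Carries.zero
  | insert a s ha hs =>
    rw [Finset.sum_insert ha, Finset.sum_insert ha]
    exact (h a).add hs

lemma Carries.mulMap {P Q : Type*} [AddCommGroup P] [Module ℂ P] [AddCommGroup Q] [Module ℂ Q]
    {p : P →ₗ[ℂ] Module.End ℂ V} {q : Q →ₗ[ℂ] Module.End ℂ V} {p' : P →ₗ[ℂ] Module.End ℂ W}
    {q' : Q →ₗ[ℂ] Module.End ℂ W} (hp : ∀ x, Carries f (p x) (p' x))
    (hq : ∀ x, Carries f (q x) (q' x)) (w : P ⊗[ℂ] Q) :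
    Carries f (QDSN.mulMap p q w) (QDSN.mulMap p' q' w) := by
  induction w with
  | zero => rw [map_zero, map_zero]; exact Carries.zero
  | add s t hs ht => rw [map_add, map_add]; exact hs.add ht
  | tmul x y => exact (hp x).mul (hq y)

end Carries

lemma Carries.one_sub {V W : Type*} [AddCommGroup V] [Module ℂ V] [AddCommGroup W] [Module ℂ W]
    {f : V →ₗ[ℂ] W} {X : Module.End ℂ V} {X' : Module.End ℂ W} (h : Carries f X X') :
    Carries f (1 - X) (1 - X') := by
  rw [Carries] at *
  rw [LinearMap.comp_sub, LinearMap.sub_comp, h]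
  rfl

lemma mulMap_tmul {P : Type*} {Q : Type*} {R : Type*} [AddCommGroup P] [Module ℂ P]
    [AddCommGroup Q] [Module ℂ Q] [Semiring R] [Algebra ℂ R] (f : P →ₗ[ℂ] R) (g : Q →ₗ[ℂ] R)
    (x : P) (y : Q) : mulMap f g (x ⊗ₜ y) = f x * g y := rfl

section Total

variable (L : Lattice) {P P' : Type*} {Q Q' : Type*} [AddCommGroup P] [Module ℂ P]
  [AddCommGroup Q] [Module ℂ Q] [AddCommGroup P'] [Module ℂ P'] [AddCommGroup Q'] [Module ℂ Q']

/-- The map of total spaces induced by maps of edge spaces. -/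
def totalMap (f : P →ₗ[ℂ] P') (g : Q →ₗ[ℂ] Q') : Total L P Q →ₗ[ℂ] Total L P' Q' :=
  TensorProduct.map (PiTensorProduct.map fun _ => f) (PiTensorProduct.map fun _ => g)

variable {L}

lemma bulkOp_eq (e : L.E) (T : Module.End ℂ P) : bulkOp (Q := Q) L e T = TensorProduct.map
    (PiTensorProduct.map (Function.update (fun _ => LinearMap.id) e T)) LinearMap.id := rfl

lemma bdryOp_eq (b : L.B) (T : Module.End ℂ Q) : bdryOp (P := P) L b T = TensorProduct.map
    LinearMap.id (PiTensorProduct.map (Function.update (fun _ => LinearMap.id) b T)) := rfl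

lemma comp_map_update {ι : Type} [DecidableEq ι] (f : P →ₗ[ℂ] P') (e : ι) {T : Module.End ℂ P}
    {T' : Module.End ℂ P'} (h : f ∘ₗ T = T' ∘ₗ f) :
    (PiTensorProduct.map fun _ : ι => f) ∘ₗ
        PiTensorProduct.map (Function.update (fun _ => LinearMap.id) e T) =
      PiTensorProduct.map (Function.update (fun _ => LinearMap.id) e T') ∘ₗ
        PiTensorProduct.map fun _ : ι => f := by
  rw [← PiTensorProduct.map_comp, ← PiTensorProduct.map_comp]
  congr 1
  funext i
  by_cases hi : i = e
  · subst hi; simpa using h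
  · simp [Function.update_of_ne hi]

lemma map_update_comm {ι : Type} [DecidableEq ι] {e e' : ι} (h : e ≠ e') (T T' : Module.End ℂ P) :
    PiTensorProduct.map (s := fun _ => P) (Function.update (fun _ => LinearMap.id) e T) ∘ₗ
        PiTensorProduct.map (s := fun _ => P) (Function.update (fun _ => LinearMap.id) e' T') =
      PiTensorProduct.map (Function.update (fun _ => LinearMap.id) e' T') ∘ₗ
        PiTensorProduct.map (Function.update (fun _ => LinearMap.id) e T) := by
  rw [← PiTensorProduct.map_comp, ← PiTensorProduct.map_comp]
  congr 1
  funext i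
  by_cases hi : i = e
  · subst hi; simp [Function.update_of_ne h]
  · simp [Function.update_of_ne hi]

lemma carries_bulkOp (f : P →ₗ[ℂ] P') (g : Q →ₗ[ℂ] Q') (e : L.E) {T : Module.End ℂ P}
    {T' : Module.End ℂ P'} (h : f ∘ₗ T = T' ∘ₗ f) :
    Carries (totalMap L f g) (bulkOp L e T) (bulkOp L e T') := by
  rw [Carries, bulkOp_eq, bulkOp_eq, totalMap, ← TensorProduct.map_comp, ← TensorProduct.map_comp,
    comp_map_update f e h]
  rfl

lemma carries_bdryOp (f : P →ₗ[ℂ] P') (g : Q →ₗ[ℂ] Q') (b : L.B) {T : Module.End ℂ Q}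
    {T' : Module.End ℂ Q'} (h : g ∘ₗ T = T' ∘ₗ g) :
    Carries (totalMap L f g) (bdryOp L b T) (bdryOp L b T') := by
  rw [Carries, bdryOp_eq, bdryOp_eq, totalMap, ← TensorProduct.map_comp, ← TensorProduct.map_comp,
    comp_map_update g b h]
  rfl

lemma bulkOp_comm {e e' : L.E} (h : e ≠ e') (T T' : Module.End ℂ P) :
    Commute (bulkOp (Q := Q) L e T) (bulkOp L e' T') := by
  change bulkOp L e T ∘ₗ bulkOp L e' T' = bulkOp L e' T' ∘ₗ bulkOp L e T
  rw [bulkOp_eq, bulkOp_eq, ← TensorProduct.map_comp, ← TensorProduct.map_comp, map_update_comm h]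

lemma bdryOp_comm {b b' : L.B} (h : b ≠ b') (T T' : Module.End ℂ Q) :
    Commute (bdryOp (P := P) L b T) (bdryOp L b' T') := by
  change bdryOp L b T ∘ₗ bdryOp L b' T' = bdryOp L b' T' ∘ₗ bdryOp L b T
  rw [bdryOp_eq, bdryOp_eq, ← TensorProduct.map_comp, ← TensorProduct.map_comp, map_update_comm h]

lemma bulkOp_bdryOp_comm (e : L.E) (b : L.B) (T : Module.End ℂ P) (T' : Module.End ℂ Q) :
    Commute (bulkOp L e T) (bdryOp L b T') := by
  change bulkOp L e T ∘ₗ bdryOp L b T' = bdryOp L b T' ∘ₗ bulkOp L e T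
  rw [bulkOp_eq, bdryOp_eq, ← TensorProduct.map_comp, ← TensorProduct.map_comp]
  rfl

lemma totalMap_bijective {f : P →ₗ[ℂ] P'} {g : Q →ₗ[ℂ] Q'} (hf : Function.Bijective f)
    (hg : Function.Bijective g) : Function.Bijective (totalMap L f g) :=
  (TensorProduct.congr (PiTensorProduct.congr fun _ : L.E => LinearEquiv.ofBijective f hf)
    (PiTensorProduct.congr fun _ : L.B => LinearEquiv.ofBijective g hg)).bijective

end Total

/-! ### Vertex operators -/

section VertexAlgebra

variable {H : Type u} [Ring H] [HopfAlgebra ℂ H] [Module.Finite ℂ H] {A : Type v} [Ring A]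
  [Algebra ℂ A] [Module.Finite ℂ A] {β : A →ₐ[ℂ] H ⊗[ℂ] A} {l : A ⊗[ℂ] A}
  {R : Type*} [Semiring R] [Algebra ℂ R] (Z : H →ₗ[ℂ] R) (X Y : A →ₗ[ℂ] R)

omit [Module.Finite ℂ H] [Module.Finite ℂ A] in
lemma mulMap_coact (l : A ⊗[ℂ] A) : mulMap (mulMap Z X ∘ₗ β.toLinearMap) Y l =
    mulMap Z (mulMap X Y) (TensorProduct.assoc ℂ H A A (β.toLinearMap.rTensor A l)) := by
  induction l with
  | zero => simp
  | add s t hs ht => simp only [map_add, hs, ht]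
  | tmul u v =>
    rw [mulMap_tmul, LinearMap.comp_apply, LinearMap.rTensor_tmul]
    generalize β.toLinearMap u = w
    induction w with
    | zero => simp
    | add s t hs ht => simp only [map_add, TensorProduct.add_tmul, add_mul, hs, ht]
    | tmul p q => simp [mulMap_tmul, mul_assoc]

omit [Module.Finite ℂ H] [Module.Finite ℂ A] in
lemma mulMap_coact_swap (hl : QD.IsSymmSeparabilityIdempotent A l)
    (hXY : ∀ a b, Commute (X a) (Y b)) (hZX : ∀ a h, Commute (Z h) (X a)) :
    mulMap X (mulMap Z Y ∘ₗ β.toLinearMap) l =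
      mulMap Z (mulMap Y X) (TensorProduct.assoc ℂ H A A (β.toLinearMap.rTensor A l)) := by
  conv_rhs => rw [← hl.2.2]
  generalize l = t
  induction t with
  | zero => simp
  | add s t hs ht => simp only [map_add, hs, ht]
  | tmul u v =>
    rw [mulMap_tmul, LinearMap.comp_apply, TensorProduct.comm_tmul, LinearMap.rTensor_tmul]
    generalize β.toLinearMap v = w
    induction w with
    | zero => simp
    | add s t hs ht => simp only [map_add, TensorProduct.add_tmul, mul_add, hs, ht]
    | tmul p q =>
      simp only [mulMap_tmul, TensorProduct.assoc_tmul]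
      rw [← mul_assoc, ← (hZX u p).eq, mul_assoc, (hXY u q).eq]

lemma mulMap_coact_antipode (hβ : IsCoact β.toLinearMap) (hS : ∀ x : H, S (S x) = x)
    (hl : QD.IsSymmSeparabilityIdempotent A l) (hXY : ∀ a b, Commute (X a) (Y b)) :
    mulMap (mulMap (Z ∘ₗ S) X ∘ₗ β.toLinearMap) Y l =
      mulMap Z (mulMap Y X) (TensorProduct.assoc ℂ H A A (β.toLinearMap.rTensor A l)) := by
  conv_rhs => rw [← hl.2.2]
  rw [mulMap_coact, IsSep.coinvariant β hβ hS hl]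
  generalize l = t
  induction t with
  | zero => simp
  | add s t hs ht => simp only [map_add, hs, ht]
  | tmul u v =>
    rw [TensorProduct.comm_tmul, LinearMap.rTensor_tmul, LinearMap.lTensor_tmul,
      LinearMap.lTensor_tmul]
    generalize β.toLinearMap v = w
    induction w with
    | zero => simp
    | add s t hs ht =>
      simp only [map_add, TensorProduct.add_tmul, TensorProduct.tmul_add, hs, ht]
    | tmul p q => simp [mulMap_tmul, hS, (hXY u q).eq]

lemma mulMap_coact_antipode_swap (hβ : IsCoact β.toLinearMap) (hS : ∀ x : H, S (S x) = x)
    (hl : QD.IsSymmSeparabilityIdempotent A l) (hZX : ∀ a h, Commute (Z h) (X a)) :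
    mulMap X (mulMap (Z ∘ₗ S) Y ∘ₗ β.toLinearMap) l =
      mulMap Z (mulMap X Y) (TensorProduct.assoc ℂ H A A (β.toLinearMap.rTensor A l)) := by
  rw [IsSep.coinvariant β hβ hS hl]
  generalize l = t
  induction t with
  | zero => simp
  | add s t hs ht => simp only [map_add, hs, ht]
  | tmul u v =>
    rw [mulMap_tmul, LinearMap.comp_apply, LinearMap.lTensor_tmul, LinearMap.lTensor_tmul]
    generalize β.toLinearMap v = w
    induction w with
    | zero => simp
    | add s t hs ht =>
      simp only [map_add, TensorProduct.tmul_add, mul_add, hs, ht]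
    | tmul p q =>
      simp only [mulMap_tmul, TensorProduct.leftComm_tmul, LinearMap.rTensor_tmul,
        LinearMap.comp_apply]
      rw [← mul_assoc, ← (hZX u (S p)).eq, mul_assoc]

variable {h : H} (X Y : H →ₗ[ℂ] R)

omit [Module.Finite ℂ H] in
lemma IsHaar.comul_cyclic (hh : QD.IsHaar H h) (hS : ∀ x : H, S (S x) = x) :
    TensorProduct.assoc ℂ H H H (TensorProduct.comm ℂ H (H ⊗[ℂ] H)
      (Coalgebra.comul.lTensor H (Coalgebra.comul (R := ℂ) h))) =
      Coalgebra.comul.lTensor H (Coalgebra.comul (R := ℂ) h) := by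
  have e : ∀ t : H ⊗[ℂ] H, TensorProduct.comm ℂ H (H ⊗[ℂ] H) (Coalgebra.comul.lTensor H t) =
      Coalgebra.comul.rTensor H (TensorProduct.comm ℂ H H t) := by
    intro t
    induction t with
    | zero => simp
    | add s t hs ht => simp only [map_add, hs, ht]
    | tmul u v => simp
  rw [e, IsHaar.comm_comul hh hS, Coalgebra.coassoc_apply]

omit [Module.Finite ℂ H] in
lemma mulMap_haar (hh : QD.IsHaar H h) (hS : ∀ x : H, S (S x) = x)
    (hXZ : ∀ a b, Commute (X a) (Z b)) (hYZ : ∀ a b, Commute (Y a) (Z b)) :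
    mulMap X (mulMap (Y ∘ₗ S) Z ∘ₗ Coalgebra.comul) (Coalgebra.comul (R := ℂ) h) =
      mulMap Z (mulMap X Y) (TensorProduct.assoc ℂ H H H
        ((Bialgebra.comulAlgHom ℂ H).toLinearMap.rTensor H
          ((S (H := H)).lTensor H (Coalgebra.comul (R := ℂ) h)))) := by
  have e1 : ∀ t : H ⊗[ℂ] H, mulMap X (mulMap (Y ∘ₗ S) Z ∘ₗ Coalgebra.comul) t =
      mulMap X (mulMap (Y ∘ₗ S) Z) (Coalgebra.comul.lTensor H t) := by
    intro t
    induction t with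
    | zero => simp
    | add s t hs ht => simp only [map_add, hs, ht]
    | tmul u v => rfl
  have e2 : ∀ w : H ⊗[ℂ] (H ⊗[ℂ] H), mulMap X (mulMap (Y ∘ₗ S) Z)
      (TensorProduct.assoc ℂ H H H (TensorProduct.comm ℂ H (H ⊗[ℂ] H) w)) =
      mulMap Z (mulMap X (Y ∘ₗ S)) w := by
    intro w
    induction w with
    | zero => simp
    | add s t hs ht => simp only [map_add, hs, ht]
    | tmul p w =>
      induction w with
      | zero => simp
      | add s t hs ht => simp only [map_add, TensorProduct.tmul_add, hs, ht]
      | tmul q r =>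
        simp only [mulMap_tmul, TensorProduct.comm_tmul, TensorProduct.assoc_tmul,
          LinearMap.comp_apply]
        rw [(hYZ (S r) p).eq, ← mul_assoc, (hXZ q p).eq, mul_assoc]
  have e3 : ∀ t : H ⊗[ℂ] H, mulMap Z (mulMap X Y) (TensorProduct.assoc ℂ H H H
        ((Bialgebra.comulAlgHom ℂ H).toLinearMap.rTensor H ((S (H := H)).lTensor H t))) =
      mulMap Z (mulMap X (Y ∘ₗ S)) (TensorProduct.assoc ℂ H H H (Coalgebra.comul.rTensor H t)) := by
    intro t
    induction t with
    | zero => simp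
    | add s t hs ht => simp only [map_add, hs, ht]
    | tmul u v =>
      rw [LinearMap.lTensor_tmul, LinearMap.rTensor_tmul, LinearMap.rTensor_tmul,
        AlgHom.toLinearMap_apply, Bialgebra.comulAlgHom_apply]
      generalize Coalgebra.comul (R := ℂ) u = w
      induction w with
      | zero => simp
      | add s t hs ht => simp only [map_add, TensorProduct.add_tmul, hs, ht]
      | tmul p q => rfl
  rw [e1, e3, Coalgebra.coassoc_apply, ← e2, IsHaar.comul_cyclic hh hS]

omit [Module.Finite ℂ H] in
lemma mulMap_haar_antipode (hh : QD.IsHaar H h) (hS : ∀ x : H, S (S x) = x)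
    (hXY : ∀ a b, Commute (X a) (Y b))
    (hXZ : ∀ a b, Commute (X a) (Z b)) (hYZ : ∀ a b, Commute (Y a) (Z b)) :
    mulMap X (mulMap (Y ∘ₗ S) (Z ∘ₗ S) ∘ₗ Coalgebra.comul) (Coalgebra.comul (R := ℂ) h) =
      mulMap Z (mulMap Y X) (TensorProduct.assoc ℂ H H H
        ((Bialgebra.comulAlgHom ℂ H).toLinearMap.rTensor H
          ((S (H := H)).lTensor H (Coalgebra.comul (R := ℂ) h)))) := by
  rw [← (IsHaar.isSep hh hS).2.2]
  generalize Coalgebra.comul (R := ℂ) h = t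
  induction t with
  | zero => simp
  | add s t hs ht => simp only [map_add, hs, ht]
  | tmul u v =>
    rw [mulMap_tmul, LinearMap.lTensor_tmul, TensorProduct.comm_tmul, LinearMap.rTensor_tmul,
      AlgHom.toLinearMap_apply, Bialgebra.comulAlgHom_apply, comul_antipode, LinearMap.comp_apply]
    generalize Coalgebra.comul (R := ℂ) v = w
    induction w with
    | zero => simp
    | add s t hs ht => simp only [map_add, TensorProduct.add_tmul, mul_add, hs, ht]
    | tmul p q =>
      simp only [mulMap_tmul, TensorProduct.comm_tmul, TensorProduct.assoc_tmul,
        LinearMap.comp_apply, TensorProduct.map_tmul]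
      rw [(hYZ (S p) (S q)).eq, ← mul_assoc, (hXZ u (S q)).eq, mul_assoc, (hXY u (S p)).eq]

end VertexAlgebra

/-! ### Equivalence of the models -/

section Models

variable {H : Type u} [Ring H] [HopfAlgebra ℂ H] {A : Type v} [Ring A] [Algebra ℂ A]
  {β : A →ₐ[ℂ] H ⊗[ℂ] A} {l : A ⊗[ℂ] A}
  {C : Type u₁} [Category.{v₁} C] [MonoidalCategory C]
  {M : Type u₂} [Category.{v₂} M] [MonoidalLeftAction C M]
  {ω : C ⥤ Vect} {F : M ⥤ Vect} {J : ∀ (X : C) (N : M), ω.obj X ⊗ F.obj N ≅ F.obj (X ⊙ₗ N)}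
  {actH : ∀ X : C, H →ₐ[ℂ] Module.End ℂ (ω.obj X)}
  {actA : ∀ N : M, A →ₐ[ℂ] Module.End ℂ (F.obj N)}
  {I K : Type} [Fintype I] [DecidableEq I] [Fintype K] [DecidableEq K] {s : I → C} {t : K → M}
  {R : Type*} [Semiring R] [Algebra ℂ R] (z : Module.End ℂ (SN.EdgeSpace ω s) →ₗ[ℂ] R)
  (x y : Module.End ℂ (SN.EdgeSpace F t) →ₗ[ℂ] R)

theorem vertex_true (hF : FullyActs F actA) (hl : QD.IsSymmSeparabilityIdempotent A l)
    (hJ : Intertwines J actH actA β) :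
    SN.vertex ω F J s t true z x y =
      mulMap (z ∘ₗ opL s actH) (mulMap (x ∘ₗ opL t actA) (y ∘ₗ opR t actA))
        (TensorProduct.assoc ℂ H A A (β.toLinearMap.rTensor A l)) := by
  simp only [SN.vertex, cond_true, symbol_eq hF hl hJ]
  generalize TensorProduct.assoc ℂ H A A (β.toLinearMap.rTensor A l) = w
  induction w with
  | zero => simp
  | add s t hs ht => simp only [map_add, Finset.sum_add_distrib, hs, ht]
  | tmul p w =>
    induction w with
    | zero => simp
    | add s t hs ht =>
      simp only [map_add, TensorProduct.tmul_add, Finset.sum_add_distrib, hs, ht]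
    | tmul q r =>
      simp only [tripleAct, TensorProduct.map_tmul, mulMap_tmul, LinearMap.comp_apply,
        AlgHom.toLinearMap_apply, opL, opR, LinearMap.sum_apply, map_sum]
      rw [Finset.sum_mul_sum, Finset.sum_mul]
      simp only [Finset.mul_sum]

theorem vertex_false (hF : FullyActs F actA) (hl : QD.IsSymmSeparabilityIdempotent A l)
    (hJ : Intertwines J actH actA β) :
    SN.vertex ω F J s t false z x y =
      mulMap (z ∘ₗ opR s actH) (mulMap (y ∘ₗ opR t actA) (x ∘ₗ opL t actA))
        (TensorProduct.assoc ℂ H A A (β.toLinearMap.rTensor A l)) := by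
  simp only [SN.vertex, cond_false, symbol_eq hF hl hJ]
  generalize TensorProduct.assoc ℂ H A A (β.toLinearMap.rTensor A l) = w
  induction w with
  | zero => simp
  | add s t hs ht => simp only [map_add, Finset.sum_add_distrib, hs, ht]
  | tmul p w =>
    induction w with
    | zero => simp
    | add s t hs ht =>
      simp only [map_add, TensorProduct.tmul_add, Finset.sum_add_distrib, hs, ht]
    | tmul q r =>
      simp only [tripleAct, TensorProduct.map_tmul, mulMap_tmul, LinearMap.comp_apply,
        AlgHom.toLinearMap_apply, opL, opR, LinearMap.sum_apply, map_sum, undual_transpose]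
      rw [Finset.sum_mul_sum, Finset.sum_mul]
      simp only [Finset.mul_sum]
      refine Finset.sum_congr rfl fun i _ => ?_
      rw [Finset.sum_comm]

end Models

section Face

variable {H : Type u} [Ring H] [HopfAlgebra ℂ H] [Module.Finite ℂ H]

/-- The contraction `f ↦ f(x) y` as a linear map in `f`. -/
def contrLHom {V W : Type*} [AddCommMonoid V] [Module ℂ V] [AddCommMonoid W] [Module ℂ W]
    (t : V ⊗[ℂ] W) : Module.Dual ℂ V →ₗ[ℂ] W where
  toFun f := contrL f t
  map_add' f g := by simp [contrL, LinearMap.rTensor_add]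
  map_smul' c f := by simp [contrL, LinearMap.rTensor_smul]

lemma dualDistribEquiv_apply {V W : Type*} [AddCommGroup V] [Module ℂ V] [AddCommGroup W]
    [Module ℂ W] [Module.Finite ℂ V] [Module.Finite ℂ W]
    (τ : Module.Dual ℂ V ⊗[ℂ] Module.Dual ℂ W) :
    TensorProduct.dualDistribEquiv ℂ V W τ = TensorProduct.dualDistrib ℂ V W τ := rfl

variable {B : Type*} [Ring B] [Algebra ℂ B] {R : Type*} [Semiring R] [Algebra ℂ R]

lemma contrL_mul (g : Module.Dual ℂ B) (τ : Module.Dual ℂ B ⊗[ℂ] Module.Dual ℂ B)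
    (h : TensorProduct.dualDistrib ℂ B B τ = g ∘ₗ LinearMap.mul' ℂ B) (X Y : B ⊗[ℂ] R) :
    contrL g (X * Y) = mulMap (contrLHom X) (contrLHom Y) τ := by
  have e : ∀ (τ : Module.Dual ℂ B ⊗[ℂ] Module.Dual ℂ B) (u v : B) (r r' : R),
      mulMap (contrLHom (u ⊗ₜ r)) (contrLHom (v ⊗ₜ r')) τ =
        TensorProduct.dualDistrib ℂ B B τ (u ⊗ₜ v) • (r * r') := by
    intro τ u v r r'
    induction τ with
    | zero => simp
    | add s t hs ht => simp only [map_add, LinearMap.add_apply, add_smul, hs, ht]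
    | tmul f f' => simp [mulMap_tmul, contrLHom, smul_smul, mul_comm]
  have add₁ : ∀ s t : B ⊗[ℂ] R, contrLHom (s + t) = contrLHom s + contrLHom t := fun s t =>
    LinearMap.ext fun f => map_add (contrL f) s t
  have add₂ : ∀ {P Q : Type _} [AddCommGroup P] [Module ℂ P] [AddCommGroup Q] [Module ℂ Q]
      (f f' : P →ₗ[ℂ] R) (g : Q →ₗ[ℂ] R) (w : P ⊗[ℂ] Q),
      mulMap (f + f') g w = mulMap f g w + mulMap f' g w := by
    intro P Q _ _ _ _ f f' g w
    simp [mulMap, TensorProduct.map_add_left]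
  have add₃ : ∀ {P Q : Type _} [AddCommGroup P] [Module ℂ P] [AddCommGroup Q] [Module ℂ Q]
      (f : P →ₗ[ℂ] R) (g g' : Q →ₗ[ℂ] R) (w : P ⊗[ℂ] Q),
      mulMap f (g + g') w = mulMap f g w + mulMap f g' w := by
    intro P Q _ _ _ _ f g g' w
    simp [mulMap, TensorProduct.map_add_right]
  have zero : contrLHom (0 : B ⊗[ℂ] R) = 0 := LinearMap.ext fun f => map_zero (contrL f)
  induction X with
  | zero => simp [zero, mulMap]
  | add s t hs ht => rw [add_mul, map_add, add₁, add₂, hs, ht]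
  | tmul u r =>
    induction Y with
    | zero => simp [zero, mulMap]
    | add s t hs ht => rw [mul_add, map_add, add₁, add₃, hs, ht]
    | tmul v r' =>
      rw [e, h, Algebra.TensorProduct.tmul_mul_tmul, contrL_tmul]
      simp

lemma dualComul_comp [Module.Finite ℂ B] (ρ : H →ₐ[ℂ] B) (g : Module.Dual ℂ B) :
    QD.dualComul (g ∘ₗ ρ.toLinearMap) = TensorProduct.map ρ.toLinearMap.dualMap
      ρ.toLinearMap.dualMap ((TensorProduct.dualDistribEquiv ℂ B B).symm
        (g ∘ₗ LinearMap.mul' ℂ B)) := by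
  rw [QD.dualComul, LinearMap.comp_apply, LinearEquiv.coe_coe, LinearEquiv.symm_apply_eq,
    dualDistribEquiv_apply]
  have e : ∀ (τ : Module.Dual ℂ B ⊗[ℂ] Module.Dual ℂ B) (a b : H), TensorProduct.dualDistrib ℂ H H
      (TensorProduct.map ρ.toLinearMap.dualMap ρ.toLinearMap.dualMap τ) (a ⊗ₜ b) =
      TensorProduct.dualDistrib ℂ B B τ (ρ a ⊗ₜ ρ b) := by
    intro τ a b
    induction τ with
    | zero => simp
    | add s t hs ht => simp only [map_add, LinearMap.add_apply, hs, ht]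
    | tmul f f' => simp
  refine TensorProduct.ext' fun a b => ?_
  rw [e, ← dualDistribEquiv_apply, LinearEquiv.apply_symm_apply]
  simp

end Face

section Main

variable {H : Type u} [Ring H] [HopfAlgebra ℂ H] [Module.Finite ℂ H] [IsSemisimpleRing H]
  {A : Type v} [Ring A] [Algebra ℂ A] [Module.Finite ℂ A] [LeftComoduleAlgebra H A]
  {l : A ⊗[ℂ] A} {h : H} {φ : Module.Dual ℂ H}
  {C : Type u₁} [Category.{v₁} C] [MonoidalCategory C]
  {M : Type u₂} [Category.{v₂} M] [MonoidalLeftAction C M]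
  {ω : C ⥤ Vect} [ω.Monoidal] {F : M ⥤ Vect}
  {J : ∀ (X : C) (N : M), ω.obj X ⊗ F.obj N ≅ F.obj (X ⊙ₗ N)}
  {I K : Type} [Fintype I] [DecidableEq I] [Fintype K] [DecidableEq K] {s : I → C} {t : K → M}
  {actH : ∀ X : C, H →ₐ[ℂ] Module.End ℂ (ω.obj X)}
  {actA : ∀ N : M, A →ₐ[ℂ] Module.End ℂ (F.obj N)}

omit [Module.Finite ℂ H] [IsSemisimpleRing H] in
lemma comulAlgHom_toLinearMap : (Bialgebra.comulAlgHom ℂ H).toLinearMap = Coalgebra.comul := rfl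

theorem carries_step (hω : FullyActs ω actH) (hF : FullyActs F actA)
    (hh : QD.IsHaar H h) (hl : QD.IsSymmSeparabilityIdempotent A l)
    (hμ : Intertwines (M := C) (SN.bulkJ ω) actH actH (Bialgebra.comulAlgHom ℂ H))
    (hJ : Intertwines J actH actA (LeftComoduleAlgebra.coact (H := H)))
    (hbH : Function.Bijective fun (a : H) (x : I) => actH (s x) a)
    (hbA : Function.Bijective fun (a : A) (x : K) => actA (t x) a)
    (L : Lattice) (ν : C) (p : Step L.E L.B) (f : Module.Dual ℂ (Module.End ℂ (ω.obj ν))) :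
    Carries (totalMap L (fourier ω s actH) (fourier F t actA))
      (QD.step (H := H) (A := A) L p (f ∘ₗ (actH ν).toLinearMap))
      (contrL f (SN.step ω F J s t L ν p)) := by
  have hk := IsHaar.isSep hh antipode_antipode
  cases p with
  | left e =>
    have e1 : contrL f (SN.step ω F J s t L ν (.left e)) =
        bulkOp L e (contrL f (SN.edgeLeft ω ω (SN.bulkJ ω) s ν)) := contrL_lTensor _ _ _
    have e2 : QD.step (H := H) (A := A) L (.left e) (f ∘ₗ (actH ν).toLinearMap) =
        bulkOp L e (QD.Tm Coalgebra.comul (f ∘ₗ (actH ν).toLinearMap)) := rfl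
    have e3 := edgeLeft_fourier (β := Bialgebra.comulAlgHom ℂ H) (t := s) hω hk hμ
      isCoact_comul antipode_antipode hbH ν f
    rw [comulAlgHom_toLinearMap] at e3
    rw [e1, e2]
    exact carries_bulkOp _ _ _ e3
  | right e =>
    have e1 : contrL f (SN.step ω F J s t L ν (.right e)) =
        bulkOp L e (contrL f (SN.edgeRight ω s ν)) := contrL_lTensor _ _ _
    have e2 : QD.step (H := H) (A := A) L (.right e) (f ∘ₗ (actH ν).toLinearMap) =
        bulkOp L e (QD.Tp (f ∘ₗ (actH ν).toLinearMap)) := rfl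
    rw [e1, e2]
    exact carries_bulkOp _ _ _ (edgeRight_fourier hω hk hμ hbH ν f)
  | boundary b =>
    have e1 : contrL f (SN.step ω F J s t L ν (.boundary b)) =
        bdryOp L b (contrL f (SN.edgeLeft ω F J t ν)) := contrL_lTensor _ _ _
    have e2 : QD.step (H := H) (A := A) L (.boundary b) (f ∘ₗ (actH ν).toLinearMap) =
        bdryOp L b (QD.Tm (LeftComoduleAlgebra.coact (H := H) (A := A)).toLinearMap
          (f ∘ₗ (actH ν).toLinearMap)) := rfl
    rw [e1, e2]
    exact carries_bdryOp _ _ _ (edgeLeft_fourier hF hl hJ (isCoact_coact A)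
      antipode_antipode hbA ν f)

theorem carries_face (hω : FullyActs ω actH) (hF : FullyActs F actA)
    (hh : QD.IsHaar H h) (hl : QD.IsSymmSeparabilityIdempotent A l)
    (hμ : Intertwines (M := C) (SN.bulkJ ω) actH actH (Bialgebra.comulAlgHom ℂ H))
    (hJ : Intertwines J actH actA (LeftComoduleAlgebra.coact (H := H)))
    (hbH : Function.Bijective fun (a : H) (x : I) => actH (s x) a)
    (hbA : Function.Bijective fun (a : A) (x : K) => actA (t x) a)
    (L : Lattice) (ν : C) (p : List (Step L.E L.B)) (g : Module.Dual ℂ (Module.End ℂ (ω.obj ν))) :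
    Carries (totalMap L (fourier ω s actH) (fourier F t actA))
      (QD.face (H := H) (A := A) L p (g ∘ₗ (actH ν).toLinearMap))
      (contrL g (p.map (SN.step ω F J s t L ν)).prod) := by
  have hk := IsHaar.isSep hh antipode_antipode
  induction p generalizing g with
  | nil =>
    rw [List.map_nil, List.prod_nil, Algebra.TensorProduct.one_def, contrL_tmul]
    have : QD.face (H := H) (A := A) L [] (g ∘ₗ (actH ν).toLinearMap) = g 1 • 1 := by
      change (g ((actH ν) 1)) • (1 : Module.End ℂ (Total L H A)) = _
      rw [map_one]
    rw [this]
    exact Carries.one.smul _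
  | cons p ps ih =>
    rw [List.map_cons, List.prod_cons, contrL_mul g ((TensorProduct.dualDistribEquiv ℂ _ _).symm
        (g ∘ₗ LinearMap.mul' ℂ _)) (by
      rw [← dualDistribEquiv_apply, LinearEquiv.apply_symm_apply])]
    have : QD.face (H := H) (A := A) L (p :: ps) (g ∘ₗ (actH ν).toLinearMap) =
        mulMap (QD.step L p ∘ₗ (actH ν).toLinearMap.dualMap)
          (QD.face L ps ∘ₗ (actH ν).toLinearMap.dualMap)
          ((TensorProduct.dualDistribEquiv ℂ _ _).symm (g ∘ₗ LinearMap.mul' ℂ _)) := by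
      change mulMap (QD.step L p) (QD.face L ps) (QD.dualComul _) = _
      rw [dualComul_comp, mulMap, mulMap, LinearMap.comp_apply, LinearMap.comp_apply,
        TensorProduct.map_comp, LinearMap.comp_apply]
    rw [this]
    refine Carries.mulMap (fun f => ?_) ih _
    exact carries_step hω hF hh hl hμ hJ hbH hbA L ν p f

omit [MonoidalCategory C] [ω.Monoidal] in
theorem dualHaar_eq_sum (hφ : QD.IsDualHaar H φ)
    (hbH : Function.Bijective fun (a : H) (x : I) => actH (s x) a) :
    φ = ∑ i, ((Module.finrank ℂ (ω.obj (s i)) : ℂ) /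
      ∑ j, (Module.finrank ℂ (ω.obj (s j)) : ℂ) ^ 2) •
        (LinearMap.trace ℂ (ω.obj (s i)) ∘ₗ (actH (s i)).toLinearMap) := by
  have hd : (Module.finrank ℂ H : ℂ) = ∑ j, (Module.finrank ℂ (ω.obj (s j)) : ℂ) ^ 2 := by
    rw [← regChar_one, regChar_eq_sum hbH]
    simp [pow_two]
  rw [IsDualHaar.unique hφ isDualHaar_regChar]
  refine LinearMap.ext fun x => ?_
  rw [LinearMap.smul_apply, regChar_eq_sum hbH, LinearMap.sum_apply, hd, Finset.smul_sum]
  refine Finset.sum_congr rfl fun i _ => ?_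
  simp only [LinearMap.smul_apply, smul_eq_mul, LinearMap.comp_apply, AlgHom.toLinearMap_apply]
  ring

theorem carries_bulkVertex (hω : FullyActs ω actH) (hh : QD.IsHaar H h)
    (hμ : Intertwines (M := C) (SN.bulkJ ω) actH actH (Bialgebra.comulAlgHom ℂ H))
    (L : Lattice) (v : BulkVertex L.E) :
    Carries (totalMap L (fourier ω s actH) (fourier F t actA)) (QD.bulkVertex A L v h)
      (SN.bulkVertex ω F s t L v) := by
  let Φ := totalMap L (fourier ω s actH) (fourier F t actA)
  have hZL : ∀ p, Carries Φ ((bulkOp L v.z ∘ₗ QD.Lp) p)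
      ((bulkOp L v.z ∘ₗ opL s actH) p) := fun p =>
    carries_bulkOp _ _ _ (fourier_comp_Lp p)
  have hZR : ∀ p, Carries Φ ((bulkOp L v.z ∘ₗ QD.Rm) p)
      ((bulkOp L v.z ∘ₗ opR s actH) p) := fun p =>
    carries_bulkOp _ _ _ (fourier_comp_Rm p)
  have hX : ∀ p, Carries Φ ((bulkOp L v.x ∘ₗ QD.Lp) p)
      ((bulkOp L v.x ∘ₗ opL s actH) p) := fun p =>
    carries_bulkOp _ _ _ (fourier_comp_Lp p)
  have hY : ∀ p, Carries Φ ((bulkOp L v.y ∘ₗ QD.Rm) p)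
      ((bulkOp L v.y ∘ₗ opR s actH) p) := fun p =>
    carries_bulkOp _ _ _ (fourier_comp_Rm p)
  have e2 : QD.bulkVertex A L v h = mulMap (bulkOp L v.x ∘ₗ QD.Lp)
      (mulMap (bulkOp L v.y ∘ₗ QD.Rm ∘ₗ S) (bulkOp L v.z ∘ₗ
        bif v.zIn then QD.Lp else QD.Rm ∘ₗ S) ∘ₗ Coalgebra.comul) (Coalgebra.comul h) := rfl
  rw [SN.bulkVertex, e2]
  have hk := IsHaar.isSep hh antipode_antipode
  cases v.zIn with
  | true =>
    rw [vertex_true _ _ _ hω hk hμ, cond_true, ← LinearMap.comp_assoc, mulMap_haar _ _ _ hh antipode_antipode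
      (fun a b => bulkOp_comm v.x_ne_z _ _)
      (fun a b => bulkOp_comm v.y_ne_z _ _)]
    exact Carries.mulMap hZL (Carries.mulMap hX hY) _
  | false =>
    rw [vertex_false _ _ _ hω hk hμ, cond_false, ← LinearMap.comp_assoc, ← LinearMap.comp_assoc,
      mulMap_haar_antipode _ _ _ hh antipode_antipode
      (fun a b => bulkOp_comm v.x_ne_y _ _)
      (fun a b => bulkOp_comm v.x_ne_z _ _)
      (fun a b => bulkOp_comm v.y_ne_z _ _)]
    exact Carries.mulMap hZR (Carries.mulMap hY hX) _

omit [ω.Monoidal] in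
theorem carries_boundaryVertex (hF : FullyActs F actA)
    (hl : QD.IsSymmSeparabilityIdempotent A l)
    (hJ : Intertwines J actH actA (LeftComoduleAlgebra.coact (H := H)))
    (L : Lattice) (w : BoundaryVertex L.E L.B) :
    Carries (totalMap L (fourier ω s actH) (fourier F t actA)) (QD.boundaryVertex (H := H) L w l)
      (SN.boundaryVertex ω F J s t L w) := by
  let Φ := totalMap L (fourier ω s actH) (fourier F t actA)
  have hZL : ∀ p, Carries Φ ((bulkOp L w.z ∘ₗ QD.Lp) p)
      ((bulkOp L w.z ∘ₗ opL s actH) p) := fun p =>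
    carries_bulkOp _ _ _ (fourier_comp_Lp p)
  have hZR : ∀ p, Carries Φ ((bulkOp L w.z ∘ₗ QD.Rm) p)
      ((bulkOp L w.z ∘ₗ opR s actH) p) := fun p =>
    carries_bulkOp _ _ _ (fourier_comp_Rm p)
  have hX : ∀ p, Carries Φ ((bdryOp L w.x ∘ₗ QD.Lp) p)
      ((bdryOp L w.x ∘ₗ opL t actA) p) := fun p =>
    carries_bdryOp _ _ _ (fourier_comp_Lp p)
  have hY : ∀ p, Carries Φ ((bdryOp L w.y ∘ₗ QD.Rm) p)
      ((bdryOp L w.y ∘ₗ opR t actA) p) := fun p =>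
    carries_bdryOp _ _ _ (fourier_comp_Rm p)
  have hβ := isCoact_coact (H := H) A
  have hXY : ∀ a b, Commute ((bdryOp (P := H) L w.x ∘ₗ QD.Lp (A := A)) a)
      ((bdryOp L w.y ∘ₗ QD.Rm) b) :=
    fun a b => bdryOp_comm w.x_ne_y _ _
  rw [SN.boundaryVertex, QD.boundaryVertex]
  cases w.zIn with
  | true =>
    rw [vertex_true _ _ _ hF hl hJ]
    cases w.upper with
    | true =>
      rw [cond_true, cond_true, mulMap_coact]
      exact Carries.mulMap hZL (Carries.mulMap hX hY) _
    | false =>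
      rw [cond_false, cond_true, ← LinearMap.comp_assoc (f := S),
        mulMap_coact_antipode_swap _ _ _ hβ antipode_antipode hl
        (fun a p => bulkOp_bdryOp_comm _ _ _ _)]
      exact Carries.mulMap hZL (Carries.mulMap hX hY) _
  | false =>
    rw [vertex_false _ _ _ hF hl hJ]
    cases w.upper with
    | true =>
      rw [cond_true, cond_false, ← LinearMap.comp_assoc (f := S),
        mulMap_coact_antipode _ _ _ hβ antipode_antipode hl hXY]
      exact Carries.mulMap hZR (Carries.mulMap hY hX) _
    | false =>
      rw [cond_false, cond_false, mulMap_coact_swap _ _ _ hl hXY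
        (fun a p => bulkOp_bdryOp_comm _ _ _ _)]
      exact Carries.mulMap hZR (Carries.mulMap hY hX) _

theorem carries_faceOperator (hω : FullyActs ω actH) (hF : FullyActs F actA)
    (hh : QD.IsHaar H h) (hφ : QD.IsDualHaar H φ) (hl : QD.IsSymmSeparabilityIdempotent A l)
    (hμ : Intertwines (M := C) (SN.bulkJ ω) actH actH (Bialgebra.comulAlgHom ℂ H))
    (hJ : Intertwines J actH actA (LeftComoduleAlgebra.coact (H := H)))
    (hbH : Function.Bijective fun (a : H) (x : I) => actH (s x) a)
    (hbA : Function.Bijective fun (a : A) (x : K) => actA (t x) a)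
    (L : Lattice) (p : List (Step L.E L.B)) :
    Carries (totalMap L (fourier ω s actH) (fourier F t actA)) (QD.face (H := H) (A := A) L p φ)
      (SN.face ω F J s t L p) := by
  rw [dualHaar_eq_sum hφ hbH, map_sum]
  simp only [map_smul]
  exact Carries.sum _ fun i => Carries.smul _
    (carries_face hω hF hh hl hμ hJ hbH hbA L (s i) p _)

lemma carries_hamiltonian {L : Lattice} {P P' Q Q' : Type*} [AddCommGroup P] [Module ℂ P]
    [AddCommGroup Q] [Module ℂ Q] [AddCommGroup P'] [Module ℂ P'] [AddCommGroup Q'] [Module ℂ Q']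
    {f : Total L P Q →ₗ[ℂ] Total L P' Q'}
    {v : L.V → Module.End ℂ (Total L P Q)} {v' : L.V → Module.End ℂ (Total L P' Q')}
    {w : L.W → Module.End ℂ (Total L P Q)} {w' : L.W → Module.End ℂ (Total L P' Q')}
    {b : L.F → Module.End ℂ (Total L P Q)} {b' : L.F → Module.End ℂ (Total L P' Q')}
    (hv : ∀ i, Carries f (v i) (v' i)) (hw : ∀ i, Carries f (w i) (w' i))
    (hb : ∀ i, Carries f (b i) (b' i)) :
    Carries f (hamiltonian v w b) (hamiltonian v' w' b') :=
  ((Carries.sum _ fun i => Carries.one_sub (hv i)).add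
    (Carries.sum _ fun i => Carries.one_sub (hw i))).add
    (Carries.sum _ fun i => Carries.one_sub (hb i))

theorem modelsEquivalent (hω : FullyActs ω actH) (hF : FullyActs F actA)
    (hh : QD.IsHaar H h) (hφ : QD.IsDualHaar H φ) (hl : QD.IsSymmSeparabilityIdempotent A l)
    (hμ : Intertwines (M := C) (SN.bulkJ ω) actH actH (Bialgebra.comulAlgHom ℂ H))
    (hJ : Intertwines J actH actA (LeftComoduleAlgebra.coact (H := H)))
    (hbH : Function.Bijective fun (a : H) (x : I) => actH (s x) a)
    (hbA : Function.Bijective fun (a : A) (x : K) => actA (t x) a) :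
    ModelsEquivalent h φ l ω F J s t actH actA := by
  refine ⟨fourier_bijective hbH, fourier_bijective hbA, fun L => ?_⟩
  have hv := fun v => carries_bulkVertex (F := F) (A := A) (s := s) (t := t) (actA := actA)
    hω hh hμ L (L.bulkVertex v)
  have hw := fun w => carries_boundaryVertex (s := s) (t := t) hF hl hJ L (L.boundaryVertex w)
  have hf := fun f => carries_faceOperator hω hF hh hφ hl hμ hJ hbH hbA L (L.face f)
  exact ⟨totalMap_bijective (fourier_bijective hbH) (fourier_bijective hbA), hv, hw, hf,
    carries_hamiltonian hv hw hf⟩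

end Main

set_option linter.unusedSectionVars false

/-! ### Semisimple categories -/

section Semisimple

variable {M : Type u₂} [Category.{v₂} M]

lemma lin_map_comp (F : M ⥤ Vect) {X Y Z : M} (f : X ⟶ Y) (g : Y ⟶ Z) (v : F.obj X) :
    lin (F.map (f ≫ g)) v = lin (F.map g) (lin (F.map f) v) := by
  rw [F.map_comp]; rfl

lemma lin_map_id (F : M ⥤ Vect) {X : M} (v : F.obj X) : lin (F.map (𝟙 X)) v = v := by
  rw [F.map_id]; rfl

/-! ### Universal elements -/

/-- The pair `(P, ξ)` represents the functor `F`. -/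
def IsUniversal (F : M ⥤ Vect) (P : M) (ξ : F.obj P) : Prop :=
  ∀ (X : M) (v : F.obj X), ∃! f : P ⟶ X, lin (F.map f) ξ = v

/-- The algebra `A` acts on the functor `F`. -/
def ActsNaturally {A : Type v} [Ring A] [Algebra ℂ A] (F : M ⥤ Vect)
    (act : ∀ N : M, A →ₐ[ℂ] Module.End ℂ (F.obj N)) : Prop :=
  ∀ {X Y : M} (f : X ⟶ Y) (a : A) (v : F.obj X),
    lin (F.map f) (act X a v) = act Y a (lin (F.map f) v)

namespace IsUniversal

variable {F : M ⥤ Vect} {P : M} {ξ : F.obj P} (hP : IsUniversal F P ξ)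

section
include hP

lemma exists_map (X : M) (v : F.obj X) : ∃ f : P ⟶ X, lin (F.map f) ξ = v := (hP X v).exists

lemma hom_ext {X : M} {f g : P ⟶ X} (h : lin (F.map f) ξ = lin (F.map g) ξ) : f = g :=
  (hP X _).unique h rfl

end

end IsUniversal

lemma lin_sum {V W : Vect} {ι : Type*} (s : Finset ι) (f : ι → (V ⟶ W)) :
    lin (∑ i ∈ s, f i) = ∑ i ∈ s, lin (f i) := by
  classical
  induction s using Finset.induction_on with
  | empty => simp; rfl
  | insert a s ha ih => rw [Finset.sum_insert ha, Finset.sum_insert ha, ← ih]; rfl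

variable [Preadditive M] [Linear ℂ M]

lemma lin_map_sum (F : M ⥤ Vect) [F.Additive] {X Y : M} {ι : Type*} (s : Finset ι)
    (f : ι → (X ⟶ Y)) (v : F.obj X) :
    lin (F.map (∑ i ∈ s, f i)) v = ∑ i ∈ s, lin (F.map (f i)) v := by
  rw [F.map_sum, lin_sum, LinearMap.sum_apply]

lemma lin_map_smul (F : M ⥤ Vect) [F.Additive] [F.Linear ℂ] {X Y : M} (c : ℂ) (f : X ⟶ Y)
    (v : F.obj X) : lin (F.map (c • f)) v = c • lin (F.map f) v := by
  rw [F.map_smul]; rfl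

namespace IsSimpleSystem

variable {K : Type} [Fintype K] {t : K → M} (ht : IsSimpleSystem t)
include ht

lemma exists_split (X : M) : ∃ (n : ℕ) (τ : Fin n → K) (a : ∀ j, X ⟶ t (τ j))
    (b : ∀ j, t (τ j) ⟶ X), ∑ j, a j ≫ b j = 𝟙 X := by
  obtain ⟨n, τ, b, ⟨hb⟩, ⟨i⟩⟩ := ht.decomposition X
  refine ⟨n, τ, fun j => i.inv ≫ b.π j, fun j => b.ι j ≫ i.hom, ?_⟩
  have := Limits.IsBilimit.total hb
  calc _ = i.inv ≫ (∑ j, b.π j ≫ b.ι j) ≫ i.hom := by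
        simp [Preadditive.sum_comp, Preadditive.comp_sum]
    _ = _ := by rw [this]; simp

lemma id_ne_zero (x : K) : 𝟙 (t x) ≠ 0 := by
  intro h
  have h1 := ht.finrank_end x
  have : Subsingleton (t x ⟶ t x) := ⟨fun f g => by
    rw [← Category.comp_id f, ← Category.comp_id g, h]; simp⟩
  rw [Module.finrank_zero_of_subsingleton] at h1
  exact zero_ne_one h1

lemma exists_smul {x : K} (f : t x ⟶ t x) : ∃ c : ℂ, c • 𝟙 (t x) = f :=
  (finrank_eq_one_iff_of_nonzero' _ (ht.id_ne_zero x)).1 (ht.finrank_end x) f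

lemma eq_zero {x y : K} (h : x ≠ y) (f : t x ⟶ t y) : f = 0 :=
  (ht.hom_zero x y h).elim _ _

lemma exists_comp_eq_id {X Y : M} {f : X ⟶ Y} (hf : f ≠ 0) :
    ∃ (x : K) (a : t x ⟶ X) (b : Y ⟶ t x), a ≫ f ≫ b = 𝟙 (t x) := by
  obtain ⟨n, τ, a, b, h⟩ := ht.exists_split X
  obtain ⟨n', τ', a', b', h'⟩ := ht.exists_split Y
  by_contra! hc
  have key : ∀ j k, b j ≫ f ≫ a' k = 0 := by
    intro j k
    by_cases hjk : τ j = τ' k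
    · generalize hbj : b j = bj
      clear hbj
      generalize hak : a' k = ak
      clear hak
      revert bj
      rw [hjk]
      intro bj
      obtain ⟨c, hc'⟩ := ht.exists_smul (bj ≫ f ≫ ak)
      by_cases h0 : c = 0
      · rw [← hc', h0, zero_smul]
      · refine absurd ?_ (hc (τ' k) (c⁻¹ • bj) ak)
        rw [Linear.smul_comp, ← hc', smul_smul, inv_mul_cancel₀ h0, one_smul]
    · exact ht.eq_zero hjk _
  apply hf
  calc f = (∑ j, a j ≫ b j) ≫ f ≫ ∑ k, a' k ≫ b' k := by rw [h, h']; simp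
    _ = ∑ j, ∑ k, a j ≫ (b j ≫ f ≫ a' k) ≫ b' k := by
      simp only [Preadditive.sum_comp, Preadditive.comp_sum, Category.assoc]
      exact Finset.sum_comm
    _ = 0 := by simp [key]

lemma exists_left_inv {X : M} {x : K} {f : X ⟶ t x} (hf : f ≠ 0) :
    ∃ a : t x ⟶ X, a ≫ f = 𝟙 (t x) := by
  obtain ⟨y, a, b, h⟩ := ht.exists_comp_eq_id hf
  by_cases hxy : x = y
  · subst hxy
    obtain ⟨c, rfl⟩ := ht.exists_smul b
    exact ⟨c • a, by simpa using h⟩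
  · rw [ht.eq_zero hxy b] at h
    exact absurd (by simpa using h.symm) (ht.id_ne_zero y)

lemma finite_hom (X Y : M) : Module.Finite ℂ (X ⟶ Y) := by
  obtain ⟨n, τ, a, b, h⟩ := ht.exists_split X
  obtain ⟨n', τ', a', b', h'⟩ := ht.exists_split Y
  have fin : ∀ x y, Module.Finite ℂ (t x ⟶ t y) := by
    intro x y
    by_cases hxy : x = y
    · subst hxy
      exact Module.finite_of_finrank_pos (by rw [ht.finrank_end]; exact one_pos)
    · have := ht.hom_zero x y hxy
      infer_instance
  have := fun j k => fin (τ j) (τ' k)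
  let L : (∀ j k, t (τ j) ⟶ t (τ' k)) →ₗ[ℂ] (X ⟶ Y) :=
    { toFun := fun g => ∑ j, ∑ k, a j ≫ g j k ≫ b' k
      map_add' := fun g g' => by simp [Finset.sum_add_distrib]
      map_smul' := fun c g => by simp [Finset.smul_sum] }
  refine Module.Finite.of_surjective L fun f => ⟨fun j k => b j ≫ f ≫ a' k, ?_⟩
  calc ∑ j, ∑ k, a j ≫ (b j ≫ f ≫ a' k) ≫ b' k = (∑ j, a j ≫ b j) ≫ f ≫ ∑ k, a' k ≫ b' k := by
        simp only [Preadditive.sum_comp, Preadditive.comp_sum, Category.assoc]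
        exact Finset.sum_comm
    _ = f := by rw [h, h']; simp

end IsSimpleSystem

namespace IsUniversal

variable {F : M ⥤ Vect} {P : M} {ξ : F.obj P} (hP : IsUniversal F P ξ)

variable [F.Additive] [F.Linear ℂ]
  {K : Type} [Fintype K] {t : K → M} (ht : IsSimpleSystem t)

lemma of_simple (ht : IsSimpleSystem t)
    (h : ∀ x (v : F.obj (t x)), ∃! f : P ⟶ t x, lin (F.map f) ξ = v) : IsUniversal F P ξ := by
  intro X v
  obtain ⟨n, τ, a, b, hab⟩ := ht.exists_split X
  choose f hf using fun j => (h (τ j) (lin (F.map (a j)) v)).exists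
  refine ⟨∑ j, f j ≫ b j, ?_, fun g hg => ?_⟩
  · change lin (F.map (∑ j, f j ≫ b j)) ξ = v
    rw [lin_map_sum]
    calc _ = lin (F.map (∑ j, a j ≫ b j)) v := by
          rw [lin_map_sum]
          exact Finset.sum_congr rfl fun j _ => by rw [lin_map_comp, hf, lin_map_comp]
      _ = v := by rw [hab, lin_map_id]
  · have : ∀ j, g ≫ a j = f j := fun j => (h (τ j) _).unique
      (by rw [lin_map_comp, hg]) (hf j)
    calc g = g ≫ ∑ j, a j ≫ b j := by rw [hab, Category.comp_id]
      _ = _ := by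
        rw [Preadditive.comp_sum]
        exact Finset.sum_congr rfl fun j _ => by rw [← this j, Category.assoc]

include hP ht

lemma exists_retract (hF : ∀ x, Nontrivial (F.obj (t x))) (U : M) :
    ∃ (n : ℕ) (a : Fin n → (U ⟶ P)) (b : Fin n → (P ⟶ U)), ∑ k, a k ≫ b k = 𝟙 U := by
  obtain ⟨n, τ, a, b, hab⟩ := ht.exists_split U
  have : ∀ x, ∃ (p : t x ⟶ P) (q : P ⟶ t x), p ≫ q = 𝟙 (t x) := by
    intro x
    obtain ⟨v, hv⟩ := exists_ne (0 : F.obj (t x))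
    obtain ⟨f, hf⟩ := hP.exists_map _ v
    have hf0 : f ≠ 0 := by
      rintro rfl
      rw [F.map_zero] at hf
      exact hv hf.symm
    obtain ⟨p, hp⟩ := ht.exists_left_inv hf0
    exact ⟨p, f, hp⟩
  choose p q hpq using this
  refine ⟨n, fun j => a j ≫ p (τ j), fun j => q (τ j) ≫ b j, ?_⟩
  rw [← hab]
  refine Finset.sum_congr rfl fun j _ => ?_
  rw [Category.assoc, ← Category.assoc (p _), hpq, Category.id_comp]

lemma faithful (hF : ∀ x, Nontrivial (F.obj (t x))) : F.Faithful where
  map_injective {X Y} f g h := by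
    obtain ⟨n, a, b, hab⟩ := hP.exists_retract ht hF X
    have : ∀ k, b k ≫ f = b k ≫ g := fun k => hP.hom_ext (by rw [lin_map_comp, lin_map_comp, h])
    calc f = (∑ k, a k ≫ b k) ≫ f := by rw [hab, Category.id_comp]
      _ = (∑ k, a k ≫ b k) ≫ g := by
        simp only [Preadditive.sum_comp, Category.assoc, this]
      _ = g := by rw [hab, Category.id_comp]

variable {A : Type v} [Ring A] [Algebra ℂ A] {act : ∀ N : M, A →ₐ[ℂ] Module.End ℂ (F.obj N)}

lemma fullyActs (hF : ∀ x, Nontrivial (F.obj (t x))) (hact : ActsNaturally F act)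
    (hA : Function.Surjective fun a : A => act P a ξ) : FullyActs F act := by
  intro U V T
  constructor
  · intro hT
    obtain ⟨n, a, b, hab⟩ := hP.exists_retract ht hF U
    choose f hf using fun k => hP.exists_map V (T (lin (F.map (b k)) ξ))
    have hf' : ∀ k p, lin (F.map (f k)) p = T (lin (F.map (b k)) p) := by
      intro k p
      obtain ⟨x, rfl⟩ := hA p
      change lin (F.map (f k)) (act P x ξ) = T (lin (F.map (b k)) (act P x ξ))
      rw [hact, hact, hf]
      exact (LinearMap.congr_fun (hT x) _).symm
    refine ⟨∑ k, a k ≫ f k, LinearMap.ext fun u => ?_⟩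
    rw [lin_map_sum]
    calc _ = T (lin (F.map (∑ k, a k ≫ b k)) u) := by
          rw [lin_map_sum, map_sum]
          exact Finset.sum_congr rfl fun k _ => by rw [lin_map_comp, hf', lin_map_comp]
      _ = T u := by rw [hab, lin_map_id]
  · rintro ⟨g, rfl⟩ a
    exact LinearMap.ext fun v => hact g a v

lemma bijective_pi (hact : ActsNaturally F act)
    (hA : Function.Bijective fun a : A => act P a ξ) :
    Function.Bijective fun (a : A) (x : K) => act (t x) a := by
  classical
  obtain ⟨n, τ, a, b, hab⟩ := ht.exists_split P
  have hsplit : ∀ p : F.obj P, p = ∑ j, lin (F.map (b j)) (lin (F.map (a j)) p) := fun p => by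
    conv_lhs => rw [← lin_map_id F p, ← hab, lin_map_sum]
    exact Finset.sum_congr rfl fun j _ => lin_map_comp F _ _ _
  constructor
  · intro c c' h
    apply hA.1
    change act P c ξ = act P c' ξ
    rw [hsplit ξ, map_sum, map_sum]
    refine Finset.sum_congr rfl fun j _ => ?_
    rw [← hact (b j), ← hact (b j)]
    exact congrArg _ (LinearMap.congr_fun (congrFun h (τ j)) _)
  · intro T
    obtain ⟨c, hc⟩ := hA.2 (∑ j, lin (F.map (b j)) (T (τ j) (lin (F.map (a j)) ξ)))
    change act P c ξ = _ at hc
    refine ⟨c, funext fun x => LinearMap.ext fun v => ?_⟩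
    obtain ⟨f, rfl⟩ := hP.exists_map _ v
    change act (t x) c _ = _
    rw [← hact, hc, map_sum]
    conv_rhs => rw [hsplit ξ]
    rw [map_sum, map_sum]
    refine Finset.sum_congr rfl fun j _ => ?_
    rw [← lin_map_comp, ← lin_map_comp]
    generalize hg : b j ≫ f = g
    generalize lin (F.map (a j)) ξ = w
    clear hg
    by_cases hx : τ j = x
    · generalize τ j = y at g w hx
      subst hx
      obtain ⟨d, rfl⟩ := ht.exists_smul g
      rw [lin_map_smul, lin_map_smul, lin_map_id, lin_map_id, map_smul]
    · rw [ht.eq_zero hx g, F.map_zero]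
      change (0 : F.obj (t x)) = T x 0
      rw [map_zero]

end IsUniversal

lemma exists_isUniversal [Limits.HasFiniteBiproducts M] (F : M ⥤ Vect) [F.Additive] [F.Linear ℂ]
    {K : Type} [Fintype K] {t : K → M} (ht : IsSimpleSystem t) :
    ∃ (P : M) (ξ : F.obj P), IsUniversal F P ξ := by
  classical
  let J := Σ x : K, Fin (Module.finrank ℂ (F.obj (t x)))
  let f : J → M := fun j => t j.1
  let e : ∀ x, Module.Basis (Fin (Module.finrank ℂ (F.obj (t x)))) ℂ (F.obj (t x)) :=
    fun x => Module.finBasis ℂ _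
  refine ⟨⨁ f, ∑ j : J, lin (F.map (Limits.biproduct.ι f j)) (e j.1 j.2), IsUniversal.of_simple ht ?_⟩
  intro x v
  have key : ∀ (g : ⨁ f ⟶ t x) (c : Fin (Module.finrank ℂ (F.obj (t x))) → ℂ),
      (∀ k, Limits.biproduct.ι f ⟨x, k⟩ ≫ g = c k • 𝟙 (t x)) →
      lin (F.map g) (∑ j : J, lin (F.map (Limits.biproduct.ι f j)) (e j.1 j.2)) =
        ∑ k, c k • e x k := by
    intro g c hc
    rw [map_sum, Fintype.sum_sigma, Finset.sum_eq_single x]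
    · refine Finset.sum_congr rfl fun k _ => ?_
      rw [← lin_map_comp, hc, lin_map_smul, lin_map_id]
    · intro y _ hy
      refine Finset.sum_eq_zero fun k _ => ?_
      rw [← lin_map_comp, ht.eq_zero hy (Limits.biproduct.ι f ⟨y, k⟩ ≫ g), F.map_zero]
      rfl
    · simp
  have coeff : ∀ g : ⨁ f ⟶ t x, ∃ c : Fin (Module.finrank ℂ (F.obj (t x))) → ℂ,
      ∀ k, Limits.biproduct.ι f ⟨x, k⟩ ≫ g = c k • 𝟙 (t x) := by
    intro g
    choose c hc using fun k => ht.exists_smul (Limits.biproduct.ι f ⟨x, k⟩ ≫ g)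
    exact ⟨c, fun k => (hc k).symm⟩
  refine ⟨∑ k, (e x).repr v k • Limits.biproduct.π f ⟨x, k⟩, ?_, fun g hg => ?_⟩
  · refine (key _ (fun k => (e x).repr v k) fun k => ?_).trans ((e x).sum_repr v)
    rw [Preadditive.comp_sum, Finset.sum_eq_single k]
    · rw [Linear.comp_smul, Limits.biproduct.ι_π_self]
    · intro l _ hl
      rw [Linear.comp_smul, Limits.biproduct.ι_π_ne, smul_zero]
      rintro h
      cases h; exact hl rfl
    · simp
  · obtain ⟨c, hc⟩ := coeff g
    have h1 : ∀ k, c k = (e x).repr v k := by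
      have := key g c hc
      rw [hg] at this
      intro k
      rw [this, (e x).repr_sum_self]
    refine Limits.biproduct.hom_ext' _ _ fun j => ?_
    obtain ⟨y, k⟩ := j
    by_cases hy : y = x
    · subst hy
      rw [hc, h1, Preadditive.comp_sum, Finset.sum_eq_single k]
      · rw [Linear.comp_smul, Limits.biproduct.ι_π_self]
      · intro l _ hl
        rw [Linear.comp_smul, Limits.biproduct.ι_π_ne, smul_zero]
        rintro h
        cases h; exact hl rfl
      · simp
    · rw [ht.eq_zero hy (Limits.biproduct.ι f ⟨y, k⟩ ≫ g),
        ht.eq_zero hy (Limits.biproduct.ι f ⟨y, k⟩ ≫ _)]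

lemma isSemisimpleRing_of_bijective {A : Type v} [Ring A] [Algebra ℂ A] {K : Type} [Fintype K]
    {V : K → Type} [∀ x, AddCommGroup (V x)] [∀ x, Module ℂ (V x)] [∀ x, Module.Finite ℂ (V x)]
    (ρ : ∀ x, A →ₐ[ℂ] Module.End ℂ (V x))
    (h : Function.Bijective fun (a : A) (x : K) => ρ x a) : IsSemisimpleRing A :=
  have : ∀ x, IsSemisimpleRing (Module.End ℂ (V x)) := fun x =>
    (LinearMap.toMatrixAlgEquiv (Module.finBasis ℂ (V x))).symm.toRingEquiv.isSemisimpleRing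
  (RingEquiv.ofBijective (RingHom.pi fun x => (ρ x).toRingHom) h).symm.isSemisimpleRing

lemma moduleFinite_of_bijective {A : Type v} [Ring A] [Algebra ℂ A] {K : Type} [Fintype K]
    {V : K → Type} [∀ x, AddCommGroup (V x)] [∀ x, Module ℂ (V x)] [∀ x, Module.Finite ℂ (V x)]
    (ρ : ∀ x, A →ₐ[ℂ] Module.End ℂ (V x))
    (h : Function.Bijective fun (a : A) (x : K) => ρ x a) : Module.Finite ℂ A :=
  Module.Finite.of_injective (LinearMap.pi fun x => (ρ x).toLinearMap) h.1

end Semisimple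

/-! ### Categories of modules -/

lemma exists_bicone {M : Type u₂} [Category.{v₂} M] [Preadditive M] {K : Type} {t : K → M}
    {X : M} {J : Type} [Fintype J] (τ : J → K) (a : ∀ j, X ⟶ t (τ j)) (b : ∀ j, t (τ j) ⟶ X)
    (h : ∑ j, a j ≫ b j = 𝟙 X) (h₁ : ∀ j, b j ≫ a j = 𝟙 _) (h₂ : ∀ i j, i ≠ j → b i ≫ a j = 0) :
    ∃ (k : ℕ) (σ : Fin k → K) (c : Limits.Bicone fun a => t (σ a)),
      Nonempty c.IsBilimit ∧ Nonempty (c.pt ≅ X) := by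
  let e := Fintype.equivFin J
  refine ⟨_, fun i => τ (e.symm i), ⟨X, fun i => a (e.symm i), fun i => b (e.symm i), ?_⟩,
    ⟨Limits.isBilimitOfTotal _ ?_⟩, ⟨Iso.refl _⟩⟩
  · intro i j
    by_cases hij : i = j
    · subst hij
      simpa using h₁ _
    · rw [dif_neg hij]
      exact h₂ _ _ (fun h => hij (e.symm.injective h))
  · exact (e.symm.sum_comp fun j => a j ≫ b j).trans h

namespace FdMod

section Basic
variable {A : Type u} [Ring A] [Algebra ℂ A]

/-- The morphism of a linear map that commutes with the action. -/
def ofHom {M N : FdMod A} (f : M.V →ₗ[ℂ] N.V) (h : ∀ a, f ∘ₗ M.ρ a = N.ρ a ∘ₗ f) : M ⟶ N :=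
  ⟨FGModuleCat.ofHom f, h⟩

lemma hom_ext {M N : FdMod A} {f g : M ⟶ N} (h : ∀ v, lin f.1 v = lin g.1 v) : f = g :=
  Subtype.ext (FGModuleCat.hom_ext (LinearMap.ext h))

lemma comm_apply {M N : FdMod A} (f : M ⟶ N) (a : A) (v : M.V) :
    lin f.1 (M.ρ a v) = N.ρ a (lin f.1 v) := LinearMap.congr_fun (f.2 a) v

/-- The direct product of modules. -/
def pi {n : ℕ} (f : Fin n → FdMod A) : FdMod A where
  V := FGModuleCat.of ℂ (∀ j, (f j).V)
  ρ :=
    { toFun := fun a => LinearMap.pi fun j => (f j).ρ a ∘ₗ LinearMap.proj j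
      map_one' := by ext1; simp; rfl
      map_mul' := fun a b => LinearMap.ext fun v => funext fun j => by simp
      map_zero' := LinearMap.ext fun v => funext fun j => by simp; rfl
      map_add' := fun a b => LinearMap.ext fun v => funext fun j => by simp
      commutes' := fun c => LinearMap.ext fun v => funext fun j => by
        simp [Module.algebraMap_end_apply] }

instance : Limits.HasFiniteBiproducts (FdMod A) where
  out n :=
    { has_biproduct := fun f =>
        ⟨⟨⟨⟨pi f, fun j => ofHom (LinearMap.proj j) fun _ => rfl,
          fun j => ofHom (LinearMap.single ℂ (fun j => (f j).V) j) fun a =>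
            LinearMap.ext fun v => funext fun i => by
              change Pi.single (M := fun j => (f j).V) j ((f j).ρ a v) i =
                (f i).ρ a (Pi.single (M := fun j => (f j).V) j v i)
              by_cases h : i = j
              · subst h; simp
              · simp [h], fun i j => by
            by_cases h : i = j
            · subst h
              rw [dif_pos rfl]
              exact hom_ext fun v => Pi.single_eq_same (M := fun j => (f j).V) i v
            · rw [dif_neg h]
              exact hom_ext fun v => Pi.single_eq_of_ne (M := fun j => (f j).V) (Ne.symm h) v⟩,
          Limits.isBilimitOfTotal _ (hom_ext fun v => by
            refine (lin_map_sum (forget A) Finset.univ (fun j => ofHom (M := pi f) (N := f j)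
              (LinearMap.proj j) (fun _ => rfl) ≫ ofHom (N := pi f)
                (LinearMap.single ℂ (fun j => (f j).V) j) _) v).trans ?_
            exact Finset.univ_sum_single (M := fun j => (f j).V) v)⟩⟩⟩ }

end Basic

section Small
variable {A : Type u} [Ring A] [Algebra ℂ A] {V : Type v} [AddCommGroup V] [Module ℂ V]
  [Module.Finite ℂ V]

/-- A finite-dimensional representation in an arbitrary universe, transported to coordinates. -/
def small (ρ : A →ₐ[ℂ] Module.End ℂ V) : FdMod A where
  V := FGModuleCat.of ℂ (Fin (Module.finrank ℂ V) → ℂ)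
  ρ := ((Module.finBasis ℂ V).equivFun.conjAlgEquiv ℂ).toAlgHom.comp ρ

/-- The identification of a representation with its transport. -/
def smallEquiv (ρ : A →ₐ[ℂ] Module.End ℂ V) : V ≃ₗ[ℂ] (small ρ).V :=
  (Module.finBasis ℂ V).equivFun

lemma small_apply (ρ : A →ₐ[ℂ] Module.End ℂ V) (a : A) (v : V) :
    (small ρ).ρ a (smallEquiv ρ v) = smallEquiv ρ (ρ a v) := by
  change smallEquiv ρ (ρ a ((smallEquiv ρ).symm (smallEquiv ρ v))) = _
  rw [LinearEquiv.symm_apply_apply]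

end Small

section Regular
variable (A : Type u) [Ring A] [Algebra ℂ A] [Module.Finite ℂ A]

/-- The regular module. -/
def reg : FdMod A := small (Algebra.lmul ℂ A)

/-- The identification of the algebra with its regular module. -/
def regEquiv : A ≃ₗ[ℂ] (reg A).V := smallEquiv (Algebra.lmul ℂ A)

variable {A}

lemma reg_apply (a b : A) : (reg A).ρ a (regEquiv A b) = regEquiv A (a * b) :=
  small_apply (Algebra.lmul ℂ A) a b

/-- The map from the regular module that sends the unit to the given element. -/
def regHom (N : FdMod A) (v : N.V) : reg A ⟶ N :=
  ofHom (N.ρ.toLinearMap.flip v ∘ₗ (regEquiv A).symm.toLinearMap) fun a =>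
    LinearMap.ext fun w => by
      obtain ⟨b, rfl⟩ := (regEquiv A).surjective w
      simp [reg_apply]

lemma regHom_apply (N : FdMod A) (v : N.V) (b : A) :
    lin (regHom N v).1 (regEquiv A b) = N.ρ b v := by
  change N.ρ ((regEquiv A).symm (regEquiv A b)) v = _
  rw [LinearEquiv.symm_apply_apply]

lemma isUniversal_reg : IsUniversal (forget A) (reg A) (regEquiv A 1) := by
  intro N (v : N.V)
  refine ⟨regHom N v, ?_, fun g hg => hom_ext fun w => ?_⟩
  · exact (regHom_apply N v 1).trans (by rw [map_one]; rfl)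
  · obtain ⟨b, rfl⟩ := (regEquiv A).surjective w
    refine Eq.trans ?_ (regHom_apply N v b).symm
    rw [← mul_one b, ← reg_apply, comm_apply, mul_one]
    exact congrArg _ hg

lemma actsNaturally : ActsNaturally (forget A) (fun N => N.ρ) := fun f a v => comm_apply f a v

lemma fullyActs : FullyActs (forget A) (fun N => N.ρ) := fun U V T =>
  ⟨fun h => ⟨ofHom T h, rfl⟩, by rintro ⟨g, rfl⟩; exact g.2⟩

lemma bijective_act_reg : Function.Bijective fun a : A => (reg A).ρ a (regEquiv A 1) := by
  simp only [reg_apply, mul_one]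
  exact (regEquiv A).bijective

lemma bijective_pi {K : Type} [Fintype K] {t : K → FdMod A} (ht : IsSimpleSystem t) :
    Function.Bijective fun (a : A) (x : K) => (t x).ρ a :=
  isUniversal_reg.bijective_pi ht actsNaturally bijective_act_reg

variable (A) in
lemma toEndForget_bijective : Function.Bijective (toEndForget A) := by
  have key : ∀ (η : End (forget A)) (X : FdMod A) (v : X.V),
      lin (NatTrans.app η X) v = lin (regHom X v).1 (lin (NatTrans.app η (reg A)) (regEquiv A 1)) := by
    intro η X v
    have h := congrArg (fun f => lin f (regEquiv A 1)) (NatTrans.naturality (η : forget A ⟶ forget A)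
      (regHom X v))
    refine Eq.trans ?_ h
    change _ = lin (NatTrans.app η X) (lin (regHom X v).1 (regEquiv A 1))
    rw [regHom_apply, map_one]
    rfl
  constructor
  · intro a b h
    apply bijective_act_reg.1
    exact congrArg (fun η : End (forget A) => lin (NatTrans.app η (reg A)) (regEquiv A 1)) h
  · intro η
    obtain ⟨a, ha⟩ := (regEquiv A).surjective (lin (NatTrans.app η (reg A)) (regEquiv A 1))
    refine ⟨a, NatTrans.ext (funext fun X => FGModuleCat.hom_ext (LinearMap.ext fun v => ?_))⟩
    refine Eq.trans ?_ (key η X v).symm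
    rw [← ha]
    exact (regHom_apply X v a).symm

end Regular

section Simple
variable {A : Type u} [Ring A] [Algebra ℂ A] {K : Type} [Fintype K] {V : K → FdMod A}

lemma nontrivial_of_id_ne_zero {N : FdMod A} (h : 𝟙 N ≠ 0) : Nontrivial N.V := by
  by_contra hn
  rw [not_nontrivial_iff_subsingleton] at hn
  exact h (hom_ext fun v => hn.elim _ _)

lemma _root_.QDSN.IsSimpleSystem.nontrivial_module (hV : IsSimpleSystem V) (x : K) :
    Nontrivial (V x).V := nontrivial_of_id_ne_zero (hV.id_ne_zero x)

variable [DecidableEq K] (h : Function.Bijective fun (a : A) (x : K) => (V x).ρ a)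

/-- The element of the algebra that acts by the given operator on one of the simple modules. -/
def lift (x : K) (T : Module.End ℂ (V x).V) : A := (h.2 (Pi.single x T)).choose

lemma lift_same (x : K) (T : Module.End ℂ (V x).V) : (V x).ρ (lift h x T) = T :=
  (congrFun (h.2 (Pi.single x T)).choose_spec x).trans (by rw [Pi.single_eq_same])

lemma lift_ne {x y : K} (hxy : y ≠ x) (T : Module.End ℂ (V x).V) : (V y).ρ (lift h x T) = 0 :=
  (congrFun (h.2 (Pi.single x T)).choose_spec y).trans (by rw [Pi.single_eq_of_ne hxy])

include h in
lemma eq_of_act {a b : A} (hab : ∀ x, (V x).ρ a = (V x).ρ b) : a = b := h.1 (funext hab)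

lemma lift_eq {x : K} {T : Module.End ℂ (V x).V} {a : A} (h₁ : (V x).ρ a = T)
    (h₂ : ∀ y, y ≠ x → (V y).ρ a = 0) : lift h x T = a := eq_of_act h fun y => by
  by_cases hy : y = x
  · subst hy; rw [lift_same, h₁]
  · rw [lift_ne h hy, h₂ y hy]

lemma lift_add (x : K) (S T : Module.End ℂ (V x).V) :
    lift h x (S + T) = lift h x S + lift h x T :=
  lift_eq h (by rw [map_add, lift_same, lift_same])
    fun y hy => by rw [map_add, lift_ne h hy, lift_ne h hy, add_zero]

lemma lift_smul (x : K) (c : ℂ) (T : Module.End ℂ (V x).V) :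
    lift h x (c • T) = c • lift h x T :=
  lift_eq h (by rw [map_smul, lift_same]) fun y hy => by rw [map_smul, lift_ne h hy, smul_zero]

/-- The linear map `lift`. -/
def liftLin (x : K) : Module.End ℂ (V x).V →ₗ[ℂ] A where
  toFun := lift h x
  map_add' := lift_add h x
  map_smul' := lift_smul h x

lemma mul_lift (a : A) (x : K) (T : Module.End ℂ (V x).V) :
    a * lift h x T = lift h x ((V x).ρ a * T) :=
  (lift_eq h (by rw [map_mul, lift_same])
    fun y hy => by rw [map_mul, lift_ne h hy, mul_zero]).symm

lemma lift_mul (a : A) (x : K) (T : Module.End ℂ (V x).V) :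
    lift h x T * a = lift h x (T * (V x).ρ a) :=
  (lift_eq h (by rw [map_mul, lift_same])
    fun y hy => by rw [map_mul, lift_ne h hy, zero_mul]).symm

lemma lift_mul_lift (x : K) (S T : Module.End ℂ (V x).V) :
    lift h x S * lift h x T = lift h x (S * T) := by
  rw [lift_mul, lift_same]

lemma lift_mul_lift_ne {x y : K} (hxy : x ≠ y) (S : Module.End ℂ (V x).V)
    (T : Module.End ℂ (V y).V) : lift h x S * lift h y T = 0 := by
  rw [lift_mul, lift_ne h hxy, mul_zero]
  exact (liftLin h x).map_zero

lemma sum_lift_one : ∑ x, lift h x (1 : Module.End ℂ (V x).V) = 1 := eq_of_act h fun y => by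
  rw [map_sum, Finset.sum_eq_single y (fun x _ hx => lift_ne h (Ne.symm hx) _) (by simp),
    lift_same, map_one]

include h in
/-- The decomposition of a module into simple modules. -/
theorem isSimpleSystem (hV : ∀ x, Nontrivial (V x).V) : IsSimpleSystem V := by
  choose v0 hv0 using fun x => exists_ne (0 : (V x).V)
  choose l hl using fun x => Module.Projective.exists_dual_ne_zero ℂ (hv0 x)
  have hl1 : ∃ l : ∀ x, Module.Dual ℂ (V x).V, ∀ x, l x (v0 x) = 1 :=
    ⟨fun x => (l x (v0 x))⁻¹ • l x, fun x => inv_mul_cancel₀ (hl x)⟩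
  clear hl l
  obtain ⟨l, hl⟩ := hl1
  have comp_rk : ∀ x (T : Module.End ℂ (V x).V) (f : Module.Dual ℂ (V x).V) v, T * LinearMap.smulRight f v =
      LinearMap.smulRight f (T v) := fun x T f v => LinearMap.ext fun w => by simp
  have rk_comp : ∀ x (T : Module.End ℂ (V x).V) (f : Module.Dual ℂ (V x).V) v, LinearMap.smulRight f v * T =
      LinearMap.smulRight (f ∘ₗ T) v := fun x T f v => LinearMap.ext fun w => by simp
  refine ⟨fun x => finrank_eq_one (𝟙 (V x)) (fun h0 => ?_) fun f => ?_, fun i j hij =>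
    ⟨fun f g => ?_⟩, fun W => ?_⟩
  · exact hv0 x (congrArg (fun f : V x ⟶ V x => lin f.1 (v0 x)) h0)
  · refine ⟨l x (lin f.1 (v0 x)), hom_ext fun v => ?_⟩
    change l x (lin f.1 (v0 x)) • v = lin f.1 v
    have := comm_apply f (lift h x (LinearMap.smulRight (l x) v)) (v0 x)
    rw [lift_same] at this
    simpa [hl] using this.symm
  · have : ∀ f : V i ⟶ V j, f = 0 := fun f => hom_ext fun v => by
      have := comm_apply f (lift h i 1) v
      rw [lift_same, lift_ne h (Ne.symm hij)] at this
      exact this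
    rw [this f, this g]
  · let p : ∀ x, Module.End ℂ W.V := fun x => W.ρ (lift h x (LinearMap.smulRight (l x) (v0 x)))
    have hp : ∀ x v, p x (p x v) = p x v := fun x v => by
      change (p x * p x) v = _
      simp only [p]
      rw [← map_mul, lift_mul_lift, comp_rk, LinearMap.smulRight_apply, hl, one_smul]
    let e := fun x => Module.finBasis ℂ (LinearMap.range (p x))
    let J := Σ x, Fin (Module.finrank ℂ (LinearMap.range (p x)))
    let w : J → W.V := fun j => (e j.1 j.2 : W.V)
    let μ : J → Module.Dual ℂ W.V := fun j => (e j.1).coord j.2 ∘ₗ (p j.1).rangeRestrict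
    have hpw : ∀ j : J, p j.1 (w j) = w j := fun j => by
      obtain ⟨u, hu⟩ := (e j.1 j.2).2
      change p j.1 (e j.1 j.2 : W.V) = (e j.1 j.2 : W.V)
      rw [← hu, hp]
    have hμp : ∀ (j : J) v, μ j (p j.1 v) = μ j v := fun j v => by
      change (e j.1).coord j.2 _ = (e j.1).coord j.2 _
      congr 1
      exact Subtype.ext (hp j.1 v)
    have hμw : ∀ x k k', μ ⟨x, k⟩ (w ⟨x, k'⟩) = if k' = k then 1 else 0 := fun x k k' => by
      change (e x).coord k ((p x).rangeRestrict (e x k' : W.V)) = _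
      have : (p x).rangeRestrict (e x k' : W.V) = e x k' := Subtype.ext (hpw ⟨x, k'⟩)
      rw [this, Module.Basis.coord_apply, Module.Basis.repr_self, Finsupp.single_apply]
    have hsum : ∀ x v, ∑ k, μ ⟨x, k⟩ v • w ⟨x, k⟩ = p x v := fun x v => by
      refine Eq.trans ?_ (congrArg Subtype.val ((e x).sum_repr ((p x).rangeRestrict v)))
      rw [AddSubmonoidClass.coe_finsetSum]
      rfl
    let c := fun x => Module.finBasis ℂ (V x).V
    let ψ : ∀ j : J, W.V →ₗ[ℂ] (V j.1).V := fun j => ∑ i, LinearMap.smulRight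
      (μ j ∘ₗ W.ρ (lift h j.1 (LinearMap.smulRight ((c j.1).coord i) (v0 j.1)))) (c j.1 i)
    let φ : ∀ j : J, (V j.1).V →ₗ[ℂ] W.V := fun j => W.ρ.toLinearMap.flip (w j) ∘ₗ
      liftLin h j.1 ∘ₗ LinearMap.smulRightₗ (l j.1)
    have hφ : ∀ j v, φ j v = W.ρ (lift h j.1 (LinearMap.smulRight (l j.1) v)) (w j) :=
      fun j v => rfl
    have hψ : ∀ j f v, f (ψ j v) = μ j (W.ρ (lift h j.1 (LinearMap.smulRight f (v0 j.1))) v) := by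
      intro j f v
      have e1 : LinearMap.smulRight f (v0 j.1) =
          ∑ i, f (c j.1 i) • LinearMap.smulRight ((c j.1).coord i) (v0 j.1) := by
        refine LinearMap.ext fun u => ?_
        simp only [LinearMap.smulRight_apply, LinearMap.sum_apply, LinearMap.smul_apply, smul_smul]
        rw [← Finset.sum_smul]
        congr 1
        conv_lhs => rw [← (c j.1).sum_repr u, map_sum]
        exact Finset.sum_congr rfl fun i _ => by simp [mul_comm]
      have e2 : lift h j.1 (LinearMap.smulRight f (v0 j.1)) = ∑ i, f (c j.1 i) •
          lift h j.1 (LinearMap.smulRight ((c j.1).coord i) (v0 j.1)) := by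
        rw [e1]
        exact (map_sum (liftLin h j.1) _ _).trans
          (Finset.sum_congr rfl fun i _ => map_smul (liftLin h j.1) _ _)
      rw [e2]
      simp only [ψ, LinearMap.sum_apply, map_sum, map_smul, LinearMap.smul_apply,
        LinearMap.smulRight_apply, LinearMap.comp_apply, smul_eq_mul]
      exact Finset.sum_congr rfl fun i _ => mul_comm _ _
    have dual_ext : ∀ x (u v : (V x).V), (∀ f : Module.Dual ℂ (V x).V, f u = f v) → u = v :=
      fun x u v huv => by
        rw [← sub_eq_zero, ← Module.forall_dual_apply_eq_zero_iff ℂ]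
        intro f
        rw [map_sub, huv, sub_self]
    have hψφ : ∀ j j' v, ψ j' (φ j v) = if hj : j = j' then hj ▸ v else 0 := by
      intro j j' v
      refine dual_ext _ _ _ fun f => ?_
      rw [hψ, hφ, ← Module.End.mul_apply, ← map_mul]
      by_cases hj : j = j'
      · subst hj
        rw [dif_pos rfl, lift_mul_lift, comp_rk, LinearMap.smulRight_apply]
        have : LinearMap.smulRight (l j.1) (f v • v0 j.1) =
            f v • LinearMap.smulRight (l j.1) (v0 j.1) := LinearMap.ext fun u => smul_comm _ _ _
        rw [this, lift_smul, map_smul, LinearMap.smul_apply, map_smul]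
        have h2 : W.ρ (lift h j.1 (LinearMap.smulRight (l j.1) (v0 j.1))) (w j) = w j := hpw j
        rw [h2, show μ j (w j) = 1 from (hμw j.1 j.2 j.2).trans (if_pos rfl), smul_eq_mul, mul_one]
      · rw [dif_neg hj, map_zero]
        by_cases hx : j.1 = j'.1
        · obtain ⟨x, k⟩ := j
          obtain ⟨x', k'⟩ := j'
          change x = x' at hx
          subst hx
          rw [lift_mul_lift, comp_rk, LinearMap.smulRight_apply]
          have : LinearMap.smulRight (l x) (f v • v0 x) =
              f v • LinearMap.smulRight (l x) (v0 x) := LinearMap.ext fun u => smul_comm _ _ _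
          rw [this, lift_smul, map_smul, LinearMap.smul_apply, map_smul]
          have h2 : W.ρ (lift h x (LinearMap.smulRight (l x) (v0 x))) (w ⟨x, k⟩) = w ⟨x, k⟩ :=
            hpw ⟨x, k⟩
          rw [h2, hμw, if_neg, smul_zero]
          rintro rfl
          exact hj rfl
        · rw [lift_mul_lift_ne h (Ne.symm hx), map_zero, LinearMap.zero_apply, map_zero]
    refine exists_bicone (J := J) (fun j => j.1)
      (fun j => ofHom (ψ j) fun a => LinearMap.ext fun v => dual_ext _ _ _ fun f => ?_)
      (fun j => ofHom (φ j) fun a => LinearMap.ext fun v => ?_)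
      (hom_ext fun v => ?_) (fun j => hom_ext fun v => ?_) fun j j' hj => hom_ext fun v => ?_
    · have e1 := hψ j (f ∘ₗ (V j.1).ρ a) v
      rw [LinearMap.comp_apply, hψ, ← Module.End.mul_apply, ← map_mul, lift_mul, rk_comp]
      exact e1.symm
    · change φ j ((V j.1).ρ a v) = W.ρ a (φ j v)
      rw [hφ, hφ, ← Module.End.mul_apply, ← map_mul,
        mul_lift, comp_rk]
    · refine (lin_map_sum (forget A) Finset.univ _ v).trans ?_
      have e1 : ∀ x, ∑ k, φ ⟨x, k⟩ (ψ ⟨x, k⟩ v) = W.ρ (lift h x 1) v := by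
        intro x
        have one_eq : (1 : Module.End ℂ (V x).V) =
            ∑ i, LinearMap.smulRight ((c x).coord i) (c x i) :=
          LinearMap.ext fun u => by
            simp
        have e2 : lift h x 1 = ∑ i, lift h x (LinearMap.smulRight ((c x).coord i) (c x i)) := by
          rw [one_eq]
          exact map_sum (liftLin h x) _ _
        rw [e2, map_sum, LinearMap.sum_apply]
        have e3 : ∀ k, φ ⟨x, k⟩ (ψ ⟨x, k⟩ v) = ∑ i,
            W.ρ (lift h x (LinearMap.smulRight (l x) (c x i)))
              (μ ⟨x, k⟩ (W.ρ (lift h x (LinearMap.smulRight ((c x).coord i) (v0 x))) v) •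
                w ⟨x, k⟩) := by
          intro k
          simp only [ψ, LinearMap.sum_apply, map_sum, LinearMap.smulRight_apply, map_smul]
          rfl
        rw [Finset.sum_congr rfl fun k _ => e3 k, Finset.sum_comm]
        refine Finset.sum_congr rfl fun i _ => ?_
        rw [← map_sum, hsum]
        simp only [p]
        rw [← Module.End.mul_apply, ← Module.End.mul_apply, ← map_mul, ← map_mul, lift_mul_lift,
          lift_mul_lift, comp_rk, comp_rk]
        simp [hl]
      refine (Fintype.sum_sigma (fun j : J => φ j (ψ j v))).trans ?_
      rw [Finset.sum_congr rfl fun x _ => e1 x, ← LinearMap.sum_apply, ← map_sum, sum_lift_one,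
        map_one]
      rfl
    · exact (hψφ j j v).trans (dif_pos rfl)
    · exact (hψφ j j' v).trans (dif_neg hj)

end Simple

variable (A : Type u) [Ring A] [Algebra ℂ A]

theorem isFinSemisimple [Module.Finite ℂ A] [IsSemisimpleRing A] : IsFinSemisimple (FdMod A) := by
  refine ⟨inferInstance, ?_⟩
  obtain ⟨n, d, hd, ⟨e⟩⟩ := IsSemisimpleRing.exists_algEquiv_pi_matrix_of_isAlgClosed ℂ A
  let V : Fin n → FdMod A := fun i =>
    { V := FGModuleCat.of ℂ (Fin (d i) → ℂ)
      ρ := (Matrix.toLinAlgEquiv' (R := ℂ) (n := Fin (d i))).toAlgHom.comp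
        ((Pi.evalAlgHom ℂ (fun i => Matrix (Fin (d i)) (Fin (d i)) ℂ) i).comp e.toAlgHom) }
  refine ⟨n, V, isSimpleSystem (V := V) ⟨fun a b hab => e.injective (funext fun i => ?_),
    fun T => ⟨e.symm fun i => (Matrix.toLinAlgEquiv' (R := ℂ) (n := Fin (d i))).symm (T i),
      funext fun i => ?_⟩⟩ fun i => ?_⟩
  · exact (Matrix.toLinAlgEquiv' (R := ℂ) (n := Fin (d i))).injective (congrFun hab i)
  · change Matrix.toLinAlgEquiv' (e (e.symm _) i) = T i
    rw [AlgEquiv.apply_symm_apply]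
    exact AlgEquiv.apply_symm_apply _ _
  · have := hd i
    change Nontrivial (Fin (d i) → ℂ)
    infer_instance

end FdMod

/-! ### Elements of fiber functors -/

section Fiber

variable {C : Type u₁} [Category.{v₁} C] [MonoidalCategory C] (ω : C ⥤ Vect) [ω.Monoidal]

/-- The linear isomorphism `ω(X) ⊗ ω(Y) ≅ ω(X ⊗ Y)`. -/
def mu (X Y : C) : ω.obj X ⊗[ℂ] ω.obj Y ≃ₗ[ℂ] ω.obj (X ⊗ Y) :=
  FGModuleCat.isoToLinearEquiv (Functor.Monoidal.μIso ω X Y)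

/-- The image of `1` in `ω(𝟙)`. -/
def unitElt : ω.obj (𝟙_ C) := lin (Functor.LaxMonoidal.ε ω) (1 : ℂ)

lemma mu_apply (X Y : C) (v : ω.obj X ⊗[ℂ] ω.obj Y) :
    mu ω X Y v = lin (Functor.LaxMonoidal.μ ω X Y) v := rfl

variable {ω}

lemma map_whiskerRight_mu {X X' : C} (f : X ⟶ X') (Y : C) (x : ω.obj X) (y : ω.obj Y) :
    lin (ω.map (f ▷ Y)) (mu ω X Y (x ⊗ₜ y)) = mu ω X' Y (lin (ω.map f) x ⊗ₜ y) :=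
  (congrArg (fun k : ω.obj X ⊗ ω.obj Y ⟶ ω.obj (X' ⊗ Y) => lin k (x ⊗ₜ y))
    (Functor.LaxMonoidal.μ_natural_left ω f Y)).symm

lemma map_whiskerLeft_mu (X : C) {Y Y' : C} (f : Y ⟶ Y') (x : ω.obj X) (y : ω.obj Y) :
    lin (ω.map (X ◁ f)) (mu ω X Y (x ⊗ₜ y)) = mu ω X Y' (x ⊗ₜ lin (ω.map f) y) :=
  (congrArg (fun k : ω.obj X ⊗ ω.obj Y ⟶ ω.obj (X ⊗ Y') => lin k (x ⊗ₜ y))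
    (Functor.LaxMonoidal.μ_natural_right ω X f)).symm

lemma map_tensorHom_mu {X X' Y Y' : C} (f : X ⟶ X') (g : Y ⟶ Y') (v : ω.obj X ⊗[ℂ] ω.obj Y) :
    lin (ω.map (f ⊗ₘ g)) (mu ω X Y v) =
      mu ω X' Y' (TensorProduct.map (lin (ω.map f)) (lin (ω.map g)) v) :=
  (congrArg (fun k : ω.obj X ⊗ ω.obj Y ⟶ ω.obj (X' ⊗ Y') => lin k v)
    (Functor.LaxMonoidal.μ_natural ω f g)).symm

lemma map_associator_mu {X Y Z : C} (x : ω.obj X) (y : ω.obj Y) (z : ω.obj Z) :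
    lin (ω.map (α_ X Y Z).hom) (mu ω (X ⊗ Y) Z (mu ω X Y (x ⊗ₜ y) ⊗ₜ z)) =
      mu ω X (Y ⊗ Z) (x ⊗ₜ mu ω Y Z (y ⊗ₜ z)) :=
  congrArg (fun k : (ω.obj X ⊗ ω.obj Y) ⊗ ω.obj Z ⟶ ω.obj (X ⊗ Y ⊗ Z) => lin k ((x ⊗ₜ y) ⊗ₜ z))
    (Functor.LaxMonoidal.associativity ω X Y Z)

lemma map_leftUnitor_mu {X : C} (x : ω.obj X) :
    lin (ω.map (λ_ X).hom) (mu ω (𝟙_ C) X (unitElt ω ⊗ₜ x)) = x :=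
  (congrArg (fun k : 𝟙_ Vect ⊗ ω.obj X ⟶ ω.obj X => lin k ((1 : ℂ) ⊗ₜ x))
    (Functor.LaxMonoidal.left_unitality ω X)).symm.trans (one_smul ℂ x)

lemma map_rightUnitor_mu {X : C} (x : ω.obj X) :
    lin (ω.map (ρ_ X).hom) (mu ω X (𝟙_ C) (x ⊗ₜ unitElt ω)) = x :=
  (congrArg (fun k : ω.obj X ⊗ 𝟙_ Vect ⟶ ω.obj X => lin k (x ⊗ₜ (1 : ℂ)))
    (Functor.LaxMonoidal.right_unitality ω X)).symm.trans (one_smul ℂ x)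

variable (ω) in
/-- The linear isomorphism `ω(𝟙) ≅ ℂ`. -/
def unitEquiv : ω.obj (𝟙_ C) ≃ₗ[ℂ] ℂ :=
  (FGModuleCat.isoToLinearEquiv (Functor.Monoidal.εIso ω)).symm

lemma unitEquiv_symm (c : ℂ) : (unitEquiv ω).symm c = c • unitElt ω := by
  have : (unitEquiv ω).symm 1 = unitElt ω := rfl
  rw [← this, ← map_smul, smul_eq_mul, mul_one]

lemma unitEquiv_smul (v : ω.obj (𝟙_ C)) : unitEquiv ω v • unitElt ω = v := by
  rw [← unitEquiv_symm, LinearEquiv.symm_apply_apply]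

lemma unitEquiv_unitElt : unitEquiv ω (unitElt ω) = 1 :=
  (unitEquiv ω).apply_symm_apply 1

lemma unitElt_ne_zero : unitElt ω ≠ 0 := fun h => by
  have := unitEquiv_unitElt (ω := ω)
  rw [h, map_zero] at this
  exact zero_ne_one this

/-! ### Duality -/

/-- The pairing `ω(Y) ⊗ ω(X) → ℂ` of an exact pairing. -/
def pairing (X Y : C) [ExactPairing X Y] : ω.obj Y ⊗[ℂ] ω.obj X →ₗ[ℂ] ℂ :=
  (unitEquiv ω).toLinearMap ∘ₗ lin (ω.map (ε_ X Y)) ∘ₗ (mu ω Y X).toLinearMap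

lemma map_evaluation_mu (X Y : C) [ExactPairing X Y] (v : ω.obj Y ⊗[ℂ] ω.obj X) :
    lin (ω.map (ε_ X Y)) (mu ω Y X v) = pairing X Y v • unitElt ω :=
  (unitEquiv_smul _).symm

variable (ω) in
/-- The copairing in `ω(X) ⊗ ω(Y)` of an exact pairing. -/
def copairing (X Y : C) [ExactPairing X Y] : ω.obj X ⊗[ℂ] ω.obj Y :=
  (mu ω X Y).symm (lin (ω.map (η_ X Y)) (unitElt ω))

lemma mu_copairing (X Y : C) [ExactPairing X Y] :
    mu ω X Y (copairing ω X Y) = lin (ω.map (η_ X Y)) (unitElt ω) :=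
  LinearEquiv.apply_symm_apply _ _

/-- `x ⊗ y ↦ f(y) x`. -/
def slice {V W : Type*} [AddCommGroup V] [Module ℂ V] [AddCommGroup W] [Module ℂ W]
    (f : W →ₗ[ℂ] ℂ) : V ⊗[ℂ] W →ₗ[ℂ] V :=
  (TensorProduct.rid ℂ V).toLinearMap ∘ₗ f.lTensor V

lemma slice_tmul {V W : Type*} [AddCommGroup V] [Module ℂ V] [AddCommGroup W] [Module ℂ W]
    (f : W →ₗ[ℂ] ℂ) (x : V) (y : W) : slice f (x ⊗ₜ[ℂ] y) = f y • x := by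
  simp [slice]

lemma slice_copairing (X Y : C) [ExactPairing X Y] (v : ω.obj X) :
    slice ((TensorProduct.curry (pairing X Y)).flip v) (copairing ω X Y) = v := by
  have e1 : ∀ t : ω.obj X ⊗[ℂ] ω.obj Y,
      lin (ω.map (ρ_ X).hom) (lin (ω.map (X ◁ ε_ X Y)) (lin (ω.map (α_ X Y X).hom)
        (mu ω (X ⊗ Y) X (mu ω X Y t ⊗ₜ v)))) =
      slice ((TensorProduct.curry (pairing X Y)).flip v) t := by
    intro t
    induction t with
    | zero => simp
    | add s t hs ht => simp only [map_add, TensorProduct.add_tmul, hs, ht]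
    | tmul x y =>
      rw [map_associator_mu, map_whiskerLeft_mu, map_evaluation_mu, TensorProduct.tmul_smul,
        map_smul, map_smul, map_rightUnitor_mu, slice_tmul]
      rfl
  rw [← e1, mu_copairing, ← map_whiskerRight_mu, ← lin_map_comp, ← lin_map_comp, ← lin_map_comp,
    ExactPairing.evaluation_coevaluation_assoc]
  simp only [Iso.inv_hom_id, Category.comp_id]
  exact map_leftUnitor_mu v

lemma slice_mate {X Y : C} [HasRightDual X] [HasRightDual Y] (f : X ⟶ Y)
    (g : ω.obj (Xᘁ) →ₗ[ℂ] ℂ) :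
    lin (ω.map f) (slice g (copairing ω X Xᘁ)) =
      slice (g ∘ₗ lin (ω.map (fᘁ))) (copairing ω Y Yᘁ) := by
  have h1 : TensorProduct.map (lin (ω.map f)) LinearMap.id (copairing ω X Xᘁ) =
      TensorProduct.map LinearMap.id (lin (ω.map (fᘁ))) (copairing ω Y Yᘁ) := by
    apply (mu ω Y Xᘁ).injective
    have e1 := map_tensorHom_mu (ω := ω) f (𝟙 (Xᘁ)) (copairing ω X Xᘁ)
    have e2 := map_tensorHom_mu (ω := ω) (𝟙 Y) (fᘁ) (copairing ω Y Yᘁ)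
    rw [ω.map_id] at e1 e2
    refine e1.symm.trans (Eq.trans ?_ e2)
    rw [mu_copairing, mu_copairing, ← lin_map_comp, ← lin_map_comp, tensorHom_id, id_tensorHom,
      coevaluation_comp_rightAdjointMate]
  have h2 : ∀ t : ω.obj X ⊗[ℂ] ω.obj Xᘁ, lin (ω.map f) (slice g t) =
      slice g (TensorProduct.map (lin (ω.map f)) LinearMap.id t) := by
    intro t
    induction t with
    | zero => simp
    | add s t hs ht => simp only [map_add, hs, ht]
    | tmul x y => simp [slice_tmul]
  have h3 : ∀ t : ω.obj Y ⊗[ℂ] ω.obj Yᘁ, slice g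
      (TensorProduct.map LinearMap.id (lin (ω.map (fᘁ))) t) =
      slice (g ∘ₗ lin (ω.map (fᘁ))) t := by
    intro t
    induction t with
    | zero => simp
    | add s t hs ht => simp only [map_add, hs, ht]
    | tmul x y => simp [slice_tmul]
  rw [h2, h1, h3]

lemma pairing_mate {X Y : C} [HasRightDual X] [HasRightDual Y] (f : X ⟶ Y)
    (y : ω.obj Yᘁ) (x : ω.obj X) :
    pairing X Xᘁ (lin (ω.map (fᘁ)) y ⊗ₜ[ℂ] x) = pairing Y Yᘁ (y ⊗ₜ[ℂ] lin (ω.map f) x) := by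
  change unitEquiv ω (lin (ω.map _) (mu ω _ _ _)) = unitEquiv ω (lin (ω.map _) (mu ω _ _ _))
  rw [← map_whiskerRight_mu, ← map_whiskerLeft_mu, ← lin_map_comp, ← lin_map_comp,
    rightAdjointMate_comp_evaluation]

end Fiber

/-! ### Reconstruction of a Hopf algebra from a fiber functor -/

section Act2

variable {A : Type u} {B : Type v} [Ring A] [Algebra ℂ A] [Ring B] [Algebra ℂ B]
  {V W : Type} [AddCommGroup V] [Module ℂ V] [AddCommGroup W] [Module ℂ W]

/-- The action of `A ⊗ B` on `V ⊗ W`. -/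
def act2 (ρ : A →ₐ[ℂ] Module.End ℂ V) (σ : B →ₐ[ℂ] Module.End ℂ W) :
    A ⊗[ℂ] B →ₐ[ℂ] Module.End ℂ (V ⊗[ℂ] W) :=
  (Module.endTensorEndAlgHom (R := ℂ) (S := ℂ) (A := ℂ) (M := V) (N := W)).comp
    (Algebra.TensorProduct.map ρ σ)

lemma act2_tmul (ρ : A →ₐ[ℂ] Module.End ℂ V) (σ : B →ₐ[ℂ] Module.End ℂ W) (a : A) (b : B) :
    act2 ρ σ (a ⊗ₜ b) = TensorProduct.map (ρ a) (σ b) := rfl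

lemma act2_bijective (ρ : A →ₐ[ℂ] Module.End ℂ V) (σ : B →ₐ[ℂ] Module.End ℂ W) {p : V} {q : W}
    (hρ : Function.Bijective fun a => ρ a p) (hσ : Function.Bijective fun b => σ b q) :
    Function.Bijective fun t => act2 ρ σ t (p ⊗ₜ q) := by
  let e₁ : A ≃ₗ[ℂ] V := LinearEquiv.ofBijective (ρ.toLinearMap.flip p) hρ
  let e₂ : B ≃ₗ[ℂ] W := LinearEquiv.ofBijective (σ.toLinearMap.flip q) hσ
  convert (TensorProduct.congr e₁ e₂).bijective using 1
  funext t
  induction t with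
  | zero => simp
  | add s t hs ht => simp only [map_add, LinearMap.add_apply, hs, ht]
  | tmul a b => rfl

end Act2

lemma slice_add {V W : Type*} [AddCommGroup V] [Module ℂ V] [AddCommGroup W] [Module ℂ W]
    (f g : W →ₗ[ℂ] ℂ) (t : V ⊗[ℂ] W) : slice (f + g) t = slice f t + slice g t := by
  simp [slice, LinearMap.lTensor_add]

lemma slice_smul {V W : Type*} [AddCommGroup V] [Module ℂ V] [AddCommGroup W] [Module ℂ W]
    (c : ℂ) (f : W →ₗ[ℂ] ℂ) (t : V ⊗[ℂ] W) : slice (c • f) t = c • slice f t := by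
  simp [slice, LinearMap.lTensor_smul]

section Tannaka

variable {C : Type u₁} [Category.{v₁} C] {ω : C ⥤ Vect}

lemma endAct_naturality (h : End ω) {X Y : C} (f : X ⟶ Y) (v : ω.obj X) :
    lin (ω.map f) (endAct ω X h v) = endAct ω Y h (lin (ω.map f) v) :=
  (congrArg (fun k => lin k v) (NatTrans.naturality (h : ω ⟶ ω) f)).symm

lemma end_ext {h k : End ω} (hk : ∀ X v, endAct ω X h v = endAct ω X k v) : h = k :=
  NatTrans.ext (funext fun X => FGModuleCat.hom_ext (LinearMap.ext (hk X)))

/-- The endomorphism of a functor with the given components. -/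
def endMk (T : ∀ X, Module.End ℂ (ω.obj X))
    (hT : ∀ {X Y : C} (f : X ⟶ Y) v, lin (ω.map f) (T X v) = T Y (lin (ω.map f) v)) : End ω where
  app X := FGModuleCat.ofHom (T X)
  naturality _ _ f := FGModuleCat.hom_ext (LinearMap.ext fun v => (hT f v).symm)

variable [Preadditive C] [Linear ℂ C] {P : C} {ξ : ω.obj P} (hP : IsUniversal ω P ξ)

lemma actsNaturally_endAct : ActsNaturally ω (endAct ω) := fun f h v => endAct_naturality h f v

variable [ω.Additive] [ω.Linear ℂ]

include hP in
lemma endAct_bijective : Function.Bijective fun h : End ω => endAct ω P h ξ := by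
  constructor
  · intro h k hk
    refine end_ext fun X v => ?_
    obtain ⟨f, rfl⟩ := hP.exists_map X v
    rw [← endAct_naturality, ← endAct_naturality]
    exact congrArg _ hk
  · intro p
    choose f hf using hP.exists_map
    refine ⟨endMk (fun X =>
      { toFun := fun v => lin (ω.map (f X v)) p
        map_add' := fun v w => ?_
        map_smul' := fun c v => ?_ }) fun {X Y} g v => ?_, ?_⟩
    · have : f X (v + w) = f X v + f X w := hP.hom_ext (by
        rw [hf, ω.map_add]
        exact (congrArg₂ (· + ·) (hf X v) (hf X w)).symm)
      rw [this, ω.map_add]; rfl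
    · have : f X (c • v) = c • f X v := hP.hom_ext (by rw [hf, lin_map_smul, hf])
      rw [this, lin_map_smul]; rfl
    · have : f X v ≫ g = f Y (lin (ω.map g) v) := hP.hom_ext (by rw [lin_map_comp, hf, hf])
      change lin (ω.map g) (lin (ω.map (f X v)) p) = lin (ω.map (f Y _)) p
      rw [← this, lin_map_comp]
    · have : f P ξ = 𝟙 P := hP.hom_ext (by rw [hf, lin_map_id])
      change lin (ω.map (f P ξ)) p = p
      rw [this, lin_map_id]

end Tannaka

section Bialgebra

variable {C : Type u₁} [Category.{v₁} C] [MonoidalCategory C] {ω : C ⥤ Vect} [ω.Monoidal]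
  {P : C} {ξ : ω.obj P} (hP : IsUniversal ω P ξ) {H : Type u} [Ring H] [Algebra ℂ H]
  {act : ∀ X : C, H →ₐ[ℂ] Module.End ℂ (ω.obj X)} (hact : ActsNaturally ω act)
  (hb : Function.Bijective fun h : H => act P h ξ)


include hP hact hb in
lemma exists_comul : ∃ Δ : H →ₐ[ℂ] H ⊗[ℂ] H, ∀ h X Y v,
    act (X ⊗ Y) h (mu ω X Y v) =
      mu ω X Y (act2 (act X) (act Y) (Δ h) v) := by
  have hb2 := act2_bijective (act P) (act P) hb hb
  let E : H ⊗[ℂ] H ≃ₗ[ℂ] ω.obj P ⊗[ℂ] ω.obj P :=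
    LinearEquiv.ofBijective ((act2 (act P) (act P)).toLinearMap.flip (ξ ⊗ₜ ξ)) hb2
  let D : H →ₗ[ℂ] H ⊗[ℂ] H := E.symm.toLinearMap ∘ₗ (mu ω P P).symm.toLinearMap ∘ₗ
    (act (P ⊗ P)).toLinearMap.flip (mu ω P P (ξ ⊗ₜ ξ))
  have hD : ∀ h, mu ω P P (act2 (act P) (act P) (D h) (ξ ⊗ₜ ξ)) =
      act (P ⊗ P) h (mu ω P P (ξ ⊗ₜ ξ)) := fun h => by
    have : act2 (act P) (act P) (D h) (ξ ⊗ₜ ξ) = E (D h) := rfl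
    rw [this]
    simp only [D, LinearMap.comp_apply, LinearEquiv.coe_coe, LinearEquiv.apply_symm_apply]
    rfl
  have nat : ∀ {X X' Y Y' : C} (f : X ⟶ X') (g : Y ⟶ Y') (t : H ⊗[ℂ] H)
      (v : ω.obj X ⊗[ℂ] ω.obj Y),
      TensorProduct.map (lin (ω.map f)) (lin (ω.map g)) (act2 (act X) (act Y) t v) =
      act2 (act X') (act Y') t
        (TensorProduct.map (lin (ω.map f)) (lin (ω.map g)) v) := by
    intro X X' Y Y' f g t v
    induction t with
    | zero => simp
    | add s t hs ht => simp only [map_add, LinearMap.add_apply, hs, ht]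
    | tmul h k =>
      induction v with
      | zero => simp
      | add s t hs ht => simp only [map_add, hs, ht]
      | tmul x y =>
        simp only [act2_tmul, TensorProduct.map_tmul, hact f, hact g]
  have key : ∀ h X Y v, act (X ⊗ Y) h (mu ω X Y v) =
      mu ω X Y (act2 (act X) (act Y) (D h) v) := by
    intro h X Y v
    induction v with
    | zero => simp
    | add s t hs ht => simp only [map_add, hs, ht]
    | tmul x y =>
      obtain ⟨f, rfl⟩ := hP.exists_map X x
      obtain ⟨g, rfl⟩ := hP.exists_map Y y
      rw [← TensorProduct.map_tmul, ← map_tensorHom_mu, ← hact, ← hD,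
        map_tensorHom_mu, nat]
  have ext : ∀ s t : H ⊗[ℂ] H, (∀ v, act2 (act P) (act P) s v =
      act2 (act P) (act P) t v) → s = t := fun s t hst => hb2.1 (hst _)
  refine ⟨AlgHom.ofLinearMap D (ext _ _ fun v => ?_) fun h k => ext _ _ fun v => ?_, key⟩
  · apply (mu ω P P).injective
    rw [← key, map_one, map_one]
    rfl
  · apply (mu ω P P).injective
    rw [← key, map_mul, map_mul, Module.End.mul_apply, Module.End.mul_apply, key, key]

variable (ω act) in
lemma exists_counit : ∃ e : H →ₐ[ℂ] ℂ, ∀ h,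
    act (𝟙_ C) h (unitElt ω) = e h • unitElt ω := by
  have key : ∀ h, act (𝟙_ C) h (unitElt ω) =
      unitEquiv ω (act (𝟙_ C) h (unitElt ω)) • unitElt ω := fun h => (unitEquiv_smul _).symm
  refine ⟨AlgHom.ofLinearMap ((unitEquiv ω).toLinearMap ∘ₗ
    (act (𝟙_ C)).toLinearMap.flip (unitElt ω)) ?_ ?_, key⟩
  · change unitEquiv ω (act (𝟙_ C) 1 (unitElt ω)) = 1
    rw [map_one]
    exact unitEquiv_unitElt
  · intro h k
    change unitEquiv ω (act (𝟙_ C) (h * k) (unitElt ω)) =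
      unitEquiv ω (act (𝟙_ C) h (unitElt ω)) * unitEquiv ω (act (𝟙_ C) k (unitElt ω))
    rw [map_mul, Module.End.mul_apply, key k, map_smul, map_smul, smul_eq_mul, mul_comm,
      unitEquiv_smul]

/-- The bialgebra structure on an algebra that represents a fiber functor. -/
abbrev bialgebraOfActs : Bialgebra ℂ H :=
  have hb2 := act2_bijective (act P) (act P) hb hb
  let Δ := (exists_comul hP hact hb).choose
  have hΔ : ∀ (h : H) (X Y : C) (v : ω.obj X ⊗[ℂ] ω.obj Y), act (X ⊗ Y) h (mu ω X Y v) =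
      mu ω X Y (act2 (act X) (act Y) (Δ h) v) := (exists_comul hP hact hb).choose_spec
  let e := (exists_counit ω act).choose
  have he : ∀ h : H, act (𝟙_ C) h (unitElt ω) = e h • unitElt ω := (exists_counit ω act).choose_spec
  Bialgebra.ofAlgHom Δ e
    (by
      refine AlgHom.ext fun h => ?_
      have hb3 := act2_bijective (V := ω.obj P) (W := ω.obj P ⊗[ℂ] ω.obj P) (act P)
        (act2 (act P) (act P)) hb hb2
      apply hb3.1
      change act2 (act P) (act2 (act P) (act P)) _ _ =
        act2 (act P) (act2 (act P) (act P)) _ _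
      let m : ω.obj P ⊗[ℂ] (ω.obj P ⊗[ℂ] ω.obj P) ≃ₗ[ℂ] ω.obj (P ⊗ P ⊗ P) :=
        TensorProduct.congr (LinearEquiv.refl ℂ _) (mu ω P P) ≪≫ₗ mu ω P (P ⊗ P)
      have hm : ∀ x y z, m (x ⊗ₜ (y ⊗ₜ z)) = mu ω P (P ⊗ P) (x ⊗ₜ mu ω P P (y ⊗ₜ z)) :=
        fun _ _ _ => rfl
      have e1 : ∀ t : H ⊗[ℂ] H, m (act2 (act P)
          (act2 (act P) (act P))
          (Algebra.TensorProduct.map (AlgHom.id ℂ (H)) Δ t) (ξ ⊗ₜ (ξ ⊗ₜ ξ))) =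
          mu ω P (P ⊗ P) (act2 (act P) (act (P ⊗ P)) t
            (ξ ⊗ₜ mu ω P P (ξ ⊗ₜ ξ))) := by
        intro t
        induction t with
        | zero => simp
        | add s t hs ht => simp only [map_add, LinearMap.add_apply, hs, ht]
        | tmul a b =>
          rw [Algebra.TensorProduct.map_tmul, act2_tmul, act2_tmul, TensorProduct.map_tmul,
            TensorProduct.map_tmul, hΔ]
          rfl
      have e2 : ∀ t : H ⊗[ℂ] H, m (act2 (act P)
          (act2 (act P) (act P))
          (TensorProduct.assoc ℂ _ _ _ (Algebra.TensorProduct.map Δ (AlgHom.id ℂ (H)) t))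
            (ξ ⊗ₜ (ξ ⊗ₜ ξ))) =
          lin (ω.map (α_ P P P).hom) (mu ω (P ⊗ P) P (act2 (act (P ⊗ P)) (act P) t
            (mu ω P P (ξ ⊗ₜ ξ) ⊗ₜ ξ))) := by
        intro t
        induction t with
        | zero => simp
        | add s t hs ht => simp only [map_add, LinearMap.add_apply, hs, ht]
        | tmul a b =>
          rw [Algebra.TensorProduct.map_tmul, act2_tmul, TensorProduct.map_tmul, hΔ]
          generalize Δ a = s
          induction s with
          | zero => simp
          | add s t hs ht => simp only [map_add, LinearMap.add_apply, TensorProduct.add_tmul, hs, ht]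
          | tmul c d =>
            rw [act2_tmul, TensorProduct.map_tmul, map_associator_mu]
            rfl
      apply m.injective
      refine (e2 (Δ h)).trans (Eq.trans ?_ (e1 (Δ h)).symm)
      rw [← hΔ, ← hΔ, hact, map_associator_mu])
    (by
      refine AlgHom.ext fun h => ?_
      have e1 : ∀ t : H ⊗[ℂ] H, act P (TensorProduct.lid ℂ _
          (Algebra.TensorProduct.map e (AlgHom.id ℂ (H)) t)) ξ = lin (ω.map (λ_ P).hom)
            (mu ω (𝟙_ C) P (act2 (act (𝟙_ C)) (act P) t (unitElt ω ⊗ₜ ξ))) := by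
        intro t
        induction t with
        | zero => simp
        | add s t hs ht => simp only [map_add, LinearMap.add_apply, hs, ht]
        | tmul a b =>
          rw [Algebra.TensorProduct.map_tmul, act2_tmul, TensorProduct.map_tmul, he,
            ← TensorProduct.smul_tmul', map_smul, map_smul, map_leftUnitor_mu]
          simp
      apply (TensorProduct.lid ℂ (H)).injective
      refine Eq.trans (hb.1 ((e1 (Δ h)).trans ?_)) (LinearEquiv.apply_symm_apply _ h).symm
      rw [← hΔ, hact, map_leftUnitor_mu])
    (by
      refine AlgHom.ext fun h => ?_
      have e1 : ∀ t : H ⊗[ℂ] H, act P (TensorProduct.rid ℂ _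
          (Algebra.TensorProduct.map (AlgHom.id ℂ (H)) e t)) ξ = lin (ω.map (ρ_ P).hom)
            (mu ω P (𝟙_ C) (act2 (act P) (act (𝟙_ C)) t (ξ ⊗ₜ unitElt ω))) := by
        intro t
        induction t with
        | zero => simp
        | add s t hs ht => simp only [map_add, LinearMap.add_apply, hs, ht]
        | tmul a b =>
          rw [Algebra.TensorProduct.map_tmul, act2_tmul, TensorProduct.map_tmul, he,
            TensorProduct.tmul_smul, map_smul, map_smul, map_rightUnitor_mu]
          simp
      apply (TensorProduct.rid ℂ (H)).injective
      refine Eq.trans (hb.1 ((e1 (Δ h)).trans ?_)) (LinearEquiv.apply_symm_apply _ h).symm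
      rw [← hΔ, hact, map_rightUnitor_mu])

end Bialgebra

section Hopf

variable {C : Type u₁} [Category.{v₁} C] [MonoidalCategory C] {ω : C ⥤ Vect} [ω.Monoidal]
  {H : Type u} [Ring H]

section Compat

variable [Bialgebra ℂ H]

/-- The action of a bialgebra on a monoidal functor is compatible with the tensor product. -/
structure ActsMonoidally (ω : C ⥤ Vect) [ω.Monoidal]
    (act : ∀ X : C, H →ₐ[ℂ] Module.End ℂ (ω.obj X)) : Prop where
  natural : ActsNaturally ω act
  comul : ∀ (h : H) (X Y : C) (v : ω.obj X ⊗[ℂ] ω.obj Y),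
    act (X ⊗ Y) h (mu ω X Y v) = mu ω X Y (actTensor (act X) (act Y) (Coalgebra.comul (R := ℂ) h) v)
  counit : ∀ h : H, act (𝟙_ C) h (unitElt ω) = Coalgebra.counit (R := ℂ) h • unitElt ω

variable {act : ∀ X : C, H →ₐ[ℂ] Module.End ℂ (ω.obj X)} (hact : ActsMonoidally ω act)
include hact

lemma ActsMonoidally.act_unit (h : H) (v : ω.obj (𝟙_ C)) :
    act (𝟙_ C) h v = Coalgebra.counit (R := ℂ) h • v := by
  rw [← unitEquiv_smul v, map_smul, hact.counit, smul_comm]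

lemma ActsMonoidally.pairing_comul (X Y : C) [ExactPairing X Y] (h : H)
    (v : ω.obj Y ⊗[ℂ] ω.obj X) :
    pairing X Y (actTensor (act Y) (act X) (Coalgebra.comul (R := ℂ) h) v) =
      Coalgebra.counit (R := ℂ) h * pairing X Y v := by
  change unitEquiv ω (lin (ω.map _) (mu ω Y X _)) = _
  rw [← hact.comul, hact.natural, hact.act_unit, map_smul]
  rfl

lemma ActsMonoidally.comul_copairing (X Y : C) [ExactPairing X Y] (h : H) :
    actTensor (act X) (act Y) (Coalgebra.comul (R := ℂ) h) (copairing ω X Y) =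
      Coalgebra.counit (R := ℂ) h • copairing ω X Y := by
  apply (mu ω X Y).injective
  rw [← hact.comul, mu_copairing, ← hact.natural, hact.counit, map_smul, map_smul, mu_copairing]

/-- The dual action. -/
def dualAct (act : ∀ X : C, H →ₐ[ℂ] Module.End ℂ (ω.obj X)) (X Y : C) [ExactPairing X Y] :
    H →ₗ[ℂ] Module.End ℂ (ω.obj X) where
  toFun h :=
    { toFun := fun v => slice ((TensorProduct.curry (pairing X Y)).flip v ∘ₗ act Y h)
        (copairing ω X Y)
      map_add' := fun v w => by rw [map_add, LinearMap.add_comp, slice_add]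
      map_smul' := fun c v => by rw [map_smul, LinearMap.smul_comp, slice_smul]; rfl }
  map_add' h k := LinearMap.ext fun v => by
    change slice ((TensorProduct.curry (pairing X Y)).flip v ∘ₗ act Y (h + k)) (copairing ω X Y) =
      slice ((TensorProduct.curry (pairing X Y)).flip v ∘ₗ act Y h) (copairing ω X Y) +
      slice ((TensorProduct.curry (pairing X Y)).flip v ∘ₗ act Y k) (copairing ω X Y)
    rw [map_add, LinearMap.comp_add, slice_add]
  map_smul' c h := LinearMap.ext fun v => by
    change slice ((TensorProduct.curry (pairing X Y)).flip v ∘ₗ act Y (c • h)) (copairing ω X Y) =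
      c • slice ((TensorProduct.curry (pairing X Y)).flip v ∘ₗ act Y h) (copairing ω X Y)
    rw [map_smul, LinearMap.comp_smul, slice_smul]

omit hact in
lemma dualAct_apply (X Y : C) [ExactPairing X Y] (h : H) (v : ω.obj X) :
    dualAct act X Y h v = slice ((TensorProduct.curry (pairing X Y)).flip v ∘ₗ act Y h)
        (copairing ω X Y) := rfl

lemma ActsMonoidally.mul_dualAct_rTensor (X Y : C) [ExactPairing X Y] (h : H) :
    LinearMap.mul' ℂ _ (TensorProduct.map (dualAct act X Y) (act X).toLinearMap
      (Coalgebra.comul (R := ℂ) h)) = Coalgebra.counit (R := ℂ) h • 1 := by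
  refine LinearMap.ext fun v => ?_
  have e : ∀ t : H ⊗[ℂ] H,
      LinearMap.mul' ℂ _ (TensorProduct.map (dualAct act X Y) (act X).toLinearMap t) v =
      slice (pairing X Y ∘ₗ actTensor (act Y) (act X) t ∘ₗ (TensorProduct.mk ℂ _ _).flip v)
        (copairing ω X Y) := by
    intro t
    induction t with
    | zero => simp [slice]
    | add s t hs ht => simp only [map_add, LinearMap.add_apply, hs, ht, LinearMap.comp_add,
        LinearMap.add_comp, slice_add]
    | tmul a b => rfl
  rw [e]
  have e2 : pairing X Y ∘ₗ actTensor (act Y) (act X) (Coalgebra.comul (R := ℂ) h) ∘ₗ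
      (TensorProduct.mk ℂ _ _).flip v =
      Coalgebra.counit (R := ℂ) h • (TensorProduct.curry (pairing X Y)).flip v :=
    LinearMap.ext fun y => hact.pairing_comul X Y h (y ⊗ₜ v)
  rw [e2, slice_smul, slice_copairing]
  rfl

lemma ActsMonoidally.mul_dualAct_lTensor (X Y : C) [ExactPairing X Y] (h : H) :
    LinearMap.mul' ℂ _ (TensorProduct.map (act X).toLinearMap (dualAct act X Y)
      (Coalgebra.comul (R := ℂ) h)) = Coalgebra.counit (R := ℂ) h • 1 := by
  refine LinearMap.ext fun v => ?_
  have e : ∀ t : H ⊗[ℂ] H,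
      LinearMap.mul' ℂ _ (TensorProduct.map (act X).toLinearMap (dualAct act X Y) t) v =
      slice ((TensorProduct.curry (pairing X Y)).flip v)
        (actTensor (act X) (act Y) t (copairing ω X Y)) := by
    intro t
    induction t with
    | zero => simp
    | add s t hs ht => simp only [map_add, LinearMap.add_apply, hs, ht]
    | tmul a b =>
      change act X a (dualAct act X Y b v) = _
      rw [dualAct_apply]
      induction copairing ω X Y with
      | zero => simp
      | add s t hs ht => simp only [map_add, hs, ht]
      | tmul x y =>
        rw [actTensor_tmul, TensorProduct.map_tmul, slice_tmul, slice_tmul, map_smul]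
        rfl
  rw [e, hact.comul_copairing, map_smul, slice_copairing]
  rfl

lemma ActsMonoidally.dualAct_naturality [RightRigidCategory C] (h : H) {X Y : C} (f : X ⟶ Y)
    (v : ω.obj X) :
    lin (ω.map f) (dualAct act X Xᘁ h v) = dualAct act Y Yᘁ h (lin (ω.map f) v) := by
  rw [dualAct_apply, dualAct_apply, slice_mate]
  refine congrArg (fun g => slice g (copairing ω Y Yᘁ)) (LinearMap.ext fun y => ?_)
  change pairing X Xᘁ (act _ h (lin (ω.map (fᘁ)) y) ⊗ₜ[ℂ] v) = pairing Y Yᘁ (_ ⊗ₜ[ℂ] _)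
  rw [← hact.natural, pairing_mate]

/-- A bialgebra that represents a fiber functor on a rigid category is a Hopf algebra. -/
lemma ActsMonoidally.exists_antipode [RightRigidCategory C]
    {P : C} {ξ : ω.obj P} (hP : IsUniversal ω P ξ)
    (hb : Function.Bijective fun h : H => act P h ξ) :
    ∃ S : H →ₗ[ℂ] H,
      LinearMap.mul' ℂ H ∘ₗ S.rTensor H ∘ₗ Coalgebra.comul =
        (Algebra.linearMap ℂ H) ∘ₗ Coalgebra.counit ∧
      LinearMap.mul' ℂ H ∘ₗ S.lTensor H ∘ₗ Coalgebra.comul =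
        (Algebra.linearMap ℂ H) ∘ₗ Coalgebra.counit := by
  let E : H ≃ₗ[ℂ] ω.obj P := LinearEquiv.ofBijective ((act P).toLinearMap.flip ξ) hb
  have hE : ∀ h, E h = act P h ξ := fun _ => rfl
  let S : H →ₗ[ℂ] H := E.symm.toLinearMap ∘ₗ (dualAct act P Pᘁ).flip ξ
  have hS : ∀ h X v, act X (S h) v = dualAct act X Xᘁ h v := by
    intro h X v
    obtain ⟨f, rfl⟩ := hP.exists_map X v
    rw [← hact.natural, ← hact.dualAct_naturality, ← hE]
    congr 1
    exact LinearEquiv.apply_symm_apply _ _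
  have hS' : ∀ X, (act X).toLinearMap ∘ₗ S = dualAct act X Xᘁ := fun X =>
    LinearMap.ext fun h => LinearMap.ext fun v => hS h X v
  refine ⟨S, LinearMap.ext fun h => hb.1 ?_, LinearMap.ext fun h => hb.1 ?_⟩
  · have e : ∀ t : H ⊗[ℂ] H, act P (LinearMap.mul' ℂ H (S.rTensor H t)) =
        LinearMap.mul' ℂ _ (TensorProduct.map ((act P).toLinearMap ∘ₗ S) (act P).toLinearMap t) := by
      intro t
      induction t with
      | zero => simp
      | add s t hs ht => simp only [map_add, hs, ht]
      | tmul a b => exact map_mul (act P) _ _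
    change act P _ ξ = act P _ ξ
    refine (LinearMap.congr_fun ((e _).trans ?_) ξ)
    rw [hS', hact.mul_dualAct_rTensor]
    exact ((act P).commutes _).symm
  · have e : ∀ t : H ⊗[ℂ] H, act P (LinearMap.mul' ℂ H (S.lTensor H t)) =
        LinearMap.mul' ℂ _ (TensorProduct.map (act P).toLinearMap ((act P).toLinearMap ∘ₗ S) t) := by
      intro t
      induction t with
      | zero => simp
      | add s t hs ht => simp only [map_add, hs, ht]
      | tmul a b => exact map_mul (act P) _ _
    change act P _ ξ = act P _ ξ
    refine (LinearMap.congr_fun ((e _).trans ?_) ξ)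
    rw [hS', hact.mul_dualAct_lTensor]
    exact ((act P).commutes _).symm

end Compat

/-- The algebra that represents a fiber functor on a rigid category is a Hopf algebra. -/
theorem exists_hopfAlgebra [RightRigidCategory C] {P : C} {ξ : ω.obj P}
    (hP : IsUniversal ω P ξ) {B : Type u} [Ring B] [Algebra ℂ B]
    {act : ∀ X : C, B →ₐ[ℂ] Module.End ℂ (ω.obj X)}
    (hact : ActsNaturally ω act) (hb : Function.Bijective fun h : B => act P h ξ) :
    ∃ (H : Type u) (_ : Ring H) (_ : HopfAlgebra ℂ H) (e : H ≃ₐ[ℂ] B),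
      ActsMonoidally ω (fun X => (act X).comp (e : H →ₐ[ℂ] B)) := by
  let i := bialgebraOfActs hP hact hb
  have h : ActsMonoidally ω act := ⟨hact, (exists_comul hP hact hb).choose_spec,
    (exists_counit ω act).choose_spec⟩
  obtain ⟨S, h1, h2⟩ := h.exists_antipode hP hb
  exact ⟨B, inferInstance, { i with
    antipode := S, mul_antipode_rTensor_comul := h1, mul_antipode_lTensor_comul := h2 },
    AlgEquiv.refl, h⟩

end Hopf

/-! ### Equivalences with categories of modules -/

section Equivalence

variable {M : Type u₂} [Category.{v₂} M] [Preadditive M] [Linear ℂ M]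

lemma essSurj_of_isSimpleSystem [Limits.HasFiniteBiproducts M] {N : Type u₁} [Category.{v₁} N]
    [Preadditive N] [Linear ℂ N] (G : M ⥤ N) [G.Additive] {K : Type} [Fintype K] {t : K → M}
    (h : IsSimpleSystem fun x => G.obj (t x)) : G.EssSurj where
  mem_essImage W := by
    obtain ⟨n, τ, b, ⟨hb⟩, ⟨i⟩⟩ := h.decomposition W
    refine ⟨⨁ fun j => t (τ j), ⟨?_ ≪≫ i⟩⟩
    let c := Limits.biproduct.bicone fun j => t (τ j)
    have hc : ∑ j, c.π j ≫ c.ι j = 𝟙 c.pt :=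
      Limits.IsBilimit.total (Limits.biproduct.isBilimit fun j => t (τ j))
    exact
      { hom := ∑ j, G.map (c.π j) ≫ b.ι j
        inv := ∑ j, b.π j ≫ G.map (c.ι j)
        hom_inv_id := by
          have : ∀ j, ∑ k, (G.map (c.π j) ≫ b.ι j) ≫ b.π k ≫ G.map (c.ι k) =
              G.map (c.π j ≫ c.ι j) := fun j => by
            rw [Finset.sum_eq_single j]
            · simp
            · intro k _ hk
              rw [Category.assoc, Limits.bicone_ι_π_ne_assoc b (Ne.symm hk)]
              simp
            · simp
          rw [Preadditive.sum_comp]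
          simp only [Preadditive.comp_sum, this]
          rw [← G.map_sum, hc, G.map_id]
        inv_hom_id := by
          have : ∀ j, ∑ k, (b.π j ≫ G.map (c.ι j)) ≫ G.map (c.π k) ≫ b.ι k =
              b.π j ≫ b.ι j := fun j => by
            rw [Finset.sum_eq_single j]
            · rw [Category.assoc, ← G.map_comp_assoc, Limits.bicone_ι_π_self c, G.map_id, Category.id_comp]
            · intro k _ hk
              rw [Category.assoc, ← G.map_comp_assoc, Limits.bicone_ι_π_ne c (Ne.symm hk)]
              simp
            · simp
          rw [Preadditive.sum_comp]
          simp only [Preadditive.comp_sum, this]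
          exact Limits.IsBilimit.total hb }

theorem isEquivalence_of_isUniversal [Limits.HasFiniteBiproducts M]
    {A : Type v} [Ring A] [Algebra ℂ A] (G : M ⥤ FdMod A) [G.Additive]
    [(G ⋙ FdMod.forget A).Linear ℂ]
    {P : M} {ξ : (G.obj P).V} (hP : IsUniversal (G ⋙ FdMod.forget A) P ξ)
    {K : Type} [Fintype K] {t : K → M} (ht : IsSimpleSystem t)
    (hF : ∀ x, Nontrivial (G.obj (t x)).V)
    (hA : Function.Bijective fun a : A => (G.obj P).ρ a ξ) : G.IsEquivalence := by
  classical
  have hact : ActsNaturally (G ⋙ FdMod.forget A) (fun N => (G.obj N).ρ) := fun f a v =>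
    FdMod.comm_apply (G.map f) a v
  have hfull := hP.fullyActs ht hF hact hA.2
  have h1 : (G ⋙ FdMod.forget A).Faithful := hP.faithful ht hF
  have : G.Faithful := Functor.Faithful.of_comp G (FdMod.forget A)
  have : G.Full := ⟨fun {U V} f => by
    obtain ⟨g, hg⟩ := (hfull U V (lin f.1)).1 f.2
    exact ⟨g, Subtype.ext (FGModuleCat.hom_ext hg)⟩⟩
  have : G.EssSurj := essSurj_of_isSimpleSystem G (t := t)
    (FdMod.isSimpleSystem (hP.bijective_pi ht hact hA) hF)
  exact {}

end Equivalence

section Fiber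

variable {C : Type u₁} [Category.{v₁} C] [Preadditive C] [Linear ℂ C] [MonoidalCategory C]
  (ω : C ⥤ Vect) [ω.Additive] [ω.Linear ℂ] [ω.Monoidal]

lemma nontrivial_obj [RightRigidCategory C] [MonoidalPreadditive C] {I : Type} [Fintype I]
    {s : I → C} (hs : IsSimpleSystem s)
    (hu : Module.finrank ℂ (𝟙_ C ⟶ 𝟙_ C) = 1) {X : C} (hX : 𝟙 X ≠ 0) : Nontrivial (ω.obj X) := by
  by_contra hn
  rw [not_nontrivial_iff_subsingleton] at hn
  have hη : η_ X Xᘁ ≠ 0 := by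
    intro h0
    apply hX
    have h1 := ExactPairing.evaluation_coevaluation X Xᘁ
    rw [h0, MonoidalPreadditive.zero_whiskerRight, Limits.zero_comp] at h1
    calc 𝟙 X = (λ_ X).inv ≫ ((λ_ X).hom ≫ (ρ_ X).inv) ≫ (ρ_ X).hom := by simp
      _ = 0 := by rw [← h1]; simp
  obtain ⟨x, a, b, hab⟩ := hs.exists_comp_eq_id hη
  have h1 : η_ X Xᘁ ≫ b ≫ a ≠ 0 := by
    intro h0
    have : a = 0 := by
      calc a = (a ≫ η_ X Xᘁ ≫ b) ≫ a := by rw [hab, Category.id_comp]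
        _ = a ≫ (η_ X Xᘁ ≫ b ≫ a) := by simp
        _ = 0 := by rw [h0, Limits.comp_zero]
    rw [this, Limits.zero_comp] at hab
    exact hs.id_ne_zero x hab.symm
  obtain ⟨c, hc⟩ := (finrank_eq_one_iff_of_nonzero' _ h1).1 hu (𝟙 _)
  apply unitElt_ne_zero (ω := ω)
  have h2 : lin (ω.map (𝟙 (𝟙_ C))) (unitElt ω) = 0 := by
    rw [← hc, lin_map_smul, lin_map_comp]
    have : lin (ω.map (η_ X Xᘁ)) (unitElt ω) = 0 := by
      rw [← mu_copairing]
      have : ∀ v : ω.obj X ⊗[ℂ] ω.obj Xᘁ, v = 0 := fun v => by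
        induction v with
        | zero => rfl
        | add s t hs ht => rw [hs, ht, add_zero]
        | tmul x y => rw [hn.elim x 0, TensorProduct.zero_tmul]
      rw [this (copairing ω X Xᘁ), map_zero]
    rw [this, map_zero, smul_zero]
  rwa [lin_map_id] at h2

variable {ω} in
variable {H : Type u} [Ring H] [Bialgebra ℂ H] {e : H →ₐ[ℂ] End ω}
  (hact : ActsMonoidally ω fun X => (endAct ω X).comp e)

instance comparison_additive {H : Type u} [Ring H] [Algebra ℂ H] (e : H →ₐ[ℂ] End ω) :
    (comparison ω e).Additive where
  map_add := Subtype.ext ω.map_add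

instance comparison_linear {H : Type u} [Ring H] [Algebra ℂ H] (e : H →ₐ[ℂ] End ω) :
    (comparison ω e ⋙ FdMod.forget H).Linear ℂ where
  map_smul f c := ω.map_smul c f

end Fiber

section Comparison

variable {C : Type u₁} [Category.{v₁} C] [MonoidalCategory C] {ω : C ⥤ Vect} [ω.Monoidal]
  {H : Type u} [Ring H] [Bialgebra ℂ H] {e : H →ₐ[ℂ] End ω}

/-- The comparison functor is monoidal. -/
@[reducible] def comparisonMonoidal (hact : ActsMonoidally ω fun X => (endAct ω X).comp e) :
    (comparison ω e).Monoidal :=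
  Functor.CoreMonoidal.toMonoidal
    { εIso := FdMod.mkIso (Functor.Monoidal.εIso ω) fun a => by
        refine LinearMap.ext fun (c : ℂ) => ?_
        change lin (Functor.LaxMonoidal.ε ω) (Coalgebra.counit (R := ℂ) a * c) =
          endAct ω (𝟙_ C) (e a) (lin (Functor.LaxMonoidal.ε ω) c)
        have h1 : ∀ d : ℂ, lin (Functor.LaxMonoidal.ε ω) d = d • unitElt ω := unitEquiv_symm
        rw [h1, h1, map_smul, mul_comm, mul_smul]
        exact congrArg _ (hact.counit a).symm
      μIso := fun X Y => FdMod.mkIso (Functor.Monoidal.μIso ω X Y) fun a =>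
        LinearMap.ext fun v => (hact.comul a X Y v).symm
      μIso_hom_natural_left := fun f Y => Subtype.ext (Functor.LaxMonoidal.μ_natural_left ω f Y)
      μIso_hom_natural_right := fun X f => Subtype.ext (Functor.LaxMonoidal.μ_natural_right ω X f)
      associativity := fun X Y Z => Subtype.ext (Functor.LaxMonoidal.associativity ω X Y Z)
      left_unitality := fun X => Subtype.ext (Functor.LaxMonoidal.left_unitality ω X)
      right_unitality := fun X => Subtype.ext (Functor.LaxMonoidal.right_unitality ω X) }

lemma comparison_μ (hact : ActsMonoidally ω fun X => (endAct ω X).comp e) (X Y : C) :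
    letI := comparisonMonoidal hact
    (FdMod.forget H).map (Functor.LaxMonoidal.μ (comparison ω e) X Y) =
      Functor.LaxMonoidal.μ ω X Y := rfl

lemma comparison_ε (hact : ActsMonoidally ω fun X => (endAct ω X).comp e) :
    letI := comparisonMonoidal hact
    (FdMod.forget H).map (Functor.LaxMonoidal.ε (comparison ω e)) = Functor.LaxMonoidal.ε ω := rfl

lemma ActsMonoidally.intertwines {act : ∀ X : C, H →ₐ[ℂ] Module.End ℂ (ω.obj X)}
    (hact : ActsMonoidally ω act) :
    Intertwines (M := C) (SN.bulkJ ω) act act (Bialgebra.comulAlgHom ℂ H) :=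
  fun X Y h v => (hact.comul h X Y v).symm

end Comparison

/-! ### Internal endomorphisms and corepresentable module functors -/

section Corepresentable

variable {M : Type u₂} [Category.{v₂} M] [Preadditive M] [Linear ℂ M]

lemma exists_corepresentable (Z : M) (hZ : ∀ N : M, Module.Finite ℂ (Z ⟶ N)) :
    ∃ (F : M ⥤ Vect) (_ : F.Additive) (_ : F.Linear ℂ) (η : F.obj Z), IsUniversal F Z η := by
  let e : ∀ N : M, (Z ⟶ N) ≃ₗ[ℂ] (Fin (Module.finrank ℂ (Z ⟶ N)) → ℂ) := fun N =>
    (Module.finBasis ℂ (Z ⟶ N)).equivFun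
  let F : M ⥤ Vect :=
    { obj := fun N => FGModuleCat.of ℂ (Fin (Module.finrank ℂ (Z ⟶ N)) → ℂ)
      map := fun {N N'} g => FGModuleCat.ofHom
        ((e N').toLinearMap ∘ₗ Linear.rightComp ℂ Z g ∘ₗ (e N).symm.toLinearMap)
      map_id := fun N => FGModuleCat.hom_ext (LinearMap.ext fun v => by
        change e N ((e N).symm v ≫ 𝟙 N) = v
        rw [Category.comp_id, LinearEquiv.apply_symm_apply])
      map_comp := fun {N N' N''} f g => FGModuleCat.hom_ext (LinearMap.ext fun v => by
        change e N'' ((e N).symm v ≫ f ≫ g) =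
          e N'' ((e N').symm (e N' ((e N).symm v ≫ f)) ≫ g)
        rw [LinearEquiv.symm_apply_apply, Category.assoc]) }
  have hF : ∀ {N N'} (g : N ⟶ N') (f : Z ⟶ N), lin (F.map g) (e N f) = e N' (f ≫ g) := by
    intro N N' g f
    change e N' ((e N).symm (e N f) ≫ g) = _
    rw [LinearEquiv.symm_apply_apply]
  refine ⟨F, ⟨fun {N N'} {f g} => FGModuleCat.hom_ext (LinearMap.ext fun v => ?_)⟩,
    ⟨fun {N N'} f c => FGModuleCat.hom_ext (LinearMap.ext fun v => ?_)⟩, e Z (𝟙 Z),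
    fun N v => ⟨(e N).symm v, ?_, fun g hg => ?_⟩⟩
  · change e N' ((e N).symm v ≫ (f + g)) = e N' ((e N).symm v ≫ f) + e N' ((e N).symm v ≫ g)
    rw [Preadditive.comp_add, map_add]
  · change e N' ((e N).symm v ≫ (c • f)) = c • e N' ((e N).symm v ≫ f)
    rw [Linear.comp_smul, map_smul]
  · change lin (F.map _) _ = _
    rw [hF, Category.id_comp, LinearEquiv.apply_symm_apply]
  · change lin (F.map _) _ = _ at hg
    rw [hF, Category.id_comp] at hg
    rw [← hg, LinearEquiv.symm_apply_apply]

/-- The morphism that corresponds to an element. -/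
def IsUniversal.toHom {F : M ⥤ Vect} [F.Additive] [F.Linear ℂ] {P : M} {ξ : F.obj P}
    (hP : IsUniversal F P ξ) (X : M) : F.obj X →ₗ[ℂ] (P ⟶ X) where
  toFun v := (hP.exists_map X v).choose
  map_add' v w := hP.hom_ext (by
    rw [(hP.exists_map X (v + w)).choose_spec, F.map_add]
    exact (congrArg₂ (· + ·) (hP.exists_map X v).choose_spec
      (hP.exists_map X w).choose_spec).symm)
  map_smul' c v := hP.hom_ext (by
    rw [(hP.exists_map X (c • v)).choose_spec, RingHom.id_apply, lin_map_smul,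
      (hP.exists_map X v).choose_spec])

section
variable {F : M ⥤ Vect} [F.Additive] [F.Linear ℂ] {P : M} {ξ : F.obj P} (hP : IsUniversal F P ξ)

lemma IsUniversal.map_toHom (X : M) (v : F.obj X) : lin (F.map (hP.toHom X v)) ξ = v :=
  (hP.exists_map X v).choose_spec

lemma IsUniversal.toHom_map {X Y : M} (f : X ⟶ Y) (v : F.obj X) :
    hP.toHom Y (lin (F.map f) v) = hP.toHom X v ≫ f :=
  hP.hom_ext (by rw [hP.map_toHom, lin_map_comp, hP.map_toHom])

lemma IsUniversal.toHom_self : hP.toHom P ξ = 𝟙 P :=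
  hP.hom_ext (by rw [hP.map_toHom, lin_map_id])

end

end Corepresentable

section ModuleFunctor

variable {C : Type u₁} [Category.{v₁} C] [Preadditive C] [Linear ℂ C] [MonoidalCategory C]
  {M : Type u₂} [Category.{v₂} M] [Preadditive M] [Linear ℂ M] [MonoidalLeftAction C M]
  (hM : IsIndecomposableModuleCategory C M)

/-- Acting on a fixed object, as a linear map. -/
def actLeft (hM : IsIndecomposableModuleCategory C M) (X Y : C) (m : M) :
    (X ⟶ Y) →ₗ[ℂ] (X ⊙ₗ m ⟶ Y ⊙ₗ m) where
  toFun f := f ⊵ₗ m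
  map_add' f g := hM.add_left f g m
  map_smul' c f := hM.smul_left c f m

/-- The action of a fixed object, as a linear map. -/
def actRight (hM : IsIndecomposableModuleCategory C M) (X : C) (m n : M) :
    (m ⟶ n) →ₗ[ℂ] (X ⊙ₗ m ⟶ X ⊙ₗ n) where
  toFun f := X ⊴ₗ f
  map_add' f g := hM.add_right X f g
  map_smul' c f := hM.smul_right X c f

lemma sum_actionHomLeft (hM : IsIndecomposableModuleCategory C M) {X Y : C} (m : M)
    {ι : Type*} (s : Finset ι) (f : ι → (X ⟶ Y)) : (∑ i ∈ s, f i) ⊵ₗ m = ∑ i ∈ s, f i ⊵ₗ m :=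
  map_sum (actLeft hM X Y m) f s

lemma zero_actionHomLeft (hM : IsIndecomposableModuleCategory C M) (X Y : C) (m : M) :
    (0 : X ⟶ Y) ⊵ₗ m = 0 := map_zero (actLeft hM X Y m)

lemma actionHomRight_zero (hM : IsIndecomposableModuleCategory C M) (X : C) (m n : M) :
    X ⊴ₗ (0 : m ⟶ n) = 0 := map_zero (actRight hM X m n)

include hM in
theorem exists_internalEnd [Limits.HasFiniteBiproducts C] {I : Type} [Fintype I] {s : I → C}
    (hs : IsSimpleSystem s) (m : M) : Nonempty (InternalEnd C m) := by
  classical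
  obtain ⟨n, t, ht⟩ := hM.finSemisimple.2
  have hfin := ht.finite_hom
  let J := Σ i : I, Fin (Module.finrank ℂ (s i ⊙ₗ m ⟶ m))
  let f : J → C := fun j => s j.1
  let φ : ∀ i, Module.Basis (Fin (Module.finrank ℂ (s i ⊙ₗ m ⟶ m))) ℂ (s i ⊙ₗ m ⟶ m) :=
    fun i => Module.finBasis ℂ _
  let ev : (⨁ f) ⊙ₗ m ⟶ m := ∑ j : J, Limits.biproduct.π f j ⊵ₗ m ≫ φ j.1 j.2
  have key : ∀ (i : I) (g : s i ⟶ ⨁ f) (c : Fin (Module.finrank ℂ (s i ⊙ₗ m ⟶ m)) → ℂ),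
      (∀ k, g ≫ Limits.biproduct.π f ⟨i, k⟩ = c k • 𝟙 (s i)) →
      g ⊵ₗ m ≫ ev = ∑ k, c k • φ i k := by
    intro i g c hc
    rw [Preadditive.comp_sum, Fintype.sum_sigma, Finset.sum_eq_single i]
    · refine Finset.sum_congr rfl fun k _ => ?_
      rw [← Category.assoc, ← MonoidalLeftAction.comp_actionHomLeft, hc, hM.smul_left,
        Linear.smul_comp, id_actionHomLeft, Category.id_comp]
    · intro y _ hy
      refine Finset.sum_eq_zero fun k _ => ?_
      rw [← Category.assoc, ← MonoidalLeftAction.comp_actionHomLeft,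
        hs.eq_zero (Ne.symm hy) (g ≫ Limits.biproduct.π f ⟨y, k⟩), zero_actionHomLeft hM,
        Limits.zero_comp]
    · simp
  have simple : ∀ (i : I) (g : s i ⊙ₗ m ⟶ m), ∃! t : s i ⟶ ⨁ f, t ⊵ₗ m ≫ ev = g := by
    intro i g
    refine ⟨∑ k, (φ i).repr g k • Limits.biproduct.ι f ⟨i, k⟩, ?_, fun t ht => ?_⟩
    · refine (key i _ (fun k => (φ i).repr g k) fun k => ?_).trans ((φ i).sum_repr g)
      rw [Preadditive.sum_comp, Finset.sum_eq_single k]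
      · rw [Linear.smul_comp, Limits.biproduct.ι_π_self]
      · intro l _ hl
        rw [Linear.smul_comp, Limits.biproduct.ι_π_ne, smul_zero]
        rintro h
        cases h; exact hl rfl
      · simp
    · choose c hc using fun k => hs.exists_smul (t ≫ Limits.biproduct.π f ⟨i, k⟩)
      have h1 : ∀ k, c k = (φ i).repr g k := by
        have := key i t c fun k => (hc k).symm
        rw [ht] at this
        intro k
        rw [this, (φ i).repr_sum_self]
      refine Limits.biproduct.hom_ext _ _ fun j => ?_
      obtain ⟨y, k⟩ := j
      by_cases hy : y = i
      · subst hy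
        rw [← hc, h1, Preadditive.sum_comp, Finset.sum_eq_single k]
        · rw [Linear.smul_comp, Limits.biproduct.ι_π_self]
        · intro l _ hl
          rw [Linear.smul_comp, Limits.biproduct.ι_π_ne, smul_zero]
          rintro h
          cases h; exact hl rfl
        · simp
      · rw [hs.eq_zero (Ne.symm hy) (t ≫ Limits.biproduct.π f ⟨y, k⟩),
          hs.eq_zero (Ne.symm hy) (_ ≫ Limits.biproduct.π f ⟨y, k⟩)]
  refine ⟨⟨⨁ f, ev, fun X g => ?_⟩⟩
  obtain ⟨n, τ, a, b, hab⟩ := hs.exists_split X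
  choose t ht using fun j => (simple (τ j) (b j ⊵ₗ m ≫ g)).exists
  refine ⟨∑ j, a j ≫ t j, ?_, fun t' ht' => ?_⟩
  · change (∑ j, a j ≫ t j) ⊵ₗ m ≫ ev = g
    have : ∀ j, (a j ≫ t j) ⊵ₗ m ≫ ev = (a j ≫ b j) ⊵ₗ m ≫ g := fun j => by
      rw [MonoidalLeftAction.comp_actionHomLeft, Category.assoc, ht,
        MonoidalLeftAction.comp_actionHomLeft, Category.assoc]
    rw [sum_actionHomLeft hM, Preadditive.sum_comp, Finset.sum_congr rfl fun j _ => this j,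
      ← Preadditive.sum_comp, ← sum_actionHomLeft hM, hab, id_actionHomLeft, Category.id_comp]
  · have : ∀ j, b j ≫ t' = t j := fun j => (simple (τ j) _).unique
      (by rw [MonoidalLeftAction.comp_actionHomLeft, Category.assoc, ht']) (ht j)
    calc t' = (∑ j, a j ≫ b j) ≫ t' := by rw [hab, Category.id_comp]
      _ = _ := by
        rw [Preadditive.sum_comp]
        exact Finset.sum_congr rfl fun j _ => by rw [← this j, Category.assoc]

/-- The linear map underlying the structure of a module functor. -/
def ModuleFunctorAlong.map {ω : C ⥤ Vect} [ω.Monoidal] {F : M ⥤ Vect}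
    (J : ModuleFunctorAlong ω F) (X : C) (N : M) :
    ω.obj X ⊗[ℂ] F.obj N ≃ₗ[ℂ] F.obj (X ⊙ₗ N) := FGModuleCat.isoToLinearEquiv (J.iso X N)

end ModuleFunctor

section Zigzag

variable {C : Type u₁} [Category.{v₁} C] [MonoidalCategory C]
  {M : Type u₂} [Category.{v₂} M] [MonoidalLeftAction C M]

lemma associator_actionHomLeft (A B D : C) (N : M) : (α_ A B D).hom ⊵ₗ N =
    (αₗ (A ⊗ B) D N).hom ≫ (αₗ A B (D ⊙ₗ N)).hom ≫ A ⊴ₗ (αₗ B D N).inv ≫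
      (αₗ A (B ⊗ D) N).inv := by
  have := MonoidalLeftAction.associator_actionHom A B D N
  simp [← reassoc_of% this]

lemma associator_inv_actionHomLeft (A B D : C) (N : M) : (α_ A B D).inv ⊵ₗ N =
    (αₗ A (B ⊗ D) N).hom ≫ A ⊴ₗ (αₗ B D N).hom ≫ (αₗ A B (D ⊙ₗ N)).inv ≫
      (αₗ (A ⊗ B) D N).inv := by
  rw [← cancel_mono ((α_ A B D).hom ⊵ₗ N), ← MonoidalLeftAction.comp_actionHomLeft,
    Iso.inv_hom_id, id_actionHomLeft, associator_actionHomLeft]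
  simp [-MonoidalLeftAction.associator_actionHom]

lemma zigzag_left (A B : C) [ExactPairing A B] (N : M) :
    (λₗ (A ⊙ₗ N)).inv ≫ η_ A B ⊵ₗ (A ⊙ₗ N) ≫ (αₗ A B (A ⊙ₗ N)).hom ≫
      A ⊴ₗ ((αₗ B A N).inv ≫ ε_ A B ⊵ₗ N ≫ (λₗ N).hom) = 𝟙 (A ⊙ₗ N) := by
  calc _ = (λₗ (A ⊙ₗ N)).inv ≫ (αₗ _ _ _).inv ≫
        (η_ A B ▷ A ≫ (α_ _ _ _).hom ≫ A ◁ ε_ A B) ⊵ₗ N ≫ (ρ_ A).hom ⊵ₗ N := by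
        simp [associator_actionHomLeft, -ExactPairing.evaluation_coevaluation,
          MonoidalLeftAction.whiskerRight_actionHomLeft,
          -MonoidalLeftAction.actionHomLeft_action]
    _ = 𝟙 (A ⊙ₗ N) := by
      rw [ExactPairing.evaluation_coevaluation, ← MonoidalLeftAction.comp_actionHomLeft]
      simp

lemma zigzag_right (A B : C) [ExactPairing A B] (N : M) :
    B ⊴ₗ ((λₗ N).inv ≫ η_ A B ⊵ₗ N ≫ (αₗ A B N).hom) ≫ (αₗ B A (B ⊙ₗ N)).inv ≫
      ε_ A B ⊵ₗ (B ⊙ₗ N) ≫ (λₗ (B ⊙ₗ N)).hom = 𝟙 (B ⊙ₗ N) := by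
  calc _ = B ⊴ₗ (λₗ N).inv ≫ (αₗ _ _ _).inv ≫
        (B ◁ η_ A B ≫ (α_ _ _ _).inv ≫ ε_ A B ▷ B) ⊵ₗ N ≫ (λ_ B).hom ⊵ₗ N := by
        simp [associator_inv_actionHomLeft, -ExactPairing.coevaluation_evaluation,
          MonoidalLeftAction.whiskerRight_actionHomLeft,
          -MonoidalLeftAction.actionHomLeft_action]
    _ = 𝟙 (B ⊙ₗ N) := by
      rw [ExactPairing.coevaluation_evaluation, ← MonoidalLeftAction.comp_actionHomLeft]
      simp [← MonoidalLeftAction.actionHomRight_comp]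

end Zigzag


section LaxModuleFunctor

variable {C : Type u₁} [Category.{v₁} C] [MonoidalCategory C]
  {M : Type u₂} [Category.{v₂} M] [MonoidalLeftAction C M]

/-- A lax module functor to vector spaces along a fiber functor. -/
structure LaxModuleFunctor (ω : C ⥤ Vect) [ω.Monoidal] (F : M ⥤ Vect) where
  map : ∀ (X : C) (N : M), ω.obj X ⊗[ℂ] F.obj N →ₗ[ℂ] F.obj (X ⊙ₗ N)
  natural_left : ∀ {X Y : C} (f : X ⟶ Y) (N : M) (x : ω.obj X) (v : F.obj N),
    lin (F.map (f ⊵ₗ N)) (map X N (x ⊗ₜ v)) = map Y N (lin (ω.map f) x ⊗ₜ v)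
  natural_right : ∀ (X : C) {N N' : M} (g : N ⟶ N') (x : ω.obj X) (v : F.obj N),
    lin (F.map (X ⊴ₗ g)) (map X N (x ⊗ₜ v)) = map X N' (x ⊗ₜ lin (F.map g) v)
  assoc : ∀ (X Y : C) (N : M) (x : ω.obj X) (y : ω.obj Y) (v : F.obj N),
    lin (F.map (αₗ X Y N).hom) (map (X ⊗ Y) N (mu ω X Y (x ⊗ₜ y) ⊗ₜ v)) =
      map X (Y ⊙ₗ N) (x ⊗ₜ map Y N (y ⊗ₜ v))
  unit : ∀ (N : M) (v : F.obj N), lin (F.map (λₗ N).hom) (map (𝟙_ C) N (unitElt ω ⊗ₜ v)) = v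

namespace LaxModuleFunctor

variable {ω : C ⥤ Vect} [ω.Monoidal] {F : M ⥤ Vect} (j : LaxModuleFunctor ω F)

/-- The inverse of the structure map, given by duality. -/
def inv (X Y : C) [ExactPairing X Y] (N : M) : F.obj (X ⊙ₗ N) →ₗ[ℂ] ω.obj X ⊗[ℂ] F.obj N :=
  (TensorProduct.lift (LinearMap.compr₂ (TensorProduct.mk ℂ (ω.obj Y) (F.obj (X ⊙ₗ N)))
    (lin (F.map ((αₗ Y X N).inv ≫ ε_ X Y ⊵ₗ N ≫ (λₗ N).hom)) ∘ₗ j.map Y (X ⊙ₗ N)))).lTensor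
      (ω.obj X) ∘ₗ (TensorProduct.assoc ℂ _ _ _).toLinearMap ∘ₗ
        TensorProduct.mk ℂ _ (F.obj (X ⊙ₗ N)) (copairing ω X Y)

lemma map_inv_self (X Y : C) [ExactPairing X Y] (N : M) (w : F.obj (X ⊙ₗ N)) :
    j.map X N (j.inv X Y N w) = w := by
  have e : ∀ t : ω.obj X ⊗[ℂ] ω.obj Y, j.map X N ((TensorProduct.lift (LinearMap.compr₂
      (TensorProduct.mk ℂ (ω.obj Y) (F.obj (X ⊙ₗ N)))
      (lin (F.map ((αₗ Y X N).inv ≫ ε_ X Y ⊵ₗ N ≫ (λₗ N).hom)) ∘ₗ j.map Y (X ⊙ₗ N)))).lTensor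
      (ω.obj X) (TensorProduct.assoc ℂ _ _ _ (t ⊗ₜ[ℂ] w))) =
      lin (F.map (X ⊴ₗ ((αₗ Y X N).inv ≫ ε_ X Y ⊵ₗ N ≫ (λₗ N).hom)))
        (lin (F.map (αₗ X Y (X ⊙ₗ N)).hom) (j.map (X ⊗ Y) (X ⊙ₗ N) (mu ω X Y t ⊗ₜ w))) := by
    intro t
    induction t with
    | zero => simp
    | add s t hs ht => simp only [map_add, TensorProduct.add_tmul, hs, ht]
    | tmul x y =>
      rw [j.assoc, j.natural_right]
      rfl
  refine (e (copairing ω X Y)).trans ?_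
  rw [mu_copairing, ← j.natural_left, ← lin_map_comp, ← lin_map_comp]
  have h := zigzag_left X Y N
  rw [Iso.inv_comp_eq, Category.comp_id] at h
  rw [h, j.unit]

lemma inv_map_self (X Y : C) [ExactPairing X Y] (N : M) (v : ω.obj X ⊗[ℂ] F.obj N) :
    j.inv X Y N (j.map X N v) = v := by
  induction v with
  | zero => simp
  | add s t hs ht => simp only [map_add, hs, ht]
  | tmul x v =>
    have e : ∀ t : ω.obj X ⊗[ℂ] ω.obj Y, (TensorProduct.lift (LinearMap.compr₂
        (TensorProduct.mk ℂ (ω.obj Y) (F.obj (X ⊙ₗ N)))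
        (lin (F.map ((αₗ Y X N).inv ≫ ε_ X Y ⊵ₗ N ≫ (λₗ N).hom)) ∘ₗ j.map Y (X ⊙ₗ N)))).lTensor
        (ω.obj X) (TensorProduct.assoc ℂ _ _ _ (t ⊗ₜ[ℂ] j.map X N (x ⊗ₜ v))) =
        slice ((TensorProduct.curry (pairing X Y)).flip x) t ⊗ₜ v := by
      intro t
      induction t with
      | zero => simp
      | add s t hs ht => simp only [map_add, TensorProduct.add_tmul, hs, ht]
      | tmul x' y =>
        rw [slice_tmul, TensorProduct.smul_tmul]
        change x' ⊗ₜ lin (F.map ((αₗ Y X N).inv ≫ ε_ X Y ⊵ₗ N ≫ (λₗ N).hom))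
          (j.map Y (X ⊙ₗ N) (y ⊗ₜ j.map X N (x ⊗ₜ v))) = _
        congr 1
        rw [← j.assoc, ← lin_map_comp, Iso.hom_inv_id_assoc, lin_map_comp, j.natural_left,
          map_evaluation_mu, ← TensorProduct.smul_tmul', map_smul, map_smul, j.unit]
        rfl
    exact (e (copairing ω X Y)).trans (by rw [slice_copairing])

lemma bijective [RightRigidCategory C] (X : C) (N : M) : Function.Bijective (j.map X N) :=
  ⟨Function.LeftInverse.injective (j.inv_map_self X Xᘁ N),
    Function.RightInverse.surjective (j.map_inv_self X Xᘁ N)⟩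

/-- A lax module functor on a rigid category is a module functor. -/
def toModuleFunctorAlong [RightRigidCategory C] : ModuleFunctorAlong ω F where
  iso X N := LinearEquiv.toFGModuleCatIso (V := ω.obj X ⊗[ℂ] F.obj N)
    (LinearEquiv.ofBijective (j.map X N) (j.bijective X N))
  natural_left f N := FGModuleCat.hom_ext (TensorProduct.ext' fun x v =>
    (j.natural_left f N x v).symm)
  natural_right X _ _ g := FGModuleCat.hom_ext (TensorProduct.ext' fun x v =>
    (j.natural_right X g x v).symm)
  assoc X Y N := FGModuleCat.hom_ext (TensorProduct.ext_threefold fun x y v => j.assoc X Y N x y v)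
  unit N := FGModuleCat.hom_ext (TensorProduct.ext' fun c v => by
    have h : ∀ d : ℂ, lin (Functor.LaxMonoidal.ε ω) d = d • unitElt ω := unitEquiv_symm
    change lin (F.map (λₗ N).hom) (j.map (𝟙_ C) N (lin (Functor.LaxMonoidal.ε ω) c ⊗ₜ v)) =
      (c : ℂ) • v
    rw [h, ← TensorProduct.smul_tmul', map_smul, map_smul, j.unit])

end LaxModuleFunctor

end LaxModuleFunctor

section Construction

variable {C : Type u₁} [Category.{v₁} C] [Preadditive C] [Linear ℂ C] [MonoidalCategory C]
  {M : Type u₂} [Category.{v₂} M] [Preadditive M] [Linear ℂ M] [MonoidalLeftAction C M]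
  (hM : IsIndecomposableModuleCategory C M)
  {ω : C ⥤ Vect} [ω.Additive] [ω.Linear ℂ] [ω.Monoidal] {P : C} {ξ : ω.obj P}
  (hP : IsUniversal ω P ξ) {m : M} {F : M ⥤ Vect} [F.Additive] [F.Linear ℂ]
  {η : F.obj (P ⊙ₗ m)} (hF : IsUniversal F (P ⊙ₗ m) η)

/-- The image in `F(X ⊗ m)` of an element of `ω(X)`. -/
def theta (hM : IsIndecomposableModuleCategory C M) (hP : IsUniversal ω P ξ)
    (η : F.obj (P ⊙ₗ m)) (X : C) : ω.obj X →ₗ[ℂ] F.obj (X ⊙ₗ m) where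
  toFun x := lin (F.map (hP.toHom X x ⊵ₗ m)) η
  map_add' x y := by
    rw [map_add, hM.add_left, F.map_add]
    rfl
  map_smul' c x := by
    rw [map_smul, hM.smul_left, lin_map_smul]
    rfl

lemma theta_apply (X : C) (x : ω.obj X) :
    theta hM hP η X x = lin (F.map (hP.toHom X x ⊵ₗ m)) η := rfl

lemma map_theta {X Y : C} (f : X ⟶ Y) (x : ω.obj X) :
    lin (F.map (f ⊵ₗ m)) (theta hM hP η X x) = theta hM hP η Y (lin (ω.map f) x) := by
  rw [theta_apply, theta_apply, hP.toHom_map, MonoidalLeftAction.comp_actionHomLeft, lin_map_comp]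

lemma theta_self : theta hM hP η P ξ = η := by
  rw [theta_apply, hP.toHom_self, id_actionHomLeft, lin_map_id]

/-- The structure map of the module functor that is corepresented by `P ⊗ m`. -/
def laxMap (hM : IsIndecomposableModuleCategory C M) (hP : IsUniversal ω P ξ)
    (hF : IsUniversal F (P ⊙ₗ m) η) (X : C) (N : M) :
    ω.obj X ⊗[ℂ] F.obj N →ₗ[ℂ] F.obj (X ⊙ₗ N) :=
  TensorProduct.lift (LinearMap.mk₂ ℂ
    (fun x v => lin (F.map ((αₗ X P m).hom ≫ X ⊴ₗ hF.toHom N v))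
      (theta hM hP η (X ⊗ P) (mu ω X P (x ⊗ₜ ξ))))
    (fun x y v => by rw [TensorProduct.add_tmul, map_add, map_add, map_add])
    (fun c x v => by rw [← TensorProduct.smul_tmul', map_smul, map_smul, map_smul])
    (fun x v w => by
      rw [map_add, hM.add_right, Preadditive.comp_add, F.map_add]
      rfl)
    (fun c x v => by rw [map_smul, hM.smul_right, Linear.comp_smul, lin_map_smul]))

lemma laxMap_tmul (X : C) (N : M) (x : ω.obj X) (v : F.obj N) :
    laxMap hM hP hF X N (x ⊗ₜ v) = lin (F.map ((αₗ X P m).hom ≫ X ⊴ₗ hF.toHom N v))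
      (theta hM hP η (X ⊗ P) (mu ω X P (x ⊗ₜ ξ))) := rfl

lemma laxMap_theta (Y X : C) {N : M} (φ : X ⊙ₗ m ⟶ N) (y : ω.obj Y) (x : ω.obj X) :
    laxMap hM hP hF Y N (y ⊗ₜ lin (F.map φ) (theta hM hP η X x)) =
      lin (F.map ((αₗ Y X m).hom ≫ Y ⊴ₗ φ)) (theta hM hP η (Y ⊗ X) (mu ω Y X (y ⊗ₜ x))) := by
  have h1 : hF.toHom N (lin (F.map φ) (theta hM hP η X x)) = hP.toHom X x ⊵ₗ m ≫ φ := by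
    rw [theta_apply, ← lin_map_comp, hF.toHom_map, hF.toHom_self, Category.id_comp]
  rw [laxMap_tmul, h1]
  conv_rhs => rw [← hP.map_toHom X x, ← map_whiskerLeft_mu, ← map_theta hM hP, ← lin_map_comp]
  congr 3
  simp

/-- The module functor that is corepresented by `P ⊗ m`. -/
def laxModuleFunctor : LaxModuleFunctor ω F where
  map := laxMap hM hP hF
  natural_left {X Y} f N x v := by
    rw [laxMap_tmul, laxMap_tmul, ← map_whiskerRight_mu, ← map_theta hM hP, ← lin_map_comp,
      ← lin_map_comp]
    congr 3
    rw [MonoidalLeftAction.whiskerRight_actionHomLeft]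
    simp [MonoidalLeftAction.action_exchange]
  natural_right X N N' g x v := by
    rw [laxMap_tmul, laxMap_tmul, ← lin_map_comp, hF.toHom_map]
    congr 3
    simp
  assoc X Y N x y v := by
    rw [laxMap_tmul, laxMap_tmul hM hP hF Y N, laxMap_theta, ← map_associator_mu,
      ← map_theta hM hP, ← lin_map_comp, ← lin_map_comp]
    congr 3
    simp
  unit N v := by
    rw [laxMap_tmul, ← lin_map_comp]
    have : ((αₗ (𝟙_ C) P m).hom ≫ 𝟙_ C ⊴ₗ hF.toHom N v) ≫ (λₗ N).hom =
        (λ_ P).hom ⊵ₗ m ≫ hF.toHom N v := by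
      simp
    rw [this, lin_map_comp, map_theta, map_leftUnitor_mu, theta_self, hF.map_toHom]

include hM hP hF in
/-- A functor that is corepresented by `P ⊗ m` is a module functor, generated by an element
of `F(m)`. -/
theorem exists_moduleFunctorAlong [RightRigidCategory C] : ∃ (J : ModuleFunctorAlong ω F)
    (u : F.obj m), J.map P m (ξ ⊗ₜ u) = η := by
  refine ⟨(laxModuleFunctor hM hP hF).toModuleFunctorAlong,
    lin (F.map (λₗ m).hom) (theta hM hP η (𝟙_ C) (unitElt ω)), ?_⟩
  refine (laxMap_theta hM hP hF P (𝟙_ C) (λₗ m).hom ξ (unitElt ω)).trans ?_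
  rw [← MonoidalLeftAction.rightUnitor_actionHom, map_theta, map_rightUnitor_mu, theta_self]

end Construction

/-! ### The action of the smash product -/

section ModuleFunctorElements

variable {C : Type u₁} [Category.{v₁} C] [MonoidalCategory C]
  {M : Type u₂} [Category.{v₂} M] [Preadditive M] [Linear ℂ M] [MonoidalLeftAction C M]
  {ω : C ⥤ Vect} [ω.Monoidal] {F : M ⥤ Vect}

namespace ModuleFunctorAlong

variable (J : ModuleFunctorAlong ω F)

lemma map_left {X Y : C} (f : X ⟶ Y) (N : M) (x : ω.obj X) (v : F.obj N) :
    lin (F.map (f ⊵ₗ N)) (J.map X N (x ⊗ₜ v)) = J.map Y N (lin (ω.map f) x ⊗ₜ v) :=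
  (congrArg (fun k : ω.obj X ⊗ F.obj N ⟶ F.obj (Y ⊙ₗ N) => lin k (x ⊗ₜ v))
    (J.natural_left f N)).symm

lemma map_right (X : C) {N N' : M} (g : N ⟶ N') (x : ω.obj X) (v : F.obj N) :
    lin (F.map (X ⊴ₗ g)) (J.map X N (x ⊗ₜ v)) = J.map X N' (x ⊗ₜ lin (F.map g) v) :=
  (congrArg (fun k : ω.obj X ⊗ F.obj N ⟶ F.obj (X ⊙ₗ N') => lin k (x ⊗ₜ v))
    (J.natural_right X g)).symm

lemma map_assoc (X Y : C) (N : M) (x : ω.obj X) (y : ω.obj Y) (v : F.obj N) :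
    lin (F.map (αₗ X Y N).hom) (J.map (X ⊗ Y) N (mu ω X Y (x ⊗ₜ y) ⊗ₜ v)) =
      J.map X (Y ⊙ₗ N) (x ⊗ₜ J.map Y N (y ⊗ₜ v)) :=
  congrArg (fun k : (ω.obj X ⊗ ω.obj Y) ⊗ F.obj N ⟶ F.obj (X ⊙ₗ Y ⊙ₗ N) =>
    lin k ((x ⊗ₜ y) ⊗ₜ v)) (J.assoc X Y N)

lemma map_unit (N : M) (v : F.obj N) :
    lin (F.map (λₗ N).hom) (J.map (𝟙_ C) N (unitElt ω ⊗ₜ v)) = v :=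
  (congrArg (fun k : 𝟙_ Vect ⊗ F.obj N ⟶ F.obj N => lin k ((1 : ℂ) ⊗ₜ v)) (J.unit N)).trans
    (one_smul ℂ v)

end ModuleFunctorAlong

end ModuleFunctorElements

section NaturalOperators

variable {M : Type u₂} [Category.{v₂} M] [Preadditive M] [Linear ℂ M] {F : M ⥤ Vect} [F.Additive]
  [F.Linear ℂ] {Q : M} {η : F.obj Q} (hF : IsUniversal F Q η)

/-- The natural operator with the given value at the universal element. -/
def natOp (hF : IsUniversal F Q η) (N : M) : F.obj Q →ₗ[ℂ] Module.End ℂ (F.obj N) :=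
  LinearMap.mk₂ ℂ (fun w v => lin (F.map (hF.toHom N v)) w)
    (fun w w' v => map_add _ _ _) (fun c w v => map_smul _ _ _)
    (fun w v v' => by rw [map_add, F.map_add]; rfl)
    (fun c w v => by rw [map_smul, lin_map_smul])

lemma natOp_map (N : M) (w : F.obj Q) (f : Q ⟶ N) :
    natOp hF N w (lin (F.map f) η) = lin (F.map f) w := by
  change lin (F.map (hF.toHom N _)) w = _
  rw [hF.toHom_map, hF.toHom_self, Category.id_comp]

lemma natOp_self (w : F.obj Q) : natOp hF Q w η = w := by
  have := natOp_map hF Q w (𝟙 Q)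
  rwa [lin_map_id, lin_map_id] at this

lemma natOp_natural {N N' : M} (w : F.obj Q) (g : N ⟶ N') (v : F.obj N) :
    lin (F.map g) (natOp hF N w v) = natOp hF N' w (lin (F.map g) v) := by
  obtain ⟨f, rfl⟩ := hF.exists_map N v
  rw [natOp_map, ← lin_map_comp, ← lin_map_comp, natOp_map]

include hF in
lemma natural_ext {T T' : ∀ N : M, Module.End ℂ (F.obj N)}
    (hT : ∀ {N N' : M} (g : N ⟶ N') v, lin (F.map g) (T N v) = T N' (lin (F.map g) v))
    (hT' : ∀ {N N' : M} (g : N ⟶ N') v, lin (F.map g) (T' N v) = T' N' (lin (F.map g) v))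
    (h : T Q η = T' Q η) (N : M) : T N = T' N := by
  refine LinearMap.ext fun v => ?_
  obtain ⟨f, rfl⟩ := hF.exists_map N v
  rw [← hT, ← hT', h]

end NaturalOperators

section SmashAction

variable {C : Type u₁} [Category.{v₁} C] [Preadditive C] [Linear ℂ C] [MonoidalCategory C]
  {M : Type u₂} [Category.{v₂} M] [Preadditive M] [Linear ℂ M] [MonoidalLeftAction C M]
  {ω : C ⥤ Vect} [ω.Additive] [ω.Linear ℂ] [ω.Monoidal] {P : C} {ξ : ω.obj P}
  (hP : IsUniversal ω P ξ) {m : M} {F : M ⥤ Vect} [F.Additive] [F.Linear ℂ]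
  (J : ModuleFunctorAlong ω F) {z : F.obj m} (hF : IsUniversal F (P ⊙ₗ m) (J.map P m (ξ ⊗ₜ z)))
  {H : Type u} [Ring H] [Bialgebra ℂ H] {act : ∀ X : C, H →ₐ[ℂ] Module.End ℂ (ω.obj X)}
  (hact : ActsMonoidally ω act) (E : InternalEnd C m)

include hP in
lemma natOp_map_tmul {X : C} {N : M} (φ : X ⊙ₗ m ⟶ N) (x : ω.obj X) (T : Module.End ℂ (ω.obj P))
    (w : F.obj m) (f : P ⟶ X) (hf : lin (ω.map f) ξ = x) :
    natOp hF N (J.map P m (T ξ ⊗ₜ w)) (lin (F.map φ) (J.map X m (x ⊗ₜ z))) =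
      lin (F.map φ) (J.map X m (lin (ω.map f) (T ξ) ⊗ₜ w)) := by
  rw [← hf, ← J.map_left, ← lin_map_comp, natOp_map, lin_map_comp, J.map_left]

/-- The action of `H`. -/
def hOp (act : ∀ X : C, H →ₐ[ℂ] Module.End ℂ (ω.obj X)) (N : M) : H →ₗ[ℂ] Module.End ℂ (F.obj N) :=
  natOp hF N ∘ₗ (J.map P m).toLinearMap ∘ₗ (TensorProduct.mk ℂ _ _).flip z ∘ₗ
    (act P).toLinearMap.flip ξ

/-- The action of the elements of an internal endomorphism object on a generator. -/
def iota : ω.obj E.obj →ₗ[ℂ] F.obj m :=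
  lin (F.map E.ev) ∘ₗ (J.map E.obj m).toLinearMap ∘ₗ (TensorProduct.mk ℂ _ _).flip z

lemma iota_apply (a : ω.obj E.obj) :
    iota (z := z) J E a = lin (F.map E.ev) (J.map E.obj m (a ⊗ₜ z)) := rfl

/-- The right action of the internal endomorphism object. -/
def rOp (N : M) : ω.obj E.obj →ₗ[ℂ] Module.End ℂ (F.obj N) :=
  natOp hF N ∘ₗ (J.map P m).toLinearMap ∘ₗ TensorProduct.mk ℂ _ _ ξ ∘ₗ iota (z := z) J E

lemma hOp_natural {N N' : M} (h : H) (g : N ⟶ N') (v : F.obj N) :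
    lin (F.map g) (hOp J hF act N h v) = hOp J hF act N' h (lin (F.map g) v) :=
  natOp_natural hF _ g v

lemma rOp_natural {N N' : M} (a : ω.obj E.obj) (g : N ⟶ N') (v : F.obj N) :
    lin (F.map g) (rOp J hF E N a v) = rOp J hF E N' a (lin (F.map g) v) :=
  natOp_natural hF _ g v

include hP hact in
lemma hOp_map {X : C} {N : M} (φ : X ⊙ₗ m ⟶ N) (x : ω.obj X) (h : H) :
    hOp J hF act N h (lin (F.map φ) (J.map X m (x ⊗ₜ z))) =
      lin (F.map φ) (J.map X m (act X h x ⊗ₜ z)) := by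
  obtain ⟨f, hf⟩ := hP.exists_map X x
  refine (natOp_map_tmul hP J hF φ x (act P h) z f hf).trans ?_
  rw [hact.natural, hf]

include hP in
lemma rOp_map {X : C} {N : M} (φ : X ⊙ₗ m ⟶ N) (x : ω.obj X) (a : ω.obj E.obj) :
    rOp J hF E N a (lin (F.map φ) (J.map X m (x ⊗ₜ z))) =
      lin (F.map φ) (J.map X m (x ⊗ₜ iota (z := z) J E a)) := by
  obtain ⟨f, hf⟩ := hP.exists_map X x
  refine (natOp_map_tmul hP J hF φ x 1 (iota (z := z) J E a) f hf).trans ?_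
  rw [Module.End.one_apply, hf]

include hP hact in
lemma hOp_iota (h : H) (a : ω.obj E.obj) :
    hOp J hF act m h (iota (z := z) J E a) = iota (z := z) J E (act E.obj h a) :=
  hOp_map hP J hF hact E.ev a h

lemma hOp_univ (h : H) : hOp J hF act (P ⊙ₗ m) h (J.map P m (ξ ⊗ₜ z)) =
    J.map P m (act P h ξ ⊗ₜ z) := natOp_self hF _

lemma rOp_univ (a : ω.obj E.obj) : rOp J hF E (P ⊙ₗ m) a (J.map P m (ξ ⊗ₜ z)) =
    J.map P m (ξ ⊗ₜ iota (z := z) J E a) := natOp_self hF _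

/-- The action of `H` as a homomorphism of algebras. -/
def hAct (hP : IsUniversal ω P ξ) (hact : ActsMonoidally ω act) (N : M) :
    H →ₐ[ℂ] Module.End ℂ (F.obj N) :=
  AlgHom.ofLinearMap (hOp J hF act N)
    (natural_ext hF (T := fun N => hOp J hF act N 1) (T' := fun N => 1)
      (fun g v => hOp_natural J hF 1 g v) (fun g v => rfl) (by
        rw [hOp_univ, map_one]; rfl) N)
    (fun h k => natural_ext hF (T := fun N => hOp J hF act N (h * k))
      (T' := fun N => hOp J hF act N h * hOp J hF act N k)
      (fun g v => hOp_natural J hF _ g v) (fun g v => by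
        rw [Module.End.mul_apply, Module.End.mul_apply, hOp_natural, hOp_natural]) (by
        rw [Module.End.mul_apply, hOp_univ, hOp_univ, map_mul, Module.End.mul_apply]
        have := hOp_map hP J hF hact (𝟙 (P ⊙ₗ m)) (act P k ξ) h
        rw [lin_map_id, lin_map_id] at this
        exact this.symm) N)

lemma hAct_apply (N : M) (h : H) : hAct J hF hP hact N h = hOp J hF act N h := rfl

lemma hOp_tensor (X : C) (N : M) (h : H) (v : ω.obj X ⊗[ℂ] F.obj N) :
    hOp J hF act (X ⊙ₗ N) h (J.map X N v) =
      J.map X N (actTensor (act X) (hAct J hF hP hact N) (Coalgebra.comul (R := ℂ) h) v) := by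
  induction v with
  | zero => simp
  | add s t hs ht => simp only [map_add, hs, ht]
  | tmul x v =>
    obtain ⟨f, rfl⟩ := hF.exists_map N v
    rw [← J.map_right, ← J.map_assoc, ← lin_map_comp, hOp_map hP J hF hact, hact.comul]
    generalize Coalgebra.comul (R := ℂ) h = t
    induction t with
    | zero => simp
    | add s t hs ht => simp only [map_add, LinearMap.add_apply, TensorProduct.add_tmul, hs, ht]
    | tmul a b =>
      rw [actTensor_tmul, actTensor_tmul, TensorProduct.map_tmul, TensorProduct.map_tmul,
        lin_map_comp, J.map_assoc, J.map_right, hAct_apply, hOp_map hP J hF hact]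

include hP in
lemma rOp_tensor (X : C) (N : M) (a : ω.obj E.obj) (v : ω.obj X ⊗[ℂ] F.obj N) :
    rOp J hF E (X ⊙ₗ N) a (J.map X N v) =
      J.map X N ((rOp J hF E N a).lTensor _ v) := by
  induction v with
  | zero => simp
  | add s t hs ht => simp only [map_add, hs, ht]
  | tmul x v =>
    obtain ⟨f, rfl⟩ := hF.exists_map N v
    rw [← J.map_right, ← J.map_assoc, ← lin_map_comp, rOp_map hP J hF, LinearMap.lTensor_tmul,
      lin_map_comp, J.map_assoc, J.map_right, rOp_map hP J hF]

/-- The algebra of an internal endomorphism object. -/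
abbrev EndAlg (ω : C ⥤ Vect) [ω.Monoidal] (E : InternalEnd C m) : Type :=
  @VAlg (ω.obj E.obj) (ω.monObjObj E.obj)

lemma endAlg_mul (a b : EndAlg ω E) :
    a * b = lin (ω.map (MonObj.mul (X := E.obj))) (mu ω E.obj E.obj
      ((show ω.obj E.obj from a) ⊗ₜ[ℂ] (show ω.obj E.obj from b))) := rfl

lemma endAlg_one : (1 : EndAlg ω E) = lin (ω.map (MonObj.one (X := E.obj))) (unitElt ω) := rfl

lemma iota_one : iota (z := z) J E (1 : EndAlg ω E) = z := by
  rw [endAlg_one, iota_apply, ← J.map_left, ← lin_map_comp]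
  have : MonObj.one (X := E.obj) ⊵ₗ m ≫ E.ev = (λₗ m).hom := E.lift_ev _
  rw [this, J.map_unit]

lemma iota_mul (a b : EndAlg ω E) : iota (z := z) J E (a * b : EndAlg ω E) =
    lin (F.map E.ev) (J.map E.obj m ((show ω.obj E.obj from a) ⊗ₜ[ℂ] iota (z := z) J E b)) := by
  rw [endAlg_mul, iota_apply, ← J.map_left, ← lin_map_comp]
  have : MonObj.mul (X := E.obj) ⊵ₗ m ≫ E.ev =
    (αₗ E.obj E.obj m).hom ≫ E.obj ⊴ₗ E.ev ≫ E.ev := E.lift_ev _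
  rw [this, lin_map_comp, J.map_assoc, lin_map_comp, J.map_right]
  rfl

include hP in
lemma rOp_of_iota_eq {a : ω.obj E.obj} (N : M) {T : ∀ N : M, Module.End ℂ (F.obj N)}
    (hT : ∀ {N N' : M} (g : N ⟶ N') v, lin (F.map g) (T N v) = T N' (lin (F.map g) v))
    (h : J.map P m (ξ ⊗ₜ iota (z := z) J E a) = T (P ⊙ₗ m) (J.map P m (ξ ⊗ₜ z))) :
    rOp J hF E N a = T N :=
  natural_ext hF (T := fun N => rOp J hF E N a) (T' := T)
    (fun g v => rOp_natural J hF E a g v) hT ((rOp_univ J hF E a).trans h) N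

include hP in
lemma rOp_one (N : M) : rOp J hF E N (1 : EndAlg ω E) = 1 :=
  rOp_of_iota_eq hP J hF E N (T := fun _ => 1) (fun _ _ => rfl)
    (congrArg (fun w => J.map P m (ξ ⊗ₜ w)) (iota_one J E))

include hP in
lemma rOp_mul (N : M) (a b : EndAlg ω E) :
    rOp J hF E N (a * b : EndAlg ω E) = rOp J hF E N b * rOp J hF E N a := by
  let a' : ω.obj E.obj := a
  let b' : ω.obj E.obj := b
  refine rOp_of_iota_eq hP J hF E N (T := fun N => rOp J hF E N b' * rOp J hF E N a')
    (fun g v => ?_) ((congrArg (fun w => J.map P m (ξ ⊗ₜ w)) (iota_mul J E a b)).trans ?_)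
  · rw [Module.End.mul_apply, Module.End.mul_apply, rOp_natural, rOp_natural]
  · change J.map P m (ξ ⊗ₜ lin (F.map E.ev) (J.map E.obj m (a' ⊗ₜ iota (z := z) J E b'))) = _
    rw [Module.End.mul_apply, rOp_univ, rOp_tensor hP, LinearMap.lTensor_tmul,
      iota_apply J E a', rOp_map hP]

lemma endAlg_mul' (t : EndAlg ω E ⊗[ℂ] EndAlg ω E) :
    LinearMap.mul' ℂ (EndAlg ω E) t =
      lin (ω.map (MonObj.mul (X := E.obj))) (mu ω E.obj E.obj t) := by
  induction t with
  | zero => exact (map_zero _).trans ((congrArg _ (map_zero _)).trans (map_zero _)).symm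
  | add s t hs ht =>
    rw [map_add, hs, ht]
    exact ((congrArg _ (map_add _ _ _)).trans (map_add _ _ _)).symm
  | tmul x y => rfl

/-- The action of a fiber functor on an internal endomorphism algebra. -/
def endModuleAlgebra (hact : ActsMonoidally ω act) (E : InternalEnd C m) :
    ModuleAlgebra H (EndAlg ω E) where
  act := act E.obj
  act_mul h a b := by
    refine Eq.trans ?_ (endAlg_mul' E _).symm
    refine (hact.natural (MonObj.mul (X := E.obj)) h (mu ω E.obj E.obj (_ ⊗ₜ[ℂ] _))).symm.trans ?_
    exact congrArg (lin (ω.map (MonObj.mul (X := E.obj)))) (hact.comul h _ _ _)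
  act_one h := by
    refine (hact.natural (MonObj.one (X := E.obj)) h (unitElt ω)).symm.trans ?_
    refine (congrArg (lin (ω.map (MonObj.one (X := E.obj)))) (hact.counit h)).trans ?_
    exact map_smul _ _ _

end SmashAction

section OpSmashAction

variable {C : Type u₁} [Category.{v₁} C] [Preadditive C] [Linear ℂ C] [MonoidalCategory C]
  {M : Type u₂} [Category.{v₂} M] [Preadditive M] [Linear ℂ M] [MonoidalLeftAction C M]
  {ω : C ⥤ Vect} [ω.Additive] [ω.Linear ℂ] [ω.Monoidal] {P : C} {ξ : ω.obj P}
  (hP : IsUniversal ω P ξ) {m : M} {F : M ⥤ Vect} [F.Additive] [F.Linear ℂ]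
  (J : ModuleFunctorAlong ω F) {z : F.obj m} (hF : IsUniversal F (P ⊙ₗ m) (J.map P m (ξ ⊗ₜ z)))
  {H : Type u} [Ring H] [Bialgebra ℂ H] {act : ∀ X : C, H →ₐ[ℂ] Module.End ℂ (ω.obj X)}
  (hact : ActsMonoidally ω act) (E : InternalEnd C m)

include hP in
lemma rOp_gen (a : ω.obj E.obj) : rOp J hF E m a z = iota (z := z) J E a := by
  have := rOp_map hP J hF E (λₗ m).hom (unitElt ω) a
  rwa [J.map_unit, J.map_unit] at this

/-- The action of `A ⊗ H`. -/
def smashOp (act : ∀ X : C, H →ₐ[ℂ] Module.End ℂ (ω.obj X)) (N : M) :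
    ω.obj E.obj ⊗[ℂ] H →ₗ[ℂ] Module.End ℂ (F.obj N) :=
  TensorProduct.lift ((LinearMap.mul ℂ (Module.End ℂ (F.obj N))).compl₁₂ (rOp J hF E N)
    (hOp J hF act N))

lemma smashOp_tmul (N : M) (a : ω.obj E.obj) (h : H) :
    smashOp J hF E act N (a ⊗ₜ h) = rOp J hF E N a * hOp J hF act N h := rfl

lemma smashOp_natural {N N' : M} (t : ω.obj E.obj ⊗[ℂ] H) (g : N ⟶ N') (v : F.obj N) :
    lin (F.map g) (smashOp J hF E act N t v) = smashOp J hF E act N' t (lin (F.map g) v) := by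
  induction t with
  | zero => simp
  | add s t hs ht => simp only [map_add, LinearMap.add_apply, hs, ht]
  | tmul a h =>
    rw [smashOp_tmul, smashOp_tmul, Module.End.mul_apply, Module.End.mul_apply, rOp_natural,
      hOp_natural]

/-- `h ⊗ k` sent to the product of the actions of `k · b` and `h`. -/
def crossOp (act : ∀ X : C, H →ₐ[ℂ] Module.End ℂ (ω.obj X)) (N : M) (b : ω.obj E.obj) :
    H ⊗[ℂ] H →ₗ[ℂ] Module.End ℂ (F.obj N) :=
  smashOp J hF E act N ∘ₗ ((act E.obj).toLinearMap.flip b).rTensor H ∘ₗ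
    (TensorProduct.comm ℂ H H).toLinearMap

lemma crossOp_tmul (N : M) (b : ω.obj E.obj) (h k : H) :
    crossOp J hF E act N b (h ⊗ₜ k) = rOp J hF E N (act E.obj k b) * hOp J hF act N h := rfl

include hP hact in
lemma crossOp_comul (N : M) (b : ω.obj E.obj) (h : H) :
    crossOp J hF E act N b (Coalgebra.comul h) = hOp J hF act N h * rOp J hF E N b := by
  refine natural_ext hF (T := fun N => crossOp J hF E act N b (Coalgebra.comul h))
    (T' := fun N => hOp J hF act N h * rOp J hF E N b)
    (fun g v => smashOp_natural J hF E _ g v) (fun g v => ?_) ?_ N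
  · rw [Module.End.mul_apply, Module.End.mul_apply, hOp_natural, rOp_natural]
  · rw [Module.End.mul_apply, rOp_univ, hOp_tensor hP J hF hact]
    generalize Coalgebra.comul (R := ℂ) h = t
    induction t with
    | zero => simp
    | add s t hs ht => simp only [map_add, LinearMap.add_apply, hs, ht]
    | tmul h k =>
      rw [crossOp_tmul, Module.End.mul_apply, hOp_univ, rOp_tensor hP, LinearMap.lTensor_tmul,
        actTensor_tmul, TensorProduct.map_tmul, rOp_gen hP, hAct_apply, hOp_iota hP J hF hact]

include hP hact in
lemma smashOp_psi (N : M) (h : H) (t : EndAlg ω E ⊗[ℂ] H) :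
    smashOp J hF E act N (OpSmash.psi (endModuleAlgebra hact E) h t) =
      hOp J hF act N h * smashOp J hF E act N t := by
  induction t with
  | zero => exact (congrArg _ (map_zero _)).trans ((map_zero _).trans (by
      rw [show smashOp J hF E act N (0 : EndAlg ω E ⊗[ℂ] H) = 0 from map_zero _, mul_zero]))
  | add s t hs ht =>
    refine (congrArg _ (map_add _ _ _)).trans ((map_add (smashOp J hF E act N) _ _).trans ?_)
    rw [hs, ht, ← mul_add]
    exact congrArg _ (map_add _ _ _).symm
  | tmul b g =>
    let b' : ω.obj E.obj := b
    change _ = hOp J hF act N h * (rOp J hF E N b' * hOp J hF act N g)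
    rw [← mul_assoc, ← crossOp_comul hP J hF hact]
    change smashOp J hF E act N (OpSmash.psi₂ (endModuleAlgebra hact E) (Coalgebra.comul h)
      (b ⊗ₜ g)) = _
    generalize Coalgebra.comul (R := ℂ) h = t
    induction t with
    | zero =>
      rw [map_zero, map_zero, zero_mul]
      exact map_zero (smashOp J hF E act N)
    | add s t hs ht =>
      rw [map_add, map_add, add_mul, ← hs, ← ht]
      exact map_add (smashOp J hF E act N) _ _
    | tmul h k =>
      change rOp J hF E N (act E.obj k b') * hOp J hF act N (h * g) =
        rOp J hF E N (act E.obj k b') * hOp J hF act N h * hOp J hF act N g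
      rw [mul_assoc]
      exact congrArg _ (map_mul (hAct J hF hP hact N) h g)

include hP in
lemma smashOp_rmul (N : M) (a : EndAlg ω E) (t : EndAlg ω E ⊗[ℂ] H) :
    smashOp J hF E act N (OpSmash.rmul a t) = rOp J hF E N a * smashOp J hF E act N t := by
  induction t with
  | zero => exact (congrArg _ (map_zero _)).trans ((map_zero _).trans (by
      rw [show smashOp J hF E act N (0 : EndAlg ω E ⊗[ℂ] H) = 0 from map_zero _, mul_zero]))
  | add s t hs ht =>
    refine (congrArg _ (map_add _ _ _)).trans ((map_add (smashOp J hF E act N) _ _).trans ?_)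
    rw [hs, ht, ← mul_add]
    exact congrArg _ (map_add _ _ _).symm
  | tmul b g =>
    refine Eq.trans (congrArg (· * hOp J hF act N g) (rOp_mul hP J hF E N b a)) ?_
    exact mul_assoc _ _ _

/-- The action of the smash product. -/
def smashAct (N : M) : OpSmash (endModuleAlgebra hact E) →ₐ[ℂ] Module.End ℂ (F.obj N) :=
  AlgHom.ofLinearMap (smashOp J hF E act N : EndAlg ω E ⊗[ℂ] H →ₗ[ℂ] _)
    ((congrArg₂ (· * ·) (rOp_one hP J hF E N) (map_one (hAct J hF hP hact N))).trans (one_mul 1))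
    (fun s t => by
      let s' : EndAlg ω E ⊗[ℂ] H := s
      change smashOp J hF E act N (OpSmash.lam (endModuleAlgebra hact E) s' t) =
        smashOp J hF E act N s' * smashOp J hF E act N t
      induction s' with
      | zero =>
        rw [map_zero]
        rw [show smashOp J hF E act N (0 : EndAlg ω E ⊗[ℂ] H) = 0 from map_zero _, zero_mul]
        exact map_zero _
      | add x y hx hy =>
        rw [map_add]
        refine (map_add (smashOp J hF E act N) _ _).trans ?_
        rw [hx, hy, ← add_mul]
        exact congrArg (· * _) (map_add _ _ _).symm
      | tmul a h =>
        rw [OpSmash.lam_tmul]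
        refine (smashOp_rmul hP J hF E N a _).trans ?_
        refine (congrArg _ (smashOp_psi hP J hF hact E N h t)).trans ?_
        exact (mul_assoc _ _ _).symm)

lemma smashAct_natural : ActsNaturally F (smashAct hP J hF hact E) :=
  fun f a v => smashOp_natural J hF E a f v

lemma smashAct_intertwines :
    Intertwines J.iso act (smashAct hP J hF hact E) (LeftComoduleAlgebra.coact (H := H)) := by
  intro X N t v
  let Φ : EndAlg ω E ⊗[ℂ] H →ₗ[ℂ] F.obj (X ⊙ₗ N) := (J.map X N).toLinearMap ∘ₗ
    LinearMap.applyₗ v ∘ₗ (actTensor (act X) (smashAct hP J hF hact E N)).toLinearMap ∘ₗ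
      OpSmash.coactLin (A := EndAlg ω E)
  let Ψ : EndAlg ω E ⊗[ℂ] H →ₗ[ℂ] F.obj (X ⊙ₗ N) :=
    LinearMap.applyₗ (J.map X N v) ∘ₗ smashOp J hF E act (X ⊙ₗ N)
  suffices h : Φ = Ψ from LinearMap.congr_fun h t
  refine TensorProduct.ext' fun a h => ?_
  let a' : ω.obj E.obj := a
  change J.map X N (actTensor (act X) (smashAct hP J hF hact E N)
      (TensorProduct.leftComm ℂ (EndAlg ω E) H H (a ⊗ₜ Coalgebra.comul h)) v) =
    rOp J hF E (X ⊙ₗ N) a' (hOp J hF act (X ⊙ₗ N) h (J.map X N v))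
  rw [hOp_tensor hP J hF hact, rOp_tensor hP]
  congr 1
  let Φ' : H ⊗[ℂ] H →ₗ[ℂ] Module.End ℂ (ω.obj X ⊗[ℂ] F.obj N) :=
    (actTensor (act X) (smashAct hP J hF hact E N)).toLinearMap ∘ₗ
      (TensorProduct.leftComm ℂ (EndAlg ω E) H H).toLinearMap ∘ₗ TensorProduct.mk ℂ _ _ a
  let Ψ' : H ⊗[ℂ] H →ₗ[ℂ] Module.End ℂ (ω.obj X ⊗[ℂ] F.obj N) :=
    LinearMap.mulLeft ℂ ((rOp J hF E N a').lTensor (ω.obj X)) ∘ₗ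
      (actTensor (act X) (hAct J hF hP hact N)).toLinearMap
  have h' : Φ' = Ψ' := TensorProduct.ext' fun h k => TensorProduct.ext' fun x v => rfl
  exact LinearMap.congr_fun (LinearMap.congr_fun h' (Coalgebra.comul h)) v

include hP hF in
lemma iota_bijective (hM : IsIndecomposableModuleCategory C M) :
    Function.Bijective (iota (z := z) J E) := by
  constructor
  · rw [← LinearMap.ker_eq_bot, LinearMap.ker_eq_bot']
    intro a ha
    obtain ⟨f, rfl⟩ := hP.exists_map E.obj a
    rw [iota_apply, ← J.map_left, ← lin_map_comp] at ha
    have h : f ⊵ₗ m ≫ E.ev = 0 := hF.hom_ext (by rw [ha, F.map_zero]; rfl)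
    have : f = 0 := E.ext (by rw [h, zero_actionHomLeft hM, Limits.zero_comp])
    rw [this, ω.map_zero]
    rfl
  · intro w
    obtain ⟨f, rfl⟩ := hF.exists_map m w
    refine ⟨lin (ω.map (E.lift f)) ξ, ?_⟩
    rw [iota_apply, ← J.map_left, ← lin_map_comp, E.lift_ev]

lemma smashAct_bijective (hM : IsIndecomposableModuleCategory C M)
    (hb : Function.Bijective fun h => act P h ξ) :
    Function.Bijective fun a => smashAct hP J hF hact E (P ⊙ₗ m) a (J.map P m (ξ ⊗ₜ z)) := by
  let eι := LinearEquiv.ofBijective (iota (z := z) J E) (iota_bijective hP J hF E hM)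
  let eξ := LinearEquiv.ofBijective ((act P).toLinearMap.flip ξ) hb
  let e := (TensorProduct.comm ℂ (ω.obj E.obj) H).trans
    ((TensorProduct.congr eξ eι).trans (J.map P m))
  have h : (smashOp J hF E act (P ⊙ₗ m)).flip (J.map P m (ξ ⊗ₜ z)) = e.toLinearMap := by
    refine TensorProduct.ext' fun a h => ?_
    change rOp J hF E (P ⊙ₗ m) a (hOp J hF act (P ⊙ₗ m) h (J.map P m (ξ ⊗ₜ z))) = _
    rw [hOp_univ, rOp_tensor hP, LinearMap.lTensor_tmul, rOp_gen hP]
    rfl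
  have h' : (fun t => smashOp J hF E act (P ⊙ₗ m) t (J.map P m (ξ ⊗ₜ z))) = e :=
    congrArg DFunLike.coe h
  exact (congrArg Function.Bijective h').mpr e.bijective

end OpSmashAction

section Splitting

variable {M : Type u₂} [Category.{v₂} M] [Preadditive M] [Linear ℂ M]

/-- A class of objects that contains every object whose identity factors through a finite family
of members of the class. -/
def IsAdditiveClass (Q : M → Prop) : Prop :=
  ∀ (N : M) (n : ℕ) (X : Fin n → M) (a : ∀ j, N ⟶ X j) (b : ∀ j, X j ⟶ N),
    (∀ j, Q (X j)) → ∑ j, a j ≫ b j = 𝟙 N → Q N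

lemma IsAdditiveClass.biproduct [Limits.HasFiniteBiproducts M] {Q : M → Prop}
    (hQ : IsAdditiveClass Q) {J : Type} [Fintype J] (f : J → M) (h : ∀ j, Q (f j)) : Q (⨁ f) := by
  classical
  let e := Fintype.equivFin J
  refine hQ (⨁ f) (Fintype.card J) (fun k => f (e.symm k))
    (fun k => Limits.biproduct.π f (e.symm k)) (fun k => Limits.biproduct.ι f (e.symm k))
    (fun k => h _) ?_
  rw [Equiv.sum_comp e.symm fun j => Limits.biproduct.π f j ≫ Limits.biproduct.ι f j]
  exact Limits.IsBilimit.total (Limits.biproduct.isBilimit f)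

lemma IsSimpleSystem.exists_binary [Limits.HasFiniteBiproducts M] {K : Type} [Fintype K]
    {t : K → M} (ht : IsSimpleSystem t) {Q R : M → Prop} (hQ : IsAdditiveClass Q)
    (hR : IsAdditiveClass R) (h : ∀ x, Q (t x) ∨ R (t x)) (N : M) :
    ∃ (p q : M) (b : Limits.BinaryBicone p q),
      Q p ∧ R q ∧ Nonempty b.IsBilimit ∧ Nonempty (b.pt ≅ N) := by
  classical
  obtain ⟨n, τ, b, ⟨hb⟩, ⟨i⟩⟩ := ht.decomposition N
  let f : {j // Q (t (τ j))} → M := fun j => t (τ j.1)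
  let g : {j // ¬ Q (t (τ j))} → M := fun j => t (τ j.1)
  refine ⟨⨁ f, ⨁ g,
    { pt := b.pt
      inl := Limits.biproduct.desc fun j => b.ι j.1
      inr := Limits.biproduct.desc fun j => b.ι j.1
      fst := Limits.biproduct.lift fun j => b.π j.1
      snd := Limits.biproduct.lift fun j => b.π j.1
      inl_fst := ?_
      inl_snd := ?_
      inr_fst := ?_
      inr_snd := ?_ }, hQ.biproduct f fun j => j.2,
    hR.biproduct g fun j => (h _).resolve_left j.2, ⟨Limits.isBinaryBilimitOfTotal _ ?_⟩, ⟨i⟩⟩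
  · refine Limits.biproduct.hom_ext _ _ fun k => Limits.biproduct.hom_ext' _ _ fun j => ?_
    by_cases hjk : j = k
    · subst hjk
      simp
      rfl
    · simp [Limits.biproduct.ι_π_ne f hjk, Limits.bicone_ι_π_ne b fun hh => hjk (Subtype.ext hh)]
  · refine Limits.biproduct.hom_ext _ _ fun k => Limits.biproduct.hom_ext' _ _ fun j => ?_
    have : j.1 ≠ k.1 := fun hh => k.2 (hh ▸ j.2)
    simp [Limits.bicone_ι_π_ne b this]
  · refine Limits.biproduct.hom_ext _ _ fun k => Limits.biproduct.hom_ext' _ _ fun j => ?_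
    have : j.1 ≠ k.1 := fun hh => j.2 (hh ▸ k.2)
    simp [Limits.bicone_ι_π_ne b this]
  · refine Limits.biproduct.hom_ext _ _ fun k => Limits.biproduct.hom_ext' _ _ fun j => ?_
    by_cases hjk : j = k
    · subst hjk
      simp
      rfl
    · simp [Limits.biproduct.ι_π_ne g hjk, Limits.bicone_ι_π_ne b fun hh => hjk (Subtype.ext hh)]
  · change Limits.biproduct.lift _ ≫ Limits.biproduct.desc _ +
      Limits.biproduct.lift _ ≫ Limits.biproduct.desc _ = 𝟙 b.pt
    rw [Limits.biproduct.lift_desc, Limits.biproduct.lift_desc, ← Limits.IsBilimit.total hb]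
    exact Fintype.sum_subtype_add_sum_subtype (fun j => Q (t (τ j))) fun j => b.π j ≫ b.ι j

end Splitting

section NonVanishing

variable {C : Type u₁} [Category.{v₁} C] [Preadditive C] [Linear ℂ C] [MonoidalCategory C]
  {M : Type u₂} [Category.{v₂} M] [Preadditive M] [Linear ℂ M] [MonoidalLeftAction C M]
  (hM : IsIndecomposableModuleCategory C M)

include hM

lemma subsingleton_action_hom (Y X : C) [ExactPairing Y X] {N q : M}
    (h : Subsingleton (N ⟶ Y ⊙ₗ q)) : Subsingleton (X ⊙ₗ N ⟶ q) := by
  refine subsingleton_of_forall_eq 0 fun f => ?_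
  have h0 : ((λₗ N).inv ≫ η_ Y X ⊵ₗ N ≫ (αₗ Y X N).hom) ≫ Y ⊴ₗ f = 0 := Subsingleton.elim _ _
  have h1 : ε_ Y X ⊵ₗ (X ⊙ₗ N) ≫ (λₗ (X ⊙ₗ N)).hom ≫ f =
      (X ⊗ Y) ⊴ₗ f ≫ ε_ Y X ⊵ₗ q ≫ (λₗ q).hom := by
    rw [MonoidalLeftAction.action_exchange_assoc]
    simp [-MonoidalLeftAction.actionHomLeft_action]
  calc f = (X ⊴ₗ ((λₗ N).inv ≫ η_ Y X ⊵ₗ N ≫ (αₗ Y X N).hom) ≫ (αₗ X Y (X ⊙ₗ N)).inv ≫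
      ε_ Y X ⊵ₗ (X ⊙ₗ N) ≫ (λₗ (X ⊙ₗ N)).hom) ≫ f := by rw [zigzag_right, Category.id_comp]
    _ = X ⊴ₗ (((λₗ N).inv ≫ η_ Y X ⊵ₗ N ≫ (αₗ Y X N).hom) ≫ Y ⊴ₗ f) ≫ (αₗ X Y q).inv ≫
        ε_ Y X ⊵ₗ q ≫ (λₗ q).hom := by
      simp only [Category.assoc, MonoidalLeftAction.actionHomRight_comp]
      rw [h1]
      simp [-MonoidalLeftAction.actionHomLeft_action]
    _ = 0 := by rw [h0, actionHomRight_zero hM, Limits.zero_comp]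

lemma subsingleton_hom_action (A B : C) [ExactPairing A B] {N q : M}
    (h : Subsingleton (B ⊙ₗ q ⟶ N)) : Subsingleton (q ⟶ A ⊙ₗ N) := by
  refine subsingleton_of_forall_eq 0 fun f => ?_
  have h0 : B ⊴ₗ f ≫ (αₗ B A N).inv ≫ ε_ A B ⊵ₗ N ≫ (λₗ N).hom = 0 := Subsingleton.elim _ _
  have h1 : f ≫ (λₗ (A ⊙ₗ N)).inv ≫ η_ A B ⊵ₗ (A ⊙ₗ N) =
      (λₗ q).inv ≫ η_ A B ⊵ₗ q ≫ (A ⊗ B) ⊴ₗ f := by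
    rw [← MonoidalLeftAction.action_exchange]
    simp [-MonoidalLeftAction.actionHomLeft_action]
  calc f = f ≫ (λₗ (A ⊙ₗ N)).inv ≫ η_ A B ⊵ₗ (A ⊙ₗ N) ≫ (αₗ A B (A ⊙ₗ N)).hom ≫
      A ⊴ₗ ((αₗ B A N).inv ≫ ε_ A B ⊵ₗ N ≫ (λₗ N).hom) := by rw [zigzag_left, Category.comp_id]
    _ = (λₗ q).inv ≫ η_ A B ⊵ₗ q ≫ (αₗ A B q).hom ≫
      A ⊴ₗ (B ⊴ₗ f ≫ (αₗ B A N).inv ≫ ε_ A B ⊵ₗ N ≫ (λₗ N).hom) := by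
      simp only [MonoidalLeftAction.actionHomRight_comp]
      rw [reassoc_of% h1]
      simp [-MonoidalLeftAction.actionHomLeft_action]
    _ = 0 := by rw [h0, actionHomRight_zero hM, Limits.comp_zero, Limits.comp_zero, Limits.comp_zero]

variable {ω : C ⥤ Vect} [ω.Additive] [ω.Linear ℂ] [ω.Monoidal] {P : C} {ξ : ω.obj P}
  (hP : IsUniversal ω P ξ) {m : M} {F : M ⥤ Vect} [F.Additive] [F.Linear ℂ]

include hP in
/-- A module functor that is corepresented by `P ⊗ m` does not vanish on simple objects. -/
theorem nontrivial_of_moduleFunctorAlong [RigidCategory C] {I : Type} [Fintype I] {s : I → C}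
    (hs : IsSimpleSystem s) (hω : ∀ i, Nontrivial (ω.obj (s i))) (J : ModuleFunctorAlong ω F)
    {η : F.obj (P ⊙ₗ m)} (hF : IsUniversal F (P ⊙ₗ m) η) (hm : ¬ Limits.IsZero m)
    {K : Type} [Fintype K] {t : K → M} (ht : IsSimpleSystem t) (x : K) :
    Nontrivial (F.obj (t x)) := by
  have := hM.finSemisimple.1
  let Q : M → Prop := fun N => Subsingleton (F.obj N)
  let R : M → Prop := fun N => ∀ q, Q q → Subsingleton (N ⟶ q) ∧ Subsingleton (q ⟶ N)
  have hQ : IsAdditiveClass Q := fun N n X a b h hab => subsingleton_of_forall_eq 0 fun v => by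
    rw [← lin_map_id F v, ← hab, lin_map_sum]
    refine Finset.sum_eq_zero fun j _ => ?_
    rw [lin_map_comp, (h j).elim (lin (F.map (a j)) v) 0, map_zero]
  have hR : IsAdditiveClass R := fun N n X a b h hab q hq =>
    ⟨subsingleton_of_forall_eq 0 fun f => by
      rw [← Category.id_comp f, ← hab, Preadditive.sum_comp]
      refine Finset.sum_eq_zero fun j _ => ?_
      rw [Category.assoc, ((h j q hq).1).elim (b j ≫ f) 0, Limits.comp_zero],
    subsingleton_of_forall_eq 0 fun f => by
      rw [← Category.comp_id f, ← hab, Preadditive.comp_sum]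
      refine Finset.sum_eq_zero fun j _ => ?_
      rw [← Category.assoc, ((h j q hq).2).elim (f ≫ a j) 0, Limits.zero_comp]⟩
  have hQact : ∀ (X : C) (N : M), Q N → Q (X ⊙ₗ N) := fun X N hN => by
    have : Subsingleton (F.obj N) := hN
    have : Subsingleton (ω.obj X ⊗[ℂ] F.obj N) := subsingleton_of_forall_eq 0 fun v => by
      induction v with
      | zero => rfl
      | add v w hv hw => rw [hv, hw, add_zero]
      | tmul x v => rw [Subsingleton.elim v 0, TensorProduct.tmul_zero]
    exact (J.map X N).symm.injective.subsingleton
  have hRact : ∀ (X : C) (N : M), R N → R (X ⊙ₗ N) := fun X N hN q hq =>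
    ⟨subsingleton_action_hom hM (ᘁX) X (hN _ (hQact _ _ hq)).1,
      subsingleton_hom_action hM X Xᘁ (hN _ (hQact _ _ hq)).2⟩
  have hsimple : ∀ x, Q (t x) ∨ R (t x) := fun x => by
    refine or_iff_not_imp_left.2 fun hx q hq => ?_
    have hne : ∀ (f : t x ⟶ q) (g : q ⟶ t x), f ≫ g ≠ 𝟙 (t x) := fun f g hfg =>
      hx (subsingleton_of_forall_eq 0 fun v => by
        rw [← lin_map_id F v, ← hfg, lin_map_comp, hq.elim (lin (F.map f) v) 0, map_zero])
    refine ⟨subsingleton_of_forall_eq 0 fun f => ?_, subsingleton_of_forall_eq 0 fun g => ?_⟩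
    · by_contra hf
      obtain ⟨y, a, b, hab⟩ := ht.exists_comp_eq_id hf
      by_cases hxy : y = x
      · subst hxy
        exact hne (a ≫ f) b (by rw [Category.assoc, hab])
      · rw [ht.eq_zero hxy a, Limits.zero_comp] at hab
        exact ht.id_ne_zero y hab.symm
    · by_contra hg
      obtain ⟨a, ha⟩ := ht.exists_left_inv hg
      exact hne a g ha
  have hzero : ∀ x, ¬ Limits.IsZero (t x) := fun x h =>
    ht.id_ne_zero x ((Limits.IsZero.iff_id_eq_zero _).1 h)
  by_contra hx
  rw [not_nontrivial_iff_subsingleton] at hx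
  rcases hM.indecomposable R Q hRact hQact (fun p q hp hq => hp q hq)
    (fun N => ht.exists_binary hR hQ (fun x => (hsimple x).symm) N) with h | h
  · have hall : ∀ x, Q (t x) := fun x => (hsimple x).resolve_right fun h' => hzero x (h _ h')
    obtain ⟨n, τ, a, b, hab⟩ := ht.exists_split (P ⊙ₗ m)
    have : Subsingleton (F.obj (P ⊙ₗ m)) := hQ _ n _ a b (fun j => hall _) hab
    have h1 : 𝟙 (P ⊙ₗ m) = 0 := hF.hom_ext (Subsingleton.elim _ _)
    obtain ⟨n, a, b, hab⟩ := hP.exists_retract hs hω (𝟙_ C)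
    refine hm ((Limits.IsZero.iff_id_eq_zero m).2 ?_)
    have h2 : 𝟙 (𝟙_ C ⊙ₗ m) = 0 := by
      rw [← MonoidalLeftAction.id_actionHomLeft (𝟙_ C) m, ← hab, sum_actionHomLeft hM]
      refine Finset.sum_eq_zero fun k _ => ?_
      rw [MonoidalLeftAction.comp_actionHomLeft, ← Category.id_comp (b k ⊵ₗ m), h1,
        Limits.zero_comp, Limits.comp_zero]
    have e := (actionUnitIso (C := C) m).inv_hom_id
    rw [← e, ← Category.id_comp (actionUnitIso m).hom, h2, Limits.zero_comp, Limits.comp_zero]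
  · exact hzero x (h _ hx)

end NonVanishing

/-! ### Reconstruction of a module category -/

section Indecomposable

variable {C : Type u₁} [Category.{v₁} C] [Preadditive C] [Linear ℂ C] [MonoidalCategory C]
  {M : Type u₂} [Category.{v₂} M] [Preadditive M] [Linear ℂ M] [MonoidalLeftAction C M]
  {ω : C ⥤ Vect} {F : M ⥤ Vect} [F.Additive] [F.Linear ℂ]
  {J : ∀ (X : C) (N : M), ω.obj X ⊗ F.obj N ≅ F.obj (X ⊙ₗ N)}
  {H : Type u} [Ring H] [Bialgebra ℂ H] {A : Type v} [Ring A] [Algebra ℂ A]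
  [LeftComoduleAlgebra H A]
  {actH : ∀ X : C, H →ₐ[ℂ] Module.End ℂ (ω.obj X)}
  {actA : ∀ N : M, A →ₐ[ℂ] Module.End ℂ (F.obj N)}

lemma isAdditiveClass_annihilated (hact : ActsNaturally F actA) (I : Submodule ℂ A) :
    IsAdditiveClass fun N => ∀ a ∈ I, actA N a = 0 := by
  intro N n X p q h hpq a ha
  refine LinearMap.ext fun v => ?_
  rw [← lin_map_id F v, ← hpq, lin_map_sum, map_sum]
  refine Finset.sum_eq_zero fun j _ => ?_
  rw [lin_map_comp, ← hact, h j a ha, LinearMap.zero_apply, map_zero]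

lemma annihilated_action (hJ : Intertwines J actH actA (LeftComoduleAlgebra.coact (H := H)))
    {I : Submodule ℂ A} (hI : ∀ x ∈ I, LeftComoduleAlgebra.coact (H := H) x ∈
      LinearMap.range (I.subtype.lTensor H)) (X : C) (N : M) (h : ∀ a ∈ I, actA N a = 0) :
    ∀ a ∈ I, actA (X ⊙ₗ N) a = 0 := by
  intro a ha
  refine LinearMap.ext fun w => ?_
  let e := FGModuleCat.isoToLinearEquiv (J X N)
  obtain ⟨v, rfl⟩ := e.surjective w
  refine (hJ X N a v).symm.trans ?_
  obtain ⟨t, ht⟩ := hI a ha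
  have : actTensor (actH X) (actA N) (LeftComoduleAlgebra.coact (H := H) a) = 0 := by
    rw [← ht]
    clear ht
    induction t with
    | zero => simp
    | add s t hs ht => rw [map_add, map_add, hs, ht, add_zero]
    | tmul k b =>
      rw [LinearMap.lTensor_tmul, actTensor_tmul, Submodule.subtype_apply, h b b.2,
        TensorProduct.map_zero_right]
  rw [this, LinearMap.zero_apply, LinearMap.zero_apply, map_zero]

/-- A comodule algebra that acts on an indecomposable module category with a fiber functor is
indecomposable. -/
theorem isIndecomposable_of_bijective (hM : IsIndecomposableModuleCategory C M)
    (hact : ActsNaturally F actA) [F.Faithful]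
    (hJ : Intertwines J actH actA (LeftComoduleAlgebra.coact (H := H)))
    {K : Type} [Fintype K] {t : K → M} (ht : IsSimpleSystem t)
    (hb : Function.Bijective fun (a : A) (x : K) => actA (t x) a) : IsIndecomposable H A := by
  classical
  intro I I' hI hII'
  have := hM.finSemisimple.1
  have h1 := hI I (by simp)
  have h2 := hI I' (by simp)
  let Q : Submodule ℂ A → M → Prop := fun K N => ∀ a ∈ K, actA N a = 0
  have hsimple : ∀ x, Q I (t x) ∨ Q I' (t x) := fun x => by
    refine or_iff_not_imp_left.2 fun hx => ?_
    change ¬ ∀ a ∈ I, actA (t x) a = 0 at hx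
    push Not at hx
    obtain ⟨a, ha, hax⟩ := hx
    obtain ⟨v, hv⟩ : ∃ v, actA (t x) a v ≠ 0 := by
      by_contra! hc
      exact hax (LinearMap.ext hc)
    intro b hb'
    refine LinearMap.ext fun w => ?_
    obtain ⟨T, hT⟩ : ∃ T : Module.End ℂ (F.obj (t x)), T (actA (t x) a v) = w := by
      obtain ⟨f, hf⟩ := Module.Projective.exists_dual_ne_zero ℂ hv
      refine ⟨(f (actA (t x) a v))⁻¹ • f.smulRight w, ?_⟩
      simp [hf]
    obtain ⟨y, hy⟩ := hb.2 (Pi.single x T)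
    have hy' : actA (t x) y = T := by
      have := congrFun hy x
      rwa [Pi.single_eq_same] at this
    have h0 : b * (y * a) = 0 := by
      have : b * (y * a) ∈ I ⊓ I' := ⟨(h1.1 b _ ((h1.1 y a ha).1)).1, (h2.1 (y * a) b hb').2⟩
      rwa [hII'.inf_eq_bot] at this
    rw [← hT, ← hy', ← Module.End.mul_apply, ← Module.End.mul_apply, ← map_mul, ← map_mul, mul_assoc, h0,
      map_zero, LinearMap.zero_apply, LinearMap.zero_apply]
  have hzero : ∀ x, ¬ Limits.IsZero (t x) := fun x h =>
    ht.id_ne_zero x ((Limits.IsZero.iff_id_eq_zero _).1 h)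
  have hbot : ∀ K : Submodule ℂ A, (∀ x, Q K (t x)) → K = ⊥ := fun K hK =>
    (Submodule.eq_bot_iff K).2 fun a ha => hb.1 (funext fun x => by
      change actA (t x) a = actA (t x) 0
      rw [hK x a ha, map_zero])
  have horth : ∀ (K K' : Submodule ℂ A), K ⊔ K' = ⊤ → ∀ p q : M, Q K p → Q K' q →
      Subsingleton (p ⟶ q) := fun K K' hK p q hp hq => subsingleton_of_forall_eq 0 fun f => by
    refine F.map_injective (FGModuleCat.hom_ext (LinearMap.ext fun v => ?_))
    obtain ⟨i, hi, j, hj, hij⟩ := Submodule.mem_sup.1 (hK ▸ Submodule.mem_top : (1 : A) ∈ K ⊔ K')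
    have e1 : v = actA p j v := by
      conv_lhs => rw [← Module.End.one_apply (R := ℂ) v, ← map_one (actA p), ← hij, map_add, hp i hi, zero_add]
    rw [F.map_zero]
    change lin (F.map f) v = 0
    rw [e1, hact, hq j hj, LinearMap.zero_apply]
  rcases hM.indecomposable (Q I) (Q I') (annihilated_action hJ h1.2) (annihilated_action hJ h2.2)
    (fun p q hp hq => ⟨horth I I' hII'.sup_eq_top p q hp hq,
      horth I' I (sup_comm I I' ▸ hII'.sup_eq_top) q p hq hp⟩)
    (ht.exists_binary (isAdditiveClass_annihilated hact I) (isAdditiveClass_annihilated hact I')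
      hsimple) with h | h
  · exact Or.inr (hbot I' fun x => (hsimple x).resolve_left fun h' => hzero x (h _ h'))
  · exact Or.inl (hbot I fun x => (hsimple x).resolve_right fun h' => hzero x (h _ h'))

end Indecomposable

section Transport

variable {C : Type u₁} [Category.{v₁} C] [MonoidalCategory C]
  {M : Type u₂} [Category.{v₂} M] [Preadditive M] [Linear ℂ M] [MonoidalLeftAction C M]
  {ω : C ⥤ Vect} {F F' : M ⥤ Vect} (κ : F ≅ F')
  {H : Type u} [Ring H] [Bialgebra ℂ H] {A : Type v} [Ring A] [Algebra ℂ A]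
  {actH : ∀ X : C, H →ₐ[ℂ] Module.End ℂ (ω.obj X)}
  {actA : ∀ N : M, A →ₐ[ℂ] Module.End ℂ (F.obj N)}

/-- The action on an isomorphic functor. -/
abbrev conjAct (actA : ∀ N : M, A →ₐ[ℂ] Module.End ℂ (F.obj N)) (N : M) :
    A →ₐ[ℂ] Module.End ℂ (F'.obj N) :=
  ((FGModuleCat.isoToLinearEquiv (κ.app N)).conjAlgEquiv ℂ).toAlgHom.comp (actA N)

lemma conjAct_app (N : M) (a : A) (v : F.obj N) :
    conjAct κ actA N a (lin (κ.hom.app N) v) = lin (κ.hom.app N) (actA N a v) := by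
  change lin (κ.hom.app N) (actA N a ((FGModuleCat.isoToLinearEquiv (κ.app N)).symm
    (FGModuleCat.isoToLinearEquiv (κ.app N) v))) = _
  rw [LinearEquiv.symm_apply_apply]

lemma app_naturality {N N' : M} (f : N ⟶ N') (v : F.obj N) :
    lin (F'.map f) (lin (κ.hom.app N) v) = lin (κ.hom.app N') (lin (F.map f) v) :=
  (congrArg (fun k : F.obj N ⟶ F'.obj N' => lin k v) (κ.hom.naturality f)).symm

lemma app_bijective (N : M) : Function.Bijective (lin (κ.hom.app N)) :=
  (FGModuleCat.isoToLinearEquiv (κ.app N)).bijective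

lemma ActsNaturally.transport (hact : ActsNaturally F actA) : ActsNaturally F' (conjAct κ actA) := by
  intro N N' f a v
  obtain ⟨v, rfl⟩ := (app_bijective κ N).2 v
  rw [conjAct_app, app_naturality, app_naturality, conjAct_app, hact]

lemma IsUniversal.of_iso {P : M} {ξ : F.obj P} (hP : IsUniversal F P ξ) :
    IsUniversal F' P (lin (κ.hom.app P) ξ) := by
  intro X v
  obtain ⟨v, rfl⟩ := (app_bijective κ X).2 v
  simp only [app_naturality, (app_bijective κ X).1.eq_iff]
  exact hP X v

lemma Intertwines.transport {J : ∀ (X : C) (N : M), ω.obj X ⊗ F.obj N ≅ F.obj (X ⊙ₗ N)}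
    {J' : ∀ (X : C) (N : M), ω.obj X ⊗ F'.obj N ≅ F'.obj (X ⊙ₗ N)} {β : A →ₐ[ℂ] H ⊗[ℂ] A}
    (hJ : Intertwines J actH actA β)
    (hκ : ∀ (X : C) (N : M), (J X N).hom ≫ κ.hom.app (X ⊙ₗ N) =
      ω.obj X ◁ κ.hom.app N ≫ (J' X N).hom) : Intertwines J' actH (conjAct κ actA) β := by
  intro X N a w
  have hκ' : ∀ v : ω.obj X ⊗[ℂ] F.obj N, lin (J' X N).hom ((lin (κ.hom.app N)).lTensor _ v) =
      lin (κ.hom.app (X ⊙ₗ N)) (lin (J X N).hom v) := fun v =>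
    (congrArg (fun k : ω.obj X ⊗ F.obj N ⟶ F'.obj (X ⊙ₗ N) => lin k v) (hκ X N)).symm
  obtain ⟨v, rfl⟩ := LinearMap.lTensor_surjective (ω.obj X) (app_bijective κ N).2 w
  have h1 := actTensor_right (actH X) (σ := actA N) (τ := conjAct κ actA N) (lin (κ.hom.app N))
    (fun b => LinearMap.ext fun x => (conjAct_app κ N b x).symm) (β a)
  have h2 : actTensor (actH X) (conjAct κ actA N) (β a) ((lin (κ.hom.app N)).lTensor _ v) =
      (lin (κ.hom.app N)).lTensor _ (actTensor (actH X) (actA N) (β a) v) :=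
    (LinearMap.congr_fun h1 v).symm
  rw [h2, hκ', hκ', conjAct_app, hJ]

end Transport

section ModuleFunctorToModules

variable {C : Type u₁} [Category.{v₁} C] [MonoidalCategory C]
  {M : Type u₂} [Category.{v₂} M] [Preadditive M] [Linear ℂ M] [MonoidalLeftAction C M]
  {ω : C ⥤ Vect} [ω.Monoidal] {F : M ⥤ Vect} [F.Additive] [F.Linear ℂ] (J : ModuleFunctorAlong ω F)
  {H : Type u} [Ring H] [Bialgebra ℂ H] {e : H →ₐ[ℂ] End ω}
  {A : Type v} [Ring A] [Algebra ℂ A] [LeftComoduleAlgebra H A]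
  {actA : ∀ N : M, A →ₐ[ℂ] Module.End ℂ (F.obj N)}

/-- A functor with an action of an algebra, as a functor to modules. -/
def toModules (hact : ActsNaturally F actA) : M ⥤ FdMod A where
  obj N := ⟨F.obj N, actA N⟩
  map f := ⟨F.map f, fun a => LinearMap.ext fun v => hact f a v⟩
  map_id N := Subtype.ext (F.map_id N)
  map_comp f g := Subtype.ext (F.map_comp f g)

instance (hact : ActsNaturally F actA) : (toModules hact).Additive where
  map_add := Subtype.ext F.map_add

instance (hact : ActsNaturally F actA) : (toModules hact ⋙ FdMod.forget A).Linear ℂ where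
  map_smul f c := F.map_smul c f

/-- A module functor with values in modules over a comodule algebra. -/
def moduleFunctorToModules (hω : ActsMonoidally ω fun X => (endAct ω X).comp e)
    (hact : ActsNaturally F actA)
    (hJ : Intertwines J.iso (fun X => (endAct ω X).comp e) actA
      (LeftComoduleAlgebra.coact (H := H))) :
    letI := comparisonMonoidal hω
    ModuleFunctorAlong (comparison ω e) (toModules hact) :=
  letI := comparisonMonoidal hω
  { iso := fun X N => FdMod.mkIso (M := (comparison ω e).obj X ⊙ₗ (toModules hact).obj N)
      (N := (toModules hact).obj (X ⊙ₗ N)) (J.iso X N)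
      fun a => LinearMap.ext fun v => hJ X N a v
    natural_left := fun f N => Subtype.ext (J.natural_left f N)
    natural_right := fun X _ _ g => Subtype.ext (J.natural_right X g)
    assoc := fun X Y N => Subtype.ext (J.assoc X Y N)
    unit := fun N => Subtype.ext (J.unit N) }

/-- The underlying module functor. -/
def moduleFunctorForget (hact : ActsNaturally F actA) :
    ModuleFunctorAlong ω (toModules hact ⋙ FdMod.forget A) where
  iso X N := J.iso X N
  natural_left := J.natural_left
  natural_right := J.natural_right
  assoc := J.assoc
  unit := J.unit

end ModuleFunctorToModules

section Reconstruction

variable {C : Type u₁} [Category.{v₁} C] [Preadditive C] [Linear ℂ C] [MonoidalCategory C]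
  {M : Type u₂} [Category.{v₂} M] [Preadditive M] [Linear ℂ M] [MonoidalLeftAction C M]
  {ω : C ⥤ Vect} [ω.Additive] [ω.Linear ℂ] [ω.Monoidal]
  {H : Type u} [Ring H] [HopfAlgebra ℂ H] [Module.Finite ℂ H] [IsSemisimpleRing H]
  {e : H ≃ₐ[ℂ] End ω}

theorem exists_equivalence_smash (hM : IsIndecomposableModuleCategory C M) [RigidCategory C]
    [Limits.HasFiniteBiproducts C]
    (hω : ActsMonoidally ω fun X => (endAct ω X).comp (e : H →ₐ[ℂ] End ω))
    {I : Type} [Fintype I] {s : I → C} (hs : IsSimpleSystem s)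
    (hnt : ∀ {I : Type} [Fintype I] {s : I → C}, IsSimpleSystem s →
      ∀ i, Nontrivial (ω.obj (s i))) {m : M} (hm : ¬ Limits.IsZero m) (E : InternalEnd C m) :
    letI := comparisonMonoidal hω
    letI : MonObj (ω.obj E.obj) := ω.monObjObj E.obj
    ∃ a : ModuleAlgebra H (VAlg (ω.obj E.obj)),
      (∀ (h : H) (x : ω.obj E.obj), a.act h x = endAct ω E.obj (e h) x) ∧
      Module.Finite ℂ (OpSmash a) ∧ IsSemisimpleRing (OpSmash a) ∧ Nontrivial (OpSmash a) ∧
      IsIndecomposable H (OpSmash a) ∧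
      (∃! l : OpSmash a ⊗[ℂ] OpSmash a, QD.IsSymmSeparabilityIdempotent (OpSmash a) l) ∧
      ∃ (G : M ⥤ FdMod (OpSmash a))
        (R : ModuleFunctorAlong (comparison ω (e : H →ₐ[ℂ] End ω)) G),
        G.IsEquivalence ∧ G.Additive ∧
        (∀ (N N' : M) (c : ℂ) (f : N ⟶ N'), G.map (c • f) = c • G.map f) ∧
        (∃ J : ModuleFunctorAlong ω (G ⋙ FdMod.forget (OpSmash a)),
          ∀ (X : C) (N : M), (J.iso X N).hom = (FdMod.forget _).map (R.iso X N).hom) ∧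
        ∀ (ωM : M ⥤ Vect) (J : ModuleFunctorAlong ω ωM)
          (κ : G ⋙ FdMod.forget (OpSmash a) ≅ ωM),
          (∀ (X : C) (N : M), (FdMod.forget _).map (R.iso X N).hom ≫ κ.hom.app (X ⊙ₗ N) =
            ω.obj X ◁ κ.hom.app N ≫ (J.iso X N).hom) →
          ∀ (h : H) (φ : Module.Dual ℂ H) (l : OpSmash a ⊗[ℂ] OpSmash a),
            QD.IsHaar H h → QD.IsDualHaar H φ →
            QD.IsSymmSeparabilityIdempotent (OpSmash a) l →
            ∀ (I K : Type) [Fintype I] [DecidableEq I] [Fintype K] [DecidableEq K]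
              (s : I → C) (t : K → M), IsSimpleSystem s → IsSimpleSystem t →
              ModelsEquivalent h φ l ω ωM J.iso s t
                (fun X => (endAct ω X).comp (e : H →ₐ[ℂ] End ω))
                (fun N => ((FGModuleCat.isoToLinearEquiv (κ.app N)).conjAlgEquiv ℂ).toAlgHom.comp
                  (G.obj N).ρ) := by
  let := comparisonMonoidal hω
  let : MonObj (ω.obj E.obj) := ω.monObjObj E.obj
  have := hM.finSemisimple.1
  obtain ⟨P, ξ, hP⟩ := exists_isUniversal ω hs
  obtain ⟨n, t, ht⟩ := hM.finSemisimple.2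
  obtain ⟨F, hFa, hFl, η, hF⟩ := exists_corepresentable (P ⊙ₗ m) (ht.finite_hom _)
  obtain ⟨J, z, rfl⟩ := exists_moduleFunctorAlong hM hP hF
  have hntF : ∀ {K : Type} [Fintype K] {t : K → M}, IsSimpleSystem t →
      ∀ x, Nontrivial (F.obj (t x)) :=
    fun ht => nontrivial_of_moduleFunctorAlong hM hP hs (hnt hs) J hF hm ht
  have hbP : Function.Bijective fun h : H => (endAct ω P).comp (e : H →ₐ[ℂ] End ω) h ξ :=
    (endAct_bijective hP).comp e.bijective
  let a : ModuleAlgebra H (EndAlg ω E) := endModuleAlgebra hω E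
  let actA := smashAct hP J hF hω E
  have hact : ActsNaturally F actA := smashAct_natural hP J hF hω E
  have hJ := smashAct_intertwines hP J hF hω E
  have hbA := smashAct_bijective hP J hF hω E hM hbP
  have hpi := hF.bijective_pi ht hact hbA
  have hfin : Module.Finite ℂ (OpSmash a) := moduleFinite_of_bijective (fun x => actA (t x)) hpi
  have hss : IsSemisimpleRing (OpSmash a) := isSemisimpleRing_of_bijective (fun x => actA (t x)) hpi
  have hfaith : F.Faithful := hF.faithful ht (hntF ht)
  have hnontriv : Nontrivial (OpSmash a) := by
    obtain ⟨N, hN⟩ := hM.nonzero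
    by_contra hA
    rw [not_nontrivial_iff_subsingleton] at hA
    refine hN ((Limits.IsZero.iff_id_eq_zero N).2 (F.map_injective
      (FGModuleCat.hom_ext (LinearMap.ext fun v => ?_))))
    have h1 : actA N 1 v = actA N 0 v := by rw [hA.elim (1 : OpSmash a) 0]
    rw [map_one, map_zero] at h1
    rw [F.map_zero, F.map_id]
    exact h1
  refine ⟨a, fun h x => rfl, hfin, hss, hnontriv,
    isIndecomposable_of_bijective hM hact hJ ht hpi, existsUnique_isSep,
    toModules hact, moduleFunctorToModules J hω hact hJ,
    isEquivalence_of_isUniversal (toModules hact) (P := P ⊙ₗ m) hF ht (hntF ht) hbA,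
    inferInstance, fun N N' c f => Subtype.ext (F.map_smul c f),
    ⟨moduleFunctorForget J hact, fun X N => rfl⟩, ?_⟩
  intro ωM J' κ hκ h φ l hh hφ hl I' K' _ _ _ _ s' t' hs' ht'
  have hωM : ωM.Additive := Functor.additive_of_iso κ
  have hωL : ωM.Linear ℂ := Functor.linear_of_iso ℂ κ
  have hF' : IsUniversal ωM (P ⊙ₗ m) _ := IsUniversal.of_iso κ hF
  have hact' : ActsNaturally ωM (conjAct κ actA) := ActsNaturally.transport κ hact
  have hbA' : Function.Bijective fun a => conjAct κ actA (P ⊙ₗ m) a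
      (lin (κ.hom.app (P ⊙ₗ m)) (J.map P m (ξ ⊗ₜ z))) := by
    have : (fun a => conjAct κ actA (P ⊙ₗ m) a
      (lin (κ.hom.app (P ⊙ₗ m)) (J.map P m (ξ ⊗ₜ z)))) = fun a => lin (κ.hom.app (P ⊙ₗ m))
        (actA (P ⊙ₗ m) a (J.map P m (ξ ⊗ₜ z))) := funext fun a => conjAct_app κ _ a _
    rw [this]
    exact (app_bijective κ (P ⊙ₗ m)).comp hbA
  have hnt' : ∀ x, Nontrivial (ωM.obj (t' x)) := fun x =>
    @Function.Injective.nontrivial _ _ (hntF ht' x) _ (app_bijective κ (t' x)).1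
  exact modelsEquivalent (hP.fullyActs hs' (hnt hs') hω.natural hbP.2)
    (hF'.fullyActs ht' hnt' hact' hbA'.2) hh hφ hl hω.intertwines
    (Intertwines.transport κ hJ hκ) (hP.bijective_pi hs' hω.natural hbP)
    (hF'.bijective_pi ht' hact' hbA')

end Reconstruction

/-! ### Modules over a semisimple Hopf algebra form a fusion category -/

namespace FdMod

section Rigid

variable {H : Type u} [Ring H] [HopfAlgebra ℂ H]

instance : MonoidalPreadditive (FdMod H) where
  whiskerLeft_zero := Subtype.ext MonoidalPreadditive.whiskerLeft_zero
  zero_whiskerRight := Subtype.ext MonoidalPreadditive.zero_whiskerRight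
  whiskerLeft_add _ _ := Subtype.ext (MonoidalPreadditive.whiskerLeft_add _ _)
  add_whiskerRight _ _ := Subtype.ext (MonoidalPreadditive.add_whiskerRight _ _)

instance : MonoidalLinear ℂ (FdMod H) where
  whiskerLeft_smul X _ _ r f := Subtype.ext (MonoidalLinear.whiskerLeft_smul X.V r f.1)
  smul_whiskerRight r _ _ f X := Subtype.ext (MonoidalLinear.smul_whiskerRight r f.1 X.V)

lemma finrank_unit : Module.finrank ℂ (𝟙_ (FdMod H) ⟶ 𝟙_ (FdMod H)) = 1 := by
  refine (finrank_eq_one_iff_of_nonzero' (𝟙 (𝟙_ (FdMod H))) fun h => ?_).2 fun f =>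
    ⟨(lin f.1 (1 : ℂ) : ℂ), hom_ext fun (v : ℂ) => ?_⟩
  · exact one_ne_zero (α := ℂ) (congrArg (fun k : 𝟙_ (FdMod H) ⟶ 𝟙_ (FdMod H) => lin k.1 (1 : ℂ)) h)
  · have : lin f.1 (v • (1 : ℂ) : ℂ) = v • lin f.1 (1 : ℂ) := map_smul _ _ _
    rw [smul_eq_mul, mul_one] at this
    exact (mul_comm (G := ℂ) _ v).trans this.symm

variable {V : Type} [AddCommGroup V] [Module ℂ V] (ρ : H →ₐ[ℂ] Module.End ℂ V)

/-- The dual representation. -/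
def dualRep : H →ₐ[ℂ] Module.End ℂ (Module.Dual ℂ V) :=
  AlgHom.ofLinearMap (Module.Dual.transpose (R := ℂ) ∘ₗ ρ.toLinearMap ∘ₗ S)
    (LinearMap.ext fun f => LinearMap.ext fun v => by
      change f (ρ (S 1) v) = f v
      rw [HopfAlgebra.antipode_one, map_one, Module.End.one_apply])
    (fun a b => LinearMap.ext fun f => LinearMap.ext fun v => by
      change f (ρ (S (a * b)) v) = f (ρ (S b) (ρ (S a) v))
      rw [HopfAlgebra.antipode_mul_antidistrib, map_mul, Module.End.mul_apply])

lemma dualRep_apply (a : H) (f : Module.Dual ℂ V) (v : V) : dualRep ρ a f v = f (ρ (S a) v) := rfl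

lemma evaluation_act (t : H ⊗[ℂ] H) (f : Module.Dual ℂ V) (v : V) :
    contractLeft ℂ V (actTensor (dualRep ρ) ρ t (f ⊗ₜ v)) =
      f (ρ ((LinearMap.mul' ℂ H ∘ₗ (S (H := H)).rTensor H) t) v) := by
  induction t with
  | zero => simp
  | add s t hs ht => simp only [map_add, LinearMap.add_apply, hs, ht]
  | tmul h k =>
    change f (ρ (S h) (ρ k v)) = f (ρ (S h * k) v)
    rw [map_mul, Module.End.mul_apply]

variable [Module.Finite ℂ V]

variable (V) in
/-- The identification of `V ⊗ V*` with the endomorphisms of `V`. -/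
def tensorDualHom :
    V ⊗[ℂ] Module.Dual ℂ V ≃ₗ[ℂ] Module.End ℂ V :=
  (TensorProduct.comm ℂ V (Module.Dual ℂ V)).trans (dualTensorHomEquiv ℂ V V)

lemma tensorDualHom_tmul (v : V)
    (f : Module.Dual ℂ V) (x : V) : tensorDualHom V (v ⊗ₜ f) x = f x • v := by
  simp [tensorDualHom]

lemma tensorDualHom_coevaluation :
    tensorDualHom V (coevaluation ℂ V 1) = 1 := by
  refine LinearMap.ext fun x => ?_
  rw [coevaluation_apply_one, map_sum, LinearMap.sum_apply]
  simp only [tensorDualHom_tmul, Module.Basis.coord_apply]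
  exact (Module.Basis.ofVectorSpace ℂ V).sum_repr x

lemma tensorDualHom_act (t : H ⊗[ℂ] H) :
    tensorDualHom V (actTensor ρ (dualRep ρ) t (coevaluation ℂ V 1)) =
      ρ ((LinearMap.mul' ℂ H ∘ₗ (S (H := H)).lTensor H) t) := by
  induction t with
  | zero => simp
  | add s t hs ht => rw [map_add, map_add, LinearMap.add_apply, map_add, hs, ht, map_add]
  | tmul h k =>
    have : ∀ w : V ⊗[ℂ] Module.Dual ℂ V, tensorDualHom V (TensorProduct.map (ρ h)
        (dualRep ρ k) w) = ρ h * tensorDualHom V w * ρ (S k) := fun w => by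
      induction w with
      | zero => simp
      | add v w hv hw => simp only [map_add, hv, hw, add_mul, mul_add]
      | tmul v f =>
        refine LinearMap.ext fun x => ?_
        rw [TensorProduct.map_tmul, tensorDualHom_tmul, dualRep_apply]
        simp [tensorDualHom_tmul]
    refine (this _).trans ?_
    rw [tensorDualHom_coevaluation, mul_one]
    simp

lemma coevaluation_act (a : H) :
    actTensor ρ (dualRep ρ) (Coalgebra.comul a) (coevaluation ℂ V 1) =
      Coalgebra.counit (R := ℂ) a • coevaluation ℂ V 1 := by
  refine (tensorDualHom V).injective ?_
  rw [tensorDualHom_act, mul_antipode_comul, map_smul, map_smul, tensorDualHom_coevaluation, map_one]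

/-- The dual representation, as an object. -/
def dual (X : FdMod H) : FdMod H := ⟨FGModuleCat.FGModuleCatDual ℂ X.V, dualRep X.ρ⟩

instance exactPairingDual (X : FdMod H) : ExactPairing X (dual X) where
  coevaluation' := ⟨FGModuleCat.FGModuleCatCoevaluation ℂ X.V, fun a => LinearMap.ext_ring
    ((map_smul (coevaluation ℂ X.V) (Coalgebra.counit (R := ℂ) a) 1).trans
      (coevaluation_act X.ρ a).symm)⟩
  evaluation' := ⟨FGModuleCat.FGModuleCatEvaluation ℂ X.V, fun a => TensorProduct.ext' fun (f : Module.Dual ℂ X.V) v =>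
    (evaluation_act X.ρ (Coalgebra.comul a) f v).trans (by
      rw [antipode_mul_comul, map_smul, map_one]
      exact map_smul f _ v)⟩
  coevaluation_evaluation' := Subtype.ext (ExactPairing.coevaluation_evaluation X.V (FGModuleCat.FGModuleCatDual ℂ X.V))
  evaluation_coevaluation' := Subtype.ext (ExactPairing.evaluation_coevaluation X.V (FGModuleCat.FGModuleCatDual ℂ X.V))

/-- A representation of a semisimple Hopf algebra is isomorphic to its double dual. -/
def bidualIso [Module.Finite ℂ H] [IsSemisimpleRing H] (X : FdMod H) : X ≅ dual (dual X) :=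
  mkIso (M := X) (N := dual (dual X)) (LinearEquiv.toFGModuleCatIso (Module.evalEquiv ℂ X.V)) fun a => LinearMap.ext fun v =>
    LinearMap.ext fun (f : Module.Dual ℂ X.V) => by
      change f (X.ρ a v) = f (X.ρ (S (S a)) v)
      rw [antipode_antipode]

theorem isFusion [Module.Finite ℂ H] [IsSemisimpleRing H] : IsFusion (FdMod H) where
  bilinear := ⟨inferInstance, inferInstance⟩
  finSemisimple := isFinSemisimple H
  rigid := ⟨
    { rightDual := fun X => ⟨dual X⟩
      leftDual := fun X => { leftDual := dual X, exact := exactPairingCongrRight (bidualIso X) } }⟩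
  finrank_unit := finrank_unit

end Rigid

section ModuleCategory

variable {H : Type u} [Ring H] [HopfAlgebra ℂ H] {A : Type v} [Ring A] [Algebra ℂ A]
  [LeftComoduleAlgebra H A]

/-- The elements that annihilate a class of modules. -/
def annihilator (Q : FdMod A → Prop) : Submodule ℂ A where
  carrier := {a | ∀ N, Q N → N.ρ a = 0}
  zero_mem' N _ := map_zero _
  add_mem' ha hb N hN := by rw [map_add, ha N hN, hb N hN, add_zero]
  smul_mem' c a ha N hN := by rw [map_smul, ha N hN, smul_zero]

lemma mem_range_lTensor {V W : Type*} [AddCommGroup V] [Module ℂ V] [AddCommGroup W] [Module ℂ W]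
    [Module.Finite ℂ V] (K : Submodule ℂ W) (t : V ⊗[ℂ] W)
    (h : ∀ f : Module.Dual ℂ V, TensorProduct.lid ℂ W (f.rTensor W t) ∈ K) :
    t ∈ LinearMap.range (K.subtype.lTensor V) := by
  let b := Module.finBasis ℂ V
  have ht : t = ∑ i, b i ⊗ₜ[ℂ] TensorProduct.lid ℂ W ((b.coord i).rTensor W t) := by
    clear h
    induction t with
    | zero => simp
    | add s t hs ht =>
      conv_lhs => rw [hs, ht]
      simp only [map_add, TensorProduct.tmul_add, Finset.sum_add_distrib]
    | tmul x y =>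
      conv_lhs => rw [← b.sum_repr x, TensorProduct.sum_tmul]
      simp [TensorProduct.smul_tmul]
  rw [ht]
  exact Submodule.sum_mem _ fun i _ => ⟨b i ⊗ₜ ⟨_, h (b.coord i)⟩, rfl⟩

lemma coact_mem_range [Module.Finite ℂ H] (Q : FdMod A → Prop)
    (hQ : ∀ (X : FdMod H) (N : FdMod A), Q N → Q (X ⊙ₗ N)) {a : A} (ha : a ∈ annihilator Q) :
    LeftComoduleAlgebra.coact (H := H) a ∈
      LinearMap.range ((annihilator Q).subtype.lTensor H) := by
  refine mem_range_lTensor _ _ fun f N hN => LinearMap.ext fun n => ?_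
  have h1 : actTensor (reg H).ρ N.ρ (LeftComoduleAlgebra.coact (H := H) a) = 0 := ha _ (hQ (reg H) N hN)
  have h2 : ∀ t : H ⊗[ℂ] A, TensorProduct.lid ℂ N.V ((f ∘ₗ (regEquiv H).symm.toLinearMap).rTensor N.V
      (actTensor (reg H).ρ N.ρ t (regEquiv H 1 ⊗ₜ n))) =
      N.ρ (TensorProduct.lid ℂ A (f.rTensor A t)) n := fun t => by
    induction t with
    | zero => simp
    | add s t hs ht => simp only [map_add, LinearMap.add_apply, hs, ht]
    | tmul h b => simp [actTensor_tmul, reg_apply]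
  rw [← h2, h1]
  simp

theorem isIndecomposableModuleCategory [Module.Finite ℂ H] [Module.Finite ℂ A] [IsSemisimpleRing A]
    [Nontrivial A] (hA : IsIndecomposable H A) :
    IsIndecomposableModuleCategory (FdMod H) (FdMod A) where
  add_left _ _ _ := Subtype.ext (MonoidalPreadditive.add_whiskerRight _ _)
  smul_left r f X := Subtype.ext (MonoidalLinear.smul_whiskerRight r f.1 X.V)
  add_right _ _ _ _ _ := Subtype.ext (MonoidalPreadditive.whiskerLeft_add _ _)
  smul_right X _ _ r f := Subtype.ext (MonoidalLinear.whiskerLeft_smul X.V r f.1)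
  finSemisimple := isFinSemisimple A
  nonzero := ⟨reg A, fun h => by
    have h1 : regEquiv A 1 = 0 := congrArg (fun k : reg A ⟶ reg A => lin k.1 (regEquiv A 1))
      ((Limits.IsZero.iff_id_eq_zero _).1 h)
    exact one_ne_zero ((regEquiv A).injective (h1.trans (map_zero _).symm))⟩
  indecomposable P Q hP hQ hPQ hsplit := by
    obtain ⟨p, q, b, hp, hq, ⟨hb⟩, ⟨i⟩⟩ := hsplit (reg A)
    have htot : i.inv ≫ b.fst ≫ b.inl ≫ i.hom + i.inv ≫ b.snd ≫ b.inr ≫ i.hom = 𝟙 (reg A) := by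
      rw [← i.inv_hom_id, ← Category.id_comp i.hom, ← Limits.IsBilimit.binary_total hb]
      simp
    let x := (regEquiv A).symm (lin (i.inv ≫ b.fst ≫ b.inl ≫ i.hom).1 (regEquiv A 1))
    let y := (regEquiv A).symm (lin (i.inv ≫ b.snd ≫ b.inr ≫ i.hom).1 (regEquiv A 1))
    have hxy : y + x = 1 := (regEquiv A).injective (by
      rw [map_add, LinearEquiv.apply_symm_apply, LinearEquiv.apply_symm_apply, add_comm]
      exact congrArg (fun k : reg A ⟶ reg A => lin k.1 (regEquiv A 1)) htot)
    have hkill : ∀ (f : reg A ⟶ reg A) (N : FdMod A), (∀ n, f ≫ regHom N n = 0) →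
        N.ρ ((regEquiv A).symm (lin f.1 (regEquiv A 1))) = 0 := fun f N h => LinearMap.ext fun n => by
      rw [← regHom_apply, LinearEquiv.apply_symm_apply]
      exact congrArg (fun k : reg A ⟶ N => lin k.1 (regEquiv A 1)) (h n)
    have hy : y ∈ annihilator P := fun N hN => hkill _ N fun n => by
      rw [Category.assoc, Category.assoc, Category.assoc,
        ((hPQ N q hN hq).2).elim (b.inr ≫ i.hom ≫ regHom N n) 0, Limits.comp_zero, Limits.comp_zero]
    have hx : x ∈ annihilator Q := fun N hN => hkill _ N fun n => by
      rw [Category.assoc, Category.assoc, Category.assoc,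
        ((hPQ p N hp hN).1).elim (b.inl ≫ i.hom ≫ regHom N n) 0, Limits.comp_zero, Limits.comp_zero]
    have hideal : ∀ Q : FdMod A → Prop, ∀ a : A, ∀ z ∈ annihilator Q,
        a * z ∈ annihilator Q ∧ z * a ∈ annihilator Q := fun Q a z hz =>
      ⟨fun N hN => by rw [map_mul, hz N hN, mul_zero],
        fun N hN => by rw [map_mul, hz N hN, zero_mul]⟩
    have hzero : ∀ (Q : FdMod A → Prop) (w : A), w = 0 → (1 - w) ∈ annihilator Q →
        ∀ N, Q N → Limits.IsZero N := fun Q w hw hQ N hN =>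
      (Limits.IsZero.iff_id_eq_zero N).2 (hom_ext fun v => by
        have := hQ N hN
        rw [hw, sub_zero, map_one] at this
        exact LinearMap.congr_fun this v)
    have hcompl : IsCompl (annihilator P) (annihilator Q) := by
      constructor
      · rw [Submodule.disjoint_def]
        intro a ha ha'
        have hz : ∀ (N : FdMod A) (f : reg A ⟶ N) (g : N ⟶ reg A), N.ρ a = 0 →
            a * (regEquiv A).symm (lin (f ≫ g).1 (regEquiv A 1)) = 0 := fun N f g h => by
          refine (regEquiv A).injective ?_
          rw [← reg_apply, LinearEquiv.apply_symm_apply, ← comm_apply, map_zero]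
          change lin g.1 (lin f.1 ((reg A).ρ a (regEquiv A 1))) = 0
          rw [comm_apply, h, LinearMap.zero_apply, map_zero]
        have e1 : a * x = 0 := by
          simpa using hz p (i.inv ≫ b.fst) (b.inl ≫ i.hom) (ha p hp)
        have e2 : a * y = 0 := by
          simpa using hz q (i.inv ≫ b.snd) (b.inr ≫ i.hom) (ha' q hq)
        rw [← mul_one a, ← hxy, mul_add, e1, e2, add_zero]
      · rw [codisjoint_iff, Submodule.eq_top_iff']
        intro a
        rw [← one_mul a, ← hxy, add_mul]
        exact Submodule.add_mem_sup (hideal P a y hy).2 (hideal Q a x hx).2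
    rcases hA _ _ (by
      rintro K (rfl | rfl)
      · exact ⟨hideal P, fun z hz => coact_mem_range P hP hz⟩
      · exact ⟨hideal Q, fun z hz => coact_mem_range Q hQ hz⟩) hcompl with h | h
    · exact Or.inr (hzero Q y ((Submodule.eq_bot_iff _).1 h y hy)
        (by rwa [← hxy, add_sub_cancel_left]))
    · exact Or.inl (hzero P x ((Submodule.eq_bot_iff _).1 h x hx)
        (by rwa [← hxy, add_sub_cancel_right]))

end ModuleCategory

end FdMod

/-! ### Positive definite sesquilinear forms -/

section Forms

variable {V W U : Type*} [AddCommGroup V] [Module ℂ V] [AddCommGroup W] [Module ℂ W]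
  [AddCommGroup U] [Module ℂ U]

/-- Hermitian and positive definite. -/
structure IsPosForm (B : V →ₗ⋆[ℂ] V →ₗ[ℂ] ℂ) : Prop where
  symm : ∀ x y, conj (B x y) = B y x
  pos : ∀ x, x ≠ 0 → 0 < (B x x).re

/-- The basis is orthonormal. -/
def IsOrthonormal {ι : Type} [Fintype ι] (B : V →ₗ⋆[ℂ] V →ₗ[ℂ] ℂ) (b : Module.Basis ι ℂ V) : Prop :=
  ∀ x y, B x y = ∑ i, conj (b.repr x i) * b.repr y i

/-- The form with a given orthonormal basis. -/
def formOfBasis {ι : Type} [Fintype ι] (b : Module.Basis ι ℂ V) : V →ₗ⋆[ℂ] V →ₗ[ℂ] ℂ :=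
  LinearMap.mk₂'ₛₗ (starRingEnd ℂ) (RingHom.id ℂ) (fun x y => ∑ i, conj (b.repr x i) * b.repr y i)
    (fun x x' y => by simp [add_mul, Finset.sum_add_distrib])
    (fun c x y => by simp [Finset.mul_sum, mul_assoc])
    (fun x y y' => by simp [mul_add, Finset.sum_add_distrib])
    (fun c x y => by simp [Finset.mul_sum, mul_left_comm])

lemma isOrthonormal_formOfBasis {ι : Type} [Fintype ι] (b : Module.Basis ι ℂ V) :
    IsOrthonormal (formOfBasis b) b := fun _ _ => rfl

lemma IsOrthonormal.isPosForm {ι : Type} [Fintype ι] {B : V →ₗ⋆[ℂ] V →ₗ[ℂ] ℂ}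
    {b : Module.Basis ι ℂ V} (h : IsOrthonormal B b) : IsPosForm B where
  symm x y := by
    rw [h, h, map_sum]
    exact Finset.sum_congr rfl fun i _ => by rw [map_mul, Complex.conj_conj, mul_comm]
  pos x hx := by
    have h1 : ∀ i, conj (b.repr x i) * b.repr x i = (Complex.normSq (b.repr x i) : ℂ) := fun i => by
      rw [mul_comm, Complex.mul_conj]
    rw [h, Finset.sum_congr rfl fun i _ => h1 i, ← Complex.ofReal_sum, Complex.ofReal_re]
    obtain ⟨i, hi⟩ : ∃ i, b.repr x i ≠ 0 := by
      by_contra! hc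
      exact hx (b.ext_elem fun i => by rw [hc, map_zero]; rfl)
    exact Finset.sum_pos' (fun i _ => Complex.normSq_nonneg _)
      ⟨i, Finset.mem_univ i, Complex.normSq_pos.2 hi⟩

namespace IsPosForm

variable {B : V →ₗ⋆[ℂ] V →ₗ[ℂ] ℂ} (hB : IsPosForm B) {B' : W →ₗ⋆[ℂ] W →ₗ[ℂ] ℂ} (hB' : IsPosForm B')
  {B'' : U →ₗ⋆[ℂ] U →ₗ[ℂ] ℂ}

include hB

lemma eq_zero {x : V} (h : B x x = 0) : x = 0 := by
  by_contra hx
  have := hB.pos x hx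
  rw [h] at this
  exact lt_irrefl _ this

lemma ext {y y' : V} (h : ∀ x, B x y = B x y') : y = y' := by
  refine sub_eq_zero.1 (hB.eq_zero ?_)
  rw [map_sub, h, sub_self]

lemma exists_orthonormal [Module.Finite ℂ V] :
    ∃ b : Module.Basis (Fin (Module.finrank ℂ V)) ℂ V, IsOrthonormal B b := by
  let c : InnerProductSpace.Core ℂ V :=
    { inner := fun x y => B x y
      conj_inner_symm := fun x y => hB.symm y x
      re_inner_nonneg := fun x => by
        by_cases hx : x = 0
        · simp [hx]
        · exact (hB.pos x hx).le
      add_left := fun x y z => by simp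
      smul_left := fun x y r => by simp
      definite := fun x h => hB.eq_zero h }
  let _ : NormedAddCommGroup V := c.toNormedAddCommGroup
  let _ : InnerProductSpace ℂ V := InnerProductSpace.ofCore c.toCore
  let b := stdOrthonormalBasis ℂ V
  refine ⟨b.toBasis, fun x y => ?_⟩
  have h : B x y = inner ℂ x y := rfl
  rw [h, ← b.sum_inner_mul_inner x y]
  refine Finset.sum_congr rfl fun i _ => ?_
  rw [OrthonormalBasis.coe_toBasis_repr_apply, OrthonormalBasis.coe_toBasis_repr_apply,
    b.repr_apply_apply, b.repr_apply_apply, inner_conj_symm]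

include hB' in
lemma exists_adjoint [Module.Finite ℂ V] (T : V →ₗ[ℂ] W) :
    ∃ T' : W →ₗ[ℂ] V, ∀ x y, B' (T x) y = B x (T' y) := by
  obtain ⟨b, hb⟩ := hB.exists_orthonormal
  refine ⟨∑ i, (B' (T (b i))).smulRight (b i), fun x y => ?_⟩
  rw [hb]
  conv_lhs => rw [← b.sum_repr x, map_sum, map_sum, LinearMap.sum_apply]
  refine Finset.sum_congr rfl fun i _ => ?_
  rw [LinearMap.sum_apply, map_sum, Finset.sum_apply', Finset.sum_eq_single i]
  · simp
  · intro j _ hj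
    simp [hj]
  · simp

include hB' in
lemma exists_tensor [Module.Finite ℂ V] [Module.Finite ℂ W] :
    ∃ C : V ⊗[ℂ] W →ₗ⋆[ℂ] V ⊗[ℂ] W →ₗ[ℂ] ℂ, IsPosForm C ∧
      ∀ x x' y y', C (x ⊗ₜ y) (x' ⊗ₜ y') = B x x' * B' y y' := by
  obtain ⟨b, hb⟩ := hB.exists_orthonormal
  obtain ⟨c, hc⟩ := hB'.exists_orthonormal
  refine ⟨formOfBasis (b.tensorProduct c), (isOrthonormal_formOfBasis _).isPosForm,
    fun x x' y y' => ?_⟩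
  rw [isOrthonormal_formOfBasis, hb, hc, Fintype.sum_prod_type, Finset.sum_mul_sum]
  refine Finset.sum_congr rfl fun i _ => Finset.sum_congr rfl fun j _ => ?_
  simp only [Module.Basis.tensorProduct_repr_tmul_apply, smul_eq_mul, map_mul]
  ring

lemma exists_isometry [Module.Finite ℂ V] : ∃ (n : ℕ) (u : V ≃ₗ[ℂ] EuclideanSpace ℂ (Fin n)),
    ∀ x y, inner ℂ (u x) (u y) = B x y := by
  obtain ⟨b, hb⟩ := hB.exists_orthonormal
  refine ⟨_, b.equivFun.trans (WithLp.linearEquiv 2 ℂ _).symm, fun x y => ?_⟩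
  rw [hb, PiLp.inner_apply]
  exact Finset.sum_congr rfl fun i _ => mul_comm _ _

lemma exists_starHom [Module.Finite ℂ V] : ∃ (n : ℕ) (u : V ≃ₗ[ℂ] EuclideanSpace ℂ (Fin n))
    (π : Module.End ℂ V ≃ₐ[ℂ] (EuclideanSpace ℂ (Fin n) →L[ℂ] EuclideanSpace ℂ (Fin n))),
    (∀ x y, inner ℂ (u x) (u y) = B x y) ∧ (∀ T x, π T (u x) = u (T x)) ∧
    ∀ T T' : Module.End ℂ V, (∀ x y, B (T x) y = B x (T' y)) ↔ π T' = star (π T) := by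
  obtain ⟨n, u, hu⟩ := hB.exists_isometry
  let π : Module.End ℂ V ≃ₐ[ℂ] (EuclideanSpace ℂ (Fin n) →L[ℂ] EuclideanSpace ℂ (Fin n)) :=
    (u.conjAlgEquiv ℂ).trans (Module.End.toContinuousLinearMap (EuclideanSpace ℂ (Fin n)))
  have hπ : ∀ T x, π T (u x) = u (T x) := fun T x => congrArg (fun y => u (T y)) (u.symm_apply_apply x)
  refine ⟨n, u, π, hu, hπ, fun T T' => ?_⟩
  rw [ContinuousLinearMap.star_eq_adjoint, ContinuousLinearMap.eq_adjoint_iff]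
  constructor
  · intro h x y
    obtain ⟨x, rfl⟩ := u.surjective x
    obtain ⟨y, rfl⟩ := u.surjective y
    rw [hπ, hπ, hu, hu, ← hB.symm, ← h, hB.symm]
  · intro h x y
    have := h (u y) (u x)
    rw [hπ, hπ, hu, hu] at this
    rw [← hB.symm, ← this, hB.symm]

include hB' in
/-- A positive endomorphism `T* T` has a positive square root, which commutes with everything that
commutes with `T* T`. -/
lemma exists_sqrt [Module.Finite ℂ V] {T : V →ₗ[ℂ] W} {T' : W →ₗ[ℂ] V}
    (h : ∀ x y, B' (T x) y = B x (T' y)) : ∃ R : Module.End ℂ V, (∀ x y, B (R x) y = B x (R y)) ∧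
      R * R = T' ∘ₗ T ∧ ∀ Q : Module.End ℂ V, Commute (T' ∘ₗ T : Module.End ℂ V) Q → Commute R Q := by
  obtain ⟨n, u, π, hu, hπ, hst⟩ := hB.exists_starHom
  have hpos : 0 ≤ π (T' ∘ₗ T) := by
    rw [ContinuousLinearMap.nonneg_iff_isPositive, ContinuousLinearMap.isPositive_iff_complex]
    intro x
    obtain ⟨x, rfl⟩ := u.surjective x
    rw [hπ, hu, LinearMap.comp_apply, ← hB.symm, ← h, hB'.symm]
    refine ⟨?_, ?_⟩
    · have := hB'.symm (T x) (T x)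
      exact Complex.conj_eq_iff_re.1 this
    · by_cases hx : T x = 0
      · simp [hx]
      · exact (hB'.pos _ hx).le
  refine ⟨π.symm (CFC.sqrt (π (T' ∘ₗ T))), ?_, ?_, fun Q hQ => ?_⟩
  · rw [hst, AlgEquiv.apply_symm_apply]
    exact (LE.le.isSelfAdjoint (CFC.sqrt_nonneg (π (T' ∘ₗ T)))).star_eq.symm
  · refine π.injective ?_
    rw [map_mul, AlgEquiv.apply_symm_apply, CFC.sqrt_mul_sqrt_self _ hpos]
  · have : Commute (CFC.sqrt (π (T' ∘ₗ T))) (π Q) := (hQ.map π).cfcₙ_nnreal _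
    refine π.injective ?_
    rw [map_mul, map_mul, AlgEquiv.apply_symm_apply]
    exact this

end IsPosForm

end Forms

/-! ### `C*` Hopf algebras -/

/-- The pullback of a sesquilinear form. -/
def pullForm {V W : Type*} [AddCommGroup V] [Module ℂ V] [AddCommGroup W] [Module ℂ W]
    (B : W →ₗ⋆[ℂ] W →ₗ[ℂ] ℂ) (f : V →ₗ[ℂ] W) : V →ₗ⋆[ℂ] V →ₗ[ℂ] ℂ :=
  LinearMap.mk₂'ₛₗ (starRingEnd ℂ) (RingHom.id ℂ) (fun x y => B (f x) (f y))
    (fun x x' y => by simp) (fun c x y => by simp) (fun x y y' => by simp) (fun c x y => by simp)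

section CStar

variable {H : Type u} [Ring H] [StarRing H]

lemma exists_invariant_form [Algebra ℂ H] [StarModule ℂ H] [Module.Finite ℂ H] {E : Type}
    [NormedAddCommGroup E] [InnerProductSpace ℂ E] [CompleteSpace E] (π : H →⋆ₐ[ℂ] (E →L[ℂ] E))
    (hπ : Function.Injective π) : ∃ B : H →ₗ⋆[ℂ] H →ₗ[ℂ] ℂ, IsPosForm B ∧
      ∀ a x y, B (a * x) y = B x (star a * y) := by
  let e : E → H →ₗ[ℂ] E := fun v => (ContinuousLinearMap.apply ℂ E v).toLinearMap ∘ₗ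
    π.toAlgHom.toLinearMap
  obtain ⟨s, hs⟩ := Finset.exists_inf_le fun v => LinearMap.ker (e v)
  refine ⟨LinearMap.mk₂'ₛₗ (starRingEnd ℂ) (RingHom.id ℂ)
    (fun x y => ∑ v ∈ s, inner ℂ (e v x) (e v y))
    (fun x x' y => by simp [ Finset.sum_add_distrib])
    (fun c x y => by simp [Finset.sum_mul, mul_comm])
    (fun x y y' => by simp [ Finset.sum_add_distrib])
    (fun c x y => by simp [ Finset.mul_sum]),
    ⟨fun x y => ?_, fun x hx => ?_⟩, fun a x y => ?_⟩
  · change conj (∑ v ∈ s, inner ℂ (π x v) (π y v)) = ∑ v ∈ s, inner ℂ (π y v) (π x v)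
    simp only [map_sum, inner_conj_symm]
  · change 0 < (∑ v ∈ s, inner ℂ (π x v) (π x v)).re
    rw [Complex.re_sum]
    refine Finset.sum_pos' (fun v _ => inner_self_nonneg (𝕜 := ℂ)) ?_
    by_contra! hc
    refine hx (hπ ?_)
    rw [map_zero]
    refine ContinuousLinearMap.ext fun v => hs v ((Submodule.mem_finsetInf).2 fun w hw => ?_)
    exact by_contra fun h0 => (hc w hw).not_gt (re_inner_self_pos (𝕜 := ℂ).2 h0)
  · change ∑ v ∈ s, inner ℂ (π (a * x) v) (π y v) = ∑ v ∈ s, inner ℂ (π x v) (π (star a * y) v)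
    refine Finset.sum_congr rfl fun v _ => ?_
    rw [map_mul, map_mul, map_star, ContinuousLinearMap.star_eq_adjoint]
    exact (ContinuousLinearMap.adjoint_inner_right (π a) (π x v) (π y v)).symm

lemma isSemisimpleRing_of_invariant_form [Algebra ℂ H] [Module.Finite ℂ H]
    {B : H →ₗ⋆[ℂ] H →ₗ[ℂ] ℂ} (hB : IsPosForm B) (hinv : ∀ a x y, B (a * x) y = B x (star a * y)) :
    IsSemisimpleRing H := by
  refine (isSemisimpleModule_iff H H).2 ⟨fun I => ?_⟩
  let i : I →ₗ[ℂ] H := (I.restrictScalars ℂ).subtype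
  have : Module.Finite ℂ I := Module.Finite.of_injective i Subtype.val_injective
  let BI : I →ₗ⋆[ℂ] I →ₗ[ℂ] ℂ := pullForm B i
  have hI : IsPosForm BI := ⟨fun x y => hB.symm _ _, fun x hx =>
    hB.pos x.1 fun h => hx (Subtype.ext h)⟩
  obtain ⟨p, hp⟩ := hI.exists_adjoint hB i
  have hp' : ∀ (x : I) (y : H), B x y = B x (p y) := hp
  let p' : H →ₗ[H] I :=
    { p with
      map_smul' := fun a y => hI.ext fun x => by
        change B x (p (a * y)) = B x (a * p y)
        have := hinv (star a) x (p y)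
        rw [star_star] at this
        rw [← this, ← hp', ← star_star a, ← hinv, star_star]
        exact hp' ⟨star a * x, I.smul_mem _ x.2⟩ y }
  exact ⟨LinearMap.ker p', LinearMap.isCompl_of_proj fun x => hI.ext fun y => (hp' y x).symm⟩

variable [HopfAlgebra ℂ H] [StarModule ℂ H]

lemma counit_star (h : IsCStarHopf H) (a : H) :
    Coalgebra.counit (R := ℂ) (star a) = conj (Coalgebra.counit (R := ℂ) a) := by
  let st : H →ₗ⋆[ℂ] H := (starLinearEquiv ℂ (A := H)).toLinearMap
  let c : H →ₗ[ℂ] ℂ := Coalgebra.counit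
  let c' : H →ₗ[ℂ] ℂ := (starLinearEquiv ℂ (A := ℂ)).toLinearMap ∘ₛₗ c ∘ₛₗ st
  have h1 : ∀ t : H ⊗[ℂ] H, TensorProduct.lid ℂ H (c.rTensor H (TensorProduct.map st st t)) =
      star (TensorProduct.lid ℂ H (c'.rTensor H t)) := fun t => by
    induction t with
    | zero => simp
    | add x y hx hy => rw [map_add, map_add, map_add, hx, hy, map_add, map_add, star_add]
    | tmul x y =>
      simp only [TensorProduct.map_tmul, LinearMap.rTensor_tmul, TensorProduct.lid_tmul, star_smul]
      congr 1
      exact (star_star _).symm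
  have h2 : TensorProduct.lid ℂ H (c'.rTensor H (Coalgebra.comul a)) = a := by
    have := h1 (Coalgebra.comul a)
    rw [← h.1, Coalgebra.rTensor_counit_comul, TensorProduct.lid_tmul, one_smul] at this
    exact star_injective this.symm
  have h3 : ∀ t : H ⊗[ℂ] H, c (TensorProduct.lid ℂ H (c'.rTensor H t)) =
      c' (TensorProduct.rid ℂ H (c.lTensor H t)) := fun t => by
    induction t with
    | zero => simp
    | add x y hx hy => simp only [map_add, hx, hy]
    | tmul x y => simp [mul_comm]
  have h4 := h3 (Coalgebra.comul a)
  rw [h2, Coalgebra.lTensor_counit_comul, TensorProduct.rid_tmul, one_smul] at h4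
  rw [show conj (Coalgebra.counit (R := ℂ) a) = conj (c' a) from congrArg _ h4]
  exact (Complex.conj_conj _).symm

end CStar

/-! ### Hermitian modules over a `C*` Hopf algebra -/

section TensorForm

variable {V W V' W' : Type*} [AddCommGroup V] [Module ℂ V] [AddCommGroup W] [Module ℂ W]
  [AddCommGroup V'] [Module ℂ V'] [AddCommGroup W'] [Module ℂ W']

/-- `C` is the tensor product of the forms `B` and `B'`. -/
def IsTensorForm (C : V ⊗[ℂ] W →ₗ⋆[ℂ] V ⊗[ℂ] W →ₗ[ℂ] ℂ) (B : V →ₗ⋆[ℂ] V →ₗ[ℂ] ℂ)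
    (B' : W →ₗ⋆[ℂ] W →ₗ[ℂ] ℂ) : Prop :=
  ∀ x x' y y', C (x ⊗ₜ y) (x' ⊗ₜ y') = B x x' * B' y y'

lemma IsTensorForm.adjoint {C : V ⊗[ℂ] W →ₗ⋆[ℂ] V ⊗[ℂ] W →ₗ[ℂ] ℂ} {B : V →ₗ⋆[ℂ] V →ₗ[ℂ] ℂ}
    {B' : W →ₗ⋆[ℂ] W →ₗ[ℂ] ℂ} (hC : IsTensorForm C B B')
    {C' : V' ⊗[ℂ] W' →ₗ⋆[ℂ] V' ⊗[ℂ] W' →ₗ[ℂ] ℂ} {D : V' →ₗ⋆[ℂ] V' →ₗ[ℂ] ℂ}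
    {D' : W' →ₗ⋆[ℂ] W' →ₗ[ℂ] ℂ} (hC' : IsTensorForm C' D D') {f : V →ₗ[ℂ] V'} {f' : V' →ₗ[ℂ] V}
    {g : W →ₗ[ℂ] W'} {g' : W' →ₗ[ℂ] W} (hf : ∀ x y, D (f x) y = B x (f' y))
    (hg : ∀ x y, D' (g x) y = B' x (g' y)) (u : V ⊗[ℂ] W) (w : V' ⊗[ℂ] W') :
    C' (TensorProduct.map f g u) w = C u (TensorProduct.map f' g' w) := by
  induction u with
  | zero => simp
  | add a b ha hb => rw [map_add, map_add, LinearMap.add_apply, ha, hb, map_add, LinearMap.add_apply]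
  | tmul x y =>
    induction w with
    | zero => simp
    | add a b ha hb => rw [map_add, ha, hb, map_add, map_add]
    | tmul x' y' => rw [TensorProduct.map_tmul, TensorProduct.map_tmul, hC, hC', hf, hg]

lemma IsTensorForm.actTensor {H : Type u} [Ring H] [Bialgebra ℂ H] [StarRing H] [StarModule ℂ H]
    {V W : Type} [AddCommGroup V] [Module ℂ V] [AddCommGroup W] [Module ℂ W]
    {C : V ⊗[ℂ] W →ₗ⋆[ℂ] V ⊗[ℂ] W →ₗ[ℂ] ℂ} {B : V →ₗ⋆[ℂ] V →ₗ[ℂ] ℂ}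
    {B' : W →ₗ⋆[ℂ] W →ₗ[ℂ] ℂ} (hC : IsTensorForm C B B') {ρ : H →ₐ[ℂ] Module.End ℂ V}
    {σ : H →ₐ[ℂ] Module.End ℂ W} (hρ : ∀ a x y, B (ρ a x) y = B x (ρ (star a) y))
    (hσ : ∀ a x y, B' (σ a x) y = B' x (σ (star a) y)) (t : H ⊗[ℂ] H) (u w : V ⊗[ℂ] W) :
    C (actTensor ρ σ t u) w =
      C u (actTensor ρ σ (TensorProduct.map (starLinearEquiv ℂ (A := H)).toLinearMap
        (starLinearEquiv ℂ (A := H)).toLinearMap t) w) := by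
  induction t with
  | zero => simp
  | add a b ha hb => simp only [map_add, LinearMap.add_apply, ha, hb]
  | tmul h k => exact hC.adjoint hC (hρ h) (hσ k) u w

end TensorForm

section Coherence

variable {V W U : Type*} [AddCommGroup V] [Module ℂ V] [AddCommGroup W] [Module ℂ W]
  [AddCommGroup U] [Module ℂ U] {B : V →ₗ⋆[ℂ] V →ₗ[ℂ] ℂ} {B' : W →ₗ⋆[ℂ] W →ₗ[ℂ] ℂ}
  {B'' : U →ₗ⋆[ℂ] U →ₗ[ℂ] ℂ}

lemma IsTensorForm.assoc {C : V ⊗[ℂ] W →ₗ⋆[ℂ] V ⊗[ℂ] W →ₗ[ℂ] ℂ} (hC : IsTensorForm C B B')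
    {C' : (V ⊗[ℂ] W) ⊗[ℂ] U →ₗ⋆[ℂ] (V ⊗[ℂ] W) ⊗[ℂ] U →ₗ[ℂ] ℂ} (hC' : IsTensorForm C' C B'')
    {D : W ⊗[ℂ] U →ₗ⋆[ℂ] W ⊗[ℂ] U →ₗ[ℂ] ℂ} (hD : IsTensorForm D B' B'')
    {D' : V ⊗[ℂ] (W ⊗[ℂ] U) →ₗ⋆[ℂ] V ⊗[ℂ] (W ⊗[ℂ] U) →ₗ[ℂ] ℂ} (hD' : IsTensorForm D' B D)
    (u w : (V ⊗[ℂ] W) ⊗[ℂ] U) :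
    D' (TensorProduct.assoc ℂ V W U u) (TensorProduct.assoc ℂ V W U w) = C' u w := by
  induction u with
  | zero => simp
  | add a b ha hb => simp only [map_add, LinearMap.add_apply, ha, hb]
  | tmul u z =>
    induction u with
    | zero => simp
    | add a b ha hb => simp only [TensorProduct.add_tmul, map_add, LinearMap.add_apply, ha, hb]
    | tmul x y =>
      induction w with
      | zero => simp
      | add a b ha hb => simp only [map_add, ha, hb]
      | tmul w z' =>
        induction w with
        | zero => simp
        | add a b ha hb => simp only [TensorProduct.add_tmul, map_add, ha, hb]
        | tmul x' y' =>
          rw [TensorProduct.assoc_tmul, TensorProduct.assoc_tmul, hD', hD, hC', hC, mul_assoc]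

lemma IsTensorForm.lid {N : ℂ →ₗ⋆[ℂ] ℂ →ₗ[ℂ] ℂ} (hN : ∀ c d, N c d = conj c * d)
    {C : ℂ ⊗[ℂ] V →ₗ⋆[ℂ] ℂ ⊗[ℂ] V →ₗ[ℂ] ℂ} (hC : IsTensorForm C N B) (u w : ℂ ⊗[ℂ] V) :
    B (TensorProduct.lid ℂ V u) (TensorProduct.lid ℂ V w) = C u w := by
  induction u with
  | zero => simp
  | add a b ha hb => simp only [map_add, LinearMap.add_apply, ha, hb]
  | tmul x y =>
    induction w with
    | zero => simp
    | add a b ha hb => simp only [map_add, ha, hb]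
    | tmul x' y' =>
      rw [hC, hN]
      simp [mul_left_comm, mul_comm]

lemma IsTensorForm.rid {N : ℂ →ₗ⋆[ℂ] ℂ →ₗ[ℂ] ℂ} (hN : ∀ c d, N c d = conj c * d)
    {C : V ⊗[ℂ] ℂ →ₗ⋆[ℂ] V ⊗[ℂ] ℂ →ₗ[ℂ] ℂ} (hC : IsTensorForm C B N) (u w : V ⊗[ℂ] ℂ) :
    B (TensorProduct.rid ℂ V u) (TensorProduct.rid ℂ V w) = C u w := by
  induction u with
  | zero => simp
  | add a b ha hb => simp only [map_add, LinearMap.add_apply, ha, hb]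
  | tmul x y =>
    induction w with
    | zero => simp
    | add a b ha hb => simp only [map_add, ha, hb]
    | tmul x' y' =>
      rw [hC, hN]
      simp [mul_left_comm, mul_comm]

end Coherence

/-- A finite-dimensional `*`-representation of a `C*` Hopf algebra. -/
structure HermMod {H : Type u} [Ring H] [HopfAlgebra ℂ H] [StarRing H] [StarModule ℂ H]
    (hH : IsCStarHopf H) where
  obj : FdMod H
  form : obj.V →ₗ⋆[ℂ] obj.V →ₗ[ℂ] ℂ
  isPos : IsPosForm form
  inv : ∀ a x y, form (obj.ρ a x) y = form x (obj.ρ (star a) y)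

namespace HermMod

variable {H : Type u} [Ring H] [HopfAlgebra ℂ H] [StarRing H] [StarModule ℂ H]
  {hH : IsCStarHopf H}

instance : Category.{0} (HermMod hH) where
  Hom X Y := X.obj ⟶ Y.obj
  id X := 𝟙 X.obj
  comp {_ _ _} f g := CategoryStruct.comp (obj := FdMod H) f g
  id_comp f := Category.id_comp (obj := FdMod H) f
  comp_id f := Category.comp_id (obj := FdMod H) f
  assoc f g h := Category.assoc (obj := FdMod H) f g h

instance : Preadditive (HermMod hH) where
  homGroup X Y := inferInstanceAs (AddCommGroup (X.obj ⟶ Y.obj))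
  add_comp _ _ _ f f' g := Preadditive.add_comp (C := FdMod H) _ _ _ f f' g
  comp_add _ _ _ f g g' := Preadditive.comp_add (C := FdMod H) _ _ _ f g g'

instance : Linear ℂ (HermMod hH) where
  homModule X Y := inferInstanceAs (Module ℂ (X.obj ⟶ Y.obj))
  smul_comp _ _ _ c f g := Linear.smul_comp (C := FdMod H) _ _ _ c f g
  comp_smul _ _ _ f c g := Linear.comp_smul (C := FdMod H) _ _ _ f c g

variable (hH) in
/-- The functor that forgets the form. -/
def forget : HermMod hH ⥤ FdMod H where
  obj X := X.obj
  map f := f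

/-- An isomorphism of modules, not necessarily unitary. -/
def mkIso {X Y : HermMod hH} (i : X.obj ≅ Y.obj) : X ≅ Y :=
  ⟨i.hom, i.inv, i.hom_inv_id, i.inv_hom_id⟩

instance : (forget hH).Faithful := ⟨fun h => h⟩

instance : (forget hH).Full := ⟨fun f => ⟨f, rfl⟩⟩

instance : (forget hH).Additive := ⟨rfl⟩

/-- The tensor product of `*`-representations. -/
def tens (X Y : HermMod hH) : HermMod hH where
  obj := X.obj ⊗ Y.obj
  form := (X.isPos.exists_tensor Y.isPos).choose
  isPos := (X.isPos.exists_tensor Y.isPos).choose_spec.1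
  inv a x y := (IsTensorForm.actTensor (X.isPos.exists_tensor Y.isPos).choose_spec.2 X.inv Y.inv
    (Coalgebra.comul a) x y).trans (by rw [← hH.1]; rfl)

lemma isTensorForm_tens (X Y : HermMod hH) : IsTensorForm (tens X Y).form X.form Y.form :=
  (X.isPos.exists_tensor Y.isPos).choose_spec.2

/-- The trivial representation. -/
def unit (hH : IsCStarHopf H) : HermMod hH where
  obj := 𝟙_ (FdMod H)
  form := innerₛₗ ℂ (E := ℂ)
  isPos := ⟨fun x y => inner_conj_symm (𝕜 := ℂ) (E := ℂ) y x,
    fun x hx => re_inner_self_pos (𝕜 := ℂ) (E := ℂ).2 hx⟩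
  inv a (x : ℂ) (y : ℂ) := by
    change y * conj (Coalgebra.counit (R := ℂ) a * x) =
      (Coalgebra.counit (R := ℂ) (star a) * y) * conj x
    rw [counit_star hH, map_mul]
    ring

instance : MonoidalCategoryStruct (HermMod hH) where
  tensorObj := tens
  whiskerLeft X _ _ f := X.obj ◁ f
  whiskerRight f Y := MonoidalCategoryStruct.whiskerRight (C := FdMod H) f Y.obj
  tensorHom f g := MonoidalCategoryStruct.tensorHom (C := FdMod H) f g
  tensorUnit := unit hH
  associator _ _ _ := mkIso (α_ _ _ _)
  leftUnitor X := mkIso (λ_ X.obj)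
  rightUnitor X := mkIso (ρ_ X.obj)

/-- The data showing that the forgetful functor preserves the tensor product strictly. -/
def forgetData : Monoidal.InducingFunctorData (forget hH) where
  μIso X Y := Iso.refl (X.obj ⊗ Y.obj)
  εIso := Iso.refl (𝟙_ (FdMod H))
  whiskerLeft_eq X _ _ f := coh_triv (MonoidalCategoryStruct.whiskerLeft (C := FdMod H) X.obj f)
  whiskerRight_eq f Y := coh_triv (MonoidalCategoryStruct.whiskerRight (C := FdMod H) f Y.obj)
  tensorHom_eq f g := coh_triv (MonoidalCategoryStruct.tensorHom (C := FdMod H) f g)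
  associator_eq X Y Z := coh_assoc X.obj Y.obj Z.obj
  leftUnitor_eq X := coh_left X.obj
  rightUnitor_eq X := coh_right X.obj

instance : MonoidalCategory (HermMod hH) := Monoidal.induced (forget hH) forgetData

instance : (forget hH).Monoidal := Monoidal.fromInducedMonoidal (forget hH) forgetData

lemma lin_tensorHom {X Y Z W : FdMod H} (f : X ⟶ Y) (g : Z ⟶ W) :
    lin (f ⊗ₘ g).1 = TensorProduct.map (lin f.1) (lin g.1) :=
  TensorProduct.ext' fun _ _ => rfl

lemma exists_dag {X Y : HermMod hH} (f : X ⟶ Y) : ∃ g : Y ⟶ X, ∀ x y,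
    Y.form (lin f.1 x) y = X.form x (lin g.1 y) := by
  obtain ⟨g, hg⟩ := X.isPos.exists_adjoint Y.isPos (lin f.1)
  refine ⟨FdMod.ofHom g fun a => LinearMap.ext fun y => X.isPos.ext fun x => ?_, hg⟩
  have h1 := Y.inv (star a) (lin f.1 x) y
  have h2 := X.inv (star a) x (g y)
  rw [star_star] at h1 h2
  rw [LinearMap.comp_apply, LinearMap.comp_apply, ← h2, ← hg, ← hg, ← h1]
  exact congrArg (fun z => Y.form z y) (FdMod.comm_apply f _ _).symm

lemma eq_of_form {X Y : HermMod hH} {g g' : Y ⟶ X}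
    (h : ∀ x y, X.form x (lin g.1 y) = X.form x (lin g'.1 y)) : g = g' :=
  FdMod.hom_ext fun y => X.isPos.ext fun x => h x y

/-- The adjoint. -/
def dag {X Y : HermMod hH} (f : X ⟶ Y) : Y ⟶ X := (exists_dag f).choose

lemma form_dag {X Y : HermMod hH} (f : X ⟶ Y) (x : X.obj.V) (y : Y.obj.V) :
    Y.form (lin f.1 x) y = X.form x (lin (dag f).1 y) := (exists_dag f).choose_spec x y

lemma dag_eq {X Y : HermMod hH} {f : X ⟶ Y} {g : Y ⟶ X}
    (h : ∀ x y, Y.form (lin f.1 x) y = X.form x (lin g.1 y)) : dag f = g :=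
  eq_of_form fun x y => by rw [← form_dag, h]

lemma dag_hom {X Y : HermMod hH} (i : X.obj ≅ Y.obj)
    (h : ∀ x x', Y.form (lin i.hom.1 x) (lin i.hom.1 x') = X.form x x') :
    dag (mkIso i : X ≅ Y).hom = (mkIso i : X ≅ Y).inv := dag_eq fun x y => by
  have : lin i.hom.1 (lin i.inv.1 y) = y :=
    congrArg (fun k : Y.obj ⟶ Y.obj => lin k.1 y) i.inv_hom_id
  refine Eq.trans ?_ (h x (lin i.inv.1 y))
  rw [this]
  rfl

variable (hH) in
/-- The unitary structure given by the adjoints. -/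
def unitaryStructure : UnitaryStructure (HermMod hH) where
  dag := dag
  dag_dag {X Y} f := dag_eq fun x y => by
    rw [← X.isPos.symm, ← form_dag, Y.isPos.symm]
  dag_comp {X Y Z} f g := dag_eq fun x y => (form_dag g (lin f.1 x) y).trans (form_dag f x _)
  dag_add {X Y} f g := dag_eq fun x y => by
    change Y.form (lin f.1 x + lin g.1 x) y = X.form x (lin (dag f).1 y + lin (dag g).1 y)
    rw [map_add, LinearMap.add_apply, map_add, form_dag, form_dag]
  dag_smul {X Y} c f := dag_eq fun x y => by
    change Y.form (c • lin f.1 x) y = X.form x (conj c • lin (dag f).1 y)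
    rw [map_smulₛₗ, LinearMap.smul_apply, map_smul, form_dag]
  dag_tensor {X Y Z W} f g := dag_eq fun u w => by
    refine Eq.trans ?_ (((isTensorForm_tens X Z).adjoint (isTensorForm_tens Y W) (form_dag f)
      (form_dag g) u w).trans ?_)
    · exact congrArg (fun T => (Y ⊗ W).form (T u) w) (lin_tensorHom f g)
    · exact congrArg (fun T => (X ⊗ Z).form u (T w)) (lin_tensorHom (dag f) (dag g)).symm
  dag_associator X Y Z := dag_hom (X := (X ⊗ Y) ⊗ Z) (Y := X ⊗ (Y ⊗ Z)) _ ((isTensorForm_tens X Y).assoc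
    (isTensorForm_tens (tens X Y) Z) (isTensorForm_tens Y Z) (isTensorForm_tens X (tens Y Z)))
  dag_leftUnitor X := dag_hom (X := 𝟙_ _ ⊗ X) (Y := X) _
    (IsTensorForm.lid (fun _ _ => mul_comm _ _) (isTensorForm_tens (unit hH) X))
  dag_rightUnitor X := dag_hom (X := X ⊗ 𝟙_ _) (Y := X) _
    (IsTensorForm.rid (fun _ _ => mul_comm _ _) (isTensorForm_tens X (unit hH)))
  eq_zero {X Y} f hf := FdMod.hom_ext fun x => Y.isPos.eq_zero (by
    rw [form_dag]
    have : lin (dag f).1 (lin f.1 x) = 0 := congrArg (fun k : X.obj ⟶ X.obj => lin k.1 x) hf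
    rw [this, map_zero])
  positive {X Y} f := by
    obtain ⟨R, hR, hRR, hcomm⟩ := X.isPos.exists_sqrt Y.isPos (form_dag f)
    have hR' : ∀ a, R ∘ₗ X.obj.ρ a = X.obj.ρ a ∘ₗ R := fun a => hcomm _ (LinearMap.ext fun x => by
      change lin (dag f).1 (lin f.1 (X.obj.ρ a x)) = X.obj.ρ a (lin (dag f).1 (lin f.1 x))
      rw [FdMod.comm_apply f, FdMod.comm_apply (dag f)])
    let g : X ⟶ X := FdMod.ofHom R hR'
    have hg : dag g = g := dag_eq hR
    refine ⟨g, ?_⟩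
    rw [hg]
    exact FdMod.hom_ext fun x => (congrArg (fun T : Module.End ℂ X.obj.V => T x) hRR).symm

variable (hH) in
/-- The forms of the `*`-representations. -/
def unitaryFiber : UnitaryFiber (unitaryStructure hH) (forget hH ⋙ FdMod.forget H) where
  form := form
  form_symm X := X.isPos.symm
  form_pos X := X.isPos.pos
  form_dag := form_dag
  form_tensor X Y x x' y y' := isTensorForm_tens X Y x x' y y'
  form_unit := show (1 : ℂ) * conj 1 = 1 by simp

end HermMod

theorem FdMod.isUnitarizable {H : Type u} [Ring H] [HopfAlgebra ℂ H] [Module.Finite ℂ H]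
    [StarRing H] [StarModule ℂ H] (hH : IsCStarHopf H) :
    IsSemisimpleRing H ∧ IsUnitarizable (FdMod.forget H) := by
  obtain ⟨E, _, _, _, π, hπ⟩ := hH.2
  obtain ⟨B, hB, hinv⟩ := exists_invariant_form π hπ
  have hss := isSemisimpleRing_of_invariant_form hB hinv
  refine ⟨hss, HermMod hH, inferInstance, inferInstance, inferInstance, inferInstance,
    HermMod.unitaryStructure hH, HermMod.forget hH ⋙ FdMod.forget H, inferInstance,
    HermMod.forget hH, inferInstance, Iso.refl _, ?_, inferInstance, fun _ _ _ _ => rfl,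
    inferInstanceAs (NatTrans.IsMonoidal (𝟙 (HermMod.forget hH ⋙ FdMod.forget H))),
    ⟨HermMod.unitaryFiber hH⟩⟩
  have : (HermMod.forget hH).EssSurj := ⟨fun X => by
    obtain ⟨_, n, s, hs⟩ := FdMod.isFinSemisimple H
    obtain ⟨n, a, b, hab⟩ := FdMod.isUniversal_reg.exists_retract hs hs.nontrivial_module X
    let f : Fin n → X.V →ₗ[ℂ] H := fun k => (FdMod.regEquiv H).symm.toLinearMap ∘ₗ lin (a k).1
    have hf : ∀ c x k, f k (X.ρ c x) = c * f k x := fun c x k => by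
      change (FdMod.regEquiv H).symm (lin (a k).1 (X.ρ c x)) = c * _
      rw [FdMod.comm_apply, ← (FdMod.regEquiv H).apply_symm_apply (lin (a k).1 x),
        FdMod.reg_apply, LinearEquiv.symm_apply_apply]
      rfl
    have happ : ∀ x y, (∑ k, pullForm B (f k)) x y = ∑ k, B (f k x) (f k y) := fun x y => by
      rw [LinearMap.sum_apply, LinearMap.sum_apply]
      rfl
    refine ⟨⟨X, ∑ k, pullForm B (f k), ⟨fun x y => ?_, fun x hx => ?_⟩, fun c x y => ?_⟩,
      ⟨Iso.refl X⟩⟩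
    · rw [happ, happ, map_sum]
      exact Finset.sum_congr rfl fun k _ => hB.symm _ _
    · rw [happ, Complex.re_sum]
      have h0 : ∀ k, f k x ≠ 0 → 0 < (B (f k x) (f k x)).re := fun k => hB.pos _
      refine Finset.sum_pos' (fun k _ => ?_) ?_
      · by_cases hk : f k x = 0
        · simp [hk]
        · exact (h0 k hk).le
      · by_contra! hc
        have h1 : ∀ k, lin (a k).1 x = 0 := fun k => (FdMod.regEquiv H).symm.map_eq_zero_iff.1
          (by_contra fun hk => (hc k (Finset.mem_univ k)).not_gt (h0 k hk))
        refine hx ((congrArg (fun k : X ⟶ X => lin k.1 x) hab).symm.trans ?_)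
        refine (lin_map_sum (FdMod.forget H) Finset.univ (fun k => a k ≫ b k) x).trans
          (Finset.sum_eq_zero fun k _ => ?_)
        change lin (b k).1 (lin (a k).1 x) = 0
        rw [h1, map_zero]
    · rw [happ, happ]
      exact Finset.sum_congr rfl fun k _ => by rw [hf, hf, hinv]⟩
  exact { }

/-! ### The involution on the endomorphisms of a unitary fiber functor -/

section Involution

variable {C : Type u₁} [Category.{v₁} C] [MonoidalCategory C] {ω : C ⥤ Vect} [ω.Monoidal]
  {H : Type u} [Ring H] [HopfAlgebra ℂ H] {act : ∀ X : C, H →ₐ[ℂ] Module.End ℂ (ω.obj X)}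

variable (ω act) in
/-- The action of a bialgebra on tensor products is given by the comultiplication. -/
def ActsByComul : Prop := ∀ (h : H) (X Y : C) (v : ω.obj X ⊗[ℂ] ω.obj Y),
  act (X ⊗ Y) h (mu ω X Y v) = mu ω X Y (actTensor (act X) (act Y) (Coalgebra.comul (R := ℂ) h) v)

section Unitary

variable [Preadditive C] [Linear ℂ C] {U : UnitaryStructure C} (Ψ : UnitaryFiber U ω)
  (hact : ActsNaturally ω act) {P : C} {ξ : ω.obj P} (hP : IsUniversal ω P ξ)
  (hb : Function.Bijective fun h => act P h ξ)

lemma UnitaryFiber.isPosForm (X : C) : IsPosForm (Ψ.form X) := ⟨Ψ.form_symm X, Ψ.form_pos X⟩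

include hact hP hb

lemma exists_star_act (h : H) : ∃ k : H, ∀ X x y,
    Ψ.form X (act X h x) y = Ψ.form X x (act X k y) := by
  choose T hT using fun X => (Ψ.isPosForm X).exists_adjoint (Ψ.isPosForm X) (act X h)
  obtain ⟨k, hk⟩ := hb.2 (T P ξ)
  refine ⟨k, fun X x y => ?_⟩
  obtain ⟨f, rfl⟩ := hP.exists_map X y
  have hk' : act P k ξ = T P ξ := hk
  have h1 : ∀ (z : ω.obj X) (p : ω.obj P), Ψ.form X z (lin (ω.map f) p) =
      Ψ.form P (lin (ω.map (U.dag f)) z) p := fun z p => by rw [Ψ.form_dag, U.dag_dag]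
  rw [h1, ← hact f, h1, hk', ← hT, hact]

lemma exists_isCStarHopf (hc : ActsByComul ω act) : ∃ (_ : StarRing H) (_ : StarModule ℂ H),
    IsCStarHopf H ∧ ∀ h X x y, Ψ.form X (act X h x) y = Ψ.form X x (act X (star h) y) := by
  choose st hst using exists_star_act Ψ hact hP hb
  have hext : ∀ k k' : H, (∀ x y, Ψ.form P x (act P k y) = Ψ.form P x (act P k' y)) → k = k' :=
    fun k k' hk => hb.1 ((Ψ.isPosForm P).ext fun x => hk x ξ)
  have hst' : ∀ h x y, Ψ.form P x (act P h y) = Ψ.form P (act P (st h) x) y := fun h x y => by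
    rw [← Ψ.form_symm, hst, Ψ.form_symm]
  let i1 : StarRing H :=
    { star := st
      star_involutive := fun h => hext _ _ fun x y => by rw [← hst, hst']
      star_mul := fun h k => hext _ _ fun x y => by
        rw [← hst, map_mul, map_mul, Module.End.mul_apply, Module.End.mul_apply, hst, hst]
      star_add := fun h k => hext _ _ fun x y => by
        rw [← hst, map_add, map_add, LinearMap.add_apply, LinearMap.add_apply, map_add, map_add,
          LinearMap.add_apply, hst, hst] }
  let i2 : StarModule ℂ H := ⟨fun c h => hext _ _ fun x y => by
    change Ψ.form P x (act P (st (c • h)) y) = Ψ.form P x (act P (conj c • st h) y)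
    rw [← hst, map_smul, map_smul, LinearMap.smul_apply, LinearMap.smul_apply, map_smulₛₗ, map_smul,
      LinearMap.smul_apply, hst]⟩
  refine ⟨i1, i2, ⟨fun h => ?_, ?_⟩, hst⟩
  · let B := pullForm (Ψ.form (P ⊗ P)) (mu ω P P).toLinearMap
    have hB : IsPosForm B := ⟨fun x y => Ψ.form_symm _ _ _, fun x hx => Ψ.form_pos _ _ fun h0 =>
      hx ((mu ω P P).map_eq_zero_iff.1 h0)⟩
    have hBt : IsTensorForm B (Ψ.form P) (Ψ.form P) := fun x x' y y' => Ψ.form_tensor P P x x' y y'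
    refine (act2_bijective (act P) (act P) hb hb).1 (hB.ext fun u => ?_)
    refine Eq.trans ?_ (hBt.actTensor (hst · P) (hst · P) (Coalgebra.comul h) u (ξ ⊗ₜ ξ))
    change Ψ.form _ (mu ω P P u) (mu ω P P (actTensor (act P) (act P) (Coalgebra.comul (st h)) _)) =
      Ψ.form _ (mu ω P P (actTensor (act P) (act P) (Coalgebra.comul h) u)) (mu ω P P _)
    rw [← hc, ← hc, hst]
  · obtain ⟨n, u, π, _, hπ, hs⟩ := (Ψ.isPosForm P).exists_starHom
    let p := π.toAlgHom.comp (act P)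
    have hp : ∀ h, p (star h) = star (p h) := fun h => (hs (act P h) (act P (st h))).1 (hst h P)
    refine ⟨_, inferInstance, inferInstance, inferInstance, ⟨p, hp⟩, fun h k hk => hb.1 ?_⟩
    exact congrArg (fun T : Module.End ℂ (ω.obj P) => T ξ) (π.injective hk)

end Unitary

section Transport

variable {D : Type u₂} [Category.{v₂} D] [MonoidalCategory D] (E : D ⥤ C)

lemma ActsByComul.comp [E.Monoidal] (hact : ActsNaturally ω act) (hc : ActsByComul ω act) :
    ActsByComul (E ⋙ ω) fun X => act (E.obj X) := fun h X Y v => by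
  have h1 : ∀ v : ω.obj (E.obj X) ⊗[ℂ] ω.obj (E.obj Y), mu (E ⋙ ω) X Y v =
      lin (ω.map (Functor.LaxMonoidal.μ E X Y)) (mu ω (E.obj X) (E.obj Y) v) := fun v => by
    rw [mu_apply, Functor.LaxMonoidal.comp_μ]
    rfl
  refine (congrArg _ (h1 v)).trans (Eq.trans ?_ (h1 _).symm)
  rw [← hc, hact]

lemma IsUniversal.exists_comp [E.IsEquivalence] {P : C} {ξ : ω.obj P} (hP : IsUniversal ω P ξ)
    (hact : ActsNaturally ω act) (hb : Function.Bijective fun h => act P h ξ) :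
    ∃ (Q : D) (η : ω.obj (E.obj Q)), IsUniversal (E ⋙ ω) Q η ∧
      Function.Bijective fun h => act (E.obj Q) h η := by
  let i := E.objObjPreimageIso P
  have hi : Function.Bijective (lin (ω.map i.inv)) :=
    (FGModuleCat.isoToLinearEquiv (ω.mapIso i.symm)).bijective
  refine ⟨E.objPreimage P, lin (ω.map i.inv) ξ, fun X v => ?_, ?_⟩
  · obtain ⟨g, hg, hu⟩ := hP (E.obj X) v
    have h1 : ∀ f : E.objPreimage P ⟶ X, lin ((E ⋙ ω).map f) (lin (ω.map i.inv) ξ) =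
        lin (ω.map (i.inv ≫ E.map f)) ξ := fun f => (lin_map_comp ω _ _ _).symm
    refine ⟨E.preimage (i.hom ≫ g), ?_, fun f hf => E.map_injective ?_⟩
    · refine (h1 _).trans ?_
      rw [E.map_preimage, Iso.inv_hom_id_assoc, hg]
    · rw [E.map_preimage, ← hu (i.inv ≫ E.map f) ((h1 f).symm.trans hf), Iso.hom_inv_id_assoc]
  · convert hi.comp hb using 1
    exact funext fun h => (hact i.inv h ξ).symm

lemma ActsByComul.transport [Preadditive C] [Linear ℂ C] {ω' : C ⥤ Vect} [ω'.Monoidal] (κ : ω ≅ ω') [NatTrans.IsMonoidal κ.hom]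
    (hc : ActsByComul ω act) : ActsByComul ω' (conjAct κ act) := fun h X Y w => by
  have hκ : ∀ v : ω.obj X ⊗[ℂ] ω.obj Y, mu ω' X Y (TensorProduct.map (lin (κ.hom.app X))
      (lin (κ.hom.app Y)) v) = lin (κ.hom.app (X ⊗ Y)) (mu ω X Y v) := fun v =>
    (congrArg (fun k : ω.obj X ⊗ ω.obj Y ⟶ ω'.obj (X ⊗ Y) => lin k v)
      (NatTrans.IsMonoidal.tensor (τ := κ.hom) X Y)).symm
  obtain ⟨v, rfl⟩ := TensorProduct.map_surjective (app_bijective κ X).2 (app_bijective κ Y).2 w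
  have h2 : ∀ t : H ⊗[ℂ] H, actTensor (conjAct κ act X) (conjAct κ act Y) t
      (TensorProduct.map (lin (κ.hom.app X)) (lin (κ.hom.app Y)) v) =
      TensorProduct.map (lin (κ.hom.app X)) (lin (κ.hom.app Y)) (actTensor (act X) (act Y) t v) :=
    fun t => by
    induction t with
    | zero => simp
    | add s t hs ht => simp only [map_add, LinearMap.add_apply, hs, ht]
    | tmul a b =>
      induction v with
      | zero => simp
      | add x y hx hy => simp only [map_add, hx, hy]
      | tmul x y =>
        simp only [actTensor_tmul, TensorProduct.map_tmul]
        rw [conjAct_app, conjAct_app]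
  rw [h2, hκ, hκ, conjAct_app, hc]

end Transport

theorem exists_isCStarHopf_of_isUnitarizable [Preadditive C] [Linear ℂ C]
    (hω : IsUnitarizable ω) (hact : ActsNaturally ω act) (hc : ActsByComul ω act) {P : C}
    {ξ : ω.obj P} (hP : IsUniversal ω P ξ) (hb : Function.Bijective fun h => act P h ξ) :
    ∃ (_ : StarRing H) (_ : StarModule ℂ H), IsCStarHopf H := by
  obtain ⟨D, _, _, _, _, U, ω', _, E, _, κ, _, _, _, _, ⟨Ψ⟩⟩ := hω
  obtain ⟨Q, η, hQ, hη⟩ := hP.exists_comp E hact hb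
  have hact' : ActsNaturally (E ⋙ ω) (fun X => act (E.obj X)) := fun f => hact (E.map f)
  obtain ⟨i, j, h, _⟩ := exists_isCStarHopf Ψ (hact'.transport κ) (hQ.of_iso κ) (by
    convert (app_bijective κ Q).comp hη using 1
    exact funext fun h => conjAct_app (actA := fun X => act (E.obj X)) κ Q h η) ((hc.comp E hact).transport κ)
  exact ⟨i, j, h⟩

end Involution

/-! ### Representations of a comodule algebra -/

section Representations

variable {H : Type u₁} [Ring H] [HopfAlgebra ℂ H] {A : Type u₂} [Ring A] [Algebra ℂ A]
  [LeftComoduleAlgebra H A]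

variable (H A) in
/-- The forgetful functor of the modules over a comodule algebra is a module functor. -/
def FdMod.moduleFunctor : ModuleFunctorAlong (FdMod.forget H) (FdMod.forget A) where
  iso X N := Iso.refl (X.V ⊗ N.V)
  natural_left f N := (Category.comp_id (f.1 ▷ N.V)).trans (Category.id_comp _).symm
  natural_right X _ _ g := (Category.comp_id (X.V ◁ g.1)).trans (Category.id_comp _).symm
  assoc X Y N := by
    change (𝟙 (X.V ⊗ Y.V)) ▷ N.V ≫ 𝟙 _ ≫ (α_ X.V Y.V N.V).hom =
      (α_ X.V Y.V N.V).hom ≫ X.V ◁ (𝟙 (Y.V ⊗ N.V)) ≫ 𝟙 _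
    simp
  unit N := by
    change (𝟙 (𝟙_ Vect)) ▷ N.V ≫ 𝟙 _ ≫ (λ_ N.V).hom = (λ_ N.V).hom
    simp

theorem FdMod.modelsEquivalent [Module.Finite ℂ H] [IsSemisimpleRing H] [Module.Finite ℂ A]
    [IsSemisimpleRing A] {h : H} {φ : Module.Dual ℂ H} {l : A ⊗[ℂ] A} (hh : QD.IsHaar H h)
    (hφ : QD.IsDualHaar H φ) (hl : QD.IsSymmSeparabilityIdempotent A l) {I K : Type} [Fintype I]
    [DecidableEq I] [Fintype K] [DecidableEq K] {s : I → FdMod H} {t : K → FdMod A}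
    (hs : IsSimpleSystem s) (ht : IsSimpleSystem t) :
    ModelsEquivalent h φ l (FdMod.forget H) (FdMod.forget A) (FdMod.moduleFunctor H A).iso s t
      (fun X => X.ρ) (fun N => N.ρ) :=
  QDSN.modelsEquivalent FdMod.fullyActs FdMod.fullyActs hh hφ hl (fun _ _ _ _ => rfl)
    (fun _ _ _ _ => rfl) (FdMod.bijective_pi hs) (FdMod.bijective_pi ht)

end Representations

end QDSN

end

theorem mainTheorem7 :
    (∀ (H : Type u₁) [Ring H] [HopfAlgebra ℂ H] [Module.Finite ℂ H] [StarRing H] [StarModule ℂ H]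
      (A : Type u₂) [Ring A] [Algebra ℂ A] [Module.Finite ℂ A] [IsSemisimpleRing A] [Nontrivial A]
      [LeftComoduleAlgebra H A],
      IsCStarHopf H → IsIndecomposable H A →
      IsFusion (FdMod H) ∧ IsUnitarizable (FdMod.forget H) ∧
      Function.Bijective (toEndForget H) ∧
      IsIndecomposableModuleCategory (FdMod H) (FdMod A) ∧
      (∃! h : H, QD.IsHaar H h) ∧ (∃! φ : Module.Dual ℂ H, QD.IsDualHaar H φ) ∧
      (∃! l : A ⊗[ℂ] A, QD.IsSymmSeparabilityIdempotent A l) ∧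
      ∃ J : ModuleFunctorAlong (FdMod.forget H) (FdMod.forget A),
        (∀ (X : FdMod H) (N : FdMod A), (J.iso X N).hom = 𝟙 (X.V ⊗ N.V)) ∧
        ∀ (h : H) (φ : Module.Dual ℂ H) (l : A ⊗[ℂ] A), QD.IsHaar H h → QD.IsDualHaar H φ →
          QD.IsSymmSeparabilityIdempotent A l →
          ∀ (I K : Type) [Fintype I] [DecidableEq I] [Fintype K] [DecidableEq K]
            (s : I → FdMod H) (t : K → FdMod A), IsSimpleSystem s → IsSimpleSystem t →
            ModelsEquivalent h φ l (FdMod.forget H) (FdMod.forget A) J.iso s t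
              (fun X => X.ρ) (fun N => N.ρ)) ∧
    (∀ (C : Type u₃) [Category.{v₁} C] [Preadditive C] [Linear ℂ C] [MonoidalCategory C]
      (ω : C ⥤ Vect) [ω.Additive] [ω.Linear ℂ] [ω.Monoidal]
      (M : Type u₄) [Category.{v₂} M] [Preadditive M] [Linear ℂ M] [MonoidalLeftAction C M],
      IsFusion C → IsIndecomposableModuleCategory C M →
      ∃ (H : Type u₃) (_ : Ring H) (_ : HopfAlgebra ℂ H) (_ : Module.Finite ℂ H)
        (e : H ≃ₐ[ℂ] End ω) (_ : (comparison ω (e : H →ₐ[ℂ] End ω)).Monoidal),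
        (∀ (h : H) (X Y : C) (v : ω.obj X ⊗[ℂ] ω.obj Y),
          endAct ω (X ⊗ Y) (e h) (lin (Functor.LaxMonoidal.μ ω X Y) v) =
            lin (Functor.LaxMonoidal.μ ω X Y)
              (actTensor ((endAct ω X).comp (e : H →ₐ[ℂ] End ω))
                ((endAct ω Y).comp (e : H →ₐ[ℂ] End ω)) (Coalgebra.comul h) v)) ∧
        (∀ h : H, endAct ω (𝟙_ C) (e h) (lin (Functor.LaxMonoidal.ε ω) (1 : ℂ)) =
          Coalgebra.counit (R := ℂ) h • lin (Functor.LaxMonoidal.ε ω) (1 : ℂ)) ∧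
        IsSemisimpleRing H ∧
        (IsUnitarizable ω → ∃ (_ : StarRing H) (_ : StarModule ℂ H), IsCStarHopf H) ∧
        (∀ (U : UnitaryStructure C) (Ψ : UnitaryFiber U ω),
          ∃ (_ : StarRing H) (_ : StarModule ℂ H), IsCStarHopf H ∧
            ∀ (h : H) (X : C) (x y : ω.obj X),
              Ψ.form X (endAct ω X (e h) x) y = Ψ.form X x (endAct ω X (e (star h)) y)) ∧
        (comparison ω (e : H →ₐ[ℂ] End ω)).IsEquivalence ∧
        (∀ X Y : C, (FdMod.forget H).map
          (Functor.LaxMonoidal.μ (comparison ω (e : H →ₐ[ℂ] End ω)) X Y) =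
            Functor.LaxMonoidal.μ ω X Y) ∧
        (FdMod.forget H).map (Functor.LaxMonoidal.ε (comparison ω (e : H →ₐ[ℂ] End ω))) =
          Functor.LaxMonoidal.ε ω ∧
        (∃! h : H, QD.IsHaar H h) ∧ (∃! φ : Module.Dual ℂ H, QD.IsDualHaar H φ) ∧
        ∀ m : M, ¬ Limits.IsZero m → Nonempty (InternalEnd C m) ∧ ∀ E : InternalEnd C m,
          letI : MonObj (ω.obj E.obj) := ω.monObjObj E.obj
          ∃ a : ModuleAlgebra H (VAlg (ω.obj E.obj)),
            (∀ (h : H) (x : ω.obj E.obj), a.act h x = endAct ω E.obj (e h) x) ∧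
            Module.Finite ℂ (OpSmash a) ∧ IsSemisimpleRing (OpSmash a) ∧ Nontrivial (OpSmash a) ∧
            IsIndecomposable H (OpSmash a) ∧
            (∃! l : OpSmash a ⊗[ℂ] OpSmash a, QD.IsSymmSeparabilityIdempotent (OpSmash a) l) ∧
            ∃ (G : M ⥤ FdMod (OpSmash a))
              (R : ModuleFunctorAlong (comparison ω (e : H →ₐ[ℂ] End ω)) G),
              G.IsEquivalence ∧ G.Additive ∧
              (∀ (N N' : M) (c : ℂ) (f : N ⟶ N'), G.map (c • f) = c • G.map f) ∧
              (∃ J : ModuleFunctorAlong ω (G ⋙ FdMod.forget (OpSmash a)),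
                ∀ (X : C) (N : M), (J.iso X N).hom = (FdMod.forget _).map (R.iso X N).hom) ∧
              ∀ (ωM : M ⥤ Vect) (J : ModuleFunctorAlong ω ωM)
                (κ : G ⋙ FdMod.forget (OpSmash a) ≅ ωM),
                (∀ (X : C) (N : M), (FdMod.forget _).map (R.iso X N).hom ≫ κ.hom.app (X ⊙ₗ N) =
                  ω.obj X ◁ κ.hom.app N ≫ (J.iso X N).hom) →
                ∀ (h : H) (φ : Module.Dual ℂ H) (l : OpSmash a ⊗[ℂ] OpSmash a),
                  QD.IsHaar H h → QD.IsDualHaar H φ →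
                  QD.IsSymmSeparabilityIdempotent (OpSmash a) l →
                  ∀ (I K : Type) [Fintype I] [DecidableEq I] [Fintype K] [DecidableEq K]
                    (s : I → C) (t : K → M), IsSimpleSystem s → IsSimpleSystem t →
                    ModelsEquivalent h φ l ω ωM J.iso s t
                      (fun X => (endAct ω X).comp (e : H →ₐ[ℂ] End ω))
                      (fun N => ((FGModuleCat.isoToLinearEquiv (κ.app N)).conjAlgEquiv ℂ).toAlgHom.comp
                        (G.obj N).ρ)) := by
  refine ⟨fun H _ _ _ _ _ A _ _ _ _ _ _ hH hA => ?_, fun C _ _ _ _ ω _ _ _ M _ _ _ _ hC hM => ?_⟩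
  · obtain ⟨_, hU⟩ := FdMod.isUnitarizable hH
    exact ⟨FdMod.isFusion, hU, FdMod.toEndForget_bijective H,
      FdMod.isIndecomposableModuleCategory hA, existsUnique_isHaar, existsUnique_isDualHaar,
      existsUnique_isSep, FdMod.moduleFunctor H A, fun _ _ => rfl,
      fun h φ l hh hφ hl I K _ _ _ _ s t hs ht => FdMod.modelsEquivalent hh hφ hl hs ht⟩
  · obtain ⟨_, _⟩ := hC.bilinear
    obtain ⟨_⟩ := hC.rigid
    have := hC.finSemisimple.1
    obtain ⟨n, s, hs⟩ := hC.finSemisimple.2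
    obtain ⟨P, ξ, hP⟩ := exists_isUniversal ω hs
    have hnt : ∀ {I : Type} [Fintype I] {s : I → C}, IsSimpleSystem s →
        ∀ i, Nontrivial (ω.obj (s i)) := fun hs i =>
      nontrivial_obj ω hs hC.finrank_unit (hs.id_ne_zero i)
    obtain ⟨H, _, _, e, hω⟩ := exists_hopfAlgebra hP (actsNaturally_endAct (ω := ω))
      (endAct_bijective hP)
    have hbP : Function.Bijective fun h : H => (endAct ω P).comp (e : H →ₐ[ℂ] End ω) h ξ :=
      (endAct_bijective hP).comp e.bijective
    have hpi := hP.bijective_pi hs hω.natural hbP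
    have : Module.Finite ℂ H := moduleFinite_of_bijective _ hpi
    have : IsSemisimpleRing H := isSemisimpleRing_of_bijective _ hpi
    refine ⟨H, inferInstance, inferInstance, inferInstance, e, comparisonMonoidal hω, hω.comul,
      hω.counit, inferInstance,
      fun hU => exists_isCStarHopf_of_isUnitarizable hU hω.natural hω.comul hP hbP,
      fun U Ψ => exists_isCStarHopf Ψ hω.natural hP hbP hω.comul,
      isEquivalence_of_isUniversal (comparison ω (e : H →ₐ[ℂ] End ω)) hP hs (hnt hs) hbP,
      comparison_μ hω, comparison_ε hω, existsUnique_isHaar, existsUnique_isDualHaar,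
      fun m hm => ⟨exists_internalEnd hM hs m, fun E =>
        exists_equivalence_smash hM hω hs hnt hm E⟩⟩
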